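/- **Setting.** Let $d\in\{2,3\}$, $\gamma>1$, $a>0$, $\mu>0$, $\lambda\ge-\frac2d\mu$, let $\Omega\subset\mathbb R^d$ be a bounded Lipschitz domain, and put $\Omega_t=(0,t)\times\Omega$, $\overline{\Omega}_t=[0,t]\times\overline\Omega$, $p(z)=az^\gamma$, $P(z)=\frac{a}{\gamma-1}z^\gamma$ and $\mathbb S(\nabla u)=\mu\big(\nabla u+(\nabla u)^T-\frac2d\,\mathrm{div}(u)\,\mathbb I\big)+\lambda\,\mathrm{div}(u)\,\mathbb I$. The Navier–Stokes system with potential temperature transport is $$\partial_t\varrho+\mathrm{div}(\varrho u)=0,\qquad \partial_t(\varrho u)+\mathrm{div}(\varrho u\otimes u)+\nabla p(\varrho\theta)=\mathrm{div}\,\mathbb S(\nabla u),\qquad \partial_t(\varrho\theta)+\mathrm{div}(\varrho\theta u)=0,$$ with $u=0$ on $\partial\Omega$ and initial data $(\varrho_0,\theta_0,u_0)$. **DMV solutions.** Let $T>0$. A measurable family $\mathcal V=\{\mathcal V_{(t,x)}\}_{(t,x)\in\Omega_T}$ of probability measures on $\mathbb R^{d+2}=\{(\tilde\varrho,\tilde\theta,\tilde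 u)\}$, with $\mathcal V_{(t,x)}(\tilde\varrho\ge0,\ \tilde\theta\ge c_\star)=1$ a.e. for some constant $c_\star>0$, is a dissipative measure-valued (DMV) solution on $\Omega_T$ with initial data $(\varrho_0,\theta_0,u_0)$ and with defects $\mathfrak E\in L^\infty_{\mathrm{weak}^\star}(0,T;\mathcal M^+(\overline\Omega))$, $\mathfrak D\in\mathcal M^+(\overline{\Omega}_T)$ and $\mathfrak R\in L^\infty_{\mathrm{weak}^\star}(0,T;\mathcal M(\overline\Omega)^{d\times d}_{\mathrm{sym},+})$ satisfying $\underline d\,\mathfrak E\le\mathrm{tr}\,\mathfrak R\le\overline d\,\mathfrak E$ for some constants $\overline d\ge\underline d>0$, if, writing $\langle\mathcal V;g\rangle=\int g\,d\mathcal V$ and $u_{\mathcal V}=\langle\mathcal V;\tilde u\rangle$, the moments below being integrable: * (energy) $u_{\mathcal V}\in L^2(0,T;W^{1,2}_0(\Omega)^d)$, $\langle\mathcal V;\frac12\tilde\varrho|\tilde u|^2+P(\tilde\varrho\tilde\theta)\rangle\in L^1(\Omega_T)$, and for a.a. $\tau\in(0,T)$ $$\int_\Omega\Big\langle\mathcal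 V_{(\tau,\cdot)};\tfrac12\tilde\varrho|\tilde u|^2+P(\tilde\varrho\tilde\theta)\Big\rangle dx+\int_0^\tau\!\!\int_\Omega\mathbb S(\nabla u_{\mathcal V}):\nabla u_{\mathcal V}\,dx\,dt+\mathfrak E(\tau)(\overline\Omega)+\mathfrak D(\overline{\Omega}_\tau)\le\int_\Omega\Big[\tfrac12\varrho_0|u_0|^2+P(\varrho_0\theta_0)\Big]dx;$$ * (continuity) $\langle\mathcal V;\tilde\varrho\rangle\in C_{\mathrm{weak}}([0,T];L^\gamma(\Omega))$ has initial value $\varrho_0$, and for all $\tau\in[0,T]$ and all $\varphi\in W^{1,\infty}(\Omega_T)$ (continuous representative) $$\Big[\int_\Omega\langle\mathcal V;\tilde\varrho\rangle\varphi\,dx\Big]_{0}^{\tau}=\int_0^\tau\!\!\int_\Omega\big[\langle\mathcal V;\tilde\varrho\rangle\partial_t\varphi+\langle\mathcal V;\tilde\varrho\tilde u\rangle\cdot\nabla\varphi\big]dx\,dt;$$ * (momentum) $\langle\mathcal V;\tilde\varrho\tilde u\rangle\in C_{\mathrm{weak}}([0,T];L^{2\gamma/(\gamma+1)}(\Omega)^d)$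 has initial value $\varrho_0u_0$, and for all $\tau\in[0,T]$ and all $\varphi\in C^1(\overline{\Omega}_T)^d$ with $\varphi=0$ on $[0,T]\times\partial\Omega$ $$\Big[\int_\Omega\langle\mathcal V;\tilde\varrho\tilde u\rangle\cdot\varphi\,dx\Big]_{0}^{\tau}=\int_0^\tau\!\!\int_\Omega\big[\langle\mathcal V;\tilde\varrho\tilde u\rangle\cdot\partial_t\varphi+\langle\mathcal V;\tilde\varrho\tilde u\otimes\tilde u+p(\tilde\varrho\tilde\theta)\mathbb I\rangle:\nabla\varphi-\mathbb S(\nabla u_{\mathcal V}):\nabla\varphi\big]dx\,dt+\int_0^\tau\!\!\int_{\overline\Omega}\nabla\varphi:d\mathfrak R(t)\,dt;$$ * (potential temperature) the statement of (continuity) holds with $\tilde\varrho\tilde\theta$ in place of $\tilde\varrho$ and $\varrho_0\theta_0$ in place of $\varrho_0$; * (entropy) for all $\psi\in W^{1,\infty}(\Omega_T)$ with $\psi\ge0$ and a.a. $\tau\in(0,T)$ $$\int_\Omega\langle\mathcal V_{(\tau,\cdot)};\tilde\varrho\ln\tilde\theta\rangle\psi(\tau,\cdot)\,dx-\int_\Omega\varrho_0\ln(\theta_0)\,\psi(0,\cdot)\,dx\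 \ge\ \int_0^\tau\!\!\int_\Omega\big[\langle\mathcal V;\tilde\varrho\ln\tilde\theta\rangle\partial_t\psi+\langle\mathcal V;\tilde\varrho\ln(\tilde\theta)\tilde u\rangle\cdot\nabla\psi\big]dx\,dt;$$ * (Poincaré) there is $C_P>0$ such that for all $U\in L^2(0,T;W^{1,2}_0(\Omega)^d)$ and a.a. $\tau\in(0,T)$ $$\int_0^\tau\!\!\int_\Omega\langle\mathcal V;|\tilde u-U|^2\rangle\,dx\,dt\le C_P\Big(\int_0^\tau\!\!\int_\Omega|\nabla(u_{\mathcal V}-U)|^2dx\,dt+\int_0^\tau\mathfrak E(t)(\overline\Omega)\,dt+\mathfrak D(\overline{\Omega}_\tau)\Big).$$ **Theorem (DMV-strong uniqueness).** Let $0<T^*\le T$ and let $(\varrho,\theta,u)$ be a strong solution of the system on $\Omega_{T^*}$ with $$\varrho,\theta\in C^1(\overline{\Omega}_{T^*}),\quad \varrho,\theta>0,\quad u\in C^1(\overline{\Omega}_{T^*})^d\cap L^2(0,T^*;W^{2,\infty}(\Omega)^d),\quad u=0\ \text{on}\ [0,T^*]\times\partial\Omega$$ (the transport equations hold pointwise,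 the momentum equation a.e. in $\Omega_{T^*}$). Let $\mathcal V$ be a DMV solution on $\Omega_T$, with defects $\mathfrak E,\mathfrak D,\mathfrak R$, emanating from the same initial data, $(\varrho_0,\theta_0,u_0)=(\varrho,\theta,u)(0,\cdot)$ a.e. in $\Omega$. Then $$\mathfrak E(t)=0\ \text{ and }\ \mathfrak R(t)=0\ \text{ for a.a. }t\in(0,T^*),\qquad \mathfrak D=0\ \text{ on }\ \big([0,T^*]\cap[0,T)\big)\times\overline\Omega,$$ and $$\mathcal V_{(t,x)}=\delta_{(\varrho(t,x),\theta(t,x),u(t,x))}\quad\text{for a.a. }(t,x)\in\Omega_{T^*}.$$ -/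

import Mathlib

open MeasureTheory ProbabilityTheory Set Topology
open scoped ContDiff

namespace PotTempNS

noncomputable section

/-! ### Spaces and domains -/

/-- The physical space `ℝᵈ` with its Euclidean norm. -/
abbrev Space (d : ℕ) : Type := EuclideanSpace ℝ (Fin d)

/-- The state space `ℝ^(d+2)` of the triples (density, potential temperature, velocity). -/
abbrev Phase (d : ℕ) : Type := ℝ × ℝ × Space d

/-- The open space-time cylinder `Ω_τ = (0,τ) × Ω`. -/
def cyl {d : ℕ} (τ : ℝ) (Ω : Set (Space d)) : Set (ℝ × Space d) := Ioo 0 τ ×ˢ Ω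

/-- The closed space-time cylinder `[0,τ] × closure Ω`, the closure of `Ω_τ` for `τ > 0`. -/
def cylClosure {d : ℕ} (τ : ℝ) (Ω : Set (Space d)) : Set (ℝ × Space d) :=
  Icc 0 τ ×ˢ closure Ω

/-- A bounded domain (non-empty, open, connected set) with Lipschitz boundary: near each boundary
point, for some unit direction `e`, the set `Ω` is the strict epigraph in direction `e` of a
Lipschitz function `h` of the coordinates orthogonal to `e`. -/
structure IsBoundedLipschitzDomain {d : ℕ} (Ω : Set (Space d)) : Prop where
  isOpen : IsOpen Ω
  isConnected : IsConnected Ω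
  isBounded : Bornology.IsBounded Ω
  lipschitz_boundary : ∀ x ∈ frontier Ω, ∃ (e : Space d) (h : Space d → ℝ) (K : NNReal) (r : ℝ),
    ‖e‖ = 1 ∧ LipschitzWith K h ∧ (∀ (y : Space d) (s : ℝ), h (y + s • e) = h y) ∧ 0 < r ∧
      ∀ y ∈ Metric.ball x r, (y ∈ Ω ↔ h y < inner ℝ e y)

/-! ### Function spaces -/

/-- `g` is the weak (distributional) derivative of `f` on the open set `D`. -/
def HasWeakDeriv {X F : Type*} [NormedAddCommGroup X] [NormedSpace ℝ X] [MeasureSpace X]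
    [NormedAddCommGroup F] [NormedSpace ℝ F] (D : Set X) (f : X → F) (g : X → X →L[ℝ] F) : Prop :=
  LocallyIntegrableOn f D ∧ LocallyIntegrableOn g D ∧
    ∀ η : X → ℝ, ContDiff ℝ ∞ η → HasCompactSupport η → tsupport η ⊆ D →
      ∀ v : X, ∫ x in D, (fderiv ℝ η x v) • f x = - ∫ x in D, η x • g x v

/-- `f ∈ W₀^{1,2}(Ω; ℝᵈ)` with weak gradient `g`: the pair `(f, g)` belongs to the closure in
`L² × L²` of the pairs `(φ, ∇φ)` with `φ` smooth and compactly supported in `Ω`. -/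
def MemW12Zero {d : ℕ} (Ω : Set (Space d)) (f : Space d → Space d)
    (g : Space d → Space d →L[ℝ] Space d) : Prop :=
  MemLp f 2 (volume.restrict Ω) ∧ MemLp g 2 (volume.restrict Ω) ∧
    ∀ ε : ENNReal, 0 < ε → ∃ φ : Space d → Space d,
      ContDiff ℝ ∞ φ ∧ HasCompactSupport φ ∧ tsupport φ ⊆ Ω ∧
        eLpNorm (fun x => f x - φ x) 2 (volume.restrict Ω) ≤ ε ∧
        eLpNorm (fun x => g x - fderiv ℝ φ x) 2 (volume.restrict Ω) ≤ ε

/-- `U ∈ L²(0,T; W₀^{1,2}(Ω; ℝᵈ))` with spatial weak gradient `DU`. -/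
def MemL2W12Zero {d : ℕ} (T : ℝ) (Ω : Set (Space d)) (U : ℝ × Space d → Space d)
    (DU : ℝ × Space d → Space d →L[ℝ] Space d) : Prop :=
  MemLp U 2 (volume.restrict (cyl T Ω)) ∧ MemLp DU 2 (volume.restrict (cyl T Ω)) ∧
    ∀ᵐ t ∂(volume.restrict (Ioo 0 T)),
      MemW12Zero Ω (fun x => U (t, x)) (fun x => DU (t, x))

/-- `u ∈ L²(0,T; W^{2,∞}(Ω; ℝᵈ))` with first and second spatial weak derivatives `Du`, `D2u`. -/
def MemL2W2Inf {d : ℕ} (T : ℝ) (Ω : Set (Space d)) (u : ℝ × Space d → Space d)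
    (Du : ℝ × Space d → Space d →L[ℝ] Space d)
    (D2u : ℝ × Space d → Space d →L[ℝ] Space d →L[ℝ] Space d) : Prop :=
  AEStronglyMeasurable u (volume.restrict (cyl T Ω)) ∧
  AEStronglyMeasurable Du (volume.restrict (cyl T Ω)) ∧
  AEStronglyMeasurable D2u (volume.restrict (cyl T Ω)) ∧
  (∃ h : ℝ → ℝ, MemLp h 2 (volume.restrict (Ioo 0 T)) ∧
    ∀ᵐ p ∂(volume.restrict (cyl T Ω)), ‖u p‖ ≤ h p.1 ∧ ‖Du p‖ ≤ h p.1 ∧ ‖D2u p‖ ≤ h p.1) ∧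
  ∀ᵐ t ∂(volume.restrict (Ioo 0 T)),
    HasWeakDeriv Ω (fun x => u (t, x)) (fun x => Du (t, x)) ∧
    HasWeakDeriv Ω (fun x => Du (t, x)) (fun x => D2u (t, x))

/-- `f ∈ C¹` on the closed cylinder `[0,T] × closure Ω`: `f` is continuous there, differentiable
in the open cylinder, and its space-time derivative extends continuously to the closed cylinder,
the extension being `f'`. -/
structure IsC1OnClosure {d : ℕ} {F : Type*} [NormedAddCommGroup F] [NormedSpace ℝ F]
    (T : ℝ) (Ω : Set (Space d)) (f : ℝ × Space d → F)
    (f' : ℝ × Space d → (ℝ × Space d) →L[ℝ] F) : Prop where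
  continuousOn : ContinuousOn f (cylClosure T Ω)
  continuousOn_deriv : ContinuousOn f' (cylClosure T Ω)
  hasFDerivAt : ∀ p ∈ cyl T Ω, HasFDerivAt f (f' p) p

/-- `φ` is the continuous representative, on the closed cylinder, of a function of class
`W^{1,∞}((0,T) × Ω)`, and `g` is its space-time weak derivative. -/
structure IsW1Inf {d : ℕ} (T : ℝ) (Ω : Set (Space d)) (φ : ℝ × Space d → ℝ)
    (g : ℝ × Space d → (ℝ × Space d) →L[ℝ] ℝ) : Prop where
  continuousOn : ContinuousOn φ (cylClosure T Ω)
  aestronglyMeasurable : AEStronglyMeasurable g (volume.restrict (cyl T Ω))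
  bounded : ∃ C : ℝ, ∀ᵐ p ∂(volume.restrict (cyl T Ω)), ‖g p‖ ≤ C
  hasWeakDeriv : HasWeakDeriv (cyl T Ω) φ g

/-- `f ∈ C_weak([0,T]; L^r(Ω; F))` for an exponent `1 < r < ∞`: each `f t` lies in `L^r`, and the
pairing with every element of the dual space `L^{r/(r-1)}` is continuous on `[0,T]`. -/
def MemCWeak {d : ℕ} {F : Type*} [NormedAddCommGroup F] [InnerProductSpace ℝ F]
    (T : ℝ) (Ω : Set (Space d)) (r : ℝ) (f : ℝ → Space d → F) : Prop :=
  (∀ t ∈ Icc 0 T, MemLp (f t) (ENNReal.ofReal r) (volume.restrict Ω)) ∧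
    ∀ g : Space d → F, MemLp g (ENNReal.ofReal (r / (r - 1))) (volume.restrict Ω) →
      ContinuousOn (fun t => ∫ x in Ω, inner ℝ (f t x) (g x)) (Icc 0 T)

/-! ### Derivatives, gradients and the viscous stress -/

/-- The spatial part `∇ₓ` of a space-time derivative. -/
def spatial {d : ℕ} {F : Type*} [NormedAddCommGroup F] [NormedSpace ℝ F]
    (L : (ℝ × Space d) →L[ℝ] F) : Space d →L[ℝ] F :=
  L.comp (ContinuousLinearMap.inr ℝ ℝ (Space d))

/-- Classical partial derivative in time. -/
def dt {d : ℕ} (f : ℝ × Space d → ℝ) (p : ℝ × Space d) : ℝ := fderiv ℝ f p (1, 0)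

/-- Classical partial derivative in the `j`-th space variable. -/
def dx {d : ℕ} (j : Fin d) (f : ℝ × Space d → ℝ) (p : ℝ × Space d) : ℝ :=
  fderiv ℝ f p (0, EuclideanSpace.single j 1)

/-- The matrix `(∂ⱼ uᵢ)ᵢⱼ` of a gradient. -/
def gradMat {d : ℕ} (A : Space d →L[ℝ] Space d) : Matrix (Fin d) (Fin d) ℝ :=
  Matrix.of fun i j => A (EuclideanSpace.single j 1) i

/-- The matrix product `A : B`. -/
def frob {d : ℕ} (A B : Matrix (Fin d) (Fin d) ℝ) : ℝ := ∑ i, ∑ j, A i j * B i j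

/-- The viscous stress tensor
`𝕊(G) = μ (G + Gᵀ - (2/d) tr(G) I) + lam tr(G) I` for a velocity gradient `G`. -/
def stress {d : ℕ} (μ lam : ℝ) (G : Matrix (Fin d) (Fin d) ℝ) : Matrix (Fin d) (Fin d) ℝ :=
  μ • (G + G.transpose - (2 / (d : ℝ) * G.trace) • (1 : Matrix (Fin d) (Fin d) ℝ)) +
    (lam * G.trace) • (1 : Matrix (Fin d) (Fin d) ℝ)

/-- The `i`-th component of `div 𝕊(∇u)`, computed from the second derivative `H` of `u`
(`H v` is the derivative of `∇u` in direction `v`). -/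
def divStress {d : ℕ} (μ lam : ℝ) (H : Space d →L[ℝ] Space d →L[ℝ] Space d) (i : Fin d) : ℝ :=
  ∑ j, stress μ lam (gradMat (H (EuclideanSpace.single j 1))) i j

/-- The pressure `p(z) = a z^γ`. -/
def pressure (a γ z : ℝ) : ℝ := a * z ^ γ

/-- The pressure potential `P(z) = a/(γ-1) z^γ`. -/
def pressurePot (a γ z : ℝ) : ℝ := a / (γ - 1) * z ^ γ

/-- The energy density `½ ρ |u|² + P(ρ θ)` of a state `z = (ρ, θ, u)`. -/
def energyDensity {d : ℕ} (a γ : ℝ) (z : Phase d) : ℝ :=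
  1 / 2 * z.1 * ‖z.2.2‖ ^ 2 + pressurePot a γ (z.1 * z.2.1)

/-! ### Strong solutions -/

/-- A strong solution `(ρ, θ, u)` on `(0,T) × Ω` of the Navier–Stokes system with potential
temperature transport and no-slip boundary condition, in the class
`ρ, θ ∈ C¹`, `ρ, θ > 0`, `u ∈ C¹ ∩ L²(0,T; W^{2,∞})`. The two transport equations hold pointwise;
the momentum equation, which contains weak second derivatives of `u`, holds almost everywhere. -/
structure IsStrongSolution {d : ℕ} (a γ μ lam T : ℝ) (Ω : Set (Space d))
    (ρ θ : ℝ × Space d → ℝ) (u : ℝ × Space d → Space d) : Prop where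
  density_C1 : ∃ ρ', IsC1OnClosure T Ω ρ ρ'
  temperature_C1 : ∃ θ', IsC1OnClosure T Ω θ θ'
  pos : ∀ p ∈ cylClosure T Ω, 0 < ρ p ∧ 0 < θ p
  no_slip : ∀ t ∈ Icc 0 T, ∀ x ∈ frontier Ω, u (t, x) = 0
  continuity : ∀ p ∈ cyl T Ω, dt ρ p + ∑ j, dx j (fun q => ρ q * u q j) p = 0
  temperature : ∀ p ∈ cyl T Ω,
    dt (fun q => ρ q * θ q) p + ∑ j, dx j (fun q => ρ q * θ q * u q j) p = 0
  velocity : ∃ u' D2u, IsC1OnClosure T Ω u u' ∧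
    MemL2W2Inf T Ω u (fun p => spatial (u' p)) D2u ∧
    ∀ᵐ p ∂(volume.restrict (cyl T Ω)), ∀ i,
      dt (fun q => ρ q * u q i) p + ∑ j, dx j (fun q => ρ q * u q i * u q j) p
        + dx i (fun q => pressure a γ (ρ q * θ q)) p = divStress μ lam (D2u p) i

/-! ### Dissipative measure-valued solutions -/

/-- The mean velocity `u_V = ⟨V; u⟩`. -/
def meanVelocity {d : ℕ} (V : Kernel (ℝ × Space d) (Phase d)) (p : ℝ × Space d) : Space d :=
  ∫ z, z.2.2 ∂V p

/-- The matrix `⟨V; ρ u ⊗ u + p(ρ θ) I⟩`. -/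
def momentumFlux {d : ℕ} (a γ : ℝ) (V : Kernel (ℝ × Space d) (Phase d)) (p : ℝ × Space d) :
    Matrix (Fin d) (Fin d) ℝ :=
  Matrix.of fun i j =>
    ∫ z, (z.1 * z.2.2 i * z.2.2 j + if i = j then pressure a γ (z.1 * z.2.1) else 0) ∂V p

/-- `g` is integrable with respect to `V_{(t,x)}` for a.a. `(t,x) ∈ Ω_T`, and the function
`(t,x) ↦ ⟨V_{(t,x)}; g⟩` lies in `L¹(Ω_T)`. -/
def MomentIntegrable {d : ℕ} {F : Type*} [NormedAddCommGroup F] [NormedSpace ℝ F] (T : ℝ)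
    (Ω : Set (Space d)) (V : Kernel (ℝ × Space d) (Phase d)) (g : Phase d → F) : Prop :=
  (∀ᵐ p ∂(volume.restrict (cyl T Ω)), Integrable g (V p)) ∧
    Integrable (fun p => ∫ z, g z ∂V p) (volume.restrict (cyl T Ω))

/-- `f` is a representative, defined at every time, of the moment `⟨V; g⟩`. -/
def IsMomentRep {d : ℕ} {F : Type*} [NormedAddCommGroup F] [NormedSpace ℝ F] (T : ℝ)
    (Ω : Set (Space d)) (V : Kernel (ℝ × Space d) (Phase d)) (g : Phase d → F)
    (f : ℝ → Space d → F) : Prop :=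
  ∀ᵐ p ∂(volume.restrict (cyl T Ω)), f p.1 p.2 = ∫ z, g z ∂V p

/-- The energy concentration defect: `𝔈 ∈ L^∞_{weak*}(0,T; 𝓜⁺(closure Ω))`. -/
structure IsEnergyDefect {d : ℕ} (T : ℝ) (Ω : Set (Space d)) (𝔈 : Kernel ℝ (Space d)) : Prop where
  concentrated : ∀ᵐ t ∂(volume.restrict (Ioo 0 T)), 𝔈 t (closure Ω)ᶜ = 0
  bounded : ∃ C : NNReal, ∀ᵐ t ∂(volume.restrict (Ioo 0 T)), 𝔈 t univ ≤ C

/-- The dissipation defect: `𝔇 ∈ 𝓜⁺([0,T] × closure Ω)`. -/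
structure IsDissipationDefect {d : ℕ} (T : ℝ) (Ω : Set (Space d)) (𝔇 : Measure (ℝ × Space d)) :
    Prop where
  concentrated : 𝔇 (cylClosure T Ω)ᶜ = 0
  finite : IsFiniteMeasure 𝔇

/-- The Reynolds concentration defect: `ℜ ∈ L^∞_{weak*}(0,T; 𝓜(closure Ω)^{d×d}_{sym,+})`, given
by the entries `ℜ t i j` of the matrix-valued measures `ℜ(t)`, with values in the set of symmetric
positive semidefinite matrices. -/
structure IsReynoldsDefect {d : ℕ} (T : ℝ) (Ω : Set (Space d))
    (ℜ : ℝ → Fin d → Fin d → SignedMeasure (Space d)) : Prop where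
  measurable : ∀ i j, ∀ A, MeasurableSet A →
    AEMeasurable (fun t => ℜ t i j A) (volume.restrict (Ioo 0 T))
  concentrated : ∀ᵐ t ∂(volume.restrict (Ioo 0 T)), ∀ i j, (ℜ t i j).variation (closure Ω)ᶜ = 0
  bounded : ∃ C : NNReal, ∀ᵐ t ∂(volume.restrict (Ioo 0 T)), ∀ i j, (ℜ t i j).variation univ ≤ C
  posSemidef : ∀ᵐ t ∂(volume.restrict (Ioo 0 T)), ∀ A, MeasurableSet A →
    (Matrix.of fun i j => ℜ t i j A).PosSemidef

/-- The trace of `ℜ` is comparable with `𝔈`: `c₁ 𝔈 ≤ tr ℜ ≤ c₂ 𝔈` for some `c₂ ≥ c₁ > 0`. -/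
def DefectsCompatible {d : ℕ} (T : ℝ) (𝔈 : Kernel ℝ (Space d))
    (ℜ : ℝ → Fin d → Fin d → SignedMeasure (Space d)) : Prop :=
  ∃ c₁ c₂ : ℝ, 0 < c₁ ∧ c₁ ≤ c₂ ∧ ∀ᵐ t ∂(volume.restrict (Ioo 0 T)), ∀ A, MeasurableSet A →
    c₁ * (𝔈 t).real A ≤ ∑ i, ℜ t i i A ∧ ∑ i, ℜ t i i A ≤ c₂ * (𝔈 t).real A

/-- The pairing `∫ M : dℜ` of a matrix-valued function and a matrix-valued measure. -/
def matrixPairing {d : ℕ} (M : Space d → Matrix (Fin d) (Fin d) ℝ)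
    (R : Fin d → Fin d → SignedMeasure (Space d)) : ℝ :=
  ∑ i, ∑ j, (R i j).integral (fun x => M x i j) (ContinuousLinearMap.lsmul ℝ ℝ)

/-- Energy inequality. Here `Du` is the weak gradient of `u_V`. -/
def EnergyInequality {d : ℕ} (a γ μ lam T : ℝ) (Ω : Set (Space d))
    (ρ₀ θ₀ : Space d → ℝ) (u₀ : Space d → Space d)
    (V : Kernel (ℝ × Space d) (Phase d)) (Du : ℝ × Space d → Space d →L[ℝ] Space d)
    (𝔈 : Kernel ℝ (Space d)) (𝔇 : Measure (ℝ × Space d)) : Prop :=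
  (∀ᵐ p ∂(volume.restrict (cyl T Ω)), Integrable (fun z : Phase d => z.2.2) (V p)) ∧
  MemL2W12Zero T Ω (meanVelocity V) Du ∧
  MomentIntegrable T Ω V (energyDensity a γ) ∧
  ∀ᵐ τ ∂(volume.restrict (Ioo 0 T)),
    (∫ x in Ω, ∫ z, energyDensity a γ z ∂V (τ, x))
      + (∫ p in cyl τ Ω, frob (stress μ lam (gradMat (Du p))) (gradMat (Du p)))
      + (𝔈 τ).real (closure Ω) + 𝔇.real (cylClosure τ Ω)
      ≤ ∫ x in Ω, energyDensity a γ (ρ₀ x, θ₀ x, u₀ x)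

/-- Continuity equation. -/
def ContinuityEquation {d : ℕ} (γ T : ℝ) (Ω : Set (Space d)) (ρ₀ : Space d → ℝ)
    (V : Kernel (ℝ × Space d) (Phase d)) : Prop :=
  ∃ r : ℝ → Space d → ℝ, IsMomentRep T Ω V (fun z => z.1) r ∧ MemCWeak T Ω γ r ∧
    (∀ᵐ x ∂(volume.restrict Ω), r 0 x = ρ₀ x) ∧
    ∀ τ ∈ Icc 0 T, ∀ φ g, IsW1Inf T Ω φ g →
      (∫ x in Ω, r τ x * φ (τ, x)) - (∫ x in Ω, r 0 x * φ (0, x))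
        = ∫ p in cyl τ Ω,
            ((∫ z, z.1 ∂V p) * g p (1, 0) + spatial (g p) (∫ z, z.1 • z.2.2 ∂V p))

/-- Momentum equation with the Reynolds defect `ℜ`. -/
def MomentumEquation {d : ℕ} (a γ μ lam T : ℝ) (Ω : Set (Space d))
    (ρ₀ : Space d → ℝ) (u₀ : Space d → Space d)
    (V : Kernel (ℝ × Space d) (Phase d)) (Du : ℝ × Space d → Space d →L[ℝ] Space d)
    (ℜ : ℝ → Fin d → Fin d → SignedMeasure (Space d)) : Prop :=
  ∃ m : ℝ → Space d → Space d, IsMomentRep T Ω V (fun z => z.1 • z.2.2) m ∧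
    MemCWeak T Ω (2 * γ / (γ + 1)) m ∧
    (∀ᵐ x ∂(volume.restrict Ω), m 0 x = ρ₀ x • u₀ x) ∧
    ∀ τ ∈ Icc 0 T, ∀ (φ : ℝ × Space d → Space d) (φ' : ℝ × Space d → (ℝ × Space d) →L[ℝ] Space d),
      IsC1OnClosure T Ω φ φ' → (∀ t ∈ Icc 0 T, ∀ x ∈ frontier Ω, φ (t, x) = 0) →
      (∫ x in Ω, inner ℝ (m τ x) (φ (τ, x))) - (∫ x in Ω, inner ℝ (m 0 x) (φ (0, x)))
        = (∫ p in cyl τ Ω,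
            (inner ℝ (∫ z, z.1 • z.2.2 ∂V p) (φ' p (1, 0))
              + frob (momentumFlux a γ V p) (gradMat (spatial (φ' p)))))
          - (∫ p in cyl τ Ω,
              frob (stress μ lam (gradMat (Du p))) (gradMat (spatial (φ' p))))
          + ∫ t in Ioo 0 τ, matrixPairing (fun x => gradMat (spatial (φ' (t, x)))) (ℜ t)

/-- Potential temperature equation. -/
def TemperatureEquation {d : ℕ} (γ T : ℝ) (Ω : Set (Space d)) (ρ₀ θ₀ : Space d → ℝ)
    (V : Kernel (ℝ × Space d) (Phase d)) : Prop :=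
  MomentIntegrable T Ω V (fun z => (z.1 * z.2.1) • z.2.2) ∧
  ∃ s : ℝ → Space d → ℝ, IsMomentRep T Ω V (fun z => z.1 * z.2.1) s ∧ MemCWeak T Ω γ s ∧
    (∀ᵐ x ∂(volume.restrict Ω), s 0 x = ρ₀ x * θ₀ x) ∧
    ∀ τ ∈ Icc 0 T, ∀ φ g, IsW1Inf T Ω φ g →
      (∫ x in Ω, s τ x * φ (τ, x)) - (∫ x in Ω, s 0 x * φ (0, x))
        = ∫ p in cyl τ Ω,
            ((∫ z, z.1 * z.2.1 ∂V p) * g p (1, 0)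
              + spatial (g p) (∫ z, (z.1 * z.2.1) • z.2.2 ∂V p))

/-- Entropy inequality; the value of `⟨V; ρ ln θ⟩` at time `0` is `ρ₀ ln θ₀`. -/
def EntropyInequality {d : ℕ} (T : ℝ) (Ω : Set (Space d)) (ρ₀ θ₀ : Space d → ℝ)
    (V : Kernel (ℝ × Space d) (Phase d)) : Prop :=
  ∀ ψ g, IsW1Inf T Ω ψ g → (∀ p ∈ cylClosure T Ω, 0 ≤ ψ p) →
    ∀ᵐ τ ∂(volume.restrict (Ioo 0 T)),
      (∫ x in Ω, (∫ z, z.1 * Real.log z.2.1 ∂V (τ, x)) * ψ (τ, x))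
          - (∫ x in Ω, ρ₀ x * Real.log (θ₀ x) * ψ (0, x))
        ≥ ∫ p in cyl τ Ω,
            ((∫ z, z.1 * Real.log z.2.1 ∂V p) * g p (1, 0)
              + spatial (g p) (∫ z, (z.1 * Real.log z.2.1) • z.2.2 ∂V p))

/-- Poincaré's inequality. The left-hand side is an integral of a non-negative function with values
in `[0,∞]`, so that its finiteness is part of the inequality. -/
def PoincareInequality {d : ℕ} (T : ℝ) (Ω : Set (Space d))
    (V : Kernel (ℝ × Space d) (Phase d)) (Du : ℝ × Space d → Space d →L[ℝ] Space d)
    (𝔈 : Kernel ℝ (Space d)) (𝔇 : Measure (ℝ × Space d)) : Prop :=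
  ∃ C : ℝ, 0 < C ∧ ∀ U DU, MemL2W12Zero T Ω U DU →
    ∀ᵐ τ ∂(volume.restrict (Ioo 0 T)),
      (∫⁻ p in cyl τ Ω, ∫⁻ z, ENNReal.ofReal (‖z.2.2 - U p‖ ^ 2) ∂V p)
        ≤ ENNReal.ofReal (C * ((∫ p in cyl τ Ω, frob (gradMat (Du p - DU p)) (gradMat (Du p - DU p)))
            + (∫ t in Ioo 0 τ, (𝔈 t).real (closure Ω)) + 𝔇.real (cylClosure τ Ω)))

/-- `V` is a dissipative measure-valued (DMV) solution on `(0,T) × Ω` with initial data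
`(ρ₀, θ₀, u₀)` and no-slip boundary condition, with energy concentration defect `𝔈`, dissipation
defect `𝔇`, Reynolds concentration defect `ℜ`, and `Du` the weak gradient of the mean velocity.
A parametrized probability measure of class `L^∞_{weak*}(Ω_T; 𝓟(ℝ^(d+2)))` is given by a
Borel representative, that is, by a Markov kernel. -/
structure IsDMVSolution {d : ℕ} (a γ μ lam T : ℝ) (Ω : Set (Space d))
    (ρ₀ θ₀ : Space d → ℝ) (u₀ : Space d → Space d)
    (V : Kernel (ℝ × Space d) (Phase d)) (Du : ℝ × Space d → Space d →L[ℝ] Space d)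
    (𝔈 : Kernel ℝ (Space d)) (𝔇 : Measure (ℝ × Space d))
    (ℜ : ℝ → Fin d → Fin d → SignedMeasure (Space d)) : Prop where
  markov : IsMarkovKernel V
  support : ∃ c : ℝ, 0 < c ∧
    ∀ᵐ p ∂(volume.restrict (cyl T Ω)), V p {z | 0 ≤ z.1 ∧ c ≤ z.2.1} = 1
  energyDefect : IsEnergyDefect T Ω 𝔈
  dissipationDefect : IsDissipationDefect T Ω 𝔇
  reynoldsDefect : IsReynoldsDefect T Ω ℜ
  compatible : DefectsCompatible T 𝔈 ℜ
  energy : EnergyInequality a γ μ lam T Ω ρ₀ θ₀ u₀ V Du 𝔈 𝔇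
  continuity : ContinuityEquation γ T Ω ρ₀ V
  momentum : MomentumEquation a γ μ lam T Ω ρ₀ u₀ V Du ℜ
  temperature : TemperatureEquation γ T Ω ρ₀ θ₀ V
  entropy : EntropyInequality T Ω ρ₀ θ₀ V
  poincare : PoincareInequality T Ω V Du 𝔈 𝔇

end

end PotTempNS

open PotTempNS

namespace PotTempNS

/-! ### Weak derivatives and `W₀^{1,2}` -/

/-! The proof is a relative energy argument. The relative energy of a state (ρ, θ, u) with respect
to a strong state (r, Θ, U) is the kinetic part ½ρ|u - U|² plus the Bregman distance of P(ρθ),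
regarded as a convex function of ρ and ρ ln θ. It is affine in moments of 𝒱 whose evolution is
known. Combining the energy inequality, the continuity and momentum equations and the entropy
inequality, tested with functions of the strong state, therefore bounds its integral
(`IsDMVSolution.relEnergy_inequality`). It starts from zero, and it vanishes only when the two
states agree (`eq_of_relEnergy_eq_zero`).

By the equations of the strong solution, the terms that are linear in the deviation reduce to the
work of f = div 𝕊(∇U) and to div(p(rΘ)U), which has mean zero. The work of f, integrated by parts,
completes the viscous term to minus the dissipation of u_𝒱 - U. The other terms are quadratic and
bounded by the relative energy (`exists_relIntegrand_le`), with one exception: (1 - ρ/r) f·(u - U)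
near the vacuum, where ρ|u - U|² says nothing about |u - U|. There the deviation is compared with a
reference field U'. Young's inequality leaves a small multiple of |u - U'|², for Poincaré's
inequality, and the mass of the states of low density, which the relative energy controls.

In dimension three the dissipation controls the full gradient of u_𝒱 - U for every admissible λ
(`MemW12Zero.integral_stress_ge`). With U' = U everything is absorbed and a Grönwall inequality
remains. In dimension two the choice λ = -μ is admissible and this control is lost. With U' = u_𝒱
the gradient term of Poincaré's inequality disappears, at the price of the integral of κ|u_𝒱 - U|,
where κ is the local mass of the states of low density. Sobolev's inequality in the plane, with
constants growing only linearly in the exponent (`exists_integral_weight_mul_norm_le`), bounds it by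
n g(t) F^(1 - 1/(4n)) for every n, where F is the relative energy plus the mass of 𝔈. An Osgood
argument in the manner of Yudovich (`ae_eq_zero_of_osgood`) then gives F = 0.

Once F = 0 on (0, T₁) for all T₁ < T*, the measures 𝒱 are Dirac masses and 𝔈 = 0, and ℜ = 0 because
its trace is dominated by 𝔈. For 𝔇, the inequality is read at times τ slightly larger than T₁, the
strong solution being prolonged by a change of time (`exists_timeCutoff`). Up to T₁ the right-hand
side gains nothing, and afterwards it is dominated by an integrable function that does not depend on
T₁. Hence 𝔇 up to time τ is at most the integral of that function over (T₁, τ), and this interval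
can be made arbitrarily short around any time s ≤ T* with s < T. -/

theorem hasWeakDeriv_of_hasFDerivAt {X F : Type*} [NormedAddCommGroup X] [NormedSpace ℝ X]
    [FiniteDimensional ℝ X] [MeasureSpace X] [BorelSpace X]
    [(volume : Measure X).IsAddHaarMeasure]
    [NormedAddCommGroup F] [NormedSpace ℝ F] {D : Set X}
    (hD : IsOpen D) {f : X → F} {f' : X → X →L[ℝ] F} (hf : ∀ x ∈ D, HasFDerivAt f (f' x) x)
    (hf' : ContinuousOn f' D) : HasWeakDeriv D f f' := by
  have : ProperSpace X := FiniteDimensional.proper ℝ X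
  have hfc : ContinuousOn f D := fun x hx => (hf x hx).continuousAt.continuousWithinAt
  refine ⟨hfc.locallyIntegrableOn hD.measurableSet, hf'.locallyIntegrableOn hD.measurableSet, ?_⟩
  intro η hη hc hsub v
  have hηd : Continuous (fderiv ℝ η) := hη.continuous_fderiv (by simp)
  -- A function continuous only on `D` becomes globally continuous after multiplication by a
  -- function supported in `tsupport η ⊆ D`: near a point outside `D` the product is zero.
  have key : ∀ (k : X → ℝ) (G : X → F), Continuous k → tsupport k ⊆ tsupport η →
      ContinuousOn G D → Integrable (fun x => k x • G x) := by
    intro k G hk hks hG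
    have hcs : HasCompactSupport k := IsCompact.of_isClosed_subset hc (isClosed_tsupport _) hks
    refine Continuous.integrable_of_hasCompactSupport ?_ hcs.smul_right
    rw [continuous_iff_continuousAt]
    intro x
    by_cases hx : x ∈ D
    · exact hk.continuousAt.smul (hG.continuousAt (hD.mem_nhds hx))
    · have hx' : x ∉ tsupport k := fun h => hx (hsub (hks h))
      have : (fun x => k x • G x) =ᶠ[𝓝 x] fun _ => 0 := by
        filter_upwards [notMem_tsupport_iff_eventuallyEq.1 hx'] with y hy
        simp [hy]
      exact this.continuousAt
  have hsup' : tsupport (fun x => fderiv ℝ η x v) ⊆ tsupport η := by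
    refine closure_minimal (fun x hx => ?_) (isClosed_tsupport _)
    by_contra hx'
    have h0 := notMem_tsupport_iff_eventuallyEq.1 hx'
    have : fderiv ℝ η x = 0 := by
      rw [h0.fderiv_eq]; simp
    exact hx (by simp [this])
  have hout : ∀ (k : X → ℝ) (G : X → F), tsupport k ⊆ tsupport η →
      ∫ x in D, k x • G x = ∫ x, k x • G x := by
    intro k G hks
    refine setIntegral_eq_integral_of_forall_compl_eq_zero fun x hx => ?_
    rw [image_eq_zero_of_notMem_tsupport (fun h => hx (hsub (hks h))), zero_smul]
  rw [hout _ _ hsup', hout η (fun x => f' x v) le_rfl]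
  have h1 := key η f hη.continuous le_rfl hfc
  have h2 := key η (fun x => f' x v) hη.continuous le_rfl (hf'.clm_apply continuousOn_const)
  have h3 := key (fun x => fderiv ℝ η x v) f (hηd.clm_apply continuous_const) hsup' hfc
  have := integral_bilinear_hasFDerivAt_right_eq_neg_left_of_integrable (μ := volume) (v := v)
    (B := ContinuousLinearMap.lsmul ℝ ℝ) (f := η) (f' := fderiv ℝ η) (g := f) (g' := f')
    (by simpa using h3) (by simpa using h2) (by simpa using h1)
    (fun x _ => (hη.differentiable (by simp) x).hasFDerivAt) (fun x hx => hf x (hsub hx))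
  simp only [ContinuousLinearMap.lsmul_apply] at this
  rw [this, neg_neg]

/-- `L` has to commute with integrals over the whole of `D`; global integrability of `f` and `f'`
makes this immediate. -/
theorem HasWeakDeriv.clm_comp {X F G : Type*} [NormedAddCommGroup X] [NormedSpace ℝ X]
    [MeasureSpace X] [OpensMeasurableSpace X] [NormedAddCommGroup F] [NormedSpace ℝ F]
    [CompleteSpace F]
    [NormedAddCommGroup G] [NormedSpace ℝ G] [CompleteSpace G]
    {D : Set X} {f : X → F} {f' : X → X →L[ℝ] F} (h : HasWeakDeriv D f f')
    (hf : IntegrableOn f D) (hf' : IntegrableOn f' D) (L : F →L[ℝ] G) :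
    HasWeakDeriv D (fun x => L (f x)) (fun x => L.comp (f' x)) := by
  have hLf : IntegrableOn (fun x => L (f x)) D := L.integrable_comp hf
  have hLf' : IntegrableOn (fun x => L.comp (f' x)) D :=
    (ContinuousLinearMap.compL ℝ X F G L).integrable_comp hf'
  refine ⟨hLf.locallyIntegrableOn, hLf'.locallyIntegrableOn, ?_⟩
  intro η hη hc hsub v
  have h0 := h.2.2 η hη hc hsub v
  have bd : ∀ k : X → ℝ, Continuous k → HasCompactSupport k → ∀ w : X → F, IntegrableOn w D →
      IntegrableOn (fun x => k x • w x) D := by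
    intro k hk hkc w hw
    obtain ⟨C, hC⟩ := hkc.exists_bound_of_continuous hk
    exact Integrable.bdd_smul hw C hk.aestronglyMeasurable (Filter.Eventually.of_forall hC)
  have hηd : Continuous (fderiv ℝ η) := hη.continuous_fderiv (by simp)
  have i1 : IntegrableOn (fun x => (fderiv ℝ η x v) • f x) D :=
    bd _ (hηd.clm_apply continuous_const) (hc.fderiv_apply ℝ v) _ hf
  have i2 : IntegrableOn (fun x => η x • f' x v) D :=
    bd _ hη.continuous hc _ ((ContinuousLinearMap.apply ℝ F v).integrable_comp hf')
  calc ∫ x in D, (fderiv ℝ η x v) • L (f x) = ∫ x in D, L ((fderiv ℝ η x v) • f x) := by simp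
    _ = L (∫ x in D, (fderiv ℝ η x v) • f x) := L.integral_comp_comm i1
    _ = - L (∫ x in D, η x • f' x v) := by rw [h0, map_neg]
    _ = - ∫ x in D, L (η x • f' x v) := by rw [L.integral_comp_comm i2]
    _ = _ := by simp

/-- Hölder's inequality with exponents 2 and 2. Through it, identities for smooth compactly
supported fields pass to `W₀^{1,2}`. -/
theorem tendsto_integral_bilin {α E F : Type*} [MeasurableSpace α] {m : Measure α}
    [NormedAddCommGroup E] [NormedSpace ℝ E] [NormedAddCommGroup F] [NormedSpace ℝ F]
    (L : E →L[ℝ] F →L[ℝ] ℝ) {A : α → E} {An : ℕ → α → E} {B : α → F}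
    (hA : MemLp A 2 m) (hAn : ∀ n, MemLp (An n) 2 m) (hB : MemLp B 2 m)
    (h : Filter.Tendsto (fun n => eLpNorm (fun x => A x - An n x) 2 m) Filter.atTop (𝓝 0)) :
    Filter.Tendsto (fun n => ∫ x, L (An n x) (B x) ∂m) Filter.atTop
      (𝓝 (∫ x, L (A x) (B x) ∂m)) := by
  have int : ∀ A : α → E, MemLp A 2 m → Integrable (fun x => L (A x) (B x)) m := by
    intro A hA
    rw [← memLp_one_iff_integrable]
    exact MemLp.of_bilin (r := 1) (fun x y => L x y) ‖L‖₊ hA hB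
      (L.aestronglyMeasurable_comp₂ hA.1 hB.1)
      (Filter.Eventually.of_forall fun x => L.le_opNorm₂ _ _)
  refine tendsto_integral_of_L1' _ (int A hA).1 (Filter.Eventually.of_forall fun n => int _ (hAn n)) ?_
  have hle : ∀ n, eLpNorm ((fun x => L (An n x) (B x)) - fun x => L (A x) (B x)) 1 m
      ≤ ‖L‖₊ * eLpNorm (fun x => A x - An n x) 2 m * eLpNorm B 2 m := by
    intro n
    have : eLpNorm ((fun x => L (An n x) (B x)) - fun x => L (A x) (B x)) 1 m
        = eLpNorm (fun x => L (A x - An n x) (B x)) 1 m := by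
      rw [← eLpNorm_neg]
      congr 1
      ext x
      simp
    rw [this]
    exact eLpNorm_le_eLpNorm_mul_eLpNorm_of_nnnorm (r := 1) (hA.1.sub (hAn n).1) hB.1
      (fun x y => L x y) ‖L‖₊ (Filter.Eventually.of_forall fun x => L.le_opNorm₂ _ _)
  refine tendsto_of_tendsto_of_tendsto_of_le_of_le tendsto_const_nhds ?_ (fun _ => zero_le) hle
  have := ENNReal.Tendsto.mul_const (b := eLpNorm B 2 m)
    (ENNReal.Tendsto.const_mul (a := (‖L‖₊ : ENNReal)) h (Or.inr (by simp))) (Or.inr hB.2.ne)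
  simpa using this

section

variable {d : ℕ} {Ω : Set (Space d)} {f : Space d → Space d} {g : Space d → Space d →L[ℝ] Space d}

theorem memLp_of_contDiff_hasCompactSupport {E : Type*} [NormedAddCommGroup E]
    {φ : Space d → E} (h : Continuous φ) (hc : HasCompactSupport φ) (p : ENNReal)
    (Ω : Set (Space d)) : MemLp φ p (volume.restrict Ω) :=
  (h.memLp_of_hasCompactSupport hc).restrict Ω

theorem MemW12Zero.exists_seq (h : MemW12Zero Ω f g) :
    ∃ φ : ℕ → Space d → Space d, (∀ n, ContDiff ℝ ∞ (φ n)) ∧ (∀ n, HasCompactSupport (φ n)) ∧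
      (∀ n, tsupport (φ n) ⊆ Ω) ∧
      Filter.Tendsto (fun n => eLpNorm (fun x => f x - φ n x) 2 (volume.restrict Ω))
        Filter.atTop (𝓝 0) ∧
      Filter.Tendsto (fun n => eLpNorm (fun x => g x - fderiv ℝ (φ n) x) 2 (volume.restrict Ω))
        Filter.atTop (𝓝 0) := by
  have hpos : ∀ n : ℕ, (0 : ENNReal) < ((n : ENNReal))⁻¹ := fun n =>
    ENNReal.inv_pos.2 (ENNReal.natCast_ne_top n)
  choose φ h1 h2 h3 h4 h5 using fun n : ℕ => h.2.2 _ (hpos n)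
  refine ⟨φ, h1, h2, h3, ?_, ?_⟩
  · exact tendsto_of_tendsto_of_tendsto_of_le_of_le tendsto_const_nhds
      ENNReal.tendsto_inv_nat_nhds_zero (fun _ => zero_le) h4
  · exact tendsto_of_tendsto_of_tendsto_of_le_of_le tendsto_const_nhds
      ENNReal.tendsto_inv_nat_nhds_zero (fun _ => zero_le) h5

theorem MemW12Zero.sub {f₂ : Space d → Space d} {g₂ : Space d → Space d →L[ℝ] Space d}
    (h : MemW12Zero Ω f g) (h₂ : MemW12Zero Ω f₂ g₂) :
    MemW12Zero Ω (fun x => f x - f₂ x) (fun x => g x - g₂ x) := by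
  refine ⟨h.1.sub h₂.1, h.2.1.sub h₂.2.1, fun ε hε => ?_⟩
  obtain ⟨φ, a1, a2, a3, a4, a5⟩ := h.2.2 (ε / 2) (ENNReal.half_pos hε.ne')
  obtain ⟨ψ, b1, b2, b3, b4, b5⟩ := h₂.2.2 (ε / 2) (ENNReal.half_pos hε.ne')
  refine ⟨fun x => φ x - ψ x, a1.sub b1, a2.sub b2,
    (tsupport_sub _ _).trans (union_subset a3 b3), ?_, ?_⟩
  · calc _ = eLpNorm ((fun x => f x - φ x) - fun x => f₂ x - ψ x) 2 (volume.restrict Ω) := by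
          congr 1; ext x; simp; abel
      _ ≤ ε / 2 + ε / 2 := (eLpNorm_sub_le
          (h.1.1.sub a1.continuous.aestronglyMeasurable)
          (h₂.1.1.sub b1.continuous.aestronglyMeasurable) (by norm_num)).trans (add_le_add a4 b4)
      _ = ε := ENNReal.add_halves ε
  · calc _ = eLpNorm ((fun x => g x - fderiv ℝ φ x) - fun x => g₂ x - fderiv ℝ ψ x) 2
            (volume.restrict Ω) := by
          congr 1; ext1 x
          rw [fderiv_fun_sub (a1.differentiable (by simp) x) (b1.differentiable (by simp) x)]
          simp only [Pi.sub_apply]; abel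
      _ ≤ ε / 2 + ε / 2 := (eLpNorm_sub_le
          (h.2.1.1.sub (a1.continuous_fderiv (by simp)).aestronglyMeasurable)
          (h₂.2.1.1.sub (b1.continuous_fderiv (by simp)).aestronglyMeasurable)
          (by norm_num)).trans (add_le_add a5 b5)
      _ = ε := ENNReal.add_halves ε

/-- Integration by parts of an element of `W₀^{1,2}` against a weakly differentiable function. -/
theorem MemW12Zero.integral_mul_weakDeriv (h : MemW12Zero Ω f g) {F : Space d → ℝ}
    {G : Space d → Space d →L[ℝ] ℝ} (hw : HasWeakDeriv Ω F G)
    (hF : MemLp F 2 (volume.restrict Ω)) (hG : MemLp G 2 (volume.restrict Ω))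
    (v : Space d) (i : Fin d) :
    ∫ x in Ω, (g x v) i * F x = - ∫ x in Ω, (f x) i * G x v := by
  obtain ⟨φ, h1, h2, h3, h4, h5⟩ := h.exists_seq
  -- For the approximants this is the definition of the weak derivative of `F`, the component `i` of
  -- `φ n` being an admissible test function.
  have e : ∀ n, ∫ x in Ω, (fderiv ℝ (φ n) x v) i * F x = - ∫ x in Ω, (φ n x) i * G x v := by
    intro n
    have hs : tsupport (fun x => φ n x i) ⊆ tsupport (φ n) :=
      closure_mono fun x hx => by
        intro h0; apply hx; simp [h0]
    have := hw.2.2 (fun x => φ n x i) (by have := h1 n; fun_prop)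
      (IsCompact.of_isClosed_subset (h2 n) (isClosed_tsupport _) hs) (hs.trans (h3 n)) v
    have hd : ∀ x, fderiv ℝ (fun x => φ n x i) x v = (fderiv ℝ (φ n) x v) i := by
      intro x
      have hφ := ((h1 n).differentiable (by simp) x).hasFDerivAt
      have : fderiv ℝ (fun x => φ n x i) x = _ :=
        ((EuclideanSpace.proj (𝕜 := ℝ) i).hasFDerivAt.comp x hφ).fderiv
      rw [this]; rfl
    simpa [hd] using this
  let L1 : (Space d →L[ℝ] Space d) →L[ℝ] ℝ →L[ℝ] ℝ :=
    (ContinuousLinearMap.mul ℝ ℝ).comp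
      ((EuclideanSpace.proj (𝕜 := ℝ) i).comp (ContinuousLinearMap.apply ℝ (Space d) v))
  let L2 : Space d →L[ℝ] (Space d →L[ℝ] ℝ) →L[ℝ] ℝ :=
    ((ContinuousLinearMap.mul ℝ ℝ).flip.comp (ContinuousLinearMap.apply ℝ ℝ v)).flip.comp
      (EuclideanSpace.proj (𝕜 := ℝ) i)
  have t1 := tendsto_integral_bilin L1 h.2.1
    (fun n => memLp_of_contDiff_hasCompactSupport ((h1 n).continuous_fderiv (by simp))
      ((h2 n).fderiv ℝ) 2 Ω) hF h5
  have t2 := tendsto_integral_bilin L2 h.1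
    (fun n => memLp_of_contDiff_hasCompactSupport (h1 n).continuous (h2 n) 2 Ω) hG h4
  have t3 := tendsto_nhds_unique t1 (t2.neg.congr fun n => (e n).symm)
  exact t3

/-- Only one of the two factors is replaced by a smooth approximant `φ n`. Integrating `g` by parts
against it turns both sides into minus the integral of the component `i` of `f` times a mixed second
derivative of `φ n`, and mixed derivatives commute. -/
theorem MemW12Zero.integral_transpose (h : MemW12Zero Ω f g) (hΩ : IsOpen Ω) (i j : Fin d) :
    ∫ x in Ω, (g x (EuclideanSpace.single j 1)) i * (g x (EuclideanSpace.single i 1)) j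
      = ∫ x in Ω, (g x (EuclideanSpace.single i 1)) i * (g x (EuclideanSpace.single j 1)) j := by
  obtain ⟨φ, h1, h2, h3, h4, h5⟩ := h.exists_seq
  have e : ∀ n, ∫ x in Ω, (g x (EuclideanSpace.single j 1)) i *
        (fderiv ℝ (φ n) x (EuclideanSpace.single i 1)) j
      = ∫ x in Ω, (g x (EuclideanSpace.single i 1)) i *
        (fderiv ℝ (φ n) x (EuclideanSpace.single j 1)) j := by
    intro n
    have hd1 : ContDiff ℝ 1 (fderiv ℝ (φ n)) := (h1 n).fderiv_right (by norm_cast)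
    have hd2 := hd1.differentiable one_ne_zero
    have key : ∀ k : Fin d, HasWeakDeriv Ω
          (fun x => (fderiv ℝ (φ n) x (EuclideanSpace.single k 1)) j)
          (fun x => ((EuclideanSpace.proj (𝕜 := ℝ) j).comp (ContinuousLinearMap.apply ℝ (Space d)
            (EuclideanSpace.single k 1))).comp (fderiv ℝ (fderiv ℝ (φ n)) x)) ∧
        MemLp (fun x => (fderiv ℝ (φ n) x (EuclideanSpace.single k 1)) j) 2 (volume.restrict Ω) ∧
        MemLp (fun x => ((EuclideanSpace.proj (𝕜 := ℝ) j).comp (ContinuousLinearMap.apply ℝ (Space d)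
            (EuclideanSpace.single k 1))).comp (fderiv ℝ (fderiv ℝ (φ n)) x)) 2
            (volume.restrict Ω) := by
      intro k
      refine ⟨?_, ?_, ?_⟩
      · refine hasWeakDeriv_of_hasFDerivAt hΩ (fun x _ => ?_) ?_
        · exact ((EuclideanSpace.proj (𝕜 := ℝ) j).comp (ContinuousLinearMap.apply ℝ (Space d)
            (EuclideanSpace.single k 1))).hasFDerivAt.comp x (hd2 x).hasFDerivAt
        · exact (continuous_const.clm_comp (hd1.continuous_fderiv one_ne_zero)).continuousOn
      · exact memLp_of_contDiff_hasCompactSupport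
          (((EuclideanSpace.proj (𝕜 := ℝ) j).comp (ContinuousLinearMap.apply ℝ (Space d)
            (EuclideanSpace.single k 1))).continuous.comp hd1.continuous)
          (((h2 n).fderiv ℝ).comp_left (g := ((EuclideanSpace.proj (𝕜 := ℝ) j).comp
            (ContinuousLinearMap.apply ℝ (Space d) (EuclideanSpace.single k 1)))) (map_zero _)) 2 Ω
      · refine memLp_of_contDiff_hasCompactSupport
          (continuous_const.clm_comp (hd1.continuous_fderiv one_ne_zero)) ?_ 2 Ω
        exact (((h2 n).fderiv ℝ).fderiv ℝ).comp_left (g := fun A =>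
          ((EuclideanSpace.proj (𝕜 := ℝ) j).comp (ContinuousLinearMap.apply ℝ (Space d)
            (EuclideanSpace.single k 1))).comp A) (by simp)
    rw [h.integral_mul_weakDeriv (key i).1 (key i).2.1 (key i).2.2,
      h.integral_mul_weakDeriv (key j).1 (key j).2.1 (key j).2.2]
    congr 1
    refine integral_congr_ae (Filter.Eventually.of_forall fun x => ?_)
    have hs : IsSymmSndFDerivAt ℝ (φ n) x :=
      ContDiffAt.isSymmSndFDerivAt (n := ((2 : ℕ) : WithTop ℕ∞))
        (contDiff_infty.1 (h1 n) 2).contDiffAt (by simp)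
    simp only [ContinuousLinearMap.comp_apply, ContinuousLinearMap.apply_apply]
    rw [hs (EuclideanSpace.single j 1) (EuclideanSpace.single i 1)]
  have lim : ∀ k l : Fin d, Filter.Tendsto (fun n => ∫ x in Ω,
      (g x (EuclideanSpace.single l 1)) i * (fderiv ℝ (φ n) x (EuclideanSpace.single k 1)) j)
      Filter.atTop (𝓝 (∫ x in Ω, (g x (EuclideanSpace.single l 1)) i *
        (g x (EuclideanSpace.single k 1)) j)) := by
    intro k l
    let P : Fin d → Fin d → (Space d →L[ℝ] Space d) →L[ℝ] ℝ := fun i k =>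
      (EuclideanSpace.proj (𝕜 := ℝ) i).comp
        (ContinuousLinearMap.apply ℝ (Space d) (EuclideanSpace.single k 1))
    have := tendsto_integral_bilin
      (((ContinuousLinearMap.mul ℝ ℝ).comp (P i l)).flip.comp (ContinuousLinearMap.id ℝ ℝ) |>.comp
        (P j k)) h.2.1
      (fun n => memLp_of_contDiff_hasCompactSupport ((h1 n).continuous_fderiv (by simp))
      ((h2 n).fderiv ℝ) 2 Ω) h.2.1 h5
    exact this
  exact tendsto_nhds_unique (lim i j) ((lim j i).congr fun n => (e n).symm)

end

end PotTempNS

namespace PotTempNS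

/-! ### `C¹` fields vanishing on the boundary belong to `W₀^{1,2}` -/

section

variable {d : ℕ} {Ω : Set (Space d)}

theorem tendsto_eLpNorm_two_of_bounded {α E : Type*} [MeasurableSpace α] {m : Measure α}
    [IsFiniteMeasure m] [NormedAddCommGroup E] {F : ℕ → α → E} {C : ℝ}
    (hF : ∀ n, AEStronglyMeasurable (F n) m)
    (hC : ∀ n, ∀ᵐ x ∂m, ‖F n x‖ ≤ C)
    (h : ∀ᵐ x ∂m, Filter.Tendsto (fun n => F n x) Filter.atTop (𝓝 0)) :
    Filter.Tendsto (fun n => eLpNorm (F n) 2 m) Filter.atTop (𝓝 0) := by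
  have key : Filter.Tendsto (fun n => ∫⁻ x, ‖F n x‖ₑ ^ (2 : ℝ) ∂m) Filter.atTop
      (𝓝 (∫⁻ _, 0 ∂m)) := by
    refine tendsto_lintegral_of_dominated_convergence' (fun _ => ENNReal.ofReal C ^ (2 : ℝ))
      (fun n => (hF n).enorm.pow_const _) (fun n => ?_) ?_ ?_
    · filter_upwards [hC n] with x hx
      gcongr
      rw [← ofReal_norm]
      exact ENNReal.ofReal_le_ofReal hx
    · simp only [lintegral_const]
      exact ENNReal.mul_ne_top (by simp) (measure_ne_top _ _)
    · filter_upwards [h] with x hx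
      have := hx.enorm
      simp only [enorm_zero] at this
      have h2 := this.ennrpow_const 2
      simpa using h2
  have e : ∀ n, eLpNorm (F n) 2 m = (∫⁻ x, ‖F n x‖ₑ ^ (2 : ℝ) ∂m) ^ (1 / (2 : ℝ)) := by
    intro n
    rw [eLpNorm_eq_lintegral_rpow_enorm_toReal (by norm_num) (by norm_num)]
    simp
  simp_rw [e]
  have := key.ennrpow_const (1 / (2 : ℝ))
  simpa using this

/-- Mollification. The radius lies below the distance from the support to the complement of `Ω` and
below the moduli of continuity of `f` and of its derivative. Since the derivative falls on `f`
inside the convolution, one estimate serves for both. -/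
theorem exists_smooth_approx_C1 (hΩ : IsOpen Ω) {f : Space d → Space d} (hf : ContDiff ℝ 1 f)
    (hc : HasCompactSupport f) (hs : tsupport f ⊆ Ω) {ε : ℝ} (hε : 0 < ε) :
    ∃ φ : Space d → Space d, ContDiff ℝ ∞ φ ∧ HasCompactSupport φ ∧ tsupport φ ⊆ Ω ∧
      ∀ x, ‖φ x - f x‖ ≤ ε ∧ ‖fderiv ℝ φ x - fderiv ℝ f x‖ ≤ ε := by
  obtain ⟨δ, hδ, hδs⟩ := hc.isCompact.exists_cthickening_subset_open hΩ hs
  have hf' : Continuous (fderiv ℝ f) := hf.continuous_fderiv one_ne_zero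
  have u1 := hc.uniformContinuous_of_continuous hf.continuous
  have u2 := (hc.fderiv ℝ).uniformContinuous_of_continuous hf'
  rw [Metric.uniformContinuous_iff] at u1 u2
  obtain ⟨δ1, hδ1, k1⟩ := u1 ε hε
  obtain ⟨δ2, hδ2, k2⟩ := u2 ε hε
  set r := min δ (min δ1 δ2) with hr
  have hr0 : 0 < r := by positivity
  let b : ContDiffBump (0 : Space d) := ⟨r / 2, r, by positivity, by linarith⟩
  have hloc : LocallyIntegrable f volume := hf.continuous.locallyIntegrable
  have hcs : HasCompactSupport (convolution (b.normed volume) f (ContinuousLinearMap.lsmul ℝ ℝ)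
      volume) := HasCompactSupport.convolution _ b.hasCompactSupport_normed hc
  refine ⟨convolution (b.normed volume) f (ContinuousLinearMap.lsmul ℝ ℝ) volume, ?_, hcs, ?_, ?_⟩
  · exact b.hasCompactSupport_normed.contDiff_convolution_left _ b.contDiff_normed hloc
  · refine Subset.trans ?_ hδs
    refine closure_minimal ?_ Metric.isClosed_cthickening
    refine (support_convolution_subset _).trans ?_
    rw [b.support_normed_eq]
    rintro x ⟨y, hy, z, hz, rfl⟩
    refine Metric.mem_cthickening_of_dist_le _ z _ _ (subset_tsupport _ hz) ?_
    have : dist y 0 < r := hy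
    simp only [dist_eq_norm, add_sub_cancel_right] at this ⊢
    have : r ≤ δ := min_le_left _ _
    simp at *
    linarith
  · intro x
    have hball1 : ∀ y ∈ Metric.ball x b.rOut, dist (f y) (f x) ≤ ε := fun y hy =>
      (k1 (lt_of_lt_of_le (Metric.mem_ball.1 hy)
        ((min_le_right _ _).trans (min_le_left _ _)))).le
    have hball2 : ∀ y ∈ Metric.ball x b.rOut, dist (fderiv ℝ f y) (fderiv ℝ f x) ≤ ε := fun y hy =>
      (k2 (lt_of_lt_of_le (Metric.mem_ball.1 hy)
        ((min_le_right _ _).trans (min_le_right _ _)))).le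
    refine ⟨?_, ?_⟩
    · rw [← dist_eq_norm]
      exact b.dist_normed_convolution_le hf.continuous.aestronglyMeasurable hball1
    · have hd := (hc.hasFDerivAt_convolution_right (μ := volume) (f := b.normed volume)
        (ContinuousLinearMap.lsmul ℝ ℝ) b.continuous_normed.locallyIntegrable hf x).fderiv
      have hpre : (ContinuousLinearMap.lsmul ℝ ℝ : ℝ →L[ℝ] Space d →L[ℝ] Space d).precompR (Space d)
          = ContinuousLinearMap.lsmul ℝ ℝ := by
        ext c A v
        simp [ContinuousLinearMap.precompR_apply]
      rw [hpre] at hd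
      rw [hd, ← dist_eq_norm]
      exact b.dist_normed_convolution_le hf'.aestronglyMeasurable hball2

/-- A smooth map vanishing near the origin and equal to the identity far from it. -/
noncomputable def truncMap (d : ℕ) (v : Space d) : Space d := Real.smoothTransition (‖v‖ ^ 2 - 1) • v

theorem contDiff_truncMap : ContDiff ℝ 1 (truncMap d) := by
  unfold truncMap
  have h : ContDiff ℝ 1 fun v : Space d => ‖v‖ ^ 2 - 1 :=
    (contDiff_norm_sq ℝ).sub contDiff_const
  exact ((Real.smoothTransition.contDiff (n := 1)).comp h).smul contDiff_id

theorem truncMap_eq_zero {v : Space d} (h : ‖v‖ ≤ 1) : truncMap d v = 0 := by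
  rw [truncMap, Real.smoothTransition.zero_of_nonpos, zero_smul]
  nlinarith [norm_nonneg v]

theorem truncMap_eq_self {v : Space d} (h : 2 ≤ ‖v‖) : truncMap d v = v := by
  rw [truncMap, Real.smoothTransition.one_of_one_le, one_smul]
  nlinarith [norm_nonneg v]

theorem fderiv_truncMap_eq_zero {v : Space d} (h : ‖v‖ < 1) : fderiv ℝ (truncMap d) v = 0 := by
  have : truncMap d =ᶠ[𝓝 v] fun _ => 0 := by
    filter_upwards [(isOpen_lt continuous_norm continuous_const).mem_nhds h] with w hw
    exact truncMap_eq_zero (le_of_lt hw)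
  rw [this.fderiv_eq]; simp

theorem fderiv_truncMap_eq_id {v : Space d} (h : 2 < ‖v‖) :
    fderiv ℝ (truncMap d) v = ContinuousLinearMap.id ℝ (Space d) := by
  have : truncMap d =ᶠ[𝓝 v] id := by
    filter_upwards [(isOpen_lt continuous_const continuous_norm).mem_nhds h] with w hw
    exact truncMap_eq_self (le_of_lt hw)
  rw [this.fderiv_eq, fderiv_id]

theorem norm_truncMap_le (v : Space d) : ‖truncMap d v‖ ≤ ‖v‖ := by
  rw [truncMap, norm_smul, Real.norm_of_nonneg (Real.smoothTransition.nonneg _)]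
  exact mul_le_of_le_one_left (norm_nonneg _) (Real.smoothTransition.le_one _)

theorem exists_bound_fderiv_truncMap (d : ℕ) : ∃ C : ℝ, 1 ≤ C ∧ ∀ v, ‖fderiv ℝ (truncMap d) v‖ ≤ C := by
  obtain ⟨C, hC⟩ := (isCompact_closedBall (0 : Space d) 2).exists_bound_of_continuousOn
    (contDiff_truncMap.continuous_fderiv one_ne_zero).continuousOn
  refine ⟨max C 1, le_max_right _ _, fun v => ?_⟩
  by_cases h : ‖v‖ ≤ 2
  · exact (hC v (by simpa using h)).trans (le_max_left _ _)
  · rw [fderiv_truncMap_eq_id (not_le.1 h)]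
    exact ContinuousLinearMap.norm_id_le.trans (le_max_right _ _)

/-- A function of class `C¹` up to the boundary and vanishing there belongs to `W₀^{1,2}`. -/
theorem memW12Zero_of_hasFDerivAt (hΩ : IsOpen Ω) (hb : Bornology.IsBounded Ω)
    {f : Space d → Space d} {g : Space d → Space d →L[ℝ] Space d}
    (hf : ContinuousOn f (closure Ω)) (h0 : ∀ x ∈ frontier Ω, f x = 0)
    (hg : ContinuousOn g (closure Ω)) (hfg : ∀ x ∈ Ω, HasFDerivAt f (g x) x) :
    MemW12Zero Ω f g := by
  have hK : IsCompact (closure Ω) := hb.isCompact_closure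
  have hfin : IsFiniteMeasure (volume.restrict Ω) :=
    ⟨by simpa using hb.measure_lt_top⟩
  obtain ⟨Cf, hCf⟩ := hK.exists_bound_of_continuousOn hf
  obtain ⟨Cg, hCg⟩ := hK.exists_bound_of_continuousOn hg
  obtain ⟨C, hC1, hC⟩ := exists_bound_fderiv_truncMap d
  have mf : AEStronglyMeasurable f (volume.restrict Ω) :=
    (hf.mono subset_closure).aestronglyMeasurable hΩ.measurableSet
  have mg : AEStronglyMeasurable g (volume.restrict Ω) :=
    (hg.mono subset_closure).aestronglyMeasurable hΩ.measurableSet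
  have bf : ∀ᵐ x ∂(volume.restrict Ω), ‖f x‖ ≤ Cf :=
    (ae_restrict_mem hΩ.measurableSet).mono fun x hx => hCf x (subset_closure hx)
  have bg : ∀ᵐ x ∂(volume.restrict Ω), ‖g x‖ ≤ Cg :=
    (ae_restrict_mem hΩ.measurableSet).mono fun x hx => hCg x (subset_closure hx)
  -- The gradient vanishes almost everywhere on the zero set of `f`: on that set `f` is approximated
  -- by the zero map with constant 0, which determines the derivative at its density points.
  have hfg0 : ∀ᵐ x ∂(volume.restrict Ω), f x = 0 → g x = 0 := by
    have hs : MeasurableSet {x | x ∈ Ω ∧ f x = 0} := by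
      have : {x | x ∈ Ω ∧ f x = 0} = Ω ∩ (closure Ω ∩ f ⁻¹' {0}) := by
        ext x; simp only [mem_ofPred_eq, mem_inter_iff, mem_preimage, mem_singleton_iff]
        exact ⟨fun h => ⟨h.1, subset_closure h.1, h.2⟩, fun h => ⟨h.1, h.2.2⟩⟩
      rw [this]
      exact hΩ.measurableSet.inter
        (hf.preimage_isClosed_of_isClosed isClosed_closure isClosed_singleton).measurableSet
    have happ : ApproximatesLinearOn f (0 : Space d →L[ℝ] Space d) {x | x ∈ Ω ∧ f x = 0} 0 := by
      intro x hx y hy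
      simp [hx.2, hy.2]
    have := happ.norm_fderiv_sub_le volume hs g
      (fun x hx => (hfg x hx.1).hasFDerivWithinAt)
    rw [ae_restrict_iff' hs] at this
    rw [ae_restrict_iff' hΩ.measurableSet]
    filter_upwards [this] with x hx hxΩ hfx
    have := hx ⟨hxΩ, hfx⟩
    simpa using this
  set f0 : Space d → Space d := Ω.indicator f with hf0
  have hf0c : Continuous f0 := continuous_indicator h0 hf
  have hf0eq : ∀ x ∈ Ω, f0 x = f x := fun x hx => indicator_of_mem hx f
  have hf0out : ∀ x ∉ Ω, f0 x = 0 := fun x hx => indicator_of_notMem hx f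
  let N : ℕ → ℝ := fun n => (n : ℝ) + 1
  have hN : ∀ n, 0 < N n := fun n => by positivity
  -- The values of `f` are truncated, not its domain: `fn n` is zero where `|f0| ≤ 1/N` and equals
  -- `f0` where `|f0| ≥ 2/N`. Its support thus stays inside `Ω` whatever the shape of the boundary,
  -- and its gradient is bounded uniformly in `n`.
  let fn : ℕ → Space d → Space d := fun n x => (N n)⁻¹ • truncMap d (N n • f0 x)
  let gn : ℕ → Space d → Space d →L[ℝ] Space d := fun n =>
    Ω.indicator fun x => (fderiv ℝ (truncMap d) (N n • f0 x)).comp (g x)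
  have hnear : ∀ n x, x ∉ Ω → ∀ᶠ y in 𝓝 x, ‖N n • f0 y‖ < 1 := by
    intro n x hx
    have hc : Continuous fun y => ‖N n • f0 y‖ := (hf0c.const_smul (N n)).norm
    refine hc.continuousAt.eventually_lt continuousAt_const ?_
    simp [hf0out x hx]
  have hder : ∀ n x, HasFDerivAt (fn n) (gn n x) x := by
    intro n x
    by_cases hx : x ∈ Ω
    · have h1 : HasFDerivAt f0 (g x) x := (hfg x hx).congr_of_eventuallyEq <| by
        filter_upwards [hΩ.mem_nhds hx] with y hy using hf0eq y hy
      have h2 := ((contDiff_truncMap.differentiable one_ne_zero (N n • f0 x)).hasFDerivAt.comp x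
        (h1.const_smul (N n))).const_smul (N n)⁻¹
      convert! h2 using 1
      simp only [gn, indicator_of_mem hx, ContinuousLinearMap.comp_smul]
      rw [smul_smul, inv_mul_cancel₀ (hN n).ne', one_smul]
    · have : fn n =ᶠ[𝓝 x] fun _ => 0 := by
        filter_upwards [hnear n x hx] with y hy
        simp [fn, truncMap_eq_zero hy.le]
      simp only [gn, indicator_of_notMem hx]
      exact (hasFDerivAt_const (0 : Space d) x).congr_of_eventuallyEq this
  have hgnc : ∀ n, Continuous (gn n) := by
    intro n
    rw [continuous_iff_continuousAt]
    intro x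
    by_cases hx : x ∈ Ω
    · have : gn n =ᶠ[𝓝 x] fun x => (fderiv ℝ (truncMap d) (N n • f0 x)).comp (g x) := by
        filter_upwards [hΩ.mem_nhds hx] with y hy
        simp only [gn, indicator_of_mem hy]
      refine ContinuousAt.congr ?_ this.symm
      refine ContinuousAt.clm_comp ?_
        ((hg.mono subset_closure).continuousAt (hΩ.mem_nhds hx))
      exact ((contDiff_truncMap.continuous_fderiv one_ne_zero).comp
        (hf0c.const_smul (N n))).continuousAt
    · have : gn n =ᶠ[𝓝 x] fun _ => 0 := by
        filter_upwards [hnear n x hx] with y hy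
        simp only [gn, indicator, fderiv_truncMap_eq_zero hy, ContinuousLinearMap.zero_comp,
          ite_self]
      exact continuousAt_const.congr this.symm
  have hfn1 : ∀ n, ContDiff ℝ 1 (fn n) := fun n =>
    contDiff_one_iff_hasFDerivAt.2 ⟨gn n, hgnc n, hder n⟩
  have hfns : ∀ n, tsupport (fn n) ⊆ Ω := by
    intro n
    have hcl : IsClosed {x | 1 ≤ ‖N n • f0 x‖} :=
      isClosed_le continuous_const (hf0c.const_smul (N n)).norm
    have hsub : tsupport (fn n) ⊆ {x | 1 ≤ ‖N n • f0 x‖} := by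
      refine closure_minimal (fun x hx => ?_) hcl
      by_contra h
      apply hx
      simp [fn, truncMap_eq_zero (not_le.1 h).le]
    refine hsub.trans fun x hx => ?_
    by_contra h
    have : (1 : ℝ) ≤ ‖N n • f0 x‖ := hx
    rw [hf0out x h] at this
    norm_num at this
  have hfnc : ∀ n, HasCompactSupport (fn n) := fun n =>
    IsCompact.of_isClosed_subset hK (isClosed_tsupport _) ((hfns n).trans subset_closure)
  have hlim : ∀ n x, 2 < ‖N n • f0 x‖ → fn n x = f0 x := by
    intro n x h
    simp only [fn, truncMap_eq_self h.le]
    rw [smul_smul, inv_mul_cancel₀ (hN n).ne', one_smul]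
  have hev : ∀ x, f0 x ≠ 0 → ∀ᶠ n in Filter.atTop, 2 < ‖N n • f0 x‖ := by
    intro x hx
    obtain ⟨n0, hn0⟩ := exists_nat_gt (2 / ‖f0 x‖)
    filter_upwards [Filter.eventually_ge_atTop n0] with n hn
    have hp : 0 < ‖f0 x‖ := norm_pos_iff.2 hx
    rw [norm_smul, Real.norm_of_nonneg (hN n).le]
    rw [div_lt_iff₀ hp] at hn0
    have : (n0 : ℝ) ≤ n := by exact_mod_cast hn
    simp only [N]
    nlinarith
  have T1 : Filter.Tendsto (fun n => eLpNorm (fun x => f x - fn n x) 2 (volume.restrict Ω))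
      Filter.atTop (𝓝 0) := by
    refine tendsto_eLpNorm_two_of_bounded (C := Cf + Cf)
      (fun n => mf.sub (hfn1 n).continuous.aestronglyMeasurable) (fun n => ?_) ?_
    · filter_upwards [bf, ae_restrict_mem hΩ.measurableSet] with x hx hxΩ
      refine (norm_sub_le _ _).trans (add_le_add hx ?_)
      simp only [fn, norm_smul, norm_inv, Real.norm_of_nonneg (hN n).le]
      have := norm_truncMap_le (N n • f0 x)
      rw [norm_smul, Real.norm_of_nonneg (hN n).le, hf0eq x hxΩ] at this
      rw [hf0eq x hxΩ, inv_mul_le_iff₀ (hN n)]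
      exact this.trans (by gcongr)
    · filter_upwards [ae_restrict_mem hΩ.measurableSet] with x hxΩ
      by_cases hx : f0 x = 0
      · have : ∀ n, f x - fn n x = 0 := fun n => by
          simp [fn, hx, ← hf0eq x hxΩ, truncMap_eq_zero (v := (0 : Space d)) (by simp)]
        simp [this]
      · refine tendsto_const_nhds.congr' ?_
        filter_upwards [hev x hx] with n hn
        rw [hlim n x hn, hf0eq x hxΩ, sub_self]
  have T2 : Filter.Tendsto (fun n => eLpNorm (fun x => g x - gn n x) 2 (volume.restrict Ω))
      Filter.atTop (𝓝 0) := by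
    refine tendsto_eLpNorm_two_of_bounded (C := Cg + C * Cg)
      (fun n => mg.sub (hgnc n).aestronglyMeasurable) (fun n => ?_) ?_
    · filter_upwards [bg, ae_restrict_mem hΩ.measurableSet] with x hx hxΩ
      refine (norm_sub_le _ _).trans (add_le_add hx ?_)
      simp only [gn, indicator_of_mem hxΩ]
      refine (ContinuousLinearMap.opNorm_comp_le _ _).trans ?_
      exact mul_le_mul (hC _) hx (norm_nonneg _) (by linarith)
    · filter_upwards [ae_restrict_mem hΩ.measurableSet, hfg0] with x hxΩ h0x
      by_cases hx : f0 x = 0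
      · have hg0 : g x = 0 := h0x (by rw [← hf0eq x hxΩ, hx])
        have : ∀ n, g x - gn n x = 0 := fun n => by
          simp [gn, indicator_of_mem hxΩ, hg0]
        simp [this]
      · refine tendsto_const_nhds.congr' ?_
        filter_upwards [hev x hx] with n hn
        simp only [gn, indicator_of_mem hxΩ, fderiv_truncMap_eq_id hn,
          ContinuousLinearMap.id_comp, sub_self]
  refine ⟨MemLp.of_bound mf Cf bf, MemLp.of_bound mg Cg bg, fun ε hε => ?_⟩
  have hε2 : 0 < ε / 2 := ENNReal.half_pos hε.ne'
  obtain ⟨n, hn1, hn2⟩ := ((T1.eventually_lt_const hε2).and (T2.eventually_lt_const hε2)).exists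
  obtain ⟨δ, hδ, hδε⟩ : ∃ δ : ℝ, 0 < δ ∧
      volume Ω ^ (1 / (2 : ℝ)) * ENNReal.ofReal δ ≤ ε / 2 := by
    have hV : volume Ω ^ (1 / (2 : ℝ)) ≠ ⊤ :=
      ENNReal.rpow_ne_top_of_nonneg (by norm_num) hb.measure_lt_top.ne
    have ht : Filter.Tendsto (fun δ : ℝ => volume Ω ^ (1 / (2 : ℝ)) * ENNReal.ofReal δ)
        (𝓝[>] 0) (𝓝 (volume Ω ^ (1 / (2 : ℝ)) * ENNReal.ofReal 0)) :=
      ENNReal.Tendsto.const_mul ((ENNReal.continuous_ofReal.tendsto 0).mono_left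
        nhdsWithin_le_nhds) (Or.inr hV)
    rw [ENNReal.ofReal_zero, mul_zero] at ht
    obtain ⟨δ, h1, h2⟩ := ((ht.eventually_lt_const hε2).and self_mem_nhdsWithin).exists
    exact ⟨δ, h2, h1.le⟩
  obtain ⟨φ, p1, p2, p3, p4⟩ := exists_smooth_approx_C1 hΩ (hfn1 n) (hfnc n) (hfns n) hδ
  have hbd : ∀ {E : Type} [NormedAddCommGroup E] (w : Space d → E), (∀ x, ‖w x‖ ≤ δ) →
      eLpNorm w 2 (volume.restrict Ω) ≤ ε / 2 := by
    intro E _ w hw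
    refine (eLpNorm_le_of_ae_bound (Filter.Eventually.of_forall hw)).trans ?_
    simpa using hδε
  refine ⟨φ, p1, p2, p3, ?_, ?_⟩
  · calc _ = eLpNorm ((fun x => f x - fn n x) + fun x => fn n x - φ x) 2 (volume.restrict Ω) := by
          congr 1; ext1 x; simp
      _ ≤ ε / 2 + ε / 2 := (eLpNorm_add_le
          (mf.sub (hfn1 n).continuous.aestronglyMeasurable)
          ((hfn1 n).continuous.sub p1.continuous).aestronglyMeasurable (by norm_num)).trans
            (add_le_add hn1.le (hbd _ fun x => (norm_sub_rev _ _).trans_le (p4 x).1))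
      _ = ε := ENNReal.add_halves ε
  · calc _ = eLpNorm ((fun x => g x - gn n x) + fun x => gn n x - fderiv ℝ φ x) 2
            (volume.restrict Ω) := by
          congr 1; ext1 x; simp
      _ ≤ ε / 2 + ε / 2 := (eLpNorm_add_le
          (mg.sub (hgnc n).aestronglyMeasurable)
          ((hgnc n).sub (p1.continuous_fderiv (by simp))).aestronglyMeasurable (by norm_num)).trans
            (add_le_add hn2.le (hbd _ fun x => by
              have := (p4 x).2
              rw [(hder n x).fderiv, norm_sub_rev] at this
              exact this))
      _ = ε := ENNReal.add_halves ε

end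

end PotTempNS

namespace PotTempNS

/-! ### Coercivity of the viscous stress, and weighted estimates in the plane -/

section

variable {d : ℕ} {Ω : Set (Space d)} {f : Space d → Space d} {g : Space d → Space d →L[ℝ] Space d}

theorem gradMat_apply (A : Space d →L[ℝ] Space d) (i j : Fin d) :
    gradMat A i j = A (EuclideanSpace.single j 1) i := rfl

/-- The entry `(i, j)` of the matrix of a gradient as a continuous linear functional. -/
noncomputable def gradEntry (i j : Fin d) : (Space d →L[ℝ] Space d) →L[ℝ] ℝ :=
  (EuclideanSpace.proj (𝕜 := ℝ) i).comp
    (ContinuousLinearMap.apply ℝ (Space d) (EuclideanSpace.single j 1))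

theorem abs_gradMat_le (A : Space d →L[ℝ] Space d) (i j : Fin d) : |gradMat A i j| ≤ ‖A‖ := by
  rw [gradMat_apply, ← Real.norm_eq_abs]
  refine (PiLp.norm_apply_le _ i).trans ((A.le_opNorm _).trans ?_)
  simp

theorem frob_nonneg (G : Matrix (Fin d) (Fin d) ℝ) : 0 ≤ frob G G :=
  Finset.sum_nonneg fun _ _ => Finset.sum_nonneg fun _ _ => mul_self_nonneg _

theorem frob_transpose_le (G : Matrix (Fin d) (Fin d) ℝ) : frob G G.transpose ≤ frob G G := by
  have h : ∑ i, ∑ j, G j i * G j i = frob G G := by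
    rw [Finset.sum_comm]; rfl
  have : frob G G.transpose ≤ ∑ i, ∑ j, (G i j * G i j + G j i * G j i) / 2 := by
    unfold frob
    gcongr with i _ j _
    rw [Matrix.transpose_apply]
    nlinarith [sq_nonneg (G i j - G j i)]
  refine this.trans (le_of_eq ?_)
  simp_rw [add_div, Finset.sum_add_distrib, ← Finset.sum_div]
  rw [h]
  change frob G G / 2 + _ = _
  ring

theorem frob_stress (μ lam : ℝ) (G H : Matrix (Fin d) (Fin d) ℝ) :
    frob (stress μ lam G) H = μ * (frob G H + frob G H.transpose)
      + (lam - 2 / d * μ) * (G.trace * H.trace) := by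
  have h1 : ∀ i, ∑ j, (1 : Matrix (Fin d) (Fin d) ℝ) i j * H i j = H i i := by
    intro i; simp [Matrix.one_apply]
  have h2 : ∑ i, ∑ j, G j i * H i j = frob G H.transpose := by
    rw [Finset.sum_comm]; rfl
  have h3 : ∑ i, ∑ j, (1 : Matrix (Fin d) (Fin d) ℝ) i j * H i j = H.trace := by
    simp_rw [h1]; rfl
  calc frob (stress μ lam G) H
      = ∑ i, ∑ j, (μ * (G i j * H i j) + μ * (G j i * H i j)
        + (lam - 2 / d * μ) * G.trace * ((1 : Matrix (Fin d) (Fin d) ℝ) i j * H i j)) := by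
        unfold frob stress
        refine Finset.sum_congr rfl fun i _ => Finset.sum_congr rfl fun j _ => ?_
        simp only [Matrix.add_apply, Matrix.sub_apply, Matrix.smul_apply, Matrix.transpose_apply,
          smul_eq_mul]
        ring
    _ = _ := by
        simp_rw [Finset.sum_add_distrib, ← Finset.mul_sum]
        rw [h2, h3]
        change μ * frob G H + _ + _ = _
        ring

theorem MemW12Zero.integrable_entry (h : MemW12Zero Ω f g) (i j k l : Fin d) :
    IntegrableOn (fun x => gradMat (g x) i j * gradMat (g x) k l) Ω := by
  have m : ∀ i j, MemLp (fun x => gradMat (g x) i j) 2 (volume.restrict Ω) := fun i j =>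
    (gradEntry i j).comp_memLp' h.2.1
  exact (m i j).integrable_mul (m k l)

theorem MemW12Zero.integral_frob_transpose (h : MemW12Zero Ω f g) (hΩ : IsOpen Ω) :
    ∫ x in Ω, frob (gradMat (g x)) (gradMat (g x)).transpose
      = ∫ x in Ω, (gradMat (g x)).trace * (gradMat (g x)).trace := by
  have e1 : ∀ x, frob (gradMat (g x)) (gradMat (g x)).transpose
      = ∑ i, ∑ j, gradMat (g x) i j * gradMat (g x) j i := fun x => rfl
  have e2 : ∀ x, (gradMat (g x)).trace * (gradMat (g x)).trace
      = ∑ i, ∑ j, gradMat (g x) i i * gradMat (g x) j j := fun x => by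
    rw [Matrix.trace, Finset.sum_mul_sum]; rfl
  simp_rw [e1, e2]
  rw [integral_finsetSum _ fun i _ => integrable_finsetSum _ fun j _ => h.integrable_entry _ _ _ _,
    integral_finsetSum _ fun i _ => integrable_finsetSum _ fun j _ => h.integrable_entry _ _ _ _]
  refine Finset.sum_congr rfl fun i _ => ?_
  rw [integral_finsetSum _ fun j _ => h.integrable_entry _ _ _ _,
    integral_finsetSum _ fun j _ => h.integrable_entry _ _ _ _]
  exact Finset.sum_congr rfl fun j _ => h.integral_transpose hΩ i j

/-- A Korn-type inequality for the viscous stress on `W₀^{1,2}`. -/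
theorem MemW12Zero.integral_stress_ge (h : MemW12Zero Ω f g) (hΩ : IsOpen Ω) {μ lam k : ℝ}
    (hk : 0 ≤ k) (hkl : -k ≤ μ + lam - 2 / d * μ) :
    (μ - k) * ∫ x in Ω, frob (gradMat (g x)) (gradMat (g x))
      ≤ ∫ x in Ω, frob (stress μ lam (gradMat (g x))) (gradMat (g x)) := by
  have i1 : IntegrableOn (fun x => frob (gradMat (g x)) (gradMat (g x))) Ω :=
    integrable_finsetSum _ fun i _ => integrable_finsetSum _ fun j _ => h.integrable_entry _ _ _ _
  have i2 : IntegrableOn (fun x => frob (gradMat (g x)) (gradMat (g x)).transpose) Ω :=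
    integrable_finsetSum _ fun i _ => integrable_finsetSum _ fun j _ => h.integrable_entry _ _ _ _
  have i3 : IntegrableOn (fun x => (gradMat (g x)).trace * (gradMat (g x)).trace) Ω := by
    have e2 : ∀ x, (gradMat (g x)).trace * (gradMat (g x)).trace
      = ∑ i, ∑ j, gradMat (g x) i i * gradMat (g x) j j := fun x => by
      rw [Matrix.trace, Finset.sum_mul_sum]; rfl
    simp_rw [e2]
    exact integrable_finsetSum _ fun i _ => integrable_finsetSum _ fun j _ =>
      h.integrable_entry _ _ _ _
  simp_rw [frob_stress]
  have i12 : IntegrableOn (fun x => frob (gradMat (g x)) (gradMat (g x))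
      + frob (gradMat (g x)) (gradMat (g x)).transpose) Ω := i1.add i2
  rw [integral_add (i12.const_mul μ) (i3.const_mul _)]
  simp_rw [integral_const_mul]
  -- As `G : Gᵀ` and `(tr G)²` have the same integral, the form is `μ ∫|G|² + (μ + lam - 2μ/d) ∫(tr
  -- G)²`, where `0 ≤ ∫(tr G)² ≤ ∫|G|²`.
  rw [integral_add i1 i2, h.integral_frob_transpose hΩ]
  have h1 : ∫ x in Ω, (gradMat (g x)).trace * (gradMat (g x)).trace
      ≤ ∫ x in Ω, frob (gradMat (g x)) (gradMat (g x)) := by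
    rw [← h.integral_frob_transpose hΩ]
    exact integral_mono i2 i1 fun x => frob_transpose_le _
  have h0 : 0 ≤ ∫ x in Ω, (gradMat (g x)).trace * (gradMat (g x)).trace :=
    integral_nonneg fun x => mul_self_nonneg _
  nlinarith

/-- The embedding of `W^{1,1}` into `L²` in the plane is applied to `|φ|^(2n)`. Cauchy–Schwarz
splits off the gradient of `φ`, and Hölder's inequality on the bounded set `Ω` absorbs the remaining
power `4n - 2` into `4n`. The chain rule costs the factor `2n`, so that the constant grows only
linearly in `n`; the Osgood lemma depends on this rate. -/
theorem integral_norm_pow_le (hd : d = 2) (hb : Bornology.IsBounded Ω) {φ : Space d → Space d}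
    (h1 : ContDiff ℝ ∞ φ) (h2 : HasCompactSupport φ) (h3 : tsupport φ ⊆ Ω) {n : ℕ} (hn : 1 ≤ n) :
    (∫ x in Ω, ‖φ x‖ ^ (4 * n)) ^ (1 / (4 * n : ℝ)) ≤
      2 * Real.sqrt (lintegralPowLePowLIntegralFDerivConst (volume : Measure (Space d)) 2)
        * max 1 (volume.real Ω) * n * Real.sqrt (∫ x in Ω, ‖fderiv ℝ φ x‖ ^ 2) := by
  subst hd
  set K : ℝ :=
    ((lintegralPowLePowLIntegralFDerivConst (volume : Measure (Space 2)) 2 : NNReal) : ℝ) with hK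
  have hK0 : 0 ≤ K := NNReal.coe_nonneg _
  set V : ℝ := volume.real Ω with hV
  have hfin : IsFiniteMeasure (volume.restrict Ω) := ⟨by simpa using hb.measure_lt_top⟩
  have hφc := h1.continuous
  have hφd : Continuous (fderiv ℝ φ) := h1.continuous_fderiv (by simp)
  have out : ∀ k : ℕ, 1 ≤ k → ∫ x in Ω, ‖φ x‖ ^ k = ∫ x, ‖φ x‖ ^ k := by
    intro k hk
    refine setIntegral_eq_integral_of_forall_compl_eq_zero fun x hx => ?_
    rw [image_eq_zero_of_notMem_tsupport (fun h => hx (h3 h)), norm_zero, zero_pow (by omega)]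
  have outd : ∫ x in Ω, ‖fderiv ℝ φ x‖ ^ 2 = ∫ x, ‖fderiv ℝ φ x‖ ^ 2 := by
    refine setIntegral_eq_integral_of_forall_compl_eq_zero fun x hx => ?_
    rw [image_eq_zero_of_notMem_tsupport (fun h => hx (h3 (tsupport_fderiv_subset ℝ h))),
      norm_zero, zero_pow (by omega)]
  set a : ℝ := ∫ x in Ω, ‖φ x‖ ^ (4 * n) with ha
  set b : ℝ := ∫ x in Ω, ‖fderiv ℝ φ x‖ ^ 2 with hb'
  have ha0 : 0 ≤ a := integral_nonneg fun x => by positivity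
  have hb0 : 0 ≤ b := integral_nonneg fun x => by positivity
  -- the Gagliardo–Nirenberg–Sobolev inequality for `‖φ‖ ^ (2n)`
  have hvs : ContDiff ℝ 1 fun x => (‖φ x‖ ^ 2) ^ n := by
    have : ContDiff ℝ 1 φ := h1.of_le (by norm_cast)
    exact (this.norm_sq ℝ).pow n
  have hvc : HasCompactSupport fun x => (‖φ x‖ ^ 2) ^ n :=
    h2.comp_left (g := fun y => (‖y‖ ^ 2) ^ n) (by simp; omega)
  have hvd : ∀ x, ‖fderiv ℝ (fun x => (‖φ x‖ ^ 2) ^ n) x‖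
      ≤ 2 * n * (‖φ x‖ ^ (2 * n - 1) * ‖fderiv ℝ φ x‖) := by
    intro x
    have hd := (((h1.differentiable (by simp) x).hasFDerivAt.norm_sq).pow n).fderiv
    rw [hd]
    have hn2 : ‖φ x‖ ^ (2 * n - 1) = (‖φ x‖ ^ 2) ^ (n - 1) * ‖φ x‖ := by
      rw [← pow_mul, ← pow_succ]; congr 1; omega
    refine ContinuousLinearMap.opNorm_le_bound _ (by positivity) fun y => ?_
    have hin : |inner ℝ (φ x) (fderiv ℝ φ x y)| ≤ ‖φ x‖ * (‖fderiv ℝ φ x‖ * ‖y‖) :=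
      (abs_real_inner_le_norm _ _).trans (by gcongr; exact ContinuousLinearMap.le_opNorm _ _)
    simp only [smul_apply, ContinuousLinearMap.comp_apply, innerSL_apply_apply,
      nsmul_eq_mul, smul_eq_mul, norm_mul, Real.norm_eq_abs, abs_pow, abs_norm, Nat.abs_cast]
    rw [hn2]
    calc _ ≤ n * (‖φ x‖ ^ 2) ^ (n - 1) * (2 * (‖φ x‖ * (‖fderiv ℝ φ x‖ * ‖y‖))) := by
          gcongr
          simp
      _ = _ := by ring
  have gns := lintegral_pow_le_pow_lintegral_fderiv (volume : Measure (Space 2)) hvs hvc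
    (p := 2) (by
      have : (Module.finrank ℝ (Space 2) : ℝ) = 2 := by simp
      rw [this]; exact Real.HolderConjugate.two_two)
  have hI1 : Integrable fun x => ‖fderiv ℝ (fun x => (‖φ x‖ ^ 2) ^ n) x‖ :=
    (hvs.continuous_fderiv one_ne_zero).norm.integrable_of_hasCompactSupport
      (hvc.fderiv ℝ).norm
  have g2 : ∫ x, ‖φ x‖ ^ (4 * n) ≤ K * (∫ x, ‖fderiv ℝ (fun x => (‖φ x‖ ^ 2) ^ n) x‖) ^ 2 := by
    have hI0 : Integrable fun x => ‖φ x‖ ^ (4 * n) :=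
      (hφc.norm.pow _).integrable_of_hasCompactSupport
        (h2.comp_left (g := fun y => ‖y‖ ^ (4 * n)) (by simp; omega))
    have e1 : ∫⁻ x, ‖(‖φ x‖ ^ 2) ^ n‖ₑ ^ (2 : ℝ) = ENNReal.ofReal (∫ x, ‖φ x‖ ^ (4 * n)) := by
      rw [ofReal_integral_eq_lintegral_ofReal hI0
        (Filter.Eventually.of_forall fun x => by positivity)]
      refine lintegral_congr fun x => ?_
      rw [← ofReal_norm, Real.norm_of_nonneg (by positivity),
        ENNReal.ofReal_rpow_of_nonneg (by positivity) (by norm_num)]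
      congr 1
      rw [← pow_mul, Real.rpow_two, ← pow_mul]
      congr 1; ring
    have e2 : ∫⁻ x, ‖fderiv ℝ (fun x => (‖φ x‖ ^ 2) ^ n) x‖ₑ
        = ENNReal.ofReal (∫ x, ‖fderiv ℝ (fun x => (‖φ x‖ ^ 2) ^ n) x‖) := by
      rw [ofReal_integral_eq_lintegral_ofReal hI1
        (Filter.Eventually.of_forall fun x => norm_nonneg _)]
      simp
    rw [e1, e2, ENNReal.ofReal_rpow_of_nonneg (integral_nonneg fun x => norm_nonneg _)
      (by norm_num), ← ENNReal.ofReal_coe_nnreal, ← ENNReal.ofReal_mul (NNReal.coe_nonneg _),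
      Real.rpow_two] at gns
    exact (ENNReal.ofReal_le_ofReal_iff (by positivity)).1 gns
  have hcs : ∀ (k : ℕ) , 1 ≤ k → Integrable fun x => ‖φ x‖ ^ k := fun k hk =>
    (hφc.norm.pow _).integrable_of_hasCompactSupport
        (h2.comp_left (g := fun y => ‖y‖ ^ k) (by simp; omega))
  have hI2 : Integrable fun x => ‖φ x‖ ^ (2 * n - 1) * ‖fderiv ℝ φ x‖ :=
    ((hφc.norm.pow _).mul hφd.norm).integrable_of_hasCompactSupport
      ((h2.fderiv ℝ).norm.mul_left)
  have g3 : ∫ x, ‖fderiv ℝ (fun x => (‖φ x‖ ^ 2) ^ n) x‖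
      ≤ 2 * n * ∫ x, ‖φ x‖ ^ (2 * n - 1) * ‖fderiv ℝ φ x‖ := by
    rw [← integral_const_mul]
    exact integral_mono hI1 (hI2.const_mul _) hvd
  have g4 : (∫ x, ‖φ x‖ ^ (2 * n - 1) * ‖fderiv ℝ φ x‖) ^ 2
      ≤ (∫ x, ‖φ x‖ ^ (4 * n - 2)) * ∫ x, ‖fderiv ℝ φ x‖ ^ 2 := by
    have m1 : MemLp (fun x => ‖φ x‖ ^ (2 * n - 1)) (ENNReal.ofReal 2) volume :=
      (hφc.norm.pow _).memLp_of_hasCompactSupport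
        (h2.comp_left (g := fun y => ‖y‖ ^ (2 * n - 1)) (by simp; omega))
    have m2 : MemLp (fun x => ‖fderiv ℝ φ x‖) (ENNReal.ofReal 2) volume :=
      hφd.norm.memLp_of_hasCompactSupport (h2.fderiv ℝ).norm
    have := integral_mul_le_Lp_mul_Lq_of_nonneg Real.HolderConjugate.two_two
      (Filter.Eventually.of_forall fun x => by positivity)
      (Filter.Eventually.of_forall fun x => by positivity) m1 m2
    simp only [Real.rpow_two, ← Real.sqrt_eq_rpow] at this
    have hp : ∀ x, (‖φ x‖ ^ (2 * n - 1)) ^ 2 = ‖φ x‖ ^ (4 * n - 2) := fun x => by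
      rw [← pow_mul]; congr 1; omega
    simp_rw [hp] at this
    calc _ ≤ (Real.sqrt (∫ x, ‖φ x‖ ^ (4 * n - 2)) * Real.sqrt (∫ x, ‖fderiv ℝ φ x‖ ^ 2)) ^ 2 := by
          gcongr
      _ = _ := by
          rw [mul_pow, Real.sq_sqrt (integral_nonneg fun x => by positivity),
            Real.sq_sqrt (integral_nonneg fun x => by positivity)]
  have hn1 : (1 : ℝ) ≤ n := by exact_mod_cast hn
  -- Hölder against the constant 1, with exponents `2n/(2n - 1)` and `2n`: indeed `(4n - 2) · 2n/(2n
  -- - 1) = 4n`.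
  have g5 : ∫ x, ‖φ x‖ ^ (4 * n - 2) ≤ a ^ (1 - 1 / (2 * n : ℝ)) * V ^ (1 / (2 * n : ℝ)) := by
    rw [← out _ (by omega)]
    have hq : Real.HolderConjugate (1 - 1 / (2 * n : ℝ))⁻¹ (2 * n : ℝ) := by
      refine Real.holderConjugate_iff.2 ⟨?_, ?_⟩
      · rw [one_lt_inv_iff₀]
        constructor
        · rw [sub_pos, div_lt_one (by positivity)]; linarith
        · rw [sub_lt_self_iff]; positivity
      · rw [inv_inv]; field_simp; ring
    have m1 : MemLp (fun x => ‖φ x‖ ^ (4 * n - 2)) (ENNReal.ofReal (1 - 1 / (2 * n : ℝ))⁻¹)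
        (volume.restrict Ω) :=
      ((hφc.norm.pow _).memLp_of_hasCompactSupport
        (h2.comp_left (g := fun y => ‖y‖ ^ (4 * n - 2)) (by simp; omega))).restrict Ω
    have := integral_mul_le_Lp_mul_Lq_of_nonneg (μ := volume.restrict Ω) hq
      (f := fun x => ‖φ x‖ ^ (4 * n - 2)) (g := fun _ => 1)
      (Filter.Eventually.of_forall fun x => by positivity)
      (Filter.Eventually.of_forall fun x => by simp) m1 (memLp_const _)
    have hp : ∀ x, (‖φ x‖ ^ (4 * n - 2)) ^ (1 - 1 / (2 * n : ℝ))⁻¹ = ‖φ x‖ ^ (4 * n) := fun x => by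
      rw [← Real.rpow_natCast, ← Real.rpow_mul (norm_nonneg _), ← Real.rpow_natCast]
      congr 1
      rw [Nat.cast_sub (by omega)]
      push_cast
      have : (2 * n - 1 : ℝ) ≠ 0 := by linarith
      have h' : (1 - 1 / (2 * n : ℝ)) = (2 * n - 1) / (2 * n) := by field_simp
      rw [h', inv_div, mul_div_assoc', div_eq_iff this]
      ring
    simp_rw [hp] at this
    simpa using this
  have main : a ≤ 4 * K * n ^ 2 * b * (a ^ (1 - 1 / (2 * n : ℝ)) * V ^ (1 / (2 * n : ℝ))) := by
    have hg3 : (∫ x, ‖fderiv ℝ (fun x => (‖φ x‖ ^ 2) ^ n) x‖) ^ 2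
        ≤ (2 * n * ∫ x, ‖φ x‖ ^ (2 * n - 1) * ‖fderiv ℝ φ x‖) ^ 2 :=
      pow_le_pow_left₀ (integral_nonneg fun x => norm_nonneg _) g3 2
    calc a = ∫ x, ‖φ x‖ ^ (4 * n) := out _ (by omega)
      _ ≤ K * (2 * n * ∫ x, ‖φ x‖ ^ (2 * n - 1) * ‖fderiv ℝ φ x‖) ^ 2 :=
          g2.trans (by gcongr)
      _ = 4 * K * n ^ 2 * (∫ x, ‖φ x‖ ^ (2 * n - 1) * ‖fderiv ℝ φ x‖) ^ 2 := by ring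
      _ ≤ 4 * K * n ^ 2 * ((∫ x, ‖φ x‖ ^ (4 * n - 2)) * b) := by
          rw [outd]; gcongr
      _ ≤ 4 * K * n ^ 2 * ((a ^ (1 - 1 / (2 * n : ℝ)) * V ^ (1 / (2 * n : ℝ))) * b) := by gcongr
      _ = _ := by ring
  have hV0 : 0 ≤ V := measureReal_nonneg
  -- A positive power of `a` is cancelled below, so the case `a = 0` is treated apart.
  rcases ha0.eq_or_lt with ha00 | hapos
  · rw [← ha00, Real.zero_rpow (by positivity)]
    positivity
  have main2 : a ^ (1 / (2 * n : ℝ)) ≤ 4 * K * n ^ 2 * b * V ^ (1 / (2 * n : ℝ)) := by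
    have e : a = a ^ (1 - 1 / (2 * n : ℝ)) * a ^ (1 / (2 * n : ℝ)) := by
      rw [← Real.rpow_add hapos]; simp
    have hpos : 0 < a ^ (1 - 1 / (2 * n : ℝ)) := Real.rpow_pos_of_pos hapos _
    refine le_of_mul_le_mul_left ?_ hpos
    rw [← e]
    calc a ≤ _ := main
      _ = _ := by ring
  -- The factor coming from the volume is bounded independently of `n`, and by a square, in view of
  -- the square root to come.
  have hVm : V ^ (1 / (2 * n : ℝ)) ≤ max 1 V ^ 2 := by
    have hm : (1 : ℝ) ≤ max 1 V := le_max_left _ _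
    calc V ^ (1 / (2 * n : ℝ)) ≤ max 1 V ^ (1 / (2 * n : ℝ)) :=
          Real.rpow_le_rpow hV0 (le_max_right _ _) (by positivity)
      _ ≤ max 1 V ^ (2 : ℝ) := by
          refine Real.rpow_le_rpow_of_exponent_le hm ?_
          rw [div_le_iff₀ (by positivity)]; linarith
      _ = _ := Real.rpow_two _
  have e : a ^ (1 / (4 * n : ℝ)) = Real.sqrt (a ^ (1 / (2 * n : ℝ))) := by
    rw [Real.sqrt_eq_rpow, ← Real.rpow_mul ha0]; congr 1; field_simp; norm_num
  rw [e]
  refine Real.sqrt_le_iff.2 ⟨by positivity, ?_⟩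
  calc a ^ (1 / (2 * n : ℝ)) ≤ 4 * K * n ^ 2 * b * max 1 V ^ 2 := main2.trans (by gcongr)
    _ = _ := by
        rw [mul_pow, mul_pow, mul_pow, mul_pow, Real.sq_sqrt hK0, Real.sq_sqrt hb0]; ring

theorem sqrt_integral_norm_sq {α E : Type*} [MeasurableSpace α] {m : Measure α}
    [NormedAddCommGroup E] {F : α → E} (hF : MemLp F 2 m) :
    Real.sqrt (∫ x, ‖F x‖ ^ 2 ∂m) = (eLpNorm F 2 m).toReal := by
  rw [hF.eLpNorm_eq_integral_rpow_norm (by norm_num) (by norm_num), ENNReal.toReal_ofReal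
    (by positivity), Real.sqrt_eq_rpow]
  simp

/-- In two dimensions, the `L¹` norm of an element of `W₀^{1,2}` weighted by `0 ≤ κ ≤ 1` is
controlled by every power smaller than one of the mass of `κ`, with a constant growing at most
linearly in the conjugate exponent. -/
theorem exists_integral_weight_mul_norm_le (hd : d = 2) (hb : Bornology.IsBounded Ω) :
    ∃ C : ℝ, 0 ≤ C ∧ ∀ (f : Space d → Space d) (g : Space d → Space d →L[ℝ] Space d),
      MemW12Zero Ω f g → ∀ κ : Space d → ℝ, AEStronglyMeasurable κ (volume.restrict Ω) →
      (∀ x, 0 ≤ κ x) → (∀ x, κ x ≤ 1) → ∀ n : ℕ, 1 ≤ n →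
      ∫ x in Ω, κ x * ‖f x‖ ≤ C * n * (∫ x in Ω, κ x) ^ (1 - 1 / (4 * n : ℝ))
        * Real.sqrt (∫ x in Ω, ‖g x‖ ^ 2) := by
  have hfin : IsFiniteMeasure (volume.restrict Ω) := ⟨by simpa using hb.measure_lt_top⟩
  refine ⟨2 * Real.sqrt (lintegralPowLePowLIntegralFDerivConst (volume : Measure (Space d)) 2)
        * max 1 (volume.real Ω), by positivity, fun f g h κ hκ hκ0 hκ1 n hn => ?_⟩
  set C := 2 * Real.sqrt (lintegralPowLePowLIntegralFDerivConst (volume : Measure (Space d)) 2)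
        * max 1 (volume.real Ω) with hC
  have hn1 : (1 : ℝ) ≤ n := by exact_mod_cast hn
  have hκb : ∀ x, ‖κ x‖ ≤ 1 := fun x => by rw [Real.norm_of_nonneg (hκ0 x)]; exact hκ1 x
  have hκm : MemLp κ ⊤ (volume.restrict Ω) :=
    memLp_top_of_bound hκ 1 (Filter.Eventually.of_forall hκb)
  have hκi : IntegrableOn κ Ω := hκm.integrable le_top
  obtain ⟨φ, h1, h2, h3, h4, h5⟩ := h.exists_seq
  set A := (∫ x in Ω, κ x) ^ (1 - 1 / (4 * n : ℝ)) with hA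
  have hexp : (0 : ℝ) < 1 - 1 / (4 * n : ℝ) := by
    rw [sub_pos, div_lt_one (by positivity)]; linarith
  have hA0 : 0 ≤ A := Real.rpow_nonneg (integral_nonneg hκ0) _
  have hg2 : ∀ m, MemLp (fderiv ℝ (φ m)) 2 (volume.restrict Ω) := fun m =>
    memLp_of_contDiff_hasCompactSupport ((h1 m).continuous_fderiv (by simp)) ((h2 m).fderiv ℝ) 2 Ω
  have hφ2 : ∀ m, MemLp (φ m) 2 (volume.restrict Ω) := fun m =>
    memLp_of_contDiff_hasCompactSupport (h1 m).continuous (h2 m) 2 Ω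
  have step : ∀ m, ∫ x in Ω, κ x * ‖φ m x‖ ≤ C * n * A *
      ((eLpNorm g 2 (volume.restrict Ω)).toReal +
        (eLpNorm (fun x => g x - fderiv ℝ (φ m) x) 2 (volume.restrict Ω)).toReal) := by
    intro m
    have hq : Real.HolderConjugate (1 - 1 / (4 * n : ℝ))⁻¹ (4 * n : ℝ) := by
      refine Real.holderConjugate_iff.2 ⟨?_, ?_⟩
      · rw [one_lt_inv_iff₀]
        exact ⟨hexp, by rw [sub_lt_self_iff]; positivity⟩
      · rw [inv_inv]; field_simp; ring
    have m1 : MemLp (fun x => ‖φ m x‖) (ENNReal.ofReal (4 * n)) (volume.restrict Ω) :=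
      (memLp_of_contDiff_hasCompactSupport (h1 m).continuous (h2 m) _ Ω).norm
    have hol := integral_mul_le_Lp_mul_Lq_of_nonneg (μ := volume.restrict Ω) hq
      (f := κ) (g := fun x => ‖φ m x‖) (Filter.Eventually.of_forall hκ0)
      (Filter.Eventually.of_forall fun x => norm_nonneg _) (hκm.mono_exponent le_top) m1
    -- Since `0 ≤ κ ≤ 1`, raising `κ` to an exponent at least one decreases it, so the Hölder norm
    -- of the weight is at most a power of its mass.
    have k1 : (∫ x in Ω, κ x ^ (1 - 1 / (4 * n : ℝ))⁻¹) ^ (1 / (1 - 1 / (4 * n : ℝ))⁻¹) ≤ A := by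
      rw [one_div (1 - 1 / (4 * n : ℝ))⁻¹, inv_inv]
      refine Real.rpow_le_rpow (integral_nonneg fun x => Real.rpow_nonneg (hκ0 x) _) ?_ hexp.le
      refine integral_mono_of_nonneg
        (Filter.Eventually.of_forall fun x => Real.rpow_nonneg (hκ0 x) _) hκi
        (Filter.Eventually.of_forall fun x => ?_)
      exact Real.rpow_le_self_of_le_one (hκ0 x) (hκ1 x) (one_le_inv_iff₀.2
        ⟨hexp, by rw [sub_le_self_iff]; positivity⟩)
    have k2 : (∫ x in Ω, ‖φ m x‖ ^ (4 * n : ℝ)) ^ (1 / (4 * n : ℝ)) ≤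
        C * n * Real.sqrt (∫ x in Ω, ‖fderiv ℝ (φ m) x‖ ^ 2) := by
      have := integral_norm_pow_le hd hb (h1 m) (h2 m) (h3 m) hn
      refine le_trans (le_of_eq ?_) this
      congr 1
      refine integral_congr_ae (Filter.Eventually.of_forall fun x => ?_)
      simp only
      rw [← Real.rpow_natCast]; push_cast; rfl
    have k3 : Real.sqrt (∫ x in Ω, ‖fderiv ℝ (φ m) x‖ ^ 2) ≤
        (eLpNorm g 2 (volume.restrict Ω)).toReal +
        (eLpNorm (fun x => g x - fderiv ℝ (φ m) x) 2 (volume.restrict Ω)).toReal := by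
      have hfin2 : eLpNorm (fun x => g x - fderiv ℝ (φ m) x) 2 (volume.restrict Ω) ≠ ⊤ :=
        (h.2.1.sub (hg2 m)).2.ne
      rw [sqrt_integral_norm_sq (hg2 m), ← ENNReal.toReal_add h.2.1.2.ne hfin2]
      refine ENNReal.toReal_mono (ENNReal.add_ne_top.2 ⟨h.2.1.2.ne, hfin2⟩) ?_
      calc eLpNorm (fderiv ℝ (φ m)) 2 (volume.restrict Ω)
          = eLpNorm (g - fun x => g x - fderiv ℝ (φ m) x) 2 (volume.restrict Ω) := by
            congr 1; ext1 x; simp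
        _ ≤ _ := eLpNorm_sub_le h.2.1.1 (h.2.1.1.sub (hg2 m).1) (by norm_num)
    calc _ ≤ _ := hol
      _ ≤ A * (C * n * Real.sqrt (∫ x in Ω, ‖fderiv ℝ (φ m) x‖ ^ 2)) := by
          gcongr
      _ ≤ A * (C * n * ((eLpNorm g 2 (volume.restrict Ω)).toReal +
        (eLpNorm (fun x => g x - fderiv ℝ (φ m) x) 2 (volume.restrict Ω)).toReal)) := by
          gcongr
      _ = _ := by ring
  have hint : ∀ w : Space d → Space d, MemLp w 2 (volume.restrict Ω) →
      IntegrableOn (fun x => κ x * ‖w x‖) Ω := fun w hw =>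
    ((hw.integrable (by norm_num)).norm).bdd_mul (c := 1) hκ (Filter.Eventually.of_forall hκb)
  have lim1 : Filter.Tendsto (fun m => ∫ x in Ω, κ x * ‖φ m x‖) Filter.atTop
      (𝓝 (∫ x in Ω, κ x * ‖f x‖)) := by
    refine tendsto_integral_of_L1' _ (hint f h.1).1
      (Filter.Eventually.of_forall fun m => hint _ (hφ2 m)) ?_
    have hle : ∀ m, eLpNorm ((fun x => κ x * ‖φ m x‖) - fun x => κ x * ‖f x‖) 1
        (volume.restrict Ω) ≤ eLpNorm (fun x => f x - φ m x) 2 (volume.restrict Ω)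
          * (volume.restrict Ω) univ ^ (1 / (1 : ENNReal).toReal - 1 / (2 : ENNReal).toReal) := by
      intro m
      refine le_trans ?_ (eLpNorm_le_eLpNorm_mul_rpow_measure_univ (by norm_num)
        (h.1.1.sub (hφ2 m).1))
      refine eLpNorm_mono fun x => ?_
      simp only [Pi.sub_apply]
      rw [← mul_sub, norm_mul]
      calc _ ≤ 1 * ‖f x - φ m x‖ := by
            gcongr
            · exact hκb x
            · rw [norm_sub_rev]; exact abs_norm_sub_norm_le _ _
        _ = _ := one_mul _
    refine tendsto_of_tendsto_of_tendsto_of_le_of_le tendsto_const_nhds ?_ (fun _ => zero_le) hle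
    have := ENNReal.Tendsto.mul_const (b := (volume.restrict Ω) univ ^
      (1 / (1 : ENNReal).toReal - 1 / (2 : ENNReal).toReal)) h4
      (Or.inr (ENNReal.rpow_ne_top_of_nonneg (by norm_num) (measure_ne_top _ _)))
    simpa using this
  have lim2 : Filter.Tendsto (fun m => C * n * A *
      ((eLpNorm g 2 (volume.restrict Ω)).toReal +
        (eLpNorm (fun x => g x - fderiv ℝ (φ m) x) 2 (volume.restrict Ω)).toReal)) Filter.atTop
      (𝓝 (C * n * A * ((eLpNorm g 2 (volume.restrict Ω)).toReal + 0))) := by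
    refine Filter.Tendsto.const_mul _ (tendsto_const_nhds.add ?_)
    have := (ENNReal.tendsto_toReal ENNReal.zero_ne_top).comp h5
    simpa [Function.comp_def] using this
  rw [sqrt_integral_norm_sq h.2.1]
  rw [add_zero] at lim2
  exact le_of_tendsto_of_tendsto' lim1 lim2 step

end

end PotTempNS

namespace PotTempNS

/-! ### An Osgood-type lemma -/

/-- Uniform continuity of the primitive of `g` on `[0, T]`. It cuts time into finitely many windows
on which the integral is small. -/
theorem exists_pos_integral_le {T : ℝ} {g : ℝ → ℝ} (hg : IntervalIntegrable g volume 0 T)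
    {ε : ℝ} (hε : 0 < ε) :
    ∃ δ : ℝ, 0 < δ ∧ ∀ s t, 0 ≤ s → s ≤ t → t ≤ T → t - s ≤ δ → ∫ x in s..t, g x ≤ ε := by
  rcases lt_or_ge T 0 with hT | hT
  · exact ⟨1, one_pos, fun s t h0 h1 h2 _ => by linarith⟩
  have hc : ContinuousOn (fun t => ∫ x in (0 : ℝ)..t, g x) (Icc 0 T) := by
    have := intervalIntegral.continuousOn_primitive_interval' hg (left_mem_uIcc)
    rwa [uIcc_of_le hT] at this
  have hu := isCompact_Icc.uniformContinuousOn_of_continuous hc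
  rw [Metric.uniformContinuousOn_iff] at hu
  obtain ⟨δ, hδ, h⟩ := hu ε hε
  refine ⟨δ / 2, by positivity, fun s t h0 h1 h2 h3 => ?_⟩
  have hs : s ∈ Icc (0 : ℝ) T := ⟨h0, h1.trans h2⟩
  have ht : t ∈ Icc (0 : ℝ) T := ⟨h0.trans h1, h2⟩
  have := h t ht s hs (by rw [Real.dist_eq, abs_of_nonneg (by linarith)]; linarith)
  rw [Real.dist_eq, intervalIntegral.integral_interval_sub_left] at this
  · exact (le_abs_self _).trans this.le
  · exact hg.mono_set (by rw [uIcc_of_le ht.1, uIcc_of_le hT]; exact Icc_subset_Icc_right ht.2)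
  · exact hg.mono_set (by rw [uIcc_of_le hs.1, uIcc_of_le hT]; exact Icc_subset_Icc_right hs.2)

theorem intervalIntegrable_of_mem {T : ℝ} {g : ℝ → ℝ} (hg : IntervalIntegrable g volume 0 T)
    {s t : ℝ} (hs : 0 ≤ s) (hst : s ≤ t) (ht : t ≤ T) : IntervalIntegrable g volume s t :=
  hg.mono_set (by
    rw [uIcc_of_le hst, uIcc_of_le (hs.trans (hst.trans ht))]; exact Icc_subset_Icc hs ht)

/-- A Grönwall lemma for a function whose increments are controlled by an integral. -/
theorem gronwall_increment {T s₀ k : ℝ} {W b : ℝ → ℝ} (hs₀ : 0 ≤ s₀)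
    (hb : IntervalIntegrable b volume 0 T) (hb0 : ∀ t, 0 ≤ b t)
    (hW0 : ∀ t ∈ Icc s₀ T, 0 ≤ W t) (hW : W s₀ ≤ k)
    (h : ∀ s t, s₀ ≤ s → s ≤ t → t ≤ T → W t - W s ≤ W t * ∫ x in s..t, b x) :
    ∀ t ∈ Icc s₀ T, W t ≤ k * Real.exp (2 * ∫ x in s₀..t, b x) := by
  -- The bound is propagated by induction over windows of length `δ`, on each of which `b` has
  -- integral at most 1/2.
  obtain ⟨δ, hδ, hd⟩ := exists_pos_integral_le hb (ε := 1 / 2) (by norm_num)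
  have claim : ∀ j : ℕ, ∀ t ∈ Icc s₀ T, t ≤ s₀ + j * δ →
      W t ≤ k * Real.exp (2 * ∫ x in s₀..t, b x) := by
    intro j
    induction j with
    | zero =>
      intro t ht htj
      have : t = s₀ := le_antisymm (by simpa using htj) ht.1
      subst this
      simpa using hW
    | succ j ih =>
      intro t ht htj
      by_cases hle : t ≤ s₀ + j * δ
      · exact ih t ht hle
      rw [not_le] at hle
      set s := s₀ + j * δ with hs
      have hs1 : s₀ ≤ s := by rw [hs]; have : 0 ≤ (j : ℝ) * δ := by positivity
                              linarith
      have hsT : s ∈ Icc s₀ T := ⟨hs1, hle.le.trans ht.2⟩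
      have hi := ih s hsT le_rfl
      have hst := h s t hs1 hle.le ht.2
      have hβ := hd s t (hs₀.trans hs1) hle.le ht.2 (by push_cast at htj; linarith)
      have hβ0 : 0 ≤ ∫ x in s..t, b x :=
        intervalIntegral.integral_nonneg_of_forall hle.le hb0
      rw [← intervalIntegral.integral_add_adjacent_intervals (b := s)
        (intervalIntegrable_of_mem hb hs₀ hs1 hsT.2)
        (intervalIntegrable_of_mem hb (hs₀.trans hs1) hle.le ht.2), mul_add, Real.exp_add,
        ← mul_assoc]
      set β := ∫ x in s..t, b x
      -- For `0 ≤ β ≤ 1/2` one has `(1 - β)(1 + 2β) = 1 + β(1 - 2β) ≥ 1`. This is the origin of the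
      -- factor 2 in the exponent.
      have hexp : 1 ≤ (1 - β) * Real.exp (2 * β) := by
        have := Real.add_one_le_exp (2 * β)
        nlinarith
      have hWt := hW0 t ht
      calc W t ≤ W t * ((1 - β) * Real.exp (2 * β)) := le_mul_of_one_le_right hWt hexp
        _ = (W t - W t * β) * Real.exp (2 * β) := by ring
        _ ≤ W s * Real.exp (2 * β) := by gcongr; linarith
        _ ≤ _ := by gcongr
  intro t ht
  obtain ⟨j, hj⟩ := exists_nat_ge ((t - s₀) / δ)
  refine claim j t ht ?_
  rw [div_le_iff₀ hδ] at hj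
  linarith

/-- The weighted arithmetic-geometric mean inequality for `e · y` and `e^(-(4n-1))` with weights `1
- 1/(4n)` and `1/(4n)`: the two exponentials cancel in the geometric mean. The sublinear power
becomes linear with slope of order `n`, up to an error that is exponentially small in `n`. -/
theorem nat_mul_rpow_le {n : ℕ} (hn : 1 ≤ n) {y : ℝ} (hy : 0 ≤ y) :
    n * y ^ (1 - 1 / (4 * n : ℝ)) ≤ (y + Real.exp (-(4 * n - 1 : ℝ))) * (Real.exp 1 * n) := by
  have hn1 : (1 : ℝ) ≤ n := by exact_mod_cast hn
  have hw : (0 : ℝ) ≤ 1 - 1 / (4 * n : ℝ) := by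
    rw [sub_nonneg, div_le_one (by positivity)]; linarith
  have := Real.geom_mean_le_arith_mean2_weighted hw (by positivity : (0 : ℝ) ≤ 1 / (4 * n))
    (mul_nonneg (Real.exp_pos 1).le hy) (Real.exp_pos (-(4 * n - 1 : ℝ))).le (by ring)
  rw [Real.mul_rpow (Real.exp_pos 1).le hy, ← Real.exp_mul, ← Real.exp_mul] at this
  have e : Real.exp (1 * (1 - 1 / (4 * n : ℝ))) * y ^ (1 - 1 / (4 * n : ℝ))
      * Real.exp (-(4 * n - 1) * (1 / (4 * n))) = y ^ (1 - 1 / (4 * n : ℝ)) := by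
    rw [mul_right_comm, ← Real.exp_add]
    have : 1 * (1 - 1 / (4 * n : ℝ)) + -(4 * n - 1) * (1 / (4 * n)) = 0 := by field_simp; ring
    rw [this, Real.exp_zero, one_mul]
  rw [e] at this
  set E := Real.exp (-(4 * n - 1 : ℝ))
  have hE : 0 < E := Real.exp_pos _
  have he : 1 ≤ Real.exp 1 := by simp
  have h1 : (1 - 1 / (4 * n : ℝ)) * (Real.exp 1 * y) ≤ Real.exp 1 * y :=
    mul_le_of_le_one_left (by positivity) (by rw [sub_le_self_iff]; positivity)
  have h2 : 1 / (4 * n : ℝ) * E ≤ Real.exp 1 * E := by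
    gcongr
    refine le_trans ?_ he
    rw [div_le_one (by positivity)]; linarith
  calc (n : ℝ) * y ^ (1 - 1 / (4 * n : ℝ)) ≤ n * (Real.exp 1 * y + Real.exp 1 * E) := by
        gcongr; linarith
    _ = _ := by ring

/-- An Osgood-type lemma: a bounded function with `F ≤ ∫ (a F + X)`, where `X` is bounded by
`n g F ^ (1 - 1 / (4n))` for all `n`, vanishes almost everywhere. -/
theorem ae_eq_zero_of_osgood {T M : ℝ} (hT : 0 ≤ T) {F X a g : ℝ → ℝ}
    (hFm : AEStronglyMeasurable F (volume.restrict (Ioo 0 T)))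
    (hXm : AEStronglyMeasurable X (volume.restrict (Ioo 0 T)))
    (hF : ∀ᵐ t ∂(volume.restrict (Ioo 0 T)), 0 ≤ F t ∧ F t ≤ M)
    (hX0 : ∀ᵐ t ∂(volume.restrict (Ioo 0 T)), 0 ≤ X t)
    (ha : IntegrableOn a (Ioo 0 T)) (hg : IntegrableOn g (Ioo 0 T))
    (ha0 : ∀ t, 0 ≤ a t) (hg0 : ∀ t, 0 ≤ g t)
    (hX : ∀ᵐ t ∂(volume.restrict (Ioo 0 T)), ∀ n : ℕ, 1 ≤ n →
      X t ≤ n * g t * F t ^ (1 - 1 / (4 * n : ℝ)))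
    (h : ∀ᵐ τ ∂(volume.restrict (Ioo 0 T)), F τ ≤ ∫ t in Ioo 0 τ, (a t * F t + X t)) :
    ∀ᵐ τ ∂(volume.restrict (Ioo 0 T)), F τ = 0 := by
  have toI : ∀ {w : ℝ → ℝ}, IntegrableOn w (Ioo 0 T) → IntervalIntegrable w volume 0 T :=
    fun hw => (intervalIntegrable_iff_integrableOn_Ioo_of_le hT).2 hw
  have hFa : IntegrableOn (fun t => a t * F t) (Ioo 0 T) := by
    refine Integrable.mul_bdd (c := M) ha hFm ?_
    filter_upwards [hF] with t ht
    rw [Real.norm_of_nonneg ht.1]; exact ht.2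
  -- The bound with `n = 1` suffices for integrability, `F` being bounded.
  have hXi : IntegrableOn X (Ioo 0 T) := by
    refine Integrable.mono' (hg.mul_const (max M 1)) hXm ?_
    filter_upwards [hX, hX0, hF] with t h1 h2 h3
    rw [Real.norm_of_nonneg h2]
    refine (h1 1 le_rfl).trans ?_
    simp only [Nat.cast_one, one_mul]
    refine mul_le_mul_of_nonneg_left ?_ (hg0 t)
    have hp : (0 : ℝ) ≤ 1 - 1 / (4 * 1) := by norm_num
    calc F t ^ (1 - 1 / (4 * 1) : ℝ) ≤ (max M 1) ^ (1 - 1 / (4 * 1) : ℝ) :=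
          Real.rpow_le_rpow h3.1 (h3.2.trans (le_max_left _ _)) hp
      _ ≤ (max M 1) ^ (1 : ℝ) :=
          Real.rpow_le_rpow_of_exponent_le (le_max_right _ _) (by norm_num)
      _ = _ := Real.rpow_one _
  -- `F` is only measurable. The argument is carried out on the monotone function `Y`, which
  -- dominates `F` almost everywhere.
  set Y : ℝ → ℝ := fun τ => ∫ t in (0 : ℝ)..τ, (a t * F t + X t) with hY
  have hint : IntervalIntegrable (fun t => a t * F t + X t) volume 0 T := toI (hFa.add hXi)
  have hnn : ∀ᵐ t ∂(volume.restrict (Ioo 0 T)), 0 ≤ a t * F t + X t := by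
    filter_upwards [hF, hX0] with t h1 h2
    exact add_nonneg (mul_nonneg (ha0 t) h1.1) h2
  have res : ∀ {s t : ℝ} {P : ℝ → Prop}, 0 ≤ s → t ≤ T →
      (∀ᵐ x ∂(volume.restrict (Ioo 0 T)), P x) → ∀ᵐ x ∂(volume.restrict (Ioc s t)), P x := by
    intro s t P hs ht hP
    rw [← Measure.restrict_congr_set Ioo_ae_eq_Ioc]
    exact ae_restrict_of_ae_restrict_of_subset (Ioo_subset_Ioo hs ht) hP
  have hdiff : ∀ s t, 0 ≤ s → s ≤ t → t ≤ T →
      Y t - Y s = ∫ x in s..t, (a x * F x + X x) := by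
    intro s t hs hst ht
    exact intervalIntegral.integral_interval_sub_left
      (intervalIntegrable_of_mem hint le_rfl (hs.trans hst) ht)
      (intervalIntegrable_of_mem hint le_rfl hs (hst.trans ht))
  have hmono : ∀ s t, 0 ≤ s → s ≤ t → t ≤ T → Y s ≤ Y t := by
    intro s t hs hst ht
    rw [← sub_nonneg, hdiff s t hs hst ht]
    exact intervalIntegral.integral_nonneg_of_ae_restrict hst
      (by rw [← Measure.restrict_congr_set Ioc_ae_eq_Icc]; exact res hs ht hnn)
  have hY0 : Y 0 = 0 := by simp [hY]
  have hYn : ∀ t, 0 ≤ t → t ≤ T → 0 ≤ Y t := fun t h0 hT' => hY0 ▸ hmono 0 t le_rfl h0 hT'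
  have hFY : ∀ᵐ τ ∂(volume.restrict (Ioo 0 T)), F τ ≤ Y τ := by
    filter_upwards [h, ae_restrict_mem measurableSet_Ioo] with τ h1 h2
    show F τ ≤ ∫ t in (0 : ℝ)..τ, (a t * F t + X t)
    rwa [intervalIntegral.integral_of_le h2.1.le, integral_Ioc_eq_integral_Ioo]
  -- For every `n`, the function `Y + e^(-(4n-1))` satisfies the hypothesis of `gronwall_increment`
  -- with the coefficient `a + e n g`.
  have inc : ∀ n : ℕ, 1 ≤ n → ∀ s t, 0 ≤ s → s ≤ t → t ≤ T →
      Y t - Y s ≤ (Y t + Real.exp (-(4 * n - 1 : ℝ))) *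
        ∫ x in s..t, (a x + Real.exp 1 * n * g x) := by
    intro n hn s t hs hst ht
    rw [hdiff s t hs hst ht, ← intervalIntegral.integral_const_mul]
    refine intervalIntegral.integral_mono_ae_restrict hst
      (intervalIntegrable_of_mem hint hs hst ht)
      (intervalIntegrable_of_mem (((toI ha).add ((toI hg).const_mul _)).const_mul _) hs hst ht) ?_
    rw [← Measure.restrict_congr_set Ioc_ae_eq_Icc]
    filter_upwards [res hs ht hF, res hs ht hX, res hs ht hFY, ae_restrict_mem measurableSet_Ioc]
      with x h1 h2 h3 h4
    have hYx : F x ≤ Y t := h3.trans (hmono x t (hs.trans h4.1.le) h4.2 ht)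
    have h5 := nat_mul_rpow_le hn h1.1
    have h6 := mul_le_mul_of_nonneg_right h5 (hg0 x)
    have h7 := h2 n hn
    have hE := Real.exp_pos (-(4 * n - 1 : ℝ))
    have hg' : 0 ≤ Real.exp 1 * n * g x := by have := hg0 x; positivity
    calc a x * F x + X x
        ≤ a x * F x + (F x + Real.exp (-(4 * n - 1 : ℝ))) * (Real.exp 1 * n * g x) := by
          nlinarith
      _ ≤ a x * (Y t + Real.exp (-(4 * n - 1 : ℝ)))
          + (Y t + Real.exp (-(4 * n - 1 : ℝ))) * (Real.exp 1 * n * g x) := by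
          have := ha0 x
          gcongr
          linarith
      _ = _ := by ring
  -- On a window where `g` has integral at most `1/(2e)`, Grönwall's lemma loses a factor `exp (2 ·
  -- n/2) = e^n` only, whereas the initial value is `e^(-(4n-1))`. Letting `n` tend to infinity
  -- gives `Y = 0` on the window, and the next window starts again from zero.
  obtain ⟨η, hη, hηg⟩ := exists_pos_integral_le (toI hg) (ε := 1 / (2 * Real.exp 1))
    (by positivity)
  have claim : ∀ j : ℕ, ∀ t, 0 ≤ t → t ≤ T → t ≤ j * η → Y t = 0 := by
    intro j
    induction j with
    | zero =>
      intro t h0 _ h1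
      have : t = 0 := le_antisymm (by simpa using h1) h0
      rw [this, hY0]
    | succ j ih =>
      intro t h0 hT' h1
      by_cases hle : t ≤ j * η
      · exact ih t h0 hT' hle
      rw [not_le] at hle
      set s := (j : ℝ) * η with hs
      have hs0 : 0 ≤ s := by positivity
      have hYs : Y s = 0 := ih s hs0 (hle.le.trans hT') le_rfl
      set A := ∫ x in s..t, a x with hA
      have hb : ∀ n : ℕ, 1 ≤ n → Y t ≤ Real.exp (2 * A + 1) * Real.exp (-(n : ℝ)) := by
        intro n hn
        have hn1 : (1 : ℝ) ≤ n := by exact_mod_cast hn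
        have hnT : IntervalIntegrable (fun x => a x + Real.exp 1 * n * g x) volume 0 T :=
          (toI ha).add ((toI hg).const_mul _)
        have := gronwall_increment (T := T) (s₀ := s) (k := Real.exp (-(4 * n - 1 : ℝ)))
          (W := fun t => Y t + Real.exp (-(4 * n - 1 : ℝ)))
          (b := fun x => a x + Real.exp 1 * n * g x) hs0 hnT
          (fun t => by have := ha0 t; have := hg0 t; positivity)
          (fun t ht => add_nonneg (hYn t (hs0.trans ht.1) ht.2) (Real.exp_pos _).le)
          (by simp [hYs])
          (fun s' t' h1 h2 h3 => by simpa using inc n hn s' t' (hs0.trans h1) h2 h3) t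
          ⟨hle.le, hT'⟩
        rw [intervalIntegral.integral_add (intervalIntegrable_of_mem (toI ha) hs0 hle.le hT')
          ((intervalIntegrable_of_mem (toI hg) hs0 hle.le hT').const_mul _),
          intervalIntegral.integral_const_mul, ← Real.exp_add] at this
        have hgt := hηg s t hs0 hle.le hT' (by push_cast at h1; linarith)
        have h8 : Real.exp 1 * n * ∫ x in s..t, g x ≤ n / 2 := by
          calc Real.exp 1 * n * ∫ x in s..t, g x ≤ Real.exp 1 * n * (1 / (2 * Real.exp 1)) := by
                gcongr
            _ = n / 2 := by field_simp
        rw [← Real.exp_add]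
        refine (le_add_of_nonneg_right (Real.exp_pos (-(4 * n - 1 : ℝ))).le).trans
          (this.trans (Real.exp_le_exp.2 ?_))
        linarith
      refine le_antisymm ?_ (hYn t h0 hT')
      have lim : Filter.Tendsto (fun n : ℕ => Real.exp (2 * A + 1) * Real.exp (-(n : ℝ)))
          Filter.atTop (𝓝 (Real.exp (2 * A + 1) * 0)) :=
        (Real.tendsto_exp_neg_atTop_nhds_zero.comp tendsto_natCast_atTop_atTop).const_mul _
      rw [mul_zero] at lim
      exact ge_of_tendsto lim (Filter.eventually_atTop.2 ⟨1, hb⟩)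
  filter_upwards [hFY, hF, ae_restrict_mem measurableSet_Ioo] with τ h1 h2 h3
  obtain ⟨j, hj⟩ := exists_nat_ge (τ / η)
  rw [div_le_iff₀ hη] at hj
  rw [claim j τ h3.1.le h3.2.le hj] at h1
  exact le_antisymm h1 h2.1

end PotTempNS

namespace PotTempNS

/-! ### The relative energy and the coefficients of its test functions -/

section Coefficients

variable {d : ℕ}

/-- The derivative `p'(ρθ)` of the pressure at the state `y`. -/
noncomputable def pressureSlope (a γ : ℝ) (y : Phase d) : ℝ := a * γ * (y.1 * y.2.1) ^ (γ - 1)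

/-- The function `P'(ρθ) θ` of the state `y = (ρ, θ, u)`, which tests the entropy inequality. -/
noncomputable def entropyCoef (a γ : ℝ) (y : Phase d) : ℝ :=
  pressureSlope a γ y * y.2.1 / (γ - 1)

/-- The function of the state which tests the continuity equation. -/
noncomputable def densityCoef (a γ : ℝ) (y : Phase d) : ℝ :=
  1 / 2 * ‖y.2.2‖ ^ 2 - entropyCoef a γ y * (1 - Real.log y.2.1)

/-- The pressure of a state. -/
noncomputable def statePressure (a γ : ℝ) (y : Phase d) : ℝ := pressure a γ (y.1 * y.2.1)

/-- The relative energy of the state `z` with respect to the state `y`. -/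
noncomputable def relEnergy (a γ : ℝ) (y z : Phase d) : ℝ :=
  energyDensity a γ z - z.1 * inner ℝ z.2.2 y.2.2 + z.1 * densityCoef a γ y
    - z.1 * Real.log z.2.1 * entropyCoef a γ y + statePressure a γ y

/-- The states with positive density and temperature. -/
def posStates (d : ℕ) : Set (Phase d) := {y | 0 < y.1 ∧ 0 < y.2.1}

theorem isOpen_posStates : IsOpen (posStates d) :=
  (isOpen_lt continuous_const continuous_fst).inter
    (isOpen_lt continuous_const continuous_snd.fst)

/-- The linear form `v ↦ s v₁ + t v₂ + ⟨w, v₃⟩` on the state space. -/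
noncomputable def stateForm (s t : ℝ) (w : Space d) : Phase d →L[ℝ] ℝ :=
  s • ContinuousLinearMap.fst ℝ ℝ (ℝ × Space d)
    + t • (ContinuousLinearMap.fst ℝ ℝ (Space d)).comp
        (ContinuousLinearMap.snd ℝ ℝ (ℝ × Space d))
    + (innerSL ℝ w).comp ((ContinuousLinearMap.snd ℝ ℝ (Space d)).comp
        (ContinuousLinearMap.snd ℝ ℝ (ℝ × Space d)))

theorem stateForm_apply (s t : ℝ) (w : Space d) (v : Phase d) :
    stateForm s t w v = s * v.1 + t * v.2.1 + inner ℝ w v.2.2 := by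
  simp [stateForm]

/-- The derivative of `statePressure`. -/
noncomputable def statePressureDeriv (a γ : ℝ) (y : Phase d) : Phase d →L[ℝ] ℝ :=
  stateForm (pressureSlope a γ y * y.2.1) (pressureSlope a γ y * y.1) 0

/-- The derivative of `entropyCoef`. -/
noncomputable def entropyCoefDeriv (a γ : ℝ) (y : Phase d) : Phase d →L[ℝ] ℝ :=
  stateForm (pressureSlope a γ y * y.2.1 / y.1) (pressureSlope a γ y * (γ / (γ - 1))) 0

/-- The derivative of `densityCoef`. -/
noncomputable def densityCoefDeriv (a γ : ℝ) (y : Phase d) : Phase d →L[ℝ] ℝ :=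
  stateForm (-(pressureSlope a γ y * y.2.1 / y.1 * (1 - Real.log y.2.1)))
    (-(pressureSlope a γ y * (γ / (γ - 1)) * (1 - Real.log y.2.1)
      - pressureSlope a γ y / (γ - 1))) y.2.2

theorem hasFDerivAt_mul_rpow {y : Phase d} (hy : y ∈ posStates d) (s : ℝ) :
    HasFDerivAt (fun y : Phase d => (y.1 * y.2.1) ^ s)
      (stateForm (s * (y.1 * y.2.1) ^ (s - 1) * y.2.1)
        (s * (y.1 * y.2.1) ^ (s - 1) * y.1) 0) y := by
  have h1 : HasFDerivAt (fun y : Phase d => y.1 * y.2.1) _ y :=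
    (hasFDerivAt_fst (𝕜 := ℝ) (p := y)).mul (hasFDerivAt_snd (𝕜 := ℝ) (p := y)).fst
  refine (h1.rpow_const (p := s) (Or.inl (mul_pos hy.1 hy.2).ne')).congr_fderiv
    (ContinuousLinearMap.ext fun v => ?_)
  simp [stateForm_apply]
  ring

theorem hasFDerivAt_statePressure (a γ : ℝ) {y : Phase d} (hy : y ∈ posStates d) :
    HasFDerivAt (statePressure a γ) (statePressureDeriv a γ y) y := by
  refine ((hasFDerivAt_mul_rpow hy γ).const_mul a).congr_fderiv
    (ContinuousLinearMap.ext fun v => ?_)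
  simp [stateForm_apply, statePressureDeriv, pressureSlope]
  ring

theorem hasFDerivAt_entropyCoef (a : ℝ) {γ : ℝ} (hγ : 1 < γ) {y : Phase d}
    (hy : y ∈ posStates d) :
    HasFDerivAt (entropyCoef a γ) (entropyCoefDeriv a γ y) y := by
  have h1 := (hasFDerivAt_mul_rpow hy (γ - 1)).const_mul (a * γ)
  have h2 := (h1.mul (hasFDerivAt_snd (𝕜 := ℝ) (p := y)).fst).mul_const ((γ - 1)⁻¹)
  have hZ : (y.1 * y.2.1) ^ (γ - 1 - 1) = (y.1 * y.2.1) ^ (γ - 1) / (y.1 * y.2.1) :=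
    Real.rpow_sub_one (mul_pos hy.1 hy.2).ne' _
  have e1 := hy.1.ne'
  have e2 := hy.2.ne'
  have e3 : γ - 1 ≠ 0 := by linarith
  have e : entropyCoef (d := d) a γ = fun y => a * γ * (y.1 * y.2.1) ^ (γ - 1) * y.2.1 * (γ - 1)⁻¹ := by
    funext y
    simp [entropyCoef, pressureSlope, div_eq_mul_inv]
  rw [e]
  refine h2.congr_fderiv (ContinuousLinearMap.ext fun v => ?_)
  simp [stateForm_apply, entropyCoefDeriv, pressureSlope, hZ]
  field_simp
  ring

theorem hasFDerivAt_densityCoef (a : ℝ) {γ : ℝ} (hγ : 1 < γ) {y : Phase d}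
    (hy : y ∈ posStates d) :
    HasFDerivAt (densityCoef a γ) (densityCoefDeriv a γ y) y := by
  have h1 : HasFDerivAt (fun y : Phase d => ‖y.2.2‖ ^ 2) _ y :=
    ((hasFDerivAt_snd (𝕜 := ℝ) (p := y)).snd).norm_sq
  have h2 := (((hasFDerivAt_snd (𝕜 := ℝ) (p := y)).fst).log hy.2.ne').const_sub 1
  have h := (h1.const_mul (1 / 2)).sub ((hasFDerivAt_entropyCoef a hγ hy).mul h2)
  have e1 := hy.1.ne'
  have e2 := hy.2.ne'
  have e3 : γ - 1 ≠ 0 := by linarith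
  refine h.congr_fderiv (ContinuousLinearMap.ext fun v => ?_)
  simp [stateForm_apply, densityCoefDeriv, entropyCoefDeriv, entropyCoef]
  field_simp
  ring

theorem continuousOn_pressureSlope (a : ℝ) (γ : ℝ) :
    ContinuousOn (pressureSlope a γ) (posStates d) := by
  unfold pressureSlope
  refine continuousOn_const.mul (ContinuousOn.rpow_const (by fun_prop) fun y hy => ?_)
  exact Or.inl (mul_pos hy.1 hy.2).ne'

theorem ContinuousOn.stateForm {X : Type*} [TopologicalSpace X] {A : Set X} {s t : X → ℝ}
    {w : X → Space d} (hs : ContinuousOn s A) (ht : ContinuousOn t A) (hw : ContinuousOn w A) :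
    ContinuousOn (fun x => stateForm (s x) (t x) (w x)) A := by
  unfold PotTempNS.stateForm
  refine ((hs.smul continuousOn_const).add (ht.smul continuousOn_const)).add ?_
  exact ((innerSL ℝ).continuous.comp_continuousOn hw).clm_comp continuousOn_const

theorem continuousOn_log_temperature :
    ContinuousOn (fun y : Phase d => Real.log y.2.1) (posStates d) :=
  ContinuousOn.log (by fun_prop) fun _ hy => hy.2.ne'

theorem continuousOn_statePressureDeriv (a γ : ℝ) :
    ContinuousOn (statePressureDeriv (d := d) a γ) (posStates d) := by
  have := continuousOn_pressureSlope (d := d) a γ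
  exact ContinuousOn.stateForm (by fun_prop) (by fun_prop) (by fun_prop)

theorem continuousOn_entropyCoefDeriv (a γ : ℝ) :
    ContinuousOn (entropyCoefDeriv (d := d) a γ) (posStates d) := by
  have := continuousOn_pressureSlope (d := d) a γ
  refine ContinuousOn.stateForm ?_ (by fun_prop) (by fun_prop)
  exact ContinuousOn.div (by fun_prop) (by fun_prop) fun y hy => hy.1.ne'

theorem continuousOn_densityCoefDeriv (a γ : ℝ) :
    ContinuousOn (densityCoefDeriv (d := d) a γ) (posStates d) := by
  have := continuousOn_pressureSlope (d := d) a γ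
  have hl := continuousOn_log_temperature (d := d)
  refine ContinuousOn.stateForm ?_ (by fun_prop) (by fun_prop)
  exact ((ContinuousOn.div (by fun_prop) (by fun_prop) fun y hy => hy.1.ne').mul
    (by fun_prop)).neg

end Coefficients

end PotTempNS

namespace PotTempNS

/-! ### Coercivity of the relative energy -/

section Coercivity

variable {d : ℕ}

/-- The part of the relative energy which does not involve the velocities. -/
noncomputable def relInternal (a γ : ℝ) (y z : Phase d) : ℝ :=
  pressurePot a γ (z.1 * z.2.1)
    - z.1 * entropyCoef a γ y * (1 + (Real.log z.2.1 - Real.log y.2.1)) + statePressure a γ y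

/-- The velocity terms complete a square. What remains is the Bregman distance of `P(ρθ)`, as a
function of `ρ` and `ρ ln θ`: `entropyCoef` is the partial derivative in the second variable, and
`entropyCoef · (1 - ln θ)` the one in the first. -/
theorem relEnergy_eq (a γ : ℝ) (y z : Phase d) :
    relEnergy a γ y z = 1 / 2 * z.1 * ‖z.2.2 - y.2.2‖ ^ 2 + relInternal a γ y z := by
  rw [relEnergy, relInternal, energyDensity, densityCoef, norm_sub_sq_real]
  ring

/-- For `s ≥ 0` this is Taylor's formula. On `[-2, 0]` it follows from `(1 + s/2)² ≤ e^s`. On `[-Λ,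
-2]` the right-hand side is at least `-s/2`, which is at least `s²/(2Λ)`. The growth is only linear
at `-∞`, hence the dependence on `Λ`. -/
theorem sq_le_exp_sub {Λ s : ℝ} (hΛ : 0 < Λ) (hs : -Λ ≤ s) :
    min (1 / 4) (1 / (2 * Λ)) * s ^ 2 ≤ Real.exp s - 1 - s := by
  have hmin : 0 < min (1 / 4) (1 / (2 * Λ)) := by positivity
  rcases le_total 0 s with h0 | h0
  · have := Real.quadratic_le_exp_of_nonneg h0
    nlinarith [min_le_left (1 / 4) (1 / (2 * Λ)), sq_nonneg s]
  rcases le_total (-2) s with h2 | h2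
  · have h1 := Real.add_one_le_exp (s / 2)
    have h3 : Real.exp s = Real.exp (s / 2) * Real.exp (s / 2) := by
      rw [← Real.exp_add]; ring_nf
    have h4 : (s / 2 + 1) * (s / 2 + 1) ≤ Real.exp s := by
      rw [h3]
      exact mul_self_le_mul_self (by linarith) h1
    nlinarith [min_le_left (1 / 4) (1 / (2 * Λ)), sq_nonneg s]
  · have h1 := Real.exp_pos s
    have h3 : min (1 / 4) (1 / (2 * Λ)) * s ^ 2 ≤ 1 / (2 * Λ) * s ^ 2 :=
      mul_le_mul_of_nonneg_right (min_le_right _ _) (sq_nonneg s)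
    have h4 : 1 / (2 * Λ) * s ^ 2 ≤ -s / 2 := by
      rw [div_mul_eq_mul_div, one_mul, div_le_div_iff₀ (by positivity) two_pos]
      nlinarith
    linarith

/-- Write `ln x = 2 ln √x` and use `ln √x ≥ 1 - 1/√x`. -/
theorem sq_sqrt_sub_one_le {x : ℝ} (hx : 0 < x) :
    (√x - 1) ^ 2 ≤ x * Real.log x - x + 1 := by
  have hs := Real.sqrt_pos.2 hx
  have h1 := Real.one_sub_inv_le_log_of_pos hs
  have h2 : Real.log x = 2 * Real.log √x := by rw [Real.log_sqrt hx.le]; ring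
  have h3 := Real.sq_sqrt hx.le
  rw [h2]
  have h4 : √x - 1 ≤ √x * Real.log √x := by
    have := mul_le_mul_of_nonneg_left h1 hs.le
    rwa [mul_sub, mul_one, mul_inv_cancel₀ hs.ne'] at this
  nlinarith

/-- In the ratios of densities and of temperatures the reference state enters only through the
factor `P`. Coercivity is thereby reduced to scalar inequalities. -/
theorem relInternal_eq {a γ : ℝ} (hγ : 1 < γ) {y z : Phase d} (hy : y ∈ posStates d)
    (h1 : 0 ≤ z.1) (h2 : 0 < z.2.1) :
    relInternal a γ y z = pressurePot a γ (y.1 * y.2.1) *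
      ((z.1 / y.1 * (z.2.1 / y.2.1)) ^ γ + (γ - 1)
        - γ * (z.1 / y.1) * (1 + (Real.log z.2.1 - Real.log y.2.1))) := by
  have hr := hy.1
  have hθ := hy.2
  have hZ : 0 < y.1 * y.2.1 := mul_pos hr hθ
  have e3 : γ - 1 ≠ 0 := by linarith
  have e : z.1 * z.2.1 = (y.1 * y.2.1) * (z.1 / y.1 * (z.2.1 / y.2.1)) := by
    field_simp
  rw [relInternal, e, pressurePot, pressurePot, statePressure, pressure, entropyCoef,
    pressureSlope, Real.mul_rpow hZ.le (by positivity), Real.rpow_sub_one hZ.ne']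
  field_simp
  ring

/-- With `x = ρ/r` and `l = ln θ - ln Θ`, Bernoulli's inequality for the power `γ` of `x e^l` leaves
exactly `γ x (e^l - 1 - l)`. -/
theorem le_relInternal_of_log {a γ : ℝ} (ha : 0 < a) (hγ : 1 < γ) {y z : Phase d}
    (hy : y ∈ posStates d) (h1 : 0 ≤ z.1) (h2 : 0 < z.2.1) :
    pressurePot a γ (y.1 * y.2.1) * (γ * (z.1 / y.1) *
      (Real.exp (Real.log z.2.1 - Real.log y.2.1) - 1 - (Real.log z.2.1 - Real.log y.2.1)))
      ≤ relInternal a γ y z := by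
  have hr := hy.1
  have hθ := hy.2
  rw [relInternal_eq hγ hy h1 h2, Real.exp_sub, Real.exp_log h2, Real.exp_log hθ]
  have hP : 0 ≤ pressurePot a γ (y.1 * y.2.1) := by
    have : 0 < γ - 1 := by linarith
    unfold pressurePot; positivity
  refine mul_le_mul_of_nonneg_left ?_ hP
  have hx : 0 ≤ z.1 / y.1 * (z.2.1 / y.2.1) := by positivity
  have := one_add_mul_self_le_rpow_one_add
    (s := z.1 / y.1 * (z.2.1 / y.2.1) - 1) (by linarith) hγ.le
  rw [add_sub_cancel] at this
  nlinarith

/-- With `x = ρ/r` and `l = ln θ - ln Θ`, the power is `x exp ((γ - 1) ln x + γ l)`. The bound `e^s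
≥ 1 + s` makes the terms in `l` cancel and leaves `(γ - 1)(x ln x - x + 1)`. The vacuum `x = 0` is
separate. -/
theorem le_relInternal_of_sqrt {a γ : ℝ} (ha : 0 < a) (hγ : 1 < γ) {y z : Phase d}
    (hy : y ∈ posStates d) (h1 : 0 ≤ z.1) (h2 : 0 < z.2.1) :
    statePressure a γ y * (√(z.1 / y.1) - 1) ^ 2 ≤ relInternal a γ y z := by
  have hr := hy.1
  have hθ := hy.2
  have hγ' : 0 < γ - 1 := by linarith
  have hP : 0 ≤ pressurePot a γ (y.1 * y.2.1) := by
    unfold pressurePot; positivity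
  have e : statePressure a γ y = pressurePot a γ (y.1 * y.2.1) * (γ - 1) := by
    rw [statePressure, pressure, pressurePot]; field_simp
  rw [relInternal_eq hγ hy h1 h2, e, mul_assoc]
  refine mul_le_mul_of_nonneg_left ?_ hP
  rcases h1.eq_or_lt with h0 | h0
  · rw [← h0]
    simp [Real.zero_rpow (by linarith : γ ≠ 0)]
  have hx : 0 < z.1 / y.1 := by positivity
  have hs := sq_sqrt_sub_one_le hx
  set x := z.1 / y.1
  set l := Real.log z.2.1 - Real.log y.2.1 with hl
  have hv : (x * (z.2.1 / y.2.1)) ^ γ = x * Real.exp ((γ - 1) * Real.log x + γ * l) := by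
    rw [Real.rpow_def_of_pos (by positivity), Real.log_mul hx.ne' (by positivity),
      Real.log_div h2.ne' hθ.ne']
    nth_rewrite 2 [← Real.exp_log hx]
    rw [← Real.exp_add, hl]
    ring_nf
  have h3 := Real.add_one_le_exp ((γ - 1) * Real.log x + γ * l)
  rw [hv]
  have h4 := mul_le_mul_of_nonneg_left h3 hx.le
  nlinarith

/-- The states with density and temperature in `[m, M]` and velocity bounded by `M`. -/
def stateBox (d : ℕ) (m M : ℝ) : Set (Phase d) :=
  {y | y.1 ∈ Icc m M ∧ y.2.1 ∈ Icc m M ∧ ‖y.2.2‖ ≤ M}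

/-- The states with non-negative density and temperature at least `c`. -/
def admStates (d : ℕ) (c : ℝ) : Set (Phase d) := {z | 0 ≤ z.1 ∧ c ≤ z.2.1}

theorem stateBox_subset_posStates {m M : ℝ} (hm : 0 < m) : stateBox d m M ⊆ posStates d :=
  fun _ hy => ⟨hm.trans_le hy.1.1, hm.trans_le hy.2.1.1⟩

theorem relInternal_nonneg {a γ : ℝ} (ha : 0 < a) (hγ : 1 < γ) {y z : Phase d}
    (hy : y ∈ posStates d) (h1 : 0 ≤ z.1) (h2 : 0 < z.2.1) : 0 ≤ relInternal a γ y z := by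
  refine le_trans ?_ (le_relInternal_of_sqrt ha hγ hy h1 h2)
  have hr := hy.1
  have hθ := hy.2
  unfold statePressure pressure
  positivity

/-- The two deviations that the argument needs, uniformly over the reference states in a box. The
temperature is controlled only with the weight `ρ`, as nothing is known about it in the vacuum. -/
theorem exists_relInternal_coercive {a γ m M c : ℝ} (ha : 0 < a) (hγ : 1 < γ) (hm : 0 < m)
    (hc : 0 < c) : ∃ C : ℝ, 0 < C ∧ ∀ y ∈ stateBox d m M, ∀ z ∈ admStates d c,
      (√(z.1 / y.1) - 1) ^ 2 ≤ C * relInternal a γ y z ∧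
      z.1 * (Real.log z.2.1 - Real.log y.2.1) ^ 2 ≤ C * relInternal a γ y z := by
  have hγ' : 0 < γ - 1 := by linarith
  -- Since `θ ≥ c` and `Θ ≤ M`, the difference of the logarithms is at least `-Λ`. The maximum with
  -- 1 makes `Λ` positive.
  set Λ := max 1 (Real.log M - Real.log c) with hΛ
  have hΛ0 : 0 < Λ := lt_of_lt_of_le one_pos (le_max_left _ _)
  set k := min (1 / 4) (1 / (2 * Λ)) with hk
  have hk0 : 0 < k := by positivity
  set p₀ := a * (m * m) ^ γ with hp₀
  have hp : 0 < p₀ := by positivity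
  -- For `M < m` the box is empty; otherwise `M` is positive.
  rcases lt_or_ge M m with hMm | hMm
  · exact ⟨1, one_pos, fun y hy => absurd (hy.1.1.trans hy.1.2) (not_le.2 hMm)⟩
  have hM : 0 < M := hm.trans_le hMm
  set C₂ := M * (γ - 1) / (p₀ * γ * k) with hC₂
  have hC₂0 : 0 < C₂ := by positivity
  refine ⟨p₀⁻¹ + C₂, by positivity, fun y hy z hz => ?_⟩
  have hy' := stateBox_subset_posStates hm hy
  have hr := hy'.1
  have hθ := hy'.2
  have hz2 : 0 < z.2.1 := hc.trans_le hz.2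
  have hI := relInternal_nonneg ha hγ hy' hz.1 hz2
  have hpy : p₀ ≤ statePressure a γ y := by
    rw [hp₀, statePressure, pressure]
    gcongr
    · exact hy.1.1
    · exact hy.2.1.1
  constructor
  · have := le_relInternal_of_sqrt ha hγ hy' hz.1 hz2
    calc (√(z.1 / y.1) - 1) ^ 2 = p₀⁻¹ * (p₀ * (√(z.1 / y.1) - 1) ^ 2) := by field_simp
      _ ≤ p₀⁻¹ * relInternal a γ y z := by
        refine mul_le_mul_of_nonneg_left (le_trans ?_ this) (by positivity)
        gcongr
      _ ≤ _ := by gcongr; linarith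
  · have := le_relInternal_of_log ha hγ hy' hz.1 hz2
    set l := Real.log z.2.1 - Real.log y.2.1 with hl
    have hls : -Λ ≤ l := by
      have e1 := Real.log_le_log hc hz.2
      have e2 := Real.log_le_log hθ hy.2.1.2
      have e3 : Real.log M - Real.log c ≤ Λ := le_max_right _ _
      linarith
    have h3 := sq_le_exp_sub hΛ0 hls
    have hPP : p₀ / (γ - 1) ≤ pressurePot a γ (y.1 * y.2.1) := by
      have e : pressurePot a γ (y.1 * y.2.1) = statePressure a γ y / (γ - 1) := by
        rw [statePressure, pressure, pressurePot]; ring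
      rw [e]
      gcongr
    have hz1 := hz.1
    calc z.1 * l ^ 2 = C₂ * (p₀ / (γ - 1) * (γ * (z.1 / M) * (k * l ^ 2))) := by
          rw [hC₂]; field_simp
      _ ≤ C₂ * (pressurePot a γ (y.1 * y.2.1) *
            (γ * (z.1 / y.1) * (Real.exp l - 1 - l))) := by
          have := hy.1.2
          have h5 : 0 ≤ p₀ / (γ - 1) := by positivity
          have h6 : 0 ≤ k * l ^ 2 := by positivity
          have h7 := h5.trans hPP
          gcongr
      _ ≤ C₂ * relInternal a γ y z := by gcongr
      _ ≤ _ := by gcongr; linarith [inv_pos.2 hp]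

theorem relEnergy_nonneg {a γ : ℝ} (ha : 0 < a) (hγ : 1 < γ) {y z : Phase d}
    (hy : y ∈ posStates d) (h1 : 0 ≤ z.1) (h2 : 0 < z.2.1) : 0 ≤ relEnergy a γ y z := by
  rw [relEnergy_eq]
  have := relInternal_nonneg ha hγ hy h1 h2
  positivity

theorem eq_of_relEnergy_eq_zero {a γ : ℝ} (ha : 0 < a) (hγ : 1 < γ) {y z : Phase d}
    (hy : y ∈ posStates d) (h1 : 0 ≤ z.1) (h2 : 0 < z.2.1) (h : relEnergy a γ y z = 0) :
    z = y := by
  have hr := hy.1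
  have hθ := hy.2
  rw [relEnergy_eq] at h
  have hI := relInternal_nonneg ha hγ hy h1 h2
  have hk : 0 ≤ 1 / 2 * z.1 * ‖z.2.2 - y.2.2‖ ^ 2 := by positivity
  have hI0 : relInternal a γ y z = 0 := by linarith
  have hk0 : 1 / 2 * z.1 * ‖z.2.2 - y.2.2‖ ^ 2 = 0 := by linarith
  -- Only one pair of states is involved, so the box is fitted to `y` and the temperature bound to
  -- `z`.
  obtain ⟨C, hC, hCo⟩ := exists_relInternal_coercive (d := d) (a := a) (γ := γ)
    (m := min y.1 y.2.1) (M := max (max y.1 y.2.1) ‖y.2.2‖) (c := z.2.1) ha hγ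
    (lt_min hr hθ) h2
  obtain ⟨c1, c2⟩ := hCo y ⟨⟨min_le_left _ _, le_max_of_le_left (le_max_left _ _)⟩,
    ⟨min_le_right _ _, le_max_of_le_left (le_max_right _ _)⟩, le_max_right _ _⟩ z ⟨h1, le_rfl⟩
  rw [hI0, mul_zero] at c1 c2
  have e1 : √(z.1 / y.1) = 1 := by
    have := pow_eq_zero_iff (two_ne_zero) |>.1 (le_antisymm c1 (sq_nonneg _))
    linarith
  have e2 : z.1 = y.1 := by
    rw [Real.sqrt_eq_one, div_eq_one_iff_eq hr.ne'] at e1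
    exact e1
  have e3 : z.2.1 = y.2.1 := by
    have h3 : z.1 * (Real.log z.2.1 - Real.log y.2.1) ^ 2 = 0 :=
      le_antisymm c2 (by positivity)
    rw [e2] at h3
    have h4 := pow_eq_zero_iff (two_ne_zero) |>.1 ((mul_eq_zero.1 h3).resolve_left hr.ne')
    exact Real.log_injOn_pos h2 hθ (sub_eq_zero.1 h4)
  have e4 : z.2.2 = y.2.2 := by
    rw [e2] at hk0
    have h4 : ‖z.2.2 - y.2.2‖ ^ 2 = 0 := (mul_eq_zero.1 hk0).resolve_left (by positivity)
    exact sub_eq_zero.1 (norm_eq_zero.1 (pow_eq_zero_iff (two_ne_zero) |>.1 h4))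
  exact Prod.ext e2 (Prod.ext e3 e4)

theorem relEnergy_self {a γ : ℝ} (hγ : 1 < γ) {y : Phase d} (hy : y ∈ posStates d) :
    relEnergy a γ y y = 0 := by
  rw [relEnergy_eq, relInternal_eq hγ hy hy.1.le hy.2]
  simp [hy.1.ne', hy.2.ne']

end Coercivity

end PotTempNS

namespace PotTempNS

/-! ### The integrand of the relative energy inequality -/

section Integrand

variable {d : ℕ}

/-- The divergence of the velocity, computed from the space-time derivative of a state. -/
noncomputable def velDiv (L : (ℝ × Space d) →L[ℝ] Phase d) : ℝ :=
  ∑ j, (L (0, EuclideanSpace.single j 1)).2.2 j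

/-- The integrand of the relative energy inequality, for a state `y` with space-time derivative
`L`. -/
noncomputable def relIntegrand (a γ : ℝ) (y : Phase d) (L : (ℝ × Space d) →L[ℝ] Phase d)
    (z : Phase d) : ℝ :=
  -(z.1 * inner ℝ z.2.2 (L (1, z.2.2)).2.2) - pressure a γ (z.1 * z.2.1) * velDiv L
    + z.1 * densityCoefDeriv a γ y (L (1, z.2.2))
    - z.1 * Real.log z.2.1 * entropyCoefDeriv a γ y (L (1, z.2.2))
    + statePressureDeriv a γ y (L (1, 0))

theorem statePressure_eq_slope {a γ : ℝ} (hγ : 1 < γ) {y : Phase d} (hy : y ∈ posStates d) :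
    statePressure a γ y = pressureSlope a γ y * (y.1 * y.2.1) / γ := by
  have hZ : 0 < y.1 * y.2.1 := mul_pos hy.1 hy.2
  have e : (γ : ℝ) ≠ 0 := by linarith
  rw [statePressure, pressureSlope, pressure, Real.rpow_sub_one hZ.ne']
  have := hZ.ne'
  generalize y.1 * y.2.1 = Z at *
  field_simp

/-- The hypotheses are the equations of motion at one point in non-conservative form, `f` standing
for the viscous force. They remove the material derivative of the reference state. There remain
terms quadratic in the deviation, the work of `f`, and the divergence of pressure times velocity.
The work is split in two because `-⟨f, u - U⟩` will be integrated by parts, while the part with the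
factor `1 - ρ/r` is estimated. -/
theorem relIntegrand_eq {a γ : ℝ} (hγ : 1 < γ) {y : Phase d} (hy : y ∈ posStates d)
    {L : (ℝ × Space d) →L[ℝ] Phase d} {f : Space d}
    (hρ : (L (1, y.2.2)).1 = -(y.1 * velDiv L)) (hθ : (L (1, y.2.2)).2.1 = 0)
    (hu : ∀ v, y.1 * inner ℝ (L (1, y.2.2)).2.2 v + statePressureDeriv a γ y (L (0, v))
      = inner ℝ f v) (z : Phase d) :
    relIntegrand a γ y L z =
      -(z.1 * inner ℝ (z.2.2 - y.2.2) (L (0, z.2.2 - y.2.2)).2.2)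
      - (γ - 1) * velDiv L * relInternal a γ y z
      - z.1 * (Real.log z.2.1 - Real.log y.2.1) * entropyCoefDeriv a γ y (L (0, z.2.2 - y.2.2))
      + (1 - z.1 / y.1) * inner ℝ f (z.2.2 - y.2.2) - inner ℝ f (z.2.2 - y.2.2)
      - (statePressure a γ y * velDiv L + statePressureDeriv a γ y (L (0, y.2.2))) := by
  obtain ⟨ρ, ϑ, v⟩ := z
  obtain ⟨r, Θ, U⟩ := y
  simp only at hρ hθ hu ⊢
  have hr : r ≠ 0 := hy.1.ne'
  have hΘ : Θ ≠ 0 := hy.2.ne'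
  have e3 : γ - 1 ≠ 0 := by linarith
  have e4 : γ ≠ 0 := by linarith
  -- The derivative along the fluctuating velocity is the material derivative of the reference state
  -- plus a spatial derivative in the direction of the deviation.
  have e1 : L (1, v) = L (1, U) + L (0, v - U) := by
    rw [← map_add]; simp
  have e2 : L (1, 0) = L (1, U) - L (0, U) := by
    rw [← map_sub]; simp
  have hw := hu (v - U)
  set w := v - U with hwd
  have hv : v = w + U := by simp [hwd]
  simp only [relIntegrand, e1, e2, map_sub, map_add]
  have hpp := statePressure_eq_slope (a := a) hγ hy
  simp only at hpp
  rw [relInternal]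
  simp only [statePressureDeriv, entropyCoefDeriv, densityCoefDeriv, stateForm_apply,
    Prod.snd_add, hρ, hθ, inner_zero_left, entropyCoef, hpp,
    inner_add_right] at hw ⊢
  set κ := pressureSlope a γ (r, Θ, U)
  have hP : pressurePot a γ (ρ * ϑ) = pressure a γ (ρ * ϑ) / (γ - 1) := by
    rw [pressure, pressurePot]; ring
  rw [hP]
  have hi : inner ℝ v (L (1, U)).2.2 = inner ℝ (L (1, U)).2.2 w + inner ℝ U (L (1, U)).2.2 := by
    rw [hv, inner_add_left, real_inner_comm w]
  have hj : inner ℝ v (L (0, w)).2.2 = inner ℝ w (L (0, w)).2.2 + inner ℝ U (L (0, w)).2.2 := by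
    rw [hv, inner_add_left]
  rw [hi, hj, ← hw]
  field_simp
  ring

theorem abs_velDiv_le (L : (ℝ × Space d) →L[ℝ] Phase d) : |velDiv L| ≤ d * ‖L‖ := by
  refine (Finset.abs_sum_le_sum_abs _ _).trans ?_
  have : ∀ j ∈ (Finset.univ : Finset (Fin d)),
      |(L (0, EuclideanSpace.single j 1)).2.2 j| ≤ ‖L‖ := by
    intro j _
    have h1 : |(L (0, EuclideanSpace.single j 1)).2.2 j|
        ≤ ‖(L (0, EuclideanSpace.single j 1)).2.2‖ := by
      simpa using PiLp.norm_apply_le (L (0, EuclideanSpace.single j 1)).2.2 j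
    have h2 := (norm_snd_le (L (0, EuclideanSpace.single j 1)).2)
    have h3 := (norm_snd_le (L (0, EuclideanSpace.single j 1)))
    have h4 := L.le_opNorm (0, EuclideanSpace.single j 1)
    have h5 : ‖((0, EuclideanSpace.single j 1) : ℝ × Space d)‖ = 1 := by
      simp [Prod.norm_def]
    rw [h5, mul_one] at h4
    linarith
  simpa using Finset.sum_le_sum this

theorem norm_velocity_apply_le (L : (ℝ × Space d) →L[ℝ] Phase d) (v : ℝ × Space d) :
    ‖(L v).2.2‖ ≤ ‖L‖ * ‖v‖ :=
  ((norm_snd_le _).trans (norm_snd_le _)).trans (L.le_opNorm v)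

theorem norm_zero_prod (v : Space d) : ‖((0, v) : ℝ × Space d)‖ = ‖v‖ := by
  simp [Prod.norm_def]

theorem norm_one_prod_le (v : Space d) : ‖((1, v) : ℝ × Space d)‖ ≤ 1 + ‖v‖ := by
  simp only [Prod.norm_def, norm_one]
  exact max_le (by linarith [norm_nonneg v]) (by linarith)

theorem isCompact_stateBox (m M : ℝ) : IsCompact (stateBox d m M) := by
  have : stateBox d m M = Icc m M ×ˢ (Icc m M ×ˢ Metric.closedBall 0 M) := by
    ext y; simp [stateBox, mem_prod]
  rw [this]
  exact isCompact_Icc.prod (isCompact_Icc.prod (isCompact_closedBall _ _))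

theorem exists_coef_bound (a γ : ℝ) {m : ℝ} (hm : 0 < m) (M : ℝ) : ∃ B : ℝ, 0 ≤ B ∧
    ∀ y ∈ stateBox d m M, ‖statePressureDeriv a γ y‖ ≤ B ∧ ‖entropyCoefDeriv a γ y‖ ≤ B ∧
      ‖densityCoefDeriv a γ y‖ ≤ B := by
  have hs := stateBox_subset_posStates (d := d) (M := M) hm
  obtain ⟨B1, h1⟩ := (isCompact_stateBox (d := d) m M).exists_bound_of_continuousOn
    ((continuousOn_statePressureDeriv a γ).mono hs)
  obtain ⟨B2, h2⟩ := (isCompact_stateBox (d := d) m M).exists_bound_of_continuousOn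
    ((continuousOn_entropyCoefDeriv a γ).mono hs)
  obtain ⟨B3, h3⟩ := (isCompact_stateBox (d := d) m M).exists_bound_of_continuousOn
    ((continuousOn_densityCoefDeriv a γ).mono hs)
  refine ⟨|B1| + |B2| + |B3|, by positivity, fun y hy => ⟨?_, ?_, ?_⟩⟩
  · linarith [h1 y hy, le_abs_self B1, abs_nonneg B2, abs_nonneg B3]
  · linarith [h2 y hy, le_abs_self B2, abs_nonneg B1, abs_nonneg B3]
  · linarith [h3 y hy, le_abs_self B3, abs_nonneg B2, abs_nonneg B1]

/-- The states with density less than `m / 4`. -/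
def lowDensity (d : ℕ) (m : ℝ) : Set (Phase d) := {z | z.1 < m / 4}

/-- The threshold `m/4` in `lowDensity` makes `√(ρ/r) ≤ 1/2`, so that `(√(ρ/r) - 1)² ≥ 1/4`. Thus
the mass of the states of low density is bounded by the relative energy. -/
theorem exists_one_le_relEnergy {a γ m M c : ℝ} (ha : 0 < a) (hγ : 1 < γ) (hm : 0 < m)
    (hc : 0 < c) : ∃ C : ℝ, 0 < C ∧ ∀ y ∈ stateBox d m M, ∀ z ∈ admStates d c,
      z ∈ lowDensity d m → 1 ≤ C * relEnergy a γ y z := by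
  obtain ⟨C, hC, h⟩ := exists_relInternal_coercive (d := d) (M := M) ha hγ hm hc
  refine ⟨4 * C, by positivity, fun y hy z hz hl => ?_⟩
  have h1 := (h y hy z hz).1
  have hy' := stateBox_subset_posStates hm hy
  have hr := hy'.1
  have hz1 := hz.1
  have h2 : z.1 / y.1 ≤ (1 / 2) ^ 2 := by
    rw [div_le_iff₀ hr]
    have : z.1 < m / 4 := hl
    have := hy.1.1
    nlinarith
  have h3 : √(z.1 / y.1) ≤ 1 / 2 := Real.sqrt_le_iff.2 ⟨by norm_num, h2⟩
  have h4 : 1 / 4 ≤ (√(z.1 / y.1) - 1) ^ 2 := by nlinarith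
  rw [relEnergy_eq]
  have h5 : 0 ≤ C * (1 / 2 * z.1 * ‖z.2.2 - y.2.2‖ ^ 2) := by positivity
  nlinarith

/-- `(1 - ρ/r)² ≤ C ρ E` away from the vacuum. -/
theorem exists_sq_one_sub_le {a γ m M c : ℝ} (ha : 0 < a) (hγ : 1 < γ) (hm : 0 < m)
    (hc : 0 < c) : ∃ C : ℝ, 0 < C ∧ ∀ y ∈ stateBox d m M, ∀ z ∈ admStates d c,
      z ∉ lowDensity d m → (1 - z.1 / y.1) ^ 2 ≤ C * (z.1 * relInternal a γ y z) := by
  obtain ⟨C, hC, h⟩ := exists_relInternal_coercive (d := d) (M := M) ha hγ hm hc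
  refine ⟨C * (8 / m + 2 / m), by positivity, fun y hy z hz hl => ?_⟩
  have h1 := (h y hy z hz).1
  have hy' := stateBox_subset_posStates hm hy
  have hr := hy'.1
  have hz1 := hz.1
  have hI := relInternal_nonneg ha hγ hy' hz.1 (hc.trans_le hz.2)
  have hl' : m / 4 ≤ z.1 := not_lt.1 hl
  have hx : 0 ≤ z.1 / y.1 := by positivity
  have hs := Real.sq_sqrt hx
  have hs0 := Real.sqrt_nonneg (z.1 / y.1)
  -- The factorisation `1 - x = (1 - √x)(1 + √x)`: the first factor is controlled by coercivity, and
  -- the square of the second by a multiple of `ρ` because `ρ ≥ m/4`.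
  have h2 : (1 - z.1 / y.1) ^ 2 = (√(z.1 / y.1) - 1) ^ 2 * (1 + √(z.1 / y.1)) ^ 2 := by
    rw [← hs]
    simp only [Real.sqrt_sq hs0]
    ring
  have h3 : (1 + √(z.1 / y.1)) ^ 2 ≤ (8 / m + 2 / m) * z.1 := by
    have h4 : (1 + √(z.1 / y.1)) ^ 2 ≤ 2 + 2 * (z.1 / y.1) := by
      nlinarith [sq_nonneg (1 - √(z.1 / y.1))]
    have h5 : z.1 / y.1 ≤ z.1 / m := by gcongr; exact hy.1.1
    have h6 : 2 ≤ 8 / m * z.1 := by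
      rw [div_mul_eq_mul_div, le_div_iff₀ hm]; linarith
    have h7 : z.1 / m = 1 / m * z.1 := by ring
    have h8 : (8 / m + 2 / m) * z.1 = 8 / m * z.1 + 2 * (1 / m * z.1) := by ring
    linarith
  rw [h2]
  calc (√(z.1 / y.1) - 1) ^ 2 * (1 + √(z.1 / y.1)) ^ 2
      ≤ (C * relInternal a γ y z) * ((8 / m + 2 / m) * z.1) := by gcongr
    _ = _ := by ring

/-- The pointwise estimate behind the whole argument. Its second term is the contribution of the
near-vacuum, where the energy gives no information on the velocity. The last two terms are kept
exact, to be treated after integration over `Ω`. -/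
theorem exists_relIntegrand_le {a γ m M c K : ℝ} (ha : 0 < a) (hγ : 1 < γ) (hm : 0 < m)
    (hc : 0 < c) (hK : 0 ≤ K) : ∃ C : ℝ, 0 ≤ C ∧ ∀ y ∈ stateBox d m M,
      ∀ (L : (ℝ × Space d) →L[ℝ] Phase d) (f : Space d), ‖L‖ ≤ K →
      (L (1, y.2.2)).1 = -(y.1 * velDiv L) → (L (1, y.2.2)).2.1 = 0 →
      (∀ v, y.1 * inner ℝ (L (1, y.2.2)).2.2 v + statePressureDeriv a γ y (L (0, v))
        = inner ℝ f v) →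
      ∀ z ∈ admStates d c, relIntegrand a γ y L z
        ≤ C * (1 + ‖f‖) * relEnergy a γ y z
          + ‖f‖ * (lowDensity d m).indicator (fun z => ‖z.2.2 - y.2.2‖) z
          - inner ℝ f (z.2.2 - y.2.2)
          - (statePressure a γ y * velDiv L + statePressureDeriv a γ y (L (0, y.2.2))) := by
  obtain ⟨C₁, hC₁, h₁⟩ := exists_relInternal_coercive (d := d) (M := M) ha hγ hm hc
  obtain ⟨C₂, hC₂, h₂⟩ := exists_sq_one_sub_le (d := d) (M := M) ha hγ hm hc
  obtain ⟨B, hB, hcoef⟩ := exists_coef_bound (d := d) a γ hm M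
  refine ⟨2 * K + (γ - 1) * (d * K) + B * K * (C₁ + 2) + (C₂ + 2), ?_, ?_⟩
  · have : 0 < γ - 1 := by linarith
    positivity
  intro y hy L f hL hρ hθ hu z hz
  have hy' := stateBox_subset_posStates hm hy
  have hr := hy'.1
  have hz1 := hz.1
  have hI := relInternal_nonneg ha hγ hy' hz.1 (hc.trans_le hz.2)
  rw [relIntegrand_eq hγ hy' hρ hθ hu]
  set w := z.2.2 - y.2.2 with hw
  set E := relEnergy a γ y z with hE
  set I := relInternal a γ y z with hId
  have hEq : E = 1 / 2 * z.1 * ‖w‖ ^ 2 + I := relEnergy_eq a γ y z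
  have hkin : z.1 * ‖w‖ ^ 2 ≤ 2 * E := by linarith
  have hkin0 : 0 ≤ z.1 * ‖w‖ ^ 2 := by positivity
  have hIE : I ≤ E := by linarith
  have hE0 : 0 ≤ E := hI.trans hIE
  have t1 : -(z.1 * inner ℝ w (L (0, w)).2.2) ≤ 2 * K * E := by
    have h := abs_real_inner_le_norm w (L (0, w)).2.2
    have h' := norm_velocity_apply_le L (0, w)
    rw [norm_zero_prod] at h'
    have h3 : |inner ℝ w (L (0, w)).2.2| ≤ K * ‖w‖ ^ 2 := by
      calc _ ≤ ‖w‖ * (K * ‖w‖) := h.trans (by gcongr; exact h'.trans (by gcongr))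
        _ = _ := by ring
    have h4 := neg_le_of_abs_le h3
    nlinarith
  have t2 : -((γ - 1) * velDiv L * I) ≤ (γ - 1) * (d * K) * E := by
    have h := (abs_velDiv_le L).trans (mul_le_mul_of_nonneg_left hL (Nat.cast_nonneg d))
    have h4 := neg_le_of_abs_le h
    have hg : 0 < γ - 1 := by linarith
    calc -((γ - 1) * velDiv L * I) = (γ - 1) * (-velDiv L) * I := by ring
      _ ≤ (γ - 1) * (d * K) * E := by gcongr; linarith
  have t3 : -(z.1 * (Real.log z.2.1 - Real.log y.2.1) * entropyCoefDeriv a γ y (L (0, w)))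
      ≤ B * K * (C₁ + 2) * E := by
    set l := Real.log z.2.1 - Real.log y.2.1 with hl
    have h1 : |entropyCoefDeriv a γ y (L (0, w))| ≤ B * K * ‖w‖ := by
      have h3 := (entropyCoefDeriv a γ y).le_opNorm (L (0, w))
      have h4 := L.le_opNorm (0, w)
      rw [norm_zero_prod] at h4
      calc _ ≤ B * (K * ‖w‖) := by
            refine h3.trans ?_
            gcongr
            · exact (hcoef y hy).2.1
            · exact h4.trans (by gcongr)
        _ = _ := by ring
    have h2 := (h₁ y hy z hz).2
    calc -(z.1 * l * entropyCoefDeriv a γ y (L (0, w)))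
        ≤ |z.1 * l * entropyCoefDeriv a γ y (L (0, w))| := neg_le_abs _
      _ = z.1 * |l| * |entropyCoefDeriv a γ y (L (0, w))| := by
          rw [abs_mul, abs_mul, abs_of_nonneg hz1]
      _ ≤ z.1 * |l| * (B * K * ‖w‖) := by gcongr
      _ = B * K * (z.1 * (|l| * ‖w‖)) := by ring
      _ ≤ B * K * (z.1 * (l ^ 2 + ‖w‖ ^ 2)) := by
          gcongr
          nlinarith [sq_abs l, sq_nonneg (|l| - ‖w‖), sq_nonneg l, sq_nonneg ‖w‖]
      _ ≤ B * K * ((C₁ + 2) * E) := by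
          refine mul_le_mul_of_nonneg_left ?_ (by positivity)
          have : C₁ * I ≤ C₁ * E := by gcongr
          rw [mul_add]
          linarith
      _ = _ := by ring
  have t4 : (1 - z.1 / y.1) * inner ℝ f w ≤ (C₂ + 2) * ‖f‖ * E
      + ‖f‖ * (lowDensity d m).indicator (fun z => ‖z.2.2 - y.2.2‖) z := by
    have h1 : (1 - z.1 / y.1) * inner ℝ f w ≤ |1 - z.1 / y.1| * (‖f‖ * ‖w‖) := by
      refine (le_abs_self _).trans ?_
      rw [abs_mul]
      gcongr
      exact abs_real_inner_le_norm f w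
    refine h1.trans ?_
    by_cases hl : z ∈ lowDensity d m
    · rw [indicator_of_mem hl]
      have h2 : |1 - z.1 / y.1| ≤ 1 := by
        have h3 : 0 ≤ z.1 / y.1 := by positivity
        have h4 : z.1 / y.1 ≤ 1 := by
          rw [div_le_one hr]
          have h5 : z.1 < m / 4 := hl
          linarith [hy.1.1]
        rw [abs_le]; constructor <;> linarith
      have h3 : |1 - z.1 / y.1| * (‖f‖ * ‖w‖) ≤ 1 * (‖f‖ * ‖w‖) := by gcongr
      have h4 : 0 ≤ (C₂ + 2) * ‖f‖ * E := by positivity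
      linarith
    · rw [indicator_of_notMem hl, mul_zero, add_zero]
      have h2 := h₂ y hy z hz hl
      -- Away from the vacuum, `(1 - ρ/r)² |w|²` is at most a multiple of `I · ρ|w|²`. Each of these
      -- two factors is bounded by the relative energy, whence the product of the unsquared
      -- quantities is of the order of `E`.
      have h3 : |1 - z.1 / y.1| * ‖w‖ ≤ (C₂ + 2) * E := by
        have h4 : (|1 - z.1 / y.1| * ‖w‖) ^ 2 ≤ ((C₂ + 2) * E) ^ 2 := by
          rw [mul_pow, sq_abs]
          calc (1 - z.1 / y.1) ^ 2 * ‖w‖ ^ 2 ≤ C₂ * (z.1 * I) * ‖w‖ ^ 2 := by gcongr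
            _ = C₂ * I * (z.1 * ‖w‖ ^ 2) := by ring
            _ ≤ C₂ * E * (2 * E) := by gcongr
            _ ≤ _ := by nlinarith [sq_nonneg C₂, sq_nonneg E, mul_nonneg hC₂.le (sq_nonneg E),
                mul_nonneg (sq_nonneg C₂) (sq_nonneg E)]
        exact (le_abs_self _).trans (abs_le_of_sq_le_sq h4 (by positivity))
      calc |1 - z.1 / y.1| * (‖f‖ * ‖w‖) = ‖f‖ * (|1 - z.1 / y.1| * ‖w‖) := by ring
        _ ≤ ‖f‖ * ((C₂ + 2) * E) := by gcongr
        _ = _ := by ring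
  have t5 : 0 ≤ ‖f‖ * ((2 * K + (γ - 1) * (d * K) + B * K * (C₁ + 2)) * E) := by
    have : 0 < γ - 1 := by linarith
    positivity
  have t6 : 0 ≤ (C₂ + 2) * E := by positivity
  nlinarith

end Integrand

end PotTempNS

namespace PotTempNS

/-! ### Functions of class `C¹` on the closed cylinder -/

/-- A time change which is the identity up to `T₁` and takes its values below `S`. -/
theorem exists_timeCutoff {T₁ S : ℝ} (h0 : 0 ≤ T₁) (h1 : T₁ < S) : ∃ χ χ' : ℝ → ℝ,
    (∀ t, HasDerivAt χ (χ' t) t) ∧ Continuous χ' ∧ (∀ t, |χ' t| ≤ 1) ∧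
    (∀ t ≤ T₁, χ t = t) ∧ (∀ t ≤ T₁, χ' t = 1) ∧ (∀ t, χ t < S) ∧ (∀ t, 0 < t → 0 < χ t) := by
  set κ := S - T₁ with hκ
  have hκ0 : 0 < κ := sub_pos.2 h1
  -- A continuous speed equal to 1 up to `T₁`. Its integral over `(T₁, ∞)` is exactly `κ = S - T₁`,
  -- so its primitive never reaches `S`.
  set w : ℝ → ℝ := fun s => κ ^ 2 / (κ + max 0 (s - T₁)) ^ 2 with hw
  have hpos : ∀ s, 0 < κ + max 0 (s - T₁) := fun s =>
    add_pos_of_pos_of_nonneg hκ0 (le_max_left _ _)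
  have hwc : Continuous w := by
    refine Continuous.div (by fun_prop) (by fun_prop) fun s => (pow_pos (hpos s) 2).ne'
  have hw0 : ∀ s, 0 < w s := fun s => div_pos (by positivity) (pow_pos (hpos s) 2)
  have hw1 : ∀ s ≤ T₁, w s = 1 := by
    intro s hs
    simp only [hw, max_eq_left (sub_nonpos.2 hs), add_zero]
    exact div_self (by positivity)
  have hid : ∀ t ≤ T₁, ∫ s in (0 : ℝ)..t, w s = t := by
    intro t ht
    rw [intervalIntegral.integral_congr (g := fun _ => (1 : ℝ))]
    · simp
    · intro s hs
      refine hw1 s ?_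
      rcases le_total 0 t with h | h
      · rw [uIcc_of_le h] at hs; exact hs.2.trans ht
      · rw [uIcc_of_ge h] at hs; exact hs.2.trans h0
  refine ⟨fun t => ∫ s in (0 : ℝ)..t, w s, w, fun t => ?_, hwc, fun t => ?_, hid, hw1,
    fun t => ?_, fun t ht => ?_⟩
  · exact intervalIntegral.integral_hasDerivAt_right (hwc.intervalIntegrable _ _)
      (hwc.stronglyMeasurableAtFilter volume _) hwc.continuousAt
  · rw [abs_of_pos (hw0 t), hw, div_le_one (pow_pos (hpos t) 2)]
    have : 0 ≤ max 0 (t - T₁) := le_max_left _ _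
    gcongr
    linarith
  · rcases le_or_gt t T₁ with h | h
    · simp only [hid t h]; exact h.trans_lt h1
    have hF : ∀ s ∈ uIcc T₁ t, HasDerivAt (fun s => -κ ^ 2 * (κ + (s - T₁))⁻¹) (w s) s := by
      intro s hs
      rw [uIcc_of_le h.le] at hs
      have hs' : 0 < κ + (s - T₁) := by linarith [hs.1]
      have := (((hasDerivAt_id' s).sub_const T₁).const_add κ).fun_inv hs'.ne'
      refine (this.const_mul (-κ ^ 2)).congr_deriv ?_
      simp [hw, max_eq_right (sub_nonneg.2 hs.1), div_eq_mul_inv]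
    show ∫ s in (0 : ℝ)..t, w s < S
    rw [← intervalIntegral.integral_add_adjacent_intervals (hwc.intervalIntegrable 0 T₁)
      (hwc.intervalIntegrable T₁ t), hid T₁ le_rfl,
      intervalIntegral.integral_eq_sub_of_hasDerivAt hF (hwc.intervalIntegrable _ _)]
    have h2 : 0 < κ ^ 2 * (κ + (t - T₁))⁻¹ := by
      have : 0 < κ + (t - T₁) := by linarith
      positivity
    have h3 : κ ^ 2 * (κ + (T₁ - T₁))⁻¹ = κ := by rw [sub_self, add_zero]; field_simp
    rw [neg_mul, neg_mul, h3]
    linarith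
  · exact intervalIntegral.intervalIntegral_pos_of_pos (hwc.intervalIntegrable _ _) hw0 ht

section C1

variable {d : ℕ} {T : ℝ} {Ω : Set (Space d)} {F G : Type*} [NormedAddCommGroup F]
  [NormedSpace ℝ F] [NormedAddCommGroup G] [NormedSpace ℝ G]

theorem cyl_subset_cylClosure : cyl T Ω ⊆ cylClosure T Ω :=
  prod_mono Ioo_subset_Icc_self subset_closure

theorem isOpen_cyl (hΩ : IsOpen Ω) : IsOpen (cyl T Ω) := isOpen_Ioo.prod hΩ

theorem isCompact_cylClosure (hb : Bornology.IsBounded Ω) : IsCompact (cylClosure T Ω) :=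
  isCompact_Icc.prod hb.isCompact_closure

theorem cyl_mono {τ : ℝ} (h : τ ≤ T) : cyl τ Ω ⊆ cyl T Ω :=
  prod_mono (Ioo_subset_Ioo_right h) subset_rfl

theorem IsC1OnClosure.comp {f : ℝ × Space d → F} {f' : ℝ × Space d → (ℝ × Space d) →L[ℝ] F}
    (hf : IsC1OnClosure T Ω f f') {O : Set F} (hO : MapsTo f (cylClosure T Ω) O) {g : F → G}
    {g' : F → F →L[ℝ] G} (hg : ∀ y ∈ O, HasFDerivAt g (g' y) y) (hg' : ContinuousOn g' O) :
    IsC1OnClosure T Ω (fun p => g (f p)) (fun p => (g' (f p)).comp (f' p)) where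
  continuousOn := ContinuousOn.comp (fun y hy => (hg y hy).continuousAt.continuousWithinAt)
    hf.continuousOn hO
  continuousOn_deriv := (hg'.comp hf.continuousOn hO).clm_comp hf.continuousOn_deriv
  hasFDerivAt p hp := (hg _ (hO (cyl_subset_cylClosure hp))).comp p (hf.hasFDerivAt p hp)

theorem IsC1OnClosure.prodMk {f : ℝ × Space d → F} {f' : ℝ × Space d → (ℝ × Space d) →L[ℝ] F}
    {g : ℝ × Space d → G} {g' : ℝ × Space d → (ℝ × Space d) →L[ℝ] G}
    (hf : IsC1OnClosure T Ω f f') (hg : IsC1OnClosure T Ω g g') :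
    IsC1OnClosure T Ω (fun p => (f p, g p)) (fun p => (f' p).prod (g' p)) where
  continuousOn := hf.continuousOn.prodMk hg.continuousOn
  continuousOn_deriv := by
    have := hf.continuousOn_deriv.prodMk hg.continuousOn_deriv
    exact (ContinuousLinearMap.prodₗᵢ (𝕜 := ℝ) (E := ℝ × Space d) (F := F) (G := G) ℝ).continuous.comp_continuousOn this
  hasFDerivAt p hp := (hf.hasFDerivAt p hp).prodMk (hg.hasFDerivAt p hp)

/-- Composition with a change of the time variable. -/
theorem IsC1OnClosure.comp_time {S : ℝ} {f : ℝ × Space d → F}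
    {f' : ℝ × Space d → (ℝ × Space d) →L[ℝ] F} (hf : IsC1OnClosure S Ω f f') {χ χ' : ℝ → ℝ}
    (hχ : ∀ t, HasDerivAt χ (χ' t) t) (hχ' : Continuous χ')
    (h1 : MapsTo χ (Icc 0 T) (Icc 0 S)) (h2 : MapsTo χ (Ioo 0 T) (Ioo 0 S)) :
    IsC1OnClosure T Ω (fun p => f (χ p.1, p.2)) (fun p => (f' (χ p.1, p.2)).comp
      ((χ' p.1 • ContinuousLinearMap.fst ℝ ℝ (Space d)).prod
        (ContinuousLinearMap.snd ℝ ℝ (Space d)))) := by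
  have hχc : Continuous χ := continuous_iff_continuousAt.2 fun t => (hχ t).continuousAt
  have hc : ContinuousOn (fun p : ℝ × Space d => (χ p.1, p.2)) (cylClosure T Ω) := by fun_prop
  have hm : MapsTo (fun p : ℝ × Space d => (χ p.1, p.2)) (cylClosure T Ω) (cylClosure S Ω) :=
    fun p hp => ⟨h1 hp.1, hp.2⟩
  refine ⟨hf.continuousOn.comp hc hm, (hf.continuousOn_deriv.comp hc hm).clm_comp ?_,
    fun p hp => ?_⟩
  · refine Continuous.continuousOn ?_
    have : Continuous fun p : ℝ × Space d => (χ' p.1 • ContinuousLinearMap.fst ℝ ℝ (Space d),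
      ContinuousLinearMap.snd ℝ ℝ (Space d)) := by fun_prop
    exact (ContinuousLinearMap.prodₗᵢ (𝕜 := ℝ) (E := ℝ × Space d) (F := ℝ) (G := Space d)
      ℝ).continuous.comp this
  · have h3 : HasFDerivAt (fun p : ℝ × Space d => (χ p.1, p.2))
        ((χ' p.1 • ContinuousLinearMap.fst ℝ ℝ (Space d)).prod
          (ContinuousLinearMap.snd ℝ ℝ (Space d))) p :=
      ((hχ p.1).comp_hasFDerivAt p hasFDerivAt_fst).prodMk hasFDerivAt_snd
    exact (hf.hasFDerivAt (χ p.1, p.2) ⟨h2 hp.1, hp.2⟩).comp p h3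

theorem IsC1OnClosure.exists_bound (hb : Bornology.IsBounded Ω) {f : ℝ × Space d → F}
    {f' : ℝ × Space d → (ℝ × Space d) →L[ℝ] F} (hf : IsC1OnClosure T Ω f f') :
    ∃ K : ℝ, 0 ≤ K ∧ ∀ p ∈ cylClosure T Ω, ‖f p‖ ≤ K ∧ ‖f' p‖ ≤ K := by
  obtain ⟨K₁, h₁⟩ := (isCompact_cylClosure hb).exists_bound_of_continuousOn hf.continuousOn
  obtain ⟨K₂, h₂⟩ := (isCompact_cylClosure hb).exists_bound_of_continuousOn hf.continuousOn_deriv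
  refine ⟨|K₁| + |K₂|, by positivity, fun p hp => ⟨?_, ?_⟩⟩
  · linarith [h₁ p hp, le_abs_self K₁, abs_nonneg K₂]
  · linarith [h₂ p hp, le_abs_self K₂, abs_nonneg K₁]

theorem IsC1OnClosure.isW1Inf (hΩ : IsOpen Ω) (hb : Bornology.IsBounded Ω) {f : ℝ × Space d → ℝ}
    {f' : ℝ × Space d → (ℝ × Space d) →L[ℝ] ℝ} (hf : IsC1OnClosure T Ω f f') :
    IsW1Inf T Ω f f' where
  continuousOn := hf.continuousOn
  aestronglyMeasurable := (hf.continuousOn_deriv.mono cyl_subset_cylClosure).aestronglyMeasurable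
    (isOpen_cyl hΩ).measurableSet
  bounded := by
    obtain ⟨K, _, hK⟩ := hf.exists_bound hb
    exact ⟨K, (ae_restrict_mem (isOpen_cyl hΩ).measurableSet).mono fun p hp =>
      (hK p (cyl_subset_cylClosure hp)).2⟩
  hasWeakDeriv := by
    have : (volume : Measure (ℝ × Space d)).IsAddHaarMeasure := by
      rw [Measure.volume_eq_prod]; infer_instance
    exact hasWeakDeriv_of_hasFDerivAt (isOpen_cyl hΩ) hf.hasFDerivAt
      (hf.continuousOn_deriv.mono cyl_subset_cylClosure)

theorem IsC1OnClosure.hasFDerivAt_slice {f : ℝ × Space d → F}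
    {f' : ℝ × Space d → (ℝ × Space d) →L[ℝ] F} (hf : IsC1OnClosure T Ω f f') {t : ℝ}
    (ht : t ∈ Ioo 0 T) {x : Space d} (hx : x ∈ Ω) :
    HasFDerivAt (fun x => f (t, x)) (spatial (f' (t, x))) x :=
  (hf.hasFDerivAt (t, x) ⟨ht, hx⟩).comp x (hasFDerivAt_prodMk_right t x)

theorem continuousOn_slice {E : Type*} [NormedAddCommGroup E] {f : ℝ × Space d → E} (hf : ContinuousOn f (cylClosure T Ω)) {t : ℝ}
    (ht : t ∈ Icc 0 T) : ContinuousOn (fun x => f (t, x)) (closure Ω) :=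
  hf.comp (by fun_prop) fun _ hx => ⟨ht, hx⟩

theorem ContinuousOn.spatial {X : Type*} [TopologicalSpace X] {A : Set X}
    {f : X → (ℝ × Space d) →L[ℝ] F} (hf : ContinuousOn f A) :
    ContinuousOn (fun p => spatial (f p)) A := by
  unfold PotTempNS.spatial
  exact hf.clm_comp continuousOn_const

theorem IsC1OnClosure.memW12Zero_slice (hΩ : IsOpen Ω) (hb : Bornology.IsBounded Ω)
    {f : ℝ × Space d → Space d} {f' : ℝ × Space d → (ℝ × Space d) →L[ℝ] Space d}
    (hf : IsC1OnClosure T Ω f f') (h0 : ∀ t ∈ Icc 0 T, ∀ x ∈ frontier Ω, f (t, x) = 0) {t : ℝ}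
    (ht : t ∈ Ioo 0 T) :
    MemW12Zero Ω (fun x => f (t, x)) (fun x => spatial (f' (t, x))) :=
  memW12Zero_of_hasFDerivAt hΩ hb (continuousOn_slice hf.continuousOn (Ioo_subset_Icc_self ht))
    (h0 t (Ioo_subset_Icc_self ht))
    (continuousOn_slice (ContinuousOn.spatial hf.continuousOn_deriv) (Ioo_subset_Icc_self ht))
    fun _ hx => hf.hasFDerivAt_slice ht hx

theorem isFiniteMeasure_restrict_cyl (hb : Bornology.IsBounded Ω) :
    IsFiniteMeasure ((volume : Measure (ℝ × Space d)).restrict (cyl T Ω)) :=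
  ⟨by
    rw [Measure.restrict_apply_univ]
    exact ((Metric.isBounded_Ioo 0 T).prod hb).measure_lt_top⟩

theorem norm_spatial_le (L : (ℝ × Space d) →L[ℝ] F) : ‖spatial L‖ ≤ ‖L‖ := by
  refine ContinuousLinearMap.opNorm_le_bound _ (norm_nonneg _) fun v => ?_
  have := L.le_opNorm (0, v)
  rwa [norm_zero_prod] at this

theorem IsC1OnClosure.memL2W12Zero (hΩ : IsOpen Ω) (hb : Bornology.IsBounded Ω)
    {f : ℝ × Space d → Space d} {f' : ℝ × Space d → (ℝ × Space d) →L[ℝ] Space d}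
    (hf : IsC1OnClosure T Ω f f') (h0 : ∀ t ∈ Icc 0 T, ∀ x ∈ frontier Ω, f (t, x) = 0) :
    MemL2W12Zero T Ω f (fun p => PotTempNS.spatial (f' p)) := by
  have := isFiniteMeasure_restrict_cyl (T := T) hb
  obtain ⟨K, _, hK⟩ := hf.exists_bound hb
  have hm := (isOpen_cyl (T := T) hΩ).measurableSet
  refine ⟨?_, ?_, (ae_restrict_mem measurableSet_Ioo).mono fun t ht => hf.memW12Zero_slice hΩ hb h0 ht⟩
  · exact MemLp.of_bound ((hf.continuousOn.mono cyl_subset_cylClosure).aestronglyMeasurable hm) K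
      ((ae_restrict_mem hm).mono fun p hp => (hK p (cyl_subset_cylClosure hp)).1)
  · exact MemLp.of_bound (((ContinuousOn.spatial hf.continuousOn_deriv).mono
      cyl_subset_cylClosure).aestronglyMeasurable hm) K
      ((ae_restrict_mem hm).mono fun p hp =>
        (norm_spatial_le _).trans (hK p (cyl_subset_cylClosure hp)).2)

theorem restrict_cyl (τ : ℝ) (Ω : Set (Space d)) :
    (volume : Measure (ℝ × Space d)).restrict (cyl τ Ω)
      = (volume.restrict (Ioo 0 τ)).prod (volume.restrict Ω) := by
  rw [cyl, Measure.volume_eq_prod, Measure.prod_restrict]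

theorem ae_ae_of_ae_cyl {P : ℝ × Space d → Prop}
    (h : ∀ᵐ p ∂(volume.restrict (cyl T Ω)), P p) :
    ∀ᵐ t ∂(volume.restrict (Ioo 0 T)), ∀ᵐ x ∂(volume.restrict Ω), P (t, x) := by
  rw [restrict_cyl] at h
  exact Measure.ae_ae_of_ae_prod h

theorem integrable_slice {E : Type*} [NormedAddCommGroup E] {f : ℝ × Space d → E} (hf : IntegrableOn f (cyl T Ω)) :
    ∀ᵐ t ∂(volume.restrict (Ioo 0 T)), IntegrableOn (fun x => f (t, x)) Ω := by
  rw [IntegrableOn, restrict_cyl] at hf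
  exact hf.prod_right_ae

theorem integral_cyl {f : ℝ × Space d → F} (hf : IntegrableOn f (cyl T Ω)) :
    ∫ p in cyl T Ω, f p = ∫ t in Ioo 0 T, ∫ x in Ω, f (t, x) := by
  rw [IntegrableOn, restrict_cyl] at hf
  rw [restrict_cyl, integral_prod _ hf]

theorem integrableOn_integral_slice {f : ℝ × Space d → F} (hf : IntegrableOn f (cyl T Ω)) :
    IntegrableOn (fun t => ∫ x in Ω, f (t, x)) (Ioo 0 T) := by
  rw [IntegrableOn, restrict_cyl] at hf
  exact hf.integral_prod_left

/-- The fundamental theorem of calculus in time, integrated over the domain. -/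
theorem IsC1OnClosure.integral_sub_eq (hΩ : IsOpen Ω) (hb : Bornology.IsBounded Ω)
    {f : ℝ × Space d → ℝ} {f' : ℝ × Space d → (ℝ × Space d) →L[ℝ] ℝ}
    (hf : IsC1OnClosure T Ω f f') {τ : ℝ} (hτ : τ ∈ Ioo 0 T) :
    (∫ x in Ω, f (τ, x)) - ∫ x in Ω, f (0, x) = ∫ p in cyl τ Ω, f' p (1, 0) := by
  have hτ' : τ ∈ Icc 0 T := Ioo_subset_Icc_self hτ
  have h0' : (0 : ℝ) ∈ Icc 0 T := ⟨le_rfl, hτ.1.le.trans hτ.2.le⟩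
  obtain ⟨K, hK0, hK⟩ := hf.exists_bound hb
  have hfin := isFiniteMeasure_restrict_cyl (T := τ) hb
  have hfinΩ : IsFiniteMeasure ((volume : Measure (Space d)).restrict Ω) :=
    ⟨by rw [Measure.restrict_apply_univ]; exact hb.measure_lt_top⟩
  have hsub : cyl τ Ω ⊆ cylClosure T Ω := (cyl_mono hτ.2.le).trans cyl_subset_cylClosure
  have hm := (isOpen_cyl (T := τ) hΩ).measurableSet
  have hcd : ContinuousOn (fun p => f' p (1, 0)) (cylClosure T Ω) :=
    hf.continuousOn_deriv.clm_apply continuousOn_const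
  have hint : IntegrableOn (fun p => f' p (1, 0)) (cyl τ Ω) := by
    refine Integrable.of_bound ((hcd.mono hsub).aestronglyMeasurable hm) K ?_
    filter_upwards [ae_restrict_mem hm] with p hp
    refine ((f' p).le_opNorm _).trans ?_
    have : ‖((1, 0) : ℝ × Space d)‖ = 1 := by simp [Prod.norm_def]
    rw [this, mul_one]
    exact (hK p (hsub hp)).2
  have hslice : ∀ t ∈ Icc 0 T, IntegrableOn (fun x => f (t, x)) Ω := by
    intro t ht
    refine Integrable.of_bound (((continuousOn_slice hf.continuousOn ht).mono
      subset_closure).aestronglyMeasurable hΩ.measurableSet) K ?_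
    filter_upwards [ae_restrict_mem hΩ.measurableSet] with x hx
    exact (hK (t, x) ⟨ht, subset_closure hx⟩).1
  rw [← integral_sub (hslice τ hτ') (hslice 0 h0')]
  rw [IntegrableOn, restrict_cyl] at hint
  rw [restrict_cyl, integral_prod_symm _ hint]
  refine setIntegral_congr_fun hΩ.measurableSet fun x hx => ?_
  have hmap : MapsTo (fun t : ℝ => (t, x)) (Icc 0 τ) (cylClosure T Ω) :=
    fun t ht => ⟨⟨ht.1, ht.2.trans hτ.2.le⟩, subset_closure hx⟩
  have := intervalIntegral.integral_eq_sub_of_hasDerivAt_of_le hτ.1.le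
    (f := fun t => f (t, x)) (f' := fun t => f' (t, x) (1, 0))
    (hf.continuousOn.comp (by fun_prop) hmap)
    (fun t ht => by
      have h1 := hf.hasFDerivAt (t, x) ⟨⟨ht.1, ht.2.trans hτ.2⟩, hx⟩
      have h2 : HasDerivAt (fun t : ℝ => (t, x)) ((1 : ℝ), (0 : Space d)) t :=
        (hasDerivAt_id t).prodMk (hasDerivAt_const t x)
      exact h1.comp_hasDerivAt t h2)
    ((hcd.comp (by fun_prop) hmap).intervalIntegrable_of_Icc hτ.1.le)
  rw [← this, intervalIntegral.integral_of_le hτ.1.le, integral_Ioc_eq_integral_Ioo]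

theorem exists_mem_stateBox (hb : Bornology.IsBounded Ω) {S : ℝ × Space d → Phase d}
    (hS : ContinuousOn S (cylClosure T Ω)) (hpos : ∀ p ∈ cylClosure T Ω, S p ∈ posStates d) :
    ∃ m M : ℝ, 0 < m ∧ ∀ p ∈ cylClosure T Ω, S p ∈ stateBox d m M := by
  have hK := isCompact_cylClosure (T := T) hb
  obtain ⟨M, hM⟩ := hK.exists_bound_of_continuousOn hS
  have hmin : ∀ f : Phase d → ℝ, Continuous f → (∀ p ∈ cylClosure T Ω, 0 < f (S p)) →
      ∃ m, 0 < m ∧ ∀ p ∈ cylClosure T Ω, m ≤ f (S p) := by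
    intro f hf hp
    rcases (cylClosure T Ω).eq_empty_or_nonempty with he | hne
    · exact ⟨1, one_pos, fun p hp => by simp [he] at hp⟩
    · obtain ⟨q, hq, h⟩ := hK.exists_isMinOn hne (hf.comp_continuousOn hS)
      exact ⟨f (S q), hp q hq, fun p hp => h hp⟩
  obtain ⟨m₁, h₁, h₁'⟩ := hmin (fun y => y.1) continuous_fst fun p hp => (hpos p hp).1
  obtain ⟨m₂, h₂, h₂'⟩ := hmin (fun y => y.2.1) continuous_snd.fst fun p hp => (hpos p hp).2
  refine ⟨min m₁ m₂, M, lt_min h₁ h₂, fun p hp => ⟨⟨?_, ?_⟩, ⟨?_, ?_⟩, ?_⟩⟩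
  · exact (min_le_left _ _).trans (h₁' p hp)
  · exact (le_abs_self _).trans ((norm_fst_le _).trans (hM p hp))
  · exact (min_le_right _ _).trans (h₂' p hp)
  · exact (le_abs_self _).trans ((norm_fst_le _).trans ((norm_snd_le _).trans (hM p hp)))
  · exact (norm_snd_le _).trans ((norm_snd_le _).trans (hM p hp))

end C1

end PotTempNS

namespace PotTempNS

/-! ### Moments controlled by the energy -/

section Moments

variable {d : ℕ}

theorem energyDensity_nonneg {a γ : ℝ} (ha : 0 < a) (hγ : 1 < γ) {z : Phase d} (h1 : 0 ≤ z.1)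
    (h2 : 0 ≤ z.2.1) : 0 ≤ energyDensity a γ z := by
  have : 0 < γ - 1 := by linarith
  unfold energyDensity pressurePot
  positivity

/-- For `x ≥ 1` one has `ln x = 2 ln √x ≤ 2√x`; for `c ≤ x ≤ 1` the logarithm lies between `ln c`
and 0. -/
theorem sq_log_le {c x : ℝ} (hc : 0 < c) (hx : c ≤ x) :
    Real.log x ^ 2 ≤ Real.log c ^ 2 + 4 * x := by
  have hx0 : 0 < x := hc.trans_le hx
  rcases le_total 1 x with h | h
  · have hs := Real.sqrt_pos.2 hx0
    have h1 : Real.log x = 2 * Real.log √x := by rw [Real.log_sqrt hx0.le]; ring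
    have h2 := Real.log_le_sub_one_of_pos hs
    have h3 := Real.sq_sqrt hx0.le
    have h4 := Real.log_nonneg h
    have h5 : Real.log x ≤ 2 * √x := by linarith
    have h6 : Real.log x ^ 2 ≤ (2 * √x) ^ 2 := by gcongr
    nlinarith [sq_nonneg (Real.log c)]
  · have h1 := Real.log_nonpos hx0.le h
    have h2 := Real.log_le_log hc hx
    nlinarith

/-- Because `θ ≥ c`, the density is at most `ρθ/c`, and `ρθ ≤ 1 + (ρθ)^γ` is controlled by the
energy. Then `sq_log_le` bounds `ρ (ln θ)²`, and Young's inequality bounds the mixed terms. These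
moments are integrable as soon as the energy is. -/
theorem exists_moment_bound {a γ c : ℝ} (ha : 0 < a) (hγ : 1 < γ) (hc : 0 < c) :
    ∃ C : ℝ, 0 ≤ C ∧ ∀ z ∈ admStates d c,
      z.1 * (1 + ‖z.2.2‖) ≤ C * (1 + energyDensity a γ z) ∧
      z.1 * |Real.log z.2.1| * (1 + ‖z.2.2‖) ≤ C * (1 + energyDensity a γ z) ∧
      z.1 * ‖z.2.2‖ * (1 + ‖z.2.2‖) ≤ C * (1 + energyDensity a γ z) ∧
      pressure a γ (z.1 * z.2.1) ≤ C * (1 + energyDensity a γ z) := by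
  have hγ' : 0 < γ - 1 := by linarith
  set A := 1 + (γ - 1) / a with hA
  have hA0 : 0 < A := by positivity
  set B := A / c with hB
  have hB0 : 0 < B := by positivity
  set D := Real.log c ^ 2 * B + 4 * A with hD
  have hD0 : 0 < D := by positivity
  refine ⟨2 * B + 2 * D + 2 * B + 4 + (γ - 1), by positivity, fun z hz => ?_⟩
  obtain ⟨ρ, θ, u⟩ := z
  have hρ : 0 ≤ ρ := hz.1
  have hθ : c ≤ θ := hz.2
  have hθ0 : 0 < θ := hc.trans_le hθ
  simp only
  have hP : 0 ≤ pressurePot a γ (ρ * θ) := by unfold pressurePot; positivity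
  have he : energyDensity a γ (ρ, θ, u) = 1 / 2 * ρ * ‖u‖ ^ 2 + pressurePot a γ (ρ * θ) := rfl
  have hk : 0 ≤ ρ * ‖u‖ ^ 2 := by positivity
  set e := energyDensity a γ (ρ, θ, u)
  have hZ : ρ * θ ≤ A * (1 + e) := by
    have h1 : ρ * θ ≤ 1 + (ρ * θ) ^ γ := by
      rcases le_total (ρ * θ) 1 with h | h
      · have : 0 ≤ (ρ * θ) ^ γ := by positivity
        linarith
      · have := Real.rpow_le_rpow_of_exponent_le h hγ.le
        rw [Real.rpow_one] at this
        linarith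
    have h2 : (ρ * θ) ^ γ = (γ - 1) / a * pressurePot a γ (ρ * θ) := by
      unfold pressurePot; field_simp
    have h3 : (γ - 1) / a * pressurePot a γ (ρ * θ) ≤ (γ - 1) / a * e := by
      gcongr
      linarith
    have h4 : 0 ≤ (γ - 1) / a := by positivity
    have h5 : 0 ≤ e := by linarith
    rw [hA]
    nlinarith
  have he0 : 0 ≤ e := by linarith
  have hρ1 : ρ ≤ B * (1 + e) := by
    rw [hB, div_mul_eq_mul_div, le_div_iff₀ hc]
    nlinarith
  have hku : ρ * ‖u‖ ^ 2 ≤ 2 * (1 + e) := by linarith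
  have hρu : ρ * ‖u‖ ≤ (B + 2) * (1 + e) / 2 := by
    nlinarith [mul_nonneg hρ (sq_nonneg (1 - ‖u‖))]
  have hl2 : ρ * Real.log θ ^ 2 ≤ D * (1 + e) := by
    have h1 := mul_le_mul_of_nonneg_left (sq_log_le hc hθ) hρ
    have h2 : Real.log c ^ 2 * ρ ≤ Real.log c ^ 2 * (B * (1 + e)) := by gcongr
    rw [hD]
    nlinarith
  have hl1 : ρ * |Real.log θ| ≤ (B + D) * (1 + e) := by
    have : ρ * |Real.log θ| ≤ ρ * (1 + Real.log θ ^ 2) := by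
      gcongr
      nlinarith [sq_abs (Real.log θ), sq_nonneg (1 - |Real.log θ|), abs_nonneg (Real.log θ)]
    nlinarith
  have hlu : ρ * |Real.log θ| * ‖u‖ ≤ (2 + D) * (1 + e) := by
    have : ρ * |Real.log θ| * ‖u‖ ≤ ρ * (‖u‖ ^ 2 + Real.log θ ^ 2) := by
      rw [mul_assoc]
      gcongr
      nlinarith [sq_abs (Real.log θ), sq_nonneg (‖u‖ - |Real.log θ|), sq_nonneg ‖u‖]
    nlinarith
  have hE : 0 < 1 + e := by linarith
  have hBE : 0 ≤ B * (1 + e) := by positivity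
  have hDE : 0 ≤ D * (1 + e) := by positivity
  have hγE : 0 ≤ (γ - 1) * (1 + e) := by positivity
  have hp : pressure a γ (ρ * θ) ≤ (γ - 1) * (1 + e) := by
    have : pressure a γ (ρ * θ) = (γ - 1) * pressurePot a γ (ρ * θ) := by
      unfold pressurePot pressure; field_simp
    rw [this]
    gcongr
    linarith
  have hsum : (2 * B + 2 * D + 2 * B + 4 + (γ - 1)) * (1 + e) = 2 * (B * (1 + e))
      + 2 * (D * (1 + e)) + 2 * (B * (1 + e)) + 4 * (1 + e) + (γ - 1) * (1 + e) := by ring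
  rw [hsum]
  clear_value A B D e
  refine ⟨?_, ?_, ?_, ?_⟩ <;> linarith

/-- The measures `V p` are concentrated on the admissible states. -/
def ConcentratedOnAdm (c T : ℝ) (Ω : Set (Space d)) (V : Kernel (ℝ × Space d) (Phase d)) : Prop :=
  ∀ᵐ p ∂(volume.restrict (cyl T Ω)), ∀ᵐ z ∂V p, z ∈ admStates d c

theorem measurableSet_admStates (c : ℝ) : MeasurableSet (admStates d c) :=
  (measurableSet_le measurable_const measurable_fst).inter
    (measurableSet_le measurable_const measurable_snd.fst)

theorem concentratedOnAdm_of_support {c T : ℝ} {Ω : Set (Space d)}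
    {V : Kernel (ℝ × Space d) (Phase d)} [IsMarkovKernel V]
    (h : ∀ᵐ p ∂(volume.restrict (cyl T Ω)), V p {z | 0 ≤ z.1 ∧ c ≤ z.2.1} = 1) :
    ConcentratedOnAdm c T Ω V := by
  filter_upwards [h] with p hp
  exact (prob_compl_eq_zero_iff (measurableSet_admStates c)).2 hp

/-- A moment with parameters which is dominated by the energy is integrable. -/
theorem moment_of_bound {a γ c T C : ℝ} {Ω : Set (Space d)} {V : Kernel (ℝ × Space d) (Phase d)}
    [IsMarkovKernel V] (hadm : ConcentratedOnAdm c T Ω V)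
    (hen : MomentIntegrable T Ω V (energyDensity a γ)) (hb : Bornology.IsBounded Ω)
    {W F : Type*} [TopologicalSpace W] [TopologicalSpace.PseudoMetrizableSpace W]
    [MeasurableSpace W] [BorelSpace W] [NormedAddCommGroup F] [NormedSpace ℝ F]
    [SecondCountableTopology F] [MeasurableSpace F] [BorelSpace F]
    {w : ℝ × Space d → W} (hw : AEStronglyMeasurable w (volume.restrict (cyl T Ω)))
    {g : W → Phase d → F} (hg : Measurable (Function.uncurry g))
    (hbd : ∀ᵐ p ∂(volume.restrict (cyl T Ω)), ∀ z ∈ admStates d c,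
      ‖g (w p) z‖ ≤ C * (1 + energyDensity a γ z)) :
    (∀ᵐ p ∂(volume.restrict (cyl T Ω)), Integrable (g (w p)) (V p)) ∧
    IntegrableOn (fun p => ∫ z, g (w p) z ∂V p) (cyl T Ω) ∧
    ∀ᵐ p ∂(volume.restrict (cyl T Ω)),
      ‖∫ z, g (w p) z ∂V p‖ ≤ C * (1 + ∫ z, energyDensity a γ z ∂V p) := by
  have hfin := isFiniteMeasure_restrict_cyl (T := T) hb
  have h1 : ∀ᵐ p ∂(volume.restrict (cyl T Ω)), Integrable (g (w p)) (V p) ∧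
      ‖∫ z, g (w p) z ∂V p‖ ≤ C * (1 + ∫ z, energyDensity a γ z ∂V p) := by
    filter_upwards [hadm, hen.1, hbd] with p h1 h2 h3
    have hm : AEStronglyMeasurable (g (w p)) (V p) :=
      (hg.comp measurable_prodMk_left).aestronglyMeasurable
    have hi : Integrable (fun z => C * (1 + energyDensity a γ z)) (V p) :=
      ((integrable_const 1).add h2).const_mul C
    have hle : ∀ᵐ z ∂V p, ‖g (w p) z‖ ≤ C * (1 + energyDensity a γ z) := by
      filter_upwards [h1] with z hz using h3 z hz
    refine ⟨hi.mono' hm hle, (norm_integral_le_of_norm_le hi hle).trans_eq ?_⟩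
    rw [integral_const_mul, integral_add (integrable_const 1) h2]
    simp
  refine ⟨h1.mono fun p hp => hp.1, ?_, h1.mono fun p hp => hp.2⟩
  refine Integrable.mono' (((integrable_const 1).add hen.2).const_mul C) ?_
    (h1.mono fun p hp => hp.2)
  -- The parameter is measurable only up to null sets, so joint measurability is used for a strongly
  -- measurable representative of it.
  have hmk : StronglyMeasurable fun p => ∫ z, g (hw.mk w p) z ∂V p := by
    refine StronglyMeasurable.integral_kernel_prod_right'
      (f := fun q : (ℝ × Space d) × Phase d => g (hw.mk w q.1) q.2) ?_
    exact (hg.comp (Measurable.prodMk (hw.stronglyMeasurable_mk.measurable.comp measurable_fst)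
      measurable_snd)).stronglyMeasurable
  refine ⟨_, hmk, ?_⟩
  filter_upwards [hw.ae_eq_mk] with p hp
  rw [hp]

theorem measurable_pressure (a γ : ℝ) :
    Measurable fun z : Phase d => pressure a γ (z.1 * z.2.1) := by
  unfold pressure
  fun_prop

theorem measurable_energyDensity (a γ : ℝ) : Measurable (energyDensity (d := d) a γ) := by
  unfold energyDensity pressurePot
  fun_prop

theorem measurable_pressureSlope (a γ : ℝ) : Measurable (pressureSlope (d := d) a γ) := by
  unfold pressureSlope
  fun_prop

theorem measurable_entropyCoef (a γ : ℝ) : Measurable (entropyCoef (d := d) a γ) := by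
  have := measurable_pressureSlope (d := d) a γ
  unfold entropyCoef
  fun_prop

theorem measurable_densityCoef (a γ : ℝ) : Measurable (densityCoef (d := d) a γ) := by
  have := measurable_entropyCoef (d := d) a γ
  unfold densityCoef
  fun_prop

theorem measurable_relEnergy (a γ : ℝ) :
    Measurable (Function.uncurry (relEnergy (d := d) a γ)) := by
  have h1 : Measurable fun q : Phase d × Phase d => entropyCoef a γ q.1 :=
    (measurable_entropyCoef a γ).comp measurable_fst
  have h2 : Measurable fun q : Phase d × Phase d => densityCoef a γ q.1 :=
    (measurable_densityCoef a γ).comp measurable_fst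
  have h3 : Measurable fun q : Phase d × Phase d => energyDensity a γ q.2 :=
    (measurable_energyDensity a γ).comp measurable_snd
  have h4 : Measurable fun q : Phase d × Phase d => pressure a γ (q.1.1 * q.1.2.1) :=
    (measurable_pressure a γ).comp measurable_fst
  unfold Function.uncurry relEnergy statePressure
  fun_prop

theorem measurable_relIntegrand (a γ : ℝ) :
    Measurable fun q : (Phase d × ((ℝ × Space d) →L[ℝ] Phase d)) × Phase d =>
      relIntegrand a γ q.1.1 q.1.2 q.2 := by
  have h1 : Measurable fun q : (Phase d × ((ℝ × Space d) →L[ℝ] Phase d)) × Phase d =>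
      pressureSlope a γ q.1.1 := (measurable_pressureSlope a γ).comp measurable_fst.fst
  have h4 : Measurable fun q : (Phase d × ((ℝ × Space d) →L[ℝ] Phase d)) × Phase d =>
      pressure a γ (q.2.1 * q.2.2.1) := (measurable_pressure a γ).comp measurable_snd
  unfold relIntegrand velDiv
  simp only [densityCoefDeriv, entropyCoefDeriv, statePressureDeriv, stateForm_apply,
    inner_zero_left]
  fun_prop

theorem exists_relEnergy_bound {a γ m c : ℝ} (ha : 0 < a) (hγ : 1 < γ) (hm : 0 < m) (M : ℝ)
    (hc : 0 < c) : ∃ C : ℝ, 0 ≤ C ∧ ∀ y ∈ stateBox d m M, ∀ z ∈ admStates d c,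
      ‖relEnergy a γ y z‖ ≤ C * (1 + energyDensity a γ z) := by
  have hs := stateBox_subset_posStates (d := d) (M := M) hm
  obtain ⟨B1, h1⟩ := (isCompact_stateBox (d := d) m M).exists_bound_of_continuousOn
    (f := statePressure a γ) fun y hy =>
      (hasFDerivAt_statePressure a γ (hs hy)).continuousAt.continuousWithinAt
  obtain ⟨B2, h2⟩ := (isCompact_stateBox (d := d) m M).exists_bound_of_continuousOn
    (f := entropyCoef a γ) fun y hy =>
      (hasFDerivAt_entropyCoef a hγ (hs hy)).continuousAt.continuousWithinAt
  obtain ⟨B3, h3⟩ := (isCompact_stateBox (d := d) m M).exists_bound_of_continuousOn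
    (f := densityCoef a γ) fun y hy =>
      (hasFDerivAt_densityCoef a hγ (hs hy)).continuousAt.continuousWithinAt
  obtain ⟨C, hC, hmom⟩ := exists_moment_bound (d := d) ha hγ hc
  refine ⟨1 + C * |M| + C * |B3| + C * |B2| + |B1|, by positivity, fun y hy z hz => ?_⟩
  obtain ⟨m1, m2, m3, m4⟩ := hmom z hz
  have hz1 := hz.1
  have he := energyDensity_nonneg ha hγ hz.1 (hc.le.trans hz.2)
  have b1 := (h1 y hy).trans (le_abs_self _)
  have b2 := (h2 y hy).trans (le_abs_self _)
  have b3 := (h3 y hy).trans (le_abs_self _)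
  have b4 := hy.2.2.trans (le_abs_self _)
  rw [Real.norm_eq_abs] at b1 b2 b3
  set e := energyDensity a γ z
  have hn := norm_nonneg z.2.2
  have t1 : |z.1 * inner ℝ z.2.2 y.2.2| ≤ C * |M| * (1 + e) := by
    rw [abs_mul, abs_of_nonneg hz1]
    calc z.1 * |inner ℝ z.2.2 y.2.2| ≤ z.1 * (‖z.2.2‖ * |M|) := by
          gcongr
          exact (abs_real_inner_le_norm _ _).trans (by gcongr)
      _ = z.1 * ‖z.2.2‖ * |M| := by ring
      _ ≤ C * (1 + e) * |M| :=
          mul_le_mul_of_nonneg_right (by nlinarith) (abs_nonneg _)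
      _ = _ := by ring
  have t2 : |z.1 * densityCoef a γ y| ≤ C * |B3| * (1 + e) := by
    rw [abs_mul, abs_of_nonneg hz1]
    calc z.1 * |densityCoef a γ y| ≤ C * (1 + e) * |B3| :=
          mul_le_mul (by nlinarith) b3 (abs_nonneg _) (by positivity)
      _ = _ := by ring
  have t3 : |z.1 * Real.log z.2.1 * entropyCoef a γ y| ≤ C * |B2| * (1 + e) := by
    rw [abs_mul, abs_mul, abs_of_nonneg hz1]
    have : 0 ≤ z.1 * |Real.log z.2.1| * ‖z.2.2‖ := by positivity
    calc z.1 * |Real.log z.2.1| * |entropyCoef a γ y| ≤ C * (1 + e) * |B2| :=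
          mul_le_mul (by nlinarith) b2 (abs_nonneg _) (by positivity)
      _ = _ := by ring
  have t4 : |statePressure a γ y| ≤ |B1| * (1 + e) := by
    nlinarith [abs_nonneg B1]
  rw [relEnergy, Real.norm_eq_abs]
  have t0 : |e| ≤ 1 + e := by rw [abs_of_nonneg he]; linarith
  rw [abs_le] at t0 t1 t2 t3 t4 ⊢
  constructor <;> nlinarith

/-- The constant depends on the reference state only through its box and the bound `K` of its
derivative. This uniformity later yields one integrable majorant for all test states. -/
theorem exists_relIntegrand_bound {a γ m c K : ℝ} (ha : 0 < a) (hγ : 1 < γ) (hm : 0 < m) (M : ℝ)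
    (hc : 0 < c) (hK : 0 ≤ K) : ∃ C : ℝ, 0 ≤ C ∧ ∀ y ∈ stateBox d m M,
      ∀ L : (ℝ × Space d) →L[ℝ] Phase d, ‖L‖ ≤ K → ∀ z ∈ admStates d c,
      ‖relIntegrand a γ y L z‖ ≤ C * (1 + energyDensity a γ z) := by
  obtain ⟨B, hB, hcoef⟩ := exists_coef_bound (d := d) a γ hm M
  obtain ⟨C, hC, hmom⟩ := exists_moment_bound (d := d) ha hγ hc
  refine ⟨C * K + C * (d * K) + C * (B * K) + C * (B * K) + B * K, by positivity,
    fun y hy L hL z hz => ?_⟩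
  obtain ⟨m1, m2, m3, m4⟩ := hmom z hz
  have hz1 := hz.1
  have he := energyDensity_nonneg ha hγ hz.1 (hc.le.trans hz.2)
  obtain ⟨b1, b2, b3⟩ := hcoef y hy
  set e := energyDensity a γ z
  have hn := norm_nonneg z.2.2
  have hL1 : ‖L (1, z.2.2)‖ ≤ K * (1 + ‖z.2.2‖) :=
    (L.le_opNorm _).trans (mul_le_mul hL (norm_one_prod_le _) (norm_nonneg _) hK)
  have hp0 : 0 ≤ pressure a γ (z.1 * z.2.1) := by
    have := hc.le.trans hz.2
    unfold pressure; positivity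
  have t1 : |z.1 * inner ℝ z.2.2 (L (1, z.2.2)).2.2| ≤ C * K * (1 + e) := by
    rw [abs_mul, abs_of_nonneg hz1]
    calc z.1 * |inner ℝ z.2.2 (L (1, z.2.2)).2.2| ≤ z.1 * (‖z.2.2‖ * (K * (1 + ‖z.2.2‖))) := by
          gcongr
          refine (abs_real_inner_le_norm _ _).trans ?_
          gcongr
          exact ((norm_snd_le _).trans (norm_snd_le _)).trans hL1
      _ = z.1 * ‖z.2.2‖ * (1 + ‖z.2.2‖) * K := by ring
      _ ≤ C * (1 + e) * K := by gcongr
      _ = _ := by ring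
  have t2 : |pressure a γ (z.1 * z.2.1) * velDiv L| ≤ C * (d * K) * (1 + e) := by
    rw [abs_mul, abs_of_nonneg hp0]
    calc pressure a γ (z.1 * z.2.1) * |velDiv L| ≤ C * (1 + e) * (d * K) := by
          gcongr
          exact (abs_velDiv_le L).trans (by gcongr)
      _ = _ := by ring
  have t3 : |z.1 * densityCoefDeriv a γ y (L (1, z.2.2))| ≤ C * (B * K) * (1 + e) := by
    rw [abs_mul, abs_of_nonneg hz1]
    calc z.1 * |densityCoefDeriv a γ y (L (1, z.2.2))| ≤ z.1 * (B * (K * (1 + ‖z.2.2‖))) := by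
          gcongr
          exact ((densityCoefDeriv a γ y).le_opNorm _).trans (by gcongr)
      _ = z.1 * (1 + ‖z.2.2‖) * (B * K) := by ring
      _ ≤ C * (1 + e) * (B * K) := by gcongr
      _ = _ := by ring
  have t4 : |z.1 * Real.log z.2.1 * entropyCoefDeriv a γ y (L (1, z.2.2))|
      ≤ C * (B * K) * (1 + e) := by
    rw [abs_mul, abs_mul, abs_of_nonneg hz1]
    calc z.1 * |Real.log z.2.1| * |entropyCoefDeriv a γ y (L (1, z.2.2))|
        ≤ z.1 * |Real.log z.2.1| * (B * (K * (1 + ‖z.2.2‖))) := by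
          gcongr
          exact ((entropyCoefDeriv a γ y).le_opNorm _).trans (by gcongr)
      _ = z.1 * |Real.log z.2.1| * (1 + ‖z.2.2‖) * (B * K) := by ring
      _ ≤ C * (1 + e) * (B * K) := by gcongr
      _ = _ := by ring
  have t5 : |statePressureDeriv a γ y (L (1, 0))| ≤ B * K * (1 + e) := by
    have h0 : ‖((1, 0) : ℝ × Space d)‖ = 1 := by simp [Prod.norm_def]
    have h1 := L.le_opNorm (1, 0)
    rw [h0, mul_one] at h1
    calc |statePressureDeriv a γ y (L (1, 0))| ≤ B * K :=
          ((statePressureDeriv a γ y).le_opNorm _).trans (by gcongr; exact h1.trans hL)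
      _ ≤ B * K * (1 + e) := le_mul_of_one_le_right (by positivity) (by linarith)
  rw [relIntegrand, Real.norm_eq_abs]
  rw [abs_le] at t1 t2 t3 t4 t5 ⊢
  constructor <;> nlinarith

theorem exists_frob_stress_le (d : ℕ) (μ lam : ℝ) : ∃ C : ℝ, 0 ≤ C ∧
    ∀ A B : Space d →L[ℝ] Space d,
      |frob (stress μ lam (gradMat A)) (gradMat B)| ≤ C * (‖A‖ * ‖B‖) := by
  have h1 : ∀ A B : Space d →L[ℝ] Space d, ∀ i j k l,
      |gradMat A i j * gradMat B k l| ≤ ‖A‖ * ‖B‖ := by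
    intro A B i j k l
    rw [abs_mul]
    exact mul_le_mul (abs_gradMat_le A i j) (abs_gradMat_le B k l) (abs_nonneg _) (norm_nonneg _)
  have h2 : ∀ A B : Space d →L[ℝ] Space d, ∀ σ τ : Fin d → Fin d → Fin d,
      ∀ σ' τ' : Fin d → Fin d → Fin d,
      |∑ i, ∑ j, gradMat A (σ i j) (τ i j) * gradMat B (σ' i j) (τ' i j)|
        ≤ d * (d * (‖A‖ * ‖B‖)) := by
    intro A B σ τ σ' τ'
    have h3 : ∀ i : Fin d, |∑ j, gradMat A (σ i j) (τ i j) * gradMat B (σ' i j) (τ' i j)|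
        ≤ d * (‖A‖ * ‖B‖) := fun i =>
      (Finset.abs_sum_le_sum_abs _ _).trans
        ((Finset.sum_le_sum fun j _ => h1 A B _ _ _ _).trans_eq (by simp))
    exact (Finset.abs_sum_le_sum_abs _ _).trans
      ((Finset.sum_le_sum fun i _ => h3 i).trans_eq (by simp))
  refine ⟨(2 * |μ| + |lam - 2 / d * μ|) * (d * d), by positivity, fun A B => ?_⟩
  rw [frob_stress]
  have a1 := h2 A B (fun i _ => i) (fun _ j => j) (fun i _ => i) (fun _ j => j)
  have a2 := h2 A B (fun i _ => i) (fun _ j => j) (fun _ j => j) (fun i _ => i)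
  have a3 := h2 A B (fun i _ => i) (fun i _ => i) (fun _ j => j) (fun _ j => j)
  have e3 : (gradMat A).trace * (gradMat B).trace
      = ∑ i, ∑ j, gradMat A i i * gradMat B j j := by
    simp [Matrix.trace, Finset.sum_mul_sum]
  have e1 : frob (gradMat A) (gradMat B) = ∑ i, ∑ j, gradMat A i j * gradMat B i j := rfl
  have e2 : frob (gradMat A) (gradMat B).transpose
      = ∑ i, ∑ j, gradMat A i j * gradMat B j i := rfl
  rw [e1, e2, e3]
  refine (abs_add_le _ _).trans ?_
  rw [abs_mul, abs_mul]
  have := abs_add_le (∑ i, ∑ j, gradMat A i j * gradMat B i j)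
    (∑ i, ∑ j, gradMat A i j * gradMat B j i)
  calc _ ≤ |μ| * (d * (d * (‖A‖ * ‖B‖)) + d * (d * (‖A‖ * ‖B‖)))
        + |lam - 2 / d * μ| * (d * (d * (‖A‖ * ‖B‖))) := by gcongr; linarith
    _ = _ := by ring

end Moments

end PotTempNS

namespace PotTempNS

/-! ### The relative energy inequality -/

section RelativeEnergy

variable {d : ℕ}

/-- The projection of a state to its velocity. -/
noncomputable def velCLM (d : ℕ) : Phase d →L[ℝ] Space d :=
  (ContinuousLinearMap.snd ℝ ℝ (Space d)).comp (ContinuousLinearMap.snd ℝ ℝ (ℝ × Space d))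

@[simp] theorem velCLM_apply (y : Phase d) : velCLM d y = y.2.2 := rfl

/-- The spatial gradient of the velocity, computed from the space-time derivative of a state. -/
noncomputable def velGrad (L : (ℝ × Space d) →L[ℝ] Phase d) : Space d →L[ℝ] Space d :=
  spatial ((velCLM d).comp L)

@[simp] theorem velGrad_apply (L : (ℝ × Space d) →L[ℝ] Phase d) (v : Space d) :
    velGrad L v = (L (0, v)).2.2 := by
  simp [velGrad, spatial]

theorem velDiv_eq (L : (ℝ × Space d) →L[ℝ] Phase d) : velDiv L = (gradMat (velGrad L)).trace := by
  simp [velDiv, Matrix.trace, gradMat_apply]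

/-- The pair of time and flux terms of a transport equation is the mean of `s` times the derivative
in the direction `(1, u)`. This is the form in which `relIntegrand` is written. -/
theorem integral_pairing {ν : Measure (Phase d)} {s : Phase d → ℝ} (hs : Integrable s ν)
    (hsu : Integrable (fun z => s z • z.2.2) ν) (ℓ : (ℝ × Space d) →L[ℝ] ℝ) :
    ∫ z, s z * ℓ (1, z.2.2) ∂ν = (∫ z, s z ∂ν) * ℓ (1, 0) + spatial ℓ (∫ z, s z • z.2.2 ∂ν) := by
  have e : ∀ z : Phase d, s z * ℓ (1, z.2.2) = s z * ℓ (1, 0) + spatial ℓ (s z • z.2.2) := by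
    intro z
    have h1 : ((1, z.2.2) : ℝ × Space d) = (1, 0) + (0, z.2.2) := by simp
    rw [h1, map_add, map_smul]
    simp [spatial, mul_add]
  simp only [e]
  rw [integral_add (hs.mul_const _) ((spatial ℓ).integrable_comp hsu), integral_mul_const,
    ContinuousLinearMap.integral_comp_comm _ hsu]

theorem inner_eq_sum_gradMat (A : Space d →L[ℝ] Space d) (v : Space d) :
    inner ℝ v (A v) = ∑ i, ∑ j, v i * v j * gradMat A i j := by
  have h : v = ∑ j, v j • EuclideanSpace.single j (1 : ℝ) := by
    ext i; simp [Finset.sum_apply, Pi.single_apply]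
  rw [PiLp.inner_apply]
  refine Finset.sum_congr rfl fun i _ => ?_
  have h2 : A v i = ∑ j, v j * gradMat A i j := by
    conv_lhs => rw [h]
    rw [map_sum]
    simp [gradMat_apply]
  rw [h2]
  simp only [RCLike.inner_apply, conj_trivial, Finset.sum_mul]
  exact Finset.sum_congr rfl fun j _ => by ring

/-- The analogue of `integral_pairing` for momentum. The diagonal entries of the flux contribute the
pressure times the divergence of the test velocity. -/
theorem integral_momentum_pairing {a γ : ℝ} {V : Kernel (ℝ × Space d) (Phase d)}
    {p : ℝ × Space d} (hm : Integrable (fun z : Phase d => z.1 • z.2.2) (V p))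
    (hf : ∀ i j : Fin d, Integrable (fun z : Phase d => z.1 * z.2.2 i * z.2.2 j
      + if i = j then pressure a γ (z.1 * z.2.1) else 0) (V p))
    (L : (ℝ × Space d) →L[ℝ] Phase d) :
    ∫ z, (z.1 * inner ℝ z.2.2 (L (1, z.2.2)).2.2 + pressure a γ (z.1 * z.2.1) * velDiv L) ∂V p
      = inner ℝ (∫ z, z.1 • z.2.2 ∂V p) (((velCLM d).comp L) (1, 0))
        + frob (momentumFlux a γ V p) (gradMat (velGrad L)) := by
  have e : ∀ z : Phase d,
      z.1 * inner ℝ z.2.2 (L (1, z.2.2)).2.2 + pressure a γ (z.1 * z.2.1) * velDiv L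
        = inner ℝ (((velCLM d).comp L) (1, 0)) (z.1 • z.2.2)
          + ∑ i, ∑ j, (z.1 * z.2.2 i * z.2.2 j
            + if i = j then pressure a γ (z.1 * z.2.1) else 0) * gradMat (velGrad L) i j := by
    intro z
    have h1 : ((1, z.2.2) : ℝ × Space d) = (1, 0) + (0, z.2.2) := by simp
    have h2 : ∑ i, ∑ j, (z.1 * z.2.2 i * z.2.2 j
            + if i = j then pressure a γ (z.1 * z.2.1) else 0) * gradMat (velGrad L) i j
        = z.1 * inner ℝ z.2.2 (velGrad L z.2.2) + pressure a γ (z.1 * z.2.1) * velDiv L := by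
      rw [inner_eq_sum_gradMat, velDiv_eq, Matrix.trace, Finset.mul_sum, Finset.mul_sum,
        ← Finset.sum_add_distrib]
      refine Finset.sum_congr rfl fun i _ => ?_
      simp only [add_mul, Finset.sum_add_distrib, Finset.mul_sum, ite_mul, zero_mul,
        Finset.sum_ite_eq, Finset.mem_univ, if_true, Matrix.diag_apply]
      congr 1
      exact Finset.sum_congr rfl fun j _ => by ring
    rw [h2, h1, map_add, real_inner_smul_right]
    simp only [velGrad_apply, ContinuousLinearMap.comp_apply, velCLM_apply, Prod.snd_add,
      inner_add_right]
    rw [real_inner_comm z.2.2]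
    ring
  simp only [e]
  have hij : ∀ i j, Integrable (fun z : Phase d => (z.1 * z.2.2 i * z.2.2 j
      + if i = j then pressure a γ (z.1 * z.2.1) else 0) * gradMat (velGrad L) i j) (V p) :=
    fun i j => (hf i j).mul_const _
  rw [integral_add (hm.const_inner _)
    (integrable_finsetSum _ fun i _ => integrable_finsetSum _ fun j _ => hij i j),
    integral_inner hm, real_inner_comm, integral_finsetSum _ fun i _ =>
      integrable_finsetSum _ fun j _ => hij i j]
  congr 1
  refine Finset.sum_congr rfl fun i _ => ?_
  rw [integral_finsetSum _ fun j _ => hij i j]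
  refine Finset.sum_congr rfl fun j _ => ?_
  rw [integral_mul_const]
  rfl

theorem frob_stress_sub (μ lam : ℝ) (A B C : Space d →L[ℝ] Space d) :
    frob (stress μ lam (gradMat A)) (gradMat (B - C))
      = frob (stress μ lam (gradMat A)) (gradMat B)
        - frob (stress μ lam (gradMat A)) (gradMat C) := by
  simp only [frob, gradMat_apply, sub_apply, PiLp.sub_apply, mul_sub,
    Finset.sum_sub_distrib]

theorem frob_sub_stress (μ lam : ℝ) (A B C : Space d →L[ℝ] Space d) :
    frob (stress μ lam (gradMat (A - B))) (gradMat C)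
      = frob (stress μ lam (gradMat A)) (gradMat C)
        - frob (stress μ lam (gradMat B)) (gradMat C) := by
  have e : ∀ i j, gradMat (A - B) i j = gradMat A i j - gradMat B i j := by
    intro i j; simp [gradMat_apply]
  rw [frob_stress, frob_stress, frob_stress]
  simp only [frob, Matrix.trace, Matrix.diag_apply, e, sub_mul, Finset.sum_sub_distrib]
  ring

theorem aestronglyMeasurable_frob_stress {α : Type*} [MeasurableSpace α] {m : Measure α}
    (μ lam : ℝ) {A B : α → Space d →L[ℝ] Space d} (hA : AEStronglyMeasurable A m)
    (hB : AEStronglyMeasurable B m) :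
    AEStronglyMeasurable (fun x => frob (stress μ lam (gradMat (A x))) (gradMat (B x))) m := by
  have hc : Continuous fun q : (Space d →L[ℝ] Space d) × (Space d →L[ℝ] Space d) =>
      frob (stress μ lam (gradMat q.1)) (gradMat q.2) := by
    simp_rw [frob_stress]
    simp only [frob, Matrix.trace, Matrix.diag_apply, Matrix.transpose_apply, gradMat_apply]
    fun_prop
  have := hc.comp_aestronglyMeasurable (hA.prodMk hB)
  simpa only using this

theorem integrable_frob_stress {α : Type*} [MeasurableSpace α] {m : Measure α}
    (μ lam : ℝ) {A B : α → Space d →L[ℝ] Space d} (hA : MemLp A 2 m) (hB : MemLp B 2 m) :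
    Integrable (fun x => frob (stress μ lam (gradMat (A x))) (gradMat (B x))) m := by
  obtain ⟨C, _, hC⟩ := exists_frob_stress_le d μ lam
  refine Integrable.mono' ((hA.norm.integrable_mul hB.norm).const_mul C)
    (aestronglyMeasurable_frob_stress μ lam hA.1 hB.1) ?_
  exact Filter.Eventually.of_forall fun x => hC (A x) (B x)

end RelativeEnergy

end PotTempNS

namespace PotTempNS

/-! ### Integrable moments along a test state, and the relative energy inequality -/

section RelativeEnergyInequality

variable {d : ℕ} {a γ T : ℝ} {Ω : Set (Space d)} {V : Kernel (ℝ × Space d) (Phase d)}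

/-- Used with the weights `ρ` and `ρ ln θ`, which belong to the continuity equation and to the
entropy inequality. -/
theorem linear_moment {c C : ℝ} [IsMarkovKernel V] (hadm : ConcentratedOnAdm c T Ω V)
    (hen : MomentIntegrable T Ω V (energyDensity a γ)) (hΩ : IsOpen Ω)
    (hb : Bornology.IsBounded Ω) {s : Phase d → ℝ} (hs : Measurable s)
    (hbd : ∀ z ∈ admStates d c, |s z| * (1 + ‖z.2.2‖) ≤ C * (1 + energyDensity a γ z))
    {ℓ : ℝ × Space d → (ℝ × Space d) →L[ℝ] ℝ} (hℓ : ContinuousOn ℓ (cylClosure T Ω)) :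
    (∀ᵐ p ∂(volume.restrict (cyl T Ω)), Integrable s (V p) ∧
      Integrable (fun z => s z • z.2.2) (V p) ∧
      Integrable (fun z => s z * ℓ p (1, z.2.2)) (V p)) ∧
    IntegrableOn (fun p => ∫ z, s z * ℓ p (1, z.2.2) ∂V p) (cyl T Ω) := by
  have hm := (isOpen_cyl (T := T) hΩ).measurableSet
  obtain ⟨K, hK⟩ := (isCompact_cylClosure hb).exists_bound_of_continuousOn hℓ
  have h1 := moment_of_bound hadm hen hb (w := fun _ => (0 : ℝ)) (g := fun _ z => s z) (C := C)
    aestronglyMeasurable_const (hs.comp measurable_snd) (Filter.Eventually.of_forall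
      fun p z hz => by
        have := hbd z hz
        rw [Real.norm_eq_abs]
        nlinarith [abs_nonneg (s z), norm_nonneg z.2.2,
          mul_nonneg (abs_nonneg (s z)) (norm_nonneg z.2.2)])
  have h2 := moment_of_bound hadm hen hb (w := fun _ => (0 : ℝ)) (g := fun _ z => s z • z.2.2)
    (C := C) aestronglyMeasurable_const
    ((hs.comp measurable_snd).smul measurable_snd.snd.snd) (Filter.Eventually.of_forall
      fun p z hz => by
        have := hbd z hz
        rw [norm_smul, Real.norm_eq_abs]
        nlinarith [abs_nonneg (s z)])
  have h3 := moment_of_bound hadm hen hb (w := ℓ) (g := fun L z => s z * L (1, z.2.2))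
    (C := |K| * C) ((hℓ.mono cyl_subset_cylClosure).aestronglyMeasurable hm)
    ((hs.comp measurable_snd).mul (by fun_prop)) (by
      filter_upwards [ae_restrict_mem hm] with p hp z hz
      rw [norm_mul, Real.norm_eq_abs]
      have h4 : ‖ℓ p (1, z.2.2)‖ ≤ |K| * (1 + ‖z.2.2‖) :=
        ((ℓ p).le_opNorm _).trans (mul_le_mul
          ((hK p (cyl_subset_cylClosure hp)).trans (le_abs_self _))
          (norm_one_prod_le _) (norm_nonneg _) (abs_nonneg _))
      calc |s z| * ‖ℓ p (1, z.2.2)‖ ≤ |s z| * (|K| * (1 + ‖z.2.2‖)) := by gcongr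
        _ = |K| * (|s z| * (1 + ‖z.2.2‖)) := by ring
        _ ≤ |K| * (C * (1 + energyDensity a γ z)) :=
          mul_le_mul_of_nonneg_left (hbd z hz) (abs_nonneg _)
        _ = _ := by ring)
  refine ⟨?_, h3.2.1⟩
  filter_upwards [h1.1, h2.1, h3.1] with p p1 p2 p3 using ⟨p1, p2, p3⟩

theorem momentumFlux_moment {c : ℝ} [IsMarkovKernel V] (ha : 0 < a) (hγ : 1 < γ) (hc : 0 < c)
    (hadm : ConcentratedOnAdm c T Ω V)
    (hen : MomentIntegrable T Ω V (energyDensity a γ)) (hΩ : IsOpen Ω)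
    (hb : Bornology.IsBounded Ω) {S : ℝ × Space d → Phase d}
    {S' : ℝ × Space d → (ℝ × Space d) →L[ℝ] Phase d} (hS : IsC1OnClosure T Ω S S') :
    (∀ᵐ p ∂(volume.restrict (cyl T Ω)), Integrable (fun z : Phase d =>
      z.1 * inner ℝ z.2.2 (S' p (1, z.2.2)).2.2
        + pressure a γ (z.1 * z.2.1) * velDiv (S' p)) (V p)) ∧
    (∀ᵐ p ∂(volume.restrict (cyl T Ω)), ∀ i j : Fin d, Integrable (fun z : Phase d =>
      z.1 * z.2.2 i * z.2.2 j + if i = j then pressure a γ (z.1 * z.2.1) else 0) (V p)) ∧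
    IntegrableOn (fun p => ∫ z, (z.1 * inner ℝ z.2.2 (S' p (1, z.2.2)).2.2
        + pressure a γ (z.1 * z.2.1) * velDiv (S' p)) ∂V p) (cyl T Ω) := by
  have hm := (isOpen_cyl (T := T) hΩ).measurableSet
  obtain ⟨K, hK0, hK⟩ := hS.exists_bound hb
  obtain ⟨C, hC, hmb⟩ := exists_moment_bound (d := d) ha hγ hc
  have hp0 : ∀ z ∈ admStates d c, 0 ≤ pressure a γ (z.1 * z.2.1) := by
    intro z hz
    have h1 := hz.1
    have h2 := hc.le.trans hz.2
    unfold pressure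
    positivity
  have hmp : Measurable fun q : ((ℝ × Space d) →L[ℝ] Phase d) × Phase d =>
      pressure a γ (q.2.1 * q.2.2.1) := (measurable_pressure a γ).comp measurable_snd
  have h1 := moment_of_bound hadm hen hb (w := S') (g := fun L z =>
    z.1 * inner ℝ z.2.2 (L (1, z.2.2)).2.2 + pressure a γ (z.1 * z.2.1) * velDiv L)
    (C := C * K + C * (d * K))
    ((hS.continuousOn_deriv.mono cyl_subset_cylClosure).aestronglyMeasurable hm)
    (by unfold Function.uncurry velDiv; fun_prop) (by
      filter_upwards [ae_restrict_mem hm] with p hp z hz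
      have hL := (hK p (cyl_subset_cylClosure hp)).2
      obtain ⟨-, -, m3, m4⟩ := hmb z hz
      have hz1 := hz.1
      have hL1 : ‖S' p (1, z.2.2)‖ ≤ K * (1 + ‖z.2.2‖) :=
        ((S' p).le_opNorm _).trans (mul_le_mul hL (norm_one_prod_le _) (norm_nonneg _) hK0)
      have t1 : |z.1 * inner ℝ z.2.2 (S' p (1, z.2.2)).2.2|
          ≤ C * K * (1 + energyDensity a γ z) := by
        rw [abs_mul, abs_of_nonneg hz1]
        calc z.1 * |inner ℝ z.2.2 (S' p (1, z.2.2)).2.2|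
            ≤ z.1 * (‖z.2.2‖ * (K * (1 + ‖z.2.2‖))) := by
              gcongr
              refine (abs_real_inner_le_norm _ _).trans ?_
              gcongr
              exact ((norm_snd_le _).trans (norm_snd_le _)).trans hL1
          _ = K * (z.1 * ‖z.2.2‖ * (1 + ‖z.2.2‖)) := by ring
          _ ≤ K * (C * (1 + energyDensity a γ z)) := by gcongr
          _ = _ := by ring
      have t2 : |pressure a γ (z.1 * z.2.1) * velDiv (S' p)|
          ≤ C * (d * K) * (1 + energyDensity a γ z) := by
        rw [abs_mul, abs_of_nonneg (hp0 z hz)]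
        calc pressure a γ (z.1 * z.2.1) * |velDiv (S' p)|
            ≤ (C * (1 + energyDensity a γ z)) * (d * K) :=
              mul_le_mul m4 ((abs_velDiv_le _).trans (by gcongr)) (abs_nonneg _)
                ((hp0 z hz).trans m4)
          _ = _ := by ring
      rw [Real.norm_eq_abs]
      refine (abs_add_le _ _).trans ?_
      rw [add_mul]
      exact add_le_add t1 t2)
  refine ⟨h1.1, ?_, h1.2.1⟩
  rw [ae_all_iff]
  intro i
  rw [ae_all_iff]
  intro j
  have hmp' : Measurable fun q : ℝ × Phase d => pressure a γ (q.2.1 * q.2.2.1) :=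
    (measurable_pressure a γ).comp measurable_snd
  refine (moment_of_bound hadm hen hb (w := fun _ => (0 : ℝ)) (g := fun _ z =>
    z.1 * z.2.2 i * z.2.2 j + if i = j then pressure a γ (z.1 * z.2.1) else 0) (C := C + C)
    aestronglyMeasurable_const ?_ ?_).1
  · unfold Function.uncurry
    by_cases hij : i = j
    · simp only [hij, if_true]; fun_prop
    · simp only [hij, if_false]; fun_prop
  · refine Filter.Eventually.of_forall fun p z hz => ?_
    obtain ⟨-, -, m3, m4⟩ := hmb z hz
    have hz1 := hz.1
    have hp := hp0 z hz
    rw [Real.norm_eq_abs, add_mul]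
    refine (abs_add_le _ _).trans (add_le_add ?_ ?_)
    · have hi : |z.2.2 i| ≤ ‖z.2.2‖ := by simpa using PiLp.norm_apply_le z.2.2 i
      have hj : |z.2.2 j| ≤ ‖z.2.2‖ := by simpa using PiLp.norm_apply_le z.2.2 j
      rw [abs_mul, abs_mul, abs_of_nonneg hz1]
      calc z.1 * |z.2.2 i| * |z.2.2 j| ≤ z.1 * ‖z.2.2‖ * ‖z.2.2‖ := by gcongr
        _ ≤ z.1 * ‖z.2.2‖ * (1 + ‖z.2.2‖) := by gcongr; linarith
        _ ≤ _ := m3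
    · split_ifs
      · rw [abs_of_nonneg hp]; exact m4
      · rw [abs_zero]; exact hp.trans m4

variable {μ lam : ℝ} {ρ₀ θ₀ : Space d → ℝ} {u₀ : Space d → Space d}
  {Du : ℝ × Space d → Space d →L[ℝ] Space d} {𝔈 : Kernel ℝ (Space d)}
  {𝔇 : Measure (ℝ × Space d)} {ℜ : ℝ → Fin d → Fin d → SignedMeasure (Space d)}
  {S : ℝ × Space d → Phase d} {S' : ℝ × Space d → (ℝ × Space d) →L[ℝ] Phase d}

theorem integrableOn_comp_slice (hb : Bornology.IsBounded Ω)
    (hS : IsC1OnClosure T Ω S S') (hpos : ∀ p ∈ cylClosure T Ω, S p ∈ posStates d)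
    {f : Phase d → ℝ} (hf : ContinuousOn f (posStates d)) {t : ℝ} (ht : t ∈ Icc 0 T) :
    IntegrableOn (fun x => f (S (t, x))) Ω := by
  have h1 : ContinuousOn (fun x => f (S (t, x))) (closure Ω) :=
    hf.comp (continuousOn_slice hS.continuousOn ht) fun x hx => hpos _ ⟨ht, hx⟩
  exact (h1.integrableOn_compact hb.isCompact_closure).mono_set subset_closure

/-- The initial values of the tested relations add up to the relative energy of the initial state
with respect to itself. -/
theorem initial_relEnergy (hγ : 1 < γ) (hΩ : IsOpen Ω) (hb : Bornology.IsBounded Ω)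
    (hT : 0 < T) (hS : IsC1OnClosure T Ω S S')
    (hpos : ∀ p ∈ cylClosure T Ω, S p ∈ posStates d)
    (hinit : ∀ᵐ x ∂(volume.restrict Ω), S (0, x) = (ρ₀ x, θ₀ x, u₀ x))
    {m : Space d → Space d} {r : Space d → ℝ}
    (hm : ∀ᵐ x ∂(volume.restrict Ω), m x = ρ₀ x • u₀ x)
    (hr : ∀ᵐ x ∂(volume.restrict Ω), r x = ρ₀ x) :
    (∫ x in Ω, energyDensity a γ (ρ₀ x, θ₀ x, u₀ x)) - (∫ x in Ω, inner ℝ (m x) (S (0, x)).2.2)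
      + (∫ x in Ω, r x * densityCoef a γ (S (0, x)))
      - (∫ x in Ω, ρ₀ x * Real.log (θ₀ x) * entropyCoef a γ (S (0, x)))
      + (∫ x in Ω, statePressure a γ (S (0, x))) = 0 := by
  have h0 : (0 : ℝ) ∈ Icc 0 T := ⟨le_rfl, hT.le⟩
  have cφ : ContinuousOn (densityCoef (d := d) a γ) (posStates d) := fun y hy =>
    (hasFDerivAt_densityCoef a hγ hy).continuousAt.continuousWithinAt
  have cb : ContinuousOn (entropyCoef (d := d) a γ) (posStates d) := fun y hy =>
    (hasFDerivAt_entropyCoef a hγ hy).continuousAt.continuousWithinAt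
  have cp : ContinuousOn (statePressure (d := d) a γ) (posStates d) := fun y hy =>
    (hasFDerivAt_statePressure a γ hy).continuousAt.continuousWithinAt
  have ce : ContinuousOn (energyDensity (d := d) a γ) (posStates d) := by
    unfold energyDensity pressurePot
    refine ContinuousOn.add (by fun_prop) (continuousOn_const.mul
      (ContinuousOn.rpow_const (by fun_prop) fun y hy => Or.inl (mul_pos hy.1 hy.2).ne'))
  have cl := continuousOn_log_temperature (d := d)
  have ie := integrableOn_comp_slice hb hS hpos ce h0
  have im := integrableOn_comp_slice hb hS hpos
    (f := fun y => y.1 * inner ℝ y.2.2 y.2.2) (by fun_prop) h0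
  have ir := integrableOn_comp_slice hb hS hpos
    (f := fun y => y.1 * densityCoef a γ y) (by fun_prop) h0
  have is := integrableOn_comp_slice hb hS hpos
    (f := fun y => y.1 * Real.log y.2.1 * entropyCoef a γ y) (by fun_prop) h0
  have ip := integrableOn_comp_slice hb hS hpos cp h0
  have e1 : ∫ x in Ω, energyDensity a γ (ρ₀ x, θ₀ x, u₀ x)
      = ∫ x in Ω, energyDensity a γ (S (0, x)) :=
    integral_congr_ae (by filter_upwards [hinit] with x hx; rw [hx])
  have e2 : ∫ x in Ω, inner ℝ (m x) (S (0, x)).2.2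
      = ∫ x in Ω, (S (0, x)).1 * inner ℝ (S (0, x)).2.2 (S (0, x)).2.2 :=
    integral_congr_ae (by
      filter_upwards [hinit, hm] with x hx hx'
      rw [hx, hx', real_inner_smul_left])
  have e3 : ∫ x in Ω, r x * densityCoef a γ (S (0, x))
      = ∫ x in Ω, (S (0, x)).1 * densityCoef a γ (S (0, x)) :=
    integral_congr_ae (by
      filter_upwards [hinit, hr] with x hx hx'
      rw [hx, hx'])
  have e4 : ∫ x in Ω, ρ₀ x * Real.log (θ₀ x) * entropyCoef a γ (S (0, x))
      = ∫ x in Ω, (S (0, x)).1 * Real.log (S (0, x)).2.1 * entropyCoef a γ (S (0, x)) :=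
    integral_congr_ae (by
      filter_upwards [hinit] with x hx
      rw [hx])
  rw [e1, e2, e3, e4, ← integral_sub' ie im, ← integral_add' (ie.sub im) ir,
    ← integral_sub' ((ie.sub im).add ir) is, ← integral_add' (((ie.sub im).add ir).sub is) ip]
  have hz : ∀ x ∈ Ω, relEnergy a γ (S (0, x)) (S (0, x)) = 0 := fun x hx =>
    relEnergy_self hγ (hpos _ ⟨h0, subset_closure hx⟩)
  exact (setIntegral_congr_fun (g := fun _ => (0 : ℝ)) hΩ.measurableSet
    fun x hx => hz x hx).trans (by simp)

/-- The velocity gradient of a state. -/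
theorem IsC1OnClosure.velocity (hS : IsC1OnClosure T Ω S S') :
    IsC1OnClosure T Ω (fun p => (S p).2.2) (fun p => (velCLM d).comp (S' p)) :=
  hS.comp (O := univ) (mapsTo_univ _ _) (g := velCLM d) (g' := fun _ => velCLM d)
    (fun _ _ => (velCLM d).hasFDerivAt) continuousOn_const

theorem relEnergy_moment [IsMarkovKernel V] {c : ℝ} (ha : 0 < a) (hγ : 1 < γ) (hc : 0 < c)
    (hadm : ConcentratedOnAdm c T Ω V) (hen : MomentIntegrable T Ω V (energyDensity a γ))
    (hΩ : IsOpen Ω) (hb : Bornology.IsBounded Ω) (hS : IsC1OnClosure T Ω S S')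
    (hpos : ∀ p ∈ cylClosure T Ω, S p ∈ posStates d) :
    (∀ᵐ p ∂(volume.restrict (cyl T Ω)), Integrable (relEnergy a γ (S p)) (V p)) ∧
      IntegrableOn (fun p => ∫ z, relEnergy a γ (S p) z ∂V p) (cyl T Ω) := by
  obtain ⟨m, M, hm, hbox⟩ := exists_mem_stateBox hb hS.continuousOn hpos
  obtain ⟨C, hC, hbd⟩ := exists_relEnergy_bound (d := d) ha hγ hm M hc
  have hmc := (isOpen_cyl (T := T) hΩ).measurableSet
  have := moment_of_bound hadm hen hb (w := S) (g := relEnergy a γ) (C := C)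
    ((hS.continuousOn.mono cyl_subset_cylClosure).aestronglyMeasurable hmc)
    (measurable_relEnergy a γ) ((ae_restrict_mem hmc).mono fun p hp z hz =>
      hbd _ (hbox p (cyl_subset_cylClosure hp)) z hz)
  exact ⟨this.1, this.2.1⟩

theorem relIntegrand_moment [IsMarkovKernel V] {c C : ℝ}
    (hadm : ConcentratedOnAdm c T Ω V) (hen : MomentIntegrable T Ω V (energyDensity a γ))
    (hΩ : IsOpen Ω) (hb : Bornology.IsBounded Ω) (hS : IsC1OnClosure T Ω S S')
    (hbd : ∀ p ∈ cyl T Ω, ∀ z ∈ admStates d c,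
      ‖relIntegrand a γ (S p) (S' p) z‖ ≤ C * (1 + energyDensity a γ z)) :
    (∀ᵐ p ∂(volume.restrict (cyl T Ω)), Integrable (relIntegrand a γ (S p) (S' p)) (V p)) ∧
      IntegrableOn (fun p => ∫ z, relIntegrand a γ (S p) (S' p) z ∂V p) (cyl T Ω) ∧
      ∀ᵐ p ∂(volume.restrict (cyl T Ω)), ‖∫ z, relIntegrand a γ (S p) (S' p) z ∂V p‖
        ≤ C * (1 + ∫ z, energyDensity a γ z ∂V p) := by
  have hmc := (isOpen_cyl (T := T) hΩ).measurableSet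
  exact moment_of_bound hadm hen hb (w := fun p => (S p, S' p))
    (g := fun y z => relIntegrand a γ y.1 y.2 z) (C := C)
    (((hS.continuousOn.mono cyl_subset_cylClosure).aestronglyMeasurable hmc).prodMk
      ((hS.continuousOn_deriv.mono cyl_subset_cylClosure).aestronglyMeasurable hmc))
    (measurable_relIntegrand a γ) ((ae_restrict_mem hmc).mono fun p hp z hz => hbd p hp z hz)

/-- The relative energy inequality. -/
theorem IsDMVSolution.relEnergy_inequality (ha : 0 < a) (hγ : 1 < γ) (hΩ : IsOpen Ω)
    (hb : Bornology.IsBounded Ω) (hT : 0 < T)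
    (hV : IsDMVSolution a γ μ lam T Ω ρ₀ θ₀ u₀ V Du 𝔈 𝔇 ℜ) (hS : IsC1OnClosure T Ω S S')
    (hpos : ∀ p ∈ cylClosure T Ω, S p ∈ posStates d)
    (h0 : ∀ t ∈ Icc 0 T, ∀ x ∈ frontier Ω, (S (t, x)).2.2 = 0)
    (hinit : ∀ᵐ x ∂(volume.restrict Ω), S (0, x) = (ρ₀ x, θ₀ x, u₀ x)) :
    ∀ᵐ τ ∂(volume.restrict (Ioo 0 T)),
      (∫ x in Ω, ∫ z, relEnergy a γ (S (τ, x)) z ∂V (τ, x)) + (𝔈 τ).real (closure Ω)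
        + 𝔇.real (cylClosure τ Ω)
      ≤ (∫ p in cyl τ Ω, ((∫ z, relIntegrand a γ (S p) (S' p) z ∂V p)
          - frob (stress μ lam (gradMat (Du p))) (gradMat (Du p - velGrad (S' p)))))
        - ∫ t in Ioo 0 τ, matrixPairing (fun x => gradMat (velGrad (S' (t, x)))) (ℜ t) := by
  have := hV.markov
  obtain ⟨c, hc, hsupp⟩ := hV.support
  have hadm := concentratedOnAdm_of_support hsupp
  obtain ⟨-, hDu, hen, henergy⟩ := hV.energy
  obtain ⟨r, hr, -, hr0, hcont⟩ := hV.continuity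
  obtain ⟨m, hm, -, hm0, hmom⟩ := hV.momentum
  obtain ⟨C, hC, hmb⟩ := exists_moment_bound (d := d) ha hγ hc
  have hmc : MeasurableSet (cyl T Ω) := (isOpen_cyl hΩ).measurableSet
  have hU := hS.velocity
  have hφ := hS.comp hpos (fun y hy => hasFDerivAt_densityCoef a hγ hy)
    (continuousOn_densityCoefDeriv a γ)
  have hβ := hS.comp hpos (fun y hy => hasFDerivAt_entropyCoef a hγ hy)
    (continuousOn_entropyCoefDeriv a γ)
  have hπ := hS.comp hpos (fun y hy => hasFDerivAt_statePressure a γ hy)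
    (continuousOn_statePressureDeriv a γ)
  have bρ : ∀ z ∈ admStates d c, |z.1| * (1 + ‖z.2.2‖) ≤ C * (1 + energyDensity a γ z) :=
    fun z hz => by rw [abs_of_nonneg hz.1]; exact (hmb z hz).1
  have bs : ∀ z ∈ admStates d c, |z.1 * Real.log z.2.1| * (1 + ‖z.2.2‖)
      ≤ C * (1 + energyDensity a γ z) :=
    fun z hz => by rw [abs_mul, abs_of_nonneg hz.1]; exact (hmb z hz).2.1
  have ms : Measurable fun z : Phase d => z.1 * Real.log z.2.1 := by fun_prop
  -- the moments in the equations
  obtain ⟨iAc, IAc⟩ := linear_moment hadm hen hΩ hb measurable_fst bρ hφ.continuousOn_deriv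
  obtain ⟨iAe, IAe⟩ := linear_moment hadm hen hΩ hb ms bs hβ.continuousOn_deriv
  obtain ⟨iAm, iflux, IAm⟩ := momentumFlux_moment ha hγ hc hadm hen hΩ hb hS
  -- With a form `ℓ` that sees only the time component, `ℓ (1, u)` is the coefficient itself, so the
  -- same lemma covers the terms evaluated at a fixed time. The momentum term is obtained likewise
  -- with `ℓ (1, u) = ⟨U, u⟩`.
  obtain ⟨iTc, ITc⟩ := linear_moment hadm hen hΩ hb measurable_fst bρ
    (ℓ := fun p => densityCoef a γ (S p) • ContinuousLinearMap.fst ℝ ℝ (Space d))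
    (hφ.continuousOn.smul continuousOn_const)
  obtain ⟨iTe, ITe⟩ := linear_moment hadm hen hΩ hb ms bs
    (ℓ := fun p => entropyCoef a γ (S p) • ContinuousLinearMap.fst ℝ ℝ (Space d))
    (hβ.continuousOn.smul continuousOn_const)
  obtain ⟨iTm, ITm⟩ := linear_moment hadm hen hΩ hb measurable_fst bρ
    (ℓ := fun p => (innerSL ℝ (S p).2.2).comp (ContinuousLinearMap.snd ℝ ℝ (Space d)))
    (((innerSL ℝ).continuous.comp_continuousOn hU.continuousOn).clm_comp continuousOn_const)
  simp only [FunLike.coe_smul, ContinuousLinearMap.coe_fst', Pi.smul_apply, smul_eq_mul,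
    mul_one, ContinuousLinearMap.comp_apply, ContinuousLinearMap.coe_snd', innerSL_apply_apply]
    at iTc ITc iTe ITe iTm ITm
  have hDU := (hU.memL2W12Zero hΩ hb h0).2.1
  have IF1 := integrable_frob_stress μ lam hDu.2.1 hDu.2.1
  have IF2 := integrable_frob_stress μ lam hDu.2.1 hDU
  have Iπ : IntegrableOn (fun p => statePressureDeriv a γ (S p) (S' p (1, 0))) (cyl T Ω) := by
    have h1 : ContinuousOn (fun p => statePressureDeriv a γ (S p) (S' p (1, 0)))
        (cylClosure T Ω) := hπ.continuousOn_deriv.clm_apply continuousOn_const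
    exact (h1.integrableOn_compact (isCompact_cylClosure hb)).mono_set cyl_subset_cylClosure
  -- the moments of the relative energy and of the integrand
  have hrel : ∀ᵐ p ∂(volume.restrict (cyl T Ω)), ∫ z, relEnergy a γ (S p) z ∂V p
      = (∫ z, energyDensity a γ z ∂V p) - (∫ z, z.1 * inner ℝ (S p).2.2 z.2.2 ∂V p)
        + (∫ z, z.1 * densityCoef a γ (S p) ∂V p)
        - (∫ z, z.1 * Real.log z.2.1 * entropyCoef a γ (S p) ∂V p) + statePressure a γ (S p) := by
    filter_upwards [hen.1, iTm, iTc, iTe] with p p1 p2 p3 p4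
    rw [← integral_sub' p1 p2.2.2, ← integral_add' (p1.sub p2.2.2) p3.2.2,
      ← integral_sub' ((p1.sub p2.2.2).add p3.2.2) p4.2.2]
    have : statePressure a γ (S p) = ∫ _, statePressure a γ (S p) ∂V p := by simp
    rw [this, ← integral_add' (((p1.sub p2.2.2).add p3.2.2).sub p4.2.2) (integrable_const _)]
    refine integral_congr_ae (Filter.Eventually.of_forall fun z => ?_)
    simp only [relEnergy, real_inner_comm z.2.2, Pi.add_apply, Pi.sub_apply]
  have hint : ∀ᵐ p ∂(volume.restrict (cyl T Ω)), ∫ z, relIntegrand a γ (S p) (S' p) z ∂V p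
      = -(∫ z, (z.1 * inner ℝ z.2.2 (S' p (1, z.2.2)).2.2
          + pressure a γ (z.1 * z.2.1) * velDiv (S' p)) ∂V p)
        + (∫ z, z.1 * ((densityCoefDeriv a γ (S p)).comp (S' p)) (1, z.2.2) ∂V p)
        - (∫ z, z.1 * Real.log z.2.1
            * ((entropyCoefDeriv a γ (S p)).comp (S' p)) (1, z.2.2) ∂V p)
        + statePressureDeriv a γ (S p) (S' p (1, 0)) := by
    filter_upwards [iAm, iAc, iAe] with p p2 p3 p4
    rw [← integral_neg', ← integral_add' p2.neg p3.2.2, ← integral_sub' (p2.neg.add p3.2.2) p4.2.2]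
    have : statePressureDeriv a γ (S p) (S' p (1, 0))
      = ∫ _, statePressureDeriv a γ (S p) (S' p (1, 0)) ∂V p := by simp
    rw [this, ← integral_add' ((p2.neg.add p3.2.2).sub p4.2.2) (integrable_const _)]
    refine integral_congr_ae (Filter.Eventually.of_forall fun z => ?_)
    simp only [relIntegrand, Pi.add_apply, Pi.sub_apply, Pi.neg_apply,
      ContinuousLinearMap.comp_apply]
    simp
    ring
  have hAc : ∀ᵐ p ∂(volume.restrict (cyl T Ω)),
      (∫ z, z.1 * ((densityCoefDeriv a γ (S p)).comp (S' p)) (1, z.2.2) ∂V p)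
        = (∫ z, z.1 ∂V p) * ((densityCoefDeriv a γ (S p)).comp (S' p)) (1, 0)
          + spatial ((densityCoefDeriv a γ (S p)).comp (S' p)) (∫ z, z.1 • z.2.2 ∂V p) := by
    filter_upwards [iAc] with p p1 using integral_pairing p1.1 p1.2.1 _
  have hAe : ∀ᵐ p ∂(volume.restrict (cyl T Ω)),
      (∫ z, z.1 * Real.log z.2.1 * ((entropyCoefDeriv a γ (S p)).comp (S' p)) (1, z.2.2) ∂V p)
        = (∫ z, z.1 * Real.log z.2.1 ∂V p) * ((entropyCoefDeriv a γ (S p)).comp (S' p)) (1, 0)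
          + spatial ((entropyCoefDeriv a γ (S p)).comp (S' p))
            (∫ z, (z.1 * Real.log z.2.1) • z.2.2 ∂V p) := by
    filter_upwards [iAe] with p p1 using integral_pairing p1.1 p1.2.1 _
  have hAm : ∀ᵐ p ∂(volume.restrict (cyl T Ω)),
      (∫ z, (z.1 * inner ℝ z.2.2 (S' p (1, z.2.2)).2.2
          + pressure a γ (z.1 * z.2.1) * velDiv (S' p)) ∂V p)
        = inner ℝ (∫ z, z.1 • z.2.2 ∂V p) (((velCLM d).comp (S' p)) (1, 0))
          + frob (momentumFlux a γ V p) (gradMat (spatial ((velCLM d).comp (S' p)))) := by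
    filter_upwards [iAc, iflux] with p p1 p2 using integral_momentum_pairing p1.2.1 p2 _
  -- the values at time `τ`
  have hTm : ∀ᵐ p ∂(volume.restrict (cyl T Ω)),
      inner ℝ (m p.1 p.2) (S p).2.2 = ∫ z, z.1 * inner ℝ (S p).2.2 z.2.2 ∂V p := by
    filter_upwards [hm, iTm] with p p1 p2
    rw [p1, real_inner_comm, ← integral_inner p2.2.1]
    simp only [real_inner_smul_right]
  have hTc : ∀ᵐ p ∂(volume.restrict (cyl T Ω)),
      r p.1 p.2 * densityCoef a γ (S p) = ∫ z, z.1 * densityCoef a γ (S p) ∂V p := by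
    filter_upwards [hr] with p p1
    rw [p1, integral_mul_const]
  have hTe : ∀ p, (∫ z, z.1 * Real.log z.2.1 ∂V p) * entropyCoef a γ (S p)
      = ∫ z, z.1 * Real.log z.2.1 * entropyCoef a γ (S p) ∂V p := fun p => by
    rw [integral_mul_const]
  -- The entropy balance is an inequality, so its multiplier must be non-negative. The entropy
  -- enters `relEnergy` with a minus sign, which matches the direction of that inequality.
  have hβ0 : ∀ p ∈ cylClosure T Ω, 0 ≤ entropyCoef a γ (S p) := by
    intro p hp
    have h1 := (hpos p hp).1
    have h2 := (hpos p hp).2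
    have h3 : 0 < γ - 1 := by linarith
    unfold entropyCoef pressureSlope
    positivity
  have hent := hV.entropy _ _ (hβ.isW1Inf hΩ hb) hβ0
  have hbr := initial_relEnergy (a := a) hγ hΩ hb hT hS hpos hinit hm0 hr0
  filter_upwards [henergy, hent, ae_restrict_mem measurableSet_Ioo, ae_ae_of_ae_cyl hrel,
    ae_ae_of_ae_cyl hTm, ae_ae_of_ae_cyl hTc, integrable_slice hen.2, integrable_slice ITm,
    integrable_slice ITc, integrable_slice ITe] with τ q1 q2 hτ q4 q5 q6 q7 q8 q9 q10
  have hτ' : τ ∈ Icc 0 T := Ioo_subset_Icc_self hτ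
  have q3 := hcont τ hτ' _ _ (hφ.isW1Inf hΩ hb)
  have q11 := hmom τ hτ' _ _ hU h0
  have q12 := hπ.integral_sub_eq hΩ hb hτ
  have cp : ContinuousOn (statePressure (d := d) a γ) (posStates d) := fun y hy =>
    (hasFDerivAt_statePressure a γ hy).continuousAt.continuousWithinAt
  have ip := integrableOn_comp_slice hb hS hpos cp hτ'
  have hsub : cyl τ Ω ⊆ cyl T Ω := cyl_mono hτ.2.le
  have cg : ∀ {f g : ℝ × Space d → ℝ}, (∀ᵐ p ∂(volume.restrict (cyl T Ω)), f p = g p) →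
      ∫ p in cyl τ Ω, f p = ∫ p in cyl τ Ω, g p := fun h =>
    integral_congr_ae (ae_restrict_of_ae_restrict_of_subset hsub h)
  rw [integral_congr_ae q5] at q11
  rw [integral_congr_ae q6, ← cg hAc] at q3
  rw [← cg hAe] at q2
  simp only [hTe] at q2
  have e1 : ∫ x in Ω, ∫ z, relEnergy a γ (S (τ, x)) z ∂V (τ, x)
      = (∫ x in Ω, ∫ z, energyDensity a γ z ∂V (τ, x))
        - (∫ x in Ω, ∫ z, z.1 * inner ℝ (S (τ, x)).2.2 z.2.2 ∂V (τ, x))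
        + (∫ x in Ω, ∫ z, z.1 * densityCoef a γ (S (τ, x)) ∂V (τ, x))
        - (∫ x in Ω, ∫ z, z.1 * Real.log z.2.1 * entropyCoef a γ (S (τ, x)) ∂V (τ, x))
        + (∫ x in Ω, statePressure a γ (S (τ, x))) := by
    rw [integral_congr_ae q4]
    rw [← integral_sub' q7 q8, ← integral_add' (q7.sub q8) q9,
      ← integral_sub' ((q7.sub q8).add q9) q10,
      ← integral_add' (((q7.sub q8).add q9).sub q10) ip]
    rfl
  have e2 : (∫ p in cyl τ Ω, ((∫ z, relIntegrand a γ (S p) (S' p) z ∂V p)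
          - frob (stress μ lam (gradMat (Du p))) (gradMat (Du p - velGrad (S' p)))))
      = -(∫ p in cyl τ Ω, ∫ z, (z.1 * inner ℝ z.2.2 (S' p (1, z.2.2)).2.2
          + pressure a γ (z.1 * z.2.1) * velDiv (S' p)) ∂V p)
        + (∫ p in cyl τ Ω, ∫ z, z.1 * ((densityCoefDeriv a γ (S p)).comp (S' p)) (1, z.2.2) ∂V p)
        - (∫ p in cyl τ Ω, ∫ z, z.1 * Real.log z.2.1
            * ((entropyCoefDeriv a γ (S p)).comp (S' p)) (1, z.2.2) ∂V p)
        + (∫ p in cyl τ Ω, statePressureDeriv a γ (S p) (S' p (1, 0)))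
        - (∫ p in cyl τ Ω, frob (stress μ lam (gradMat (Du p))) (gradMat (Du p)))
        + (∫ p in cyl τ Ω, frob (stress μ lam (gradMat (Du p)))
            (gradMat (spatial ((velCLM d).comp (S' p))))) := by
    have i1 := IAm.mono_set hsub
    have i2 := IAc.mono_set hsub
    have i3 := IAe.mono_set hsub
    have i4 := Iπ.mono_set hsub
    have i5 := IntegrableOn.mono_set (t := cyl T Ω) IF1 hsub
    have i6 := IntegrableOn.mono_set (t := cyl T Ω) IF2 hsub
    rw [← integral_neg', ← integral_add' i1.neg i2, ← integral_sub' (i1.neg.add i2) i3,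
      ← integral_add' ((i1.neg.add i2).sub i3) i4,
      ← integral_sub' (((i1.neg.add i2).sub i3).add i4) i5,
      ← integral_add' ((((i1.neg.add i2).sub i3).add i4).sub i5) i6]
    refine cg ?_
    filter_upwards [hint] with p hp
    rw [hp, frob_stress_sub]
    simp only [Pi.add_apply, Pi.sub_apply, Pi.neg_apply, velGrad]
    ring
  have e3 := cg hAm
  have e4 : ∫ p in cyl τ Ω, (inner ℝ (∫ z, z.1 • z.2.2 ∂V p) (((velCLM d).comp (S' p)) (1, 0))
              + frob (momentumFlux a γ V p) (gradMat (spatial ((velCLM d).comp (S' p)))))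
      = ∫ p in cyl τ Ω, (∫ z, (z.1 * inner ℝ z.2.2 (S' p (1, z.2.2)).2.2
          + pressure a γ (z.1 * z.2.1) * velDiv (S' p)) ∂V p) := e3.symm
  rw [e4] at q11
  -- The inequality is the sum of the energy inequality, minus the momentum equation tested with the
  -- reference velocity, plus the continuity equation tested with `densityCoef`, minus the entropy
  -- inequality tested with `entropyCoef`, plus the fundamental theorem of calculus for the
  -- reference pressure. The initial values cancel by `hbr`.
  rw [e1, e2]
  simp only [ContinuousLinearMap.comp_apply] at q12 q11 q3 q2 hbr ⊢
  simp only [velGrad]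
  linarith

end RelativeEnergyInequality

end PotTempNS

namespace PotTempNS

/-! ### Consequences of the equations of a strong solution -/

section Strong

variable {d : ℕ}

theorem map_eq_sum_single {F : Type*} [NormedAddCommGroup F] [NormedSpace ℝ F]
    (A : (ℝ × Space d) →L[ℝ] F) (v : Space d) :
    A (0, v) = ∑ j, v j • A (0, EuclideanSpace.single j 1) := by
  have h : v = ∑ j, v j • EuclideanSpace.single j (1 : ℝ) := by
    ext i; simp [Finset.sum_apply, Pi.single_apply]
  have h2 : A (0, v) = spatial A v := by simp [spatial]
  rw [h2]
  conv_lhs => rw [h]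
  rw [map_sum]
  simp [spatial]

theorem map_one_eq {F : Type*} [NormedAddCommGroup F] [NormedSpace ℝ F]
    (A : (ℝ × Space d) →L[ℝ] F) (v : Space d) :
    A (1, v) = A (1, 0) + ∑ j, v j • A (0, EuclideanSpace.single j 1) := by
  rw [← map_eq_sum_single, ← map_add]
  simp

/-- The equations of motion of a strong solution in non-conservative form. -/
theorem strong_equations {a γ : ℝ} {ρ θ : ℝ × Space d → ℝ} {u : ℝ × Space d → Space d}
    {p : ℝ × Space d} {ρ' θ' : (ℝ × Space d) →L[ℝ] ℝ} {u' : (ℝ × Space d) →L[ℝ] Space d}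
    (hρ : HasFDerivAt ρ ρ' p) (hθ : HasFDerivAt θ θ' p) (hu : HasFDerivAt u u' p)
    (hpos : 0 < ρ p ∧ 0 < θ p)
    (h1 : dt ρ p + ∑ j, dx j (fun q => ρ q * u q j) p = 0)
    (h2 : dt (fun q => ρ q * θ q) p + ∑ j, dx j (fun q => ρ q * θ q * u q j) p = 0) :
    ρ' (1, u p) = -(ρ p * velDiv (ρ'.prod (θ'.prod u'))) ∧ θ' (1, u p) = 0 ∧
    ∀ f : Space d, (∀ i, dt (fun q => ρ q * u q i) p + ∑ j, dx j (fun q => ρ q * u q i * u q j) p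
        + dx i (fun q => pressure a γ (ρ q * θ q)) p = f i) →
      ∀ v, ρ p * inner ℝ (u' (1, u p)) v
        + statePressureDeriv a γ (ρ p, θ p, u p) ((ρ'.prod (θ'.prod u')) (0, v)) = inner ℝ f v := by
  have hui : ∀ i, HasFDerivAt (fun q => u q i) ((EuclideanSpace.proj i).comp u') p := fun i =>
    (EuclideanSpace.proj (𝕜 := ℝ) i).hasFDerivAt.comp p hu
  have hdiv : velDiv (ρ'.prod (θ'.prod u')) = ∑ j, u' (0, EuclideanSpace.single j 1) j := rfl
  set D := ∑ j, u' (0, EuclideanSpace.single j 1) j with hD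
  have e1 : ∀ j, dx j (fun q => ρ q * u q j) p
      = u p j * ρ' (0, EuclideanSpace.single j 1)
        + ρ p * u' (0, EuclideanSpace.single j 1) j := by
    intro j
    rw [dx, (hρ.fun_mul (hui j)).fderiv]
    simp
    ring
  have e2 : ∀ j, dx j (fun q => ρ q * θ q * u q j) p
      = θ p * (u p j * ρ' (0, EuclideanSpace.single j 1)
        + ρ p * u' (0, EuclideanSpace.single j 1) j)
        + ρ p * (u p j * θ' (0, EuclideanSpace.single j 1)) := by
    intro j
    rw [dx, ((hρ.fun_mul hθ).fun_mul (hui j)).fderiv]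
    simp
    ring
  have e3 : dt (fun q => ρ q * θ q) p = θ p * ρ' (1, 0) + ρ p * θ' (1, 0) := by
    rw [dt, (hρ.fun_mul hθ).fderiv]
    simp
    ring
  have e0 : dt ρ p = ρ' (1, 0) := by rw [dt, hρ.fderiv]
  have k1 : ρ' (1, u p) = -(ρ p * D) := by
    rw [map_one_eq]
    simp only [e0, e1, Finset.sum_add_distrib, ← Finset.mul_sum, ← hD] at h1
    simp only [smul_eq_mul]
    linarith
  have hr := hpos.1
  have hΘ := hpos.2
  -- Subtracting `θ` times the continuity equation from the potential temperature equation leaves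
  -- `ρ` times the material derivative of `θ`.
  have k2 : θ' (1, u p) = 0 := by
    have h3 : ρ p * θ' (1, u p) = 0 := by
      rw [map_one_eq] at k1 ⊢
      simp only [e3, e2, Finset.sum_add_distrib, ← Finset.mul_sum, ← hD] at h2
      simp only [smul_eq_mul] at k1 ⊢
      have : ∑ j, u p j * ρ' (0, EuclideanSpace.single j 1) = -(ρ p * D) - ρ' (1, 0) := by
        linarith
      rw [this] at h2
      linarith
    exact (mul_eq_zero.1 h3).resolve_left hr.ne'
  refine ⟨k1, k2, fun f hf v => ?_⟩
  have e4 : ∀ i, dt (fun q => ρ q * u q i) p = u p i * ρ' (1, 0) + ρ p * u' (1, 0) i := by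
    intro i
    rw [dt, (hρ.fun_mul (hui i)).fderiv]
    simp
    ring
  have e5 : ∀ i j, dx j (fun q => ρ q * u q i * u q j) p
      = u p i * (u p j * ρ' (0, EuclideanSpace.single j 1)
        + ρ p * u' (0, EuclideanSpace.single j 1) j)
        + ρ p * (u p j * u' (0, EuclideanSpace.single j 1) i) := by
    intro i j
    rw [dx, ((hρ.fun_mul (hui i)).fun_mul (hui j)).fderiv]
    simp
    ring
  have hprod : HasFDerivAt (fun q => (ρ q, θ q, u q)) (ρ'.prod (θ'.prod u')) p :=
    hρ.prodMk (hθ.prodMk hu)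
  have hpp := (hasFDerivAt_statePressure a γ (y := (ρ p, θ p, u p)) ⟨hr, hΘ⟩).comp p hprod
  have e6 : ∀ i, dx i (fun q => pressure a γ (ρ q * θ q)) p
      = statePressureDeriv a γ (ρ p, θ p, u p)
        ((ρ'.prod (θ'.prod u')) (0, EuclideanSpace.single i 1)) := by
    intro i
    have : (fun q => pressure a γ (ρ q * θ q))
      = statePressure a γ ∘ fun q => (ρ q, θ q, u q) := rfl
    rw [dx, this, hpp.fderiv]
    rfl
  -- In the same way, `u i` times the continuity equation is subtracted from the momentum equation.
  have k3 : ∀ i, ρ p * u' (1, u p) i + statePressureDeriv a γ (ρ p, θ p, u p)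
      ((ρ'.prod (θ'.prod u')) (0, EuclideanSpace.single i 1)) = f i := by
    intro i
    have h3 := hf i
    simp only [e4, e5, e6, Finset.sum_add_distrib, ← Finset.mul_sum, ← hD] at h3
    have h4 : u' (1, u p) i = u' (1, 0) i + ∑ j, u p j * u' (0, EuclideanSpace.single j 1) i := by
      rw [map_one_eq]
      simp
    rw [map_one_eq] at k1
    simp only [smul_eq_mul] at k1
    have : ∑ j, u p j * ρ' (0, EuclideanSpace.single j 1) = -(ρ p * D) - ρ' (1, 0) := by
      linarith
    rw [this] at h3
    rw [h4]
    linarith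
  have h5 : statePressureDeriv a γ (ρ p, θ p, u p) ((ρ'.prod (θ'.prod u')) (0, v))
      = ∑ i, v i * statePressureDeriv a γ (ρ p, θ p, u p)
        ((ρ'.prod (θ'.prod u')) (0, EuclideanSpace.single i 1)) := by
    have := map_eq_sum_single
      ((statePressureDeriv a γ (ρ p, θ p, u p)).comp (ρ'.prod (θ'.prod u'))) v
    simpa only [ContinuousLinearMap.comp_apply, smul_eq_mul] using this
  rw [h5, PiLp.inner_apply, PiLp.inner_apply, Finset.mul_sum, ← Finset.sum_add_distrib]
  refine Finset.sum_congr rfl fun i _ => ?_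
  simp only [RCLike.inner_apply, conj_trivial]
  rw [← k3 i]
  ring

/-- The vector `div 𝕊(∇u)`, computed from the second derivative of `u`. -/
noncomputable def divStressVec (μ lam : ℝ) (H : Space d →L[ℝ] Space d →L[ℝ] Space d) : Space d :=
  WithLp.toLp 2 fun i => divStress μ lam H i

/-- The linear map to the `(i, j)` entry of the stress tensor. -/
noncomputable def stressEntry (μ lam : ℝ) (i j : Fin d) : (Space d →L[ℝ] Space d) →L[ℝ] ℝ :=
  LinearMap.toContinuousLinearMap
    { toFun := fun A => stress μ lam (gradMat A) i j
      map_add' := fun A B => by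
        simp [stress, gradMat, Matrix.trace, Finset.sum_add_distrib]
        ring
      map_smul' := fun c A => by
        simp [stress, gradMat, Matrix.trace, ← Finset.mul_sum]
        ring }

theorem stressEntry_apply (μ lam : ℝ) (i j : Fin d) (A : Space d →L[ℝ] Space d) :
    stressEntry μ lam i j A = stress μ lam (gradMat A) i j := rfl

theorem exists_norm_divStressVec_le (d : ℕ) (μ lam : ℝ) : ∃ C : ℝ, 0 ≤ C ∧
    ∀ H : Space d →L[ℝ] Space d →L[ℝ] Space d, ‖divStressVec μ lam H‖ ≤ C * ‖H‖ := by
  refine ⟨∑ i : Fin d, ∑ j : Fin d, ‖stressEntry μ lam i j‖, by positivity, fun H => ?_⟩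
  have h1 : ‖divStressVec μ lam H‖ ≤ ∑ i, |divStressVec μ lam H i| := by
    have h : divStressVec μ lam H = ∑ j, divStressVec μ lam H j • EuclideanSpace.single j (1 : ℝ) := by
      ext i; simp [Finset.sum_apply, Pi.single_apply]
    conv_lhs => rw [h]
    refine (norm_sum_le _ _).trans (Finset.sum_le_sum fun i _ => ?_)
    rw [norm_smul]
    simp
  refine h1.trans ?_
  rw [Finset.sum_mul]
  refine Finset.sum_le_sum fun i _ => ?_
  rw [Finset.sum_mul]
  have e : divStressVec μ lam H i = ∑ j, stressEntry μ lam i j (H (EuclideanSpace.single j 1)) :=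
    rfl
  rw [e]
  refine (Finset.abs_sum_le_sum_abs _ _).trans (Finset.sum_le_sum fun j _ => ?_)
  refine ((stressEntry μ lam i j).le_opNorm _).trans ?_
  gcongr
  refine (H.le_opNorm _).trans_eq ?_
  simp

variable {Ω : Set (Space d)}

/-- Integration by parts for the viscous stress. -/
theorem MemW12Zero.integral_divStress {μ lam : ℝ} {q : Space d → Space d}
    {Dq A : Space d → Space d →L[ℝ] Space d} {H : Space d → Space d →L[ℝ] Space d →L[ℝ] Space d}
    (hq : MemW12Zero Ω q Dq) (hw : HasWeakDeriv Ω A H) (hA : MemLp A 2 (volume.restrict Ω))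
    (hHm : AEStronglyMeasurable H (volume.restrict Ω)) {K : ℝ}
    (hHK : ∀ᵐ x ∂(volume.restrict Ω), ‖H x‖ ≤ K) (hfin : IsFiniteMeasure (volume.restrict Ω)) :
    ∫ x in Ω, inner ℝ (divStressVec μ lam (H x)) (q x)
      = -∫ x in Ω, frob (stress μ lam (gradMat (A x))) (gradMat (Dq x)) := by
  have hA1 : IntegrableOn A Ω := hA.integrable (by norm_num)
  have hsA : ∀ i j, MemLp (fun x => stressEntry μ lam i j (A x)) 2 (volume.restrict Ω) :=
    fun i j => (stressEntry μ lam i j).comp_memLp' hA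
  have hsH : ∀ i j, MemLp (fun x => (stressEntry μ lam i j).comp (H x)) 2 (volume.restrict Ω) := by
    intro i j
    refine MemLp.of_bound (((ContinuousLinearMap.compL ℝ (Space d) (Space d →L[ℝ] Space d) ℝ)
      (stressEntry μ lam i j)).continuous.comp_aestronglyMeasurable hHm)
      (‖stressEntry μ lam i j‖ * K) ?_
    filter_upwards [hHK] with x hx
    exact (ContinuousLinearMap.opNorm_comp_le _ _).trans (by gcongr)
  have hibp : ∀ i j, ∫ x in Ω, gradMat (Dq x) i j * stressEntry μ lam i j (A x)
      = -∫ x in Ω, q x i * stressEntry μ lam i j (H x (EuclideanSpace.single j 1)) := by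
    intro i j
    have := hq.integral_mul_weakDeriv (hw.clm_comp hA1 (Integrable.of_bound hHm K hHK) (stressEntry μ lam i j)) (hsA i j)
      (hsH i j) (EuclideanSpace.single j 1) i
    simp only [gradMat_apply]
    exact this
  have hI1 : ∀ i j, IntegrableOn (fun x => gradMat (Dq x) i j * stressEntry μ lam i j (A x)) Ω := by
    intro i j
    exact ((gradEntry i j).comp_memLp' hq.2.1).integrable_mul (hsA i j)
  have hI2 : ∀ i j, IntegrableOn
      (fun x => q x i * stressEntry μ lam i j (H x (EuclideanSpace.single j 1))) Ω := by
    intro i j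
    refine MemLp.integrable_mul (p := 2) (q := 2)
      ((EuclideanSpace.proj (𝕜 := ℝ) i).comp_memLp' hq.1) ?_
    exact ((ContinuousLinearMap.apply ℝ ℝ (EuclideanSpace.single j 1 : Space d)).comp_memLp'
      (hsH i j))
  have e1 : ∀ x, inner ℝ (divStressVec μ lam (H x)) (q x)
      = ∑ i, ∑ j, q x i * stressEntry μ lam i j (H x (EuclideanSpace.single j 1)) := by
    intro x
    simp only [PiLp.inner_apply, RCLike.inner_apply, conj_trivial, divStressVec, divStress,
      Finset.mul_sum]
    rfl
  have e2 : ∀ x, frob (stress μ lam (gradMat (A x))) (gradMat (Dq x))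
      = ∑ i, ∑ j, gradMat (Dq x) i j * stressEntry μ lam i j (A x) := by
    intro x
    simp only [frob, stressEntry_apply, mul_comm]
  simp only [e1, e2]
  rw [integral_finsetSum _ fun i _ => integrable_finsetSum _ fun j _ => hI2 i j,
    integral_finsetSum _ fun i _ => integrable_finsetSum _ fun j _ => hI1 i j,
    ← Finset.sum_neg_distrib]
  refine Finset.sum_congr rfl fun i _ => ?_
  rw [integral_finsetSum _ fun j _ => hI2 i j, integral_finsetSum _ fun j _ => hI1 i j,
    ← Finset.sum_neg_distrib]
  exact Finset.sum_congr rfl fun j _ => by rw [hibp, neg_neg]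

/-- The divergence `div(p u)` has vanishing mean. -/
theorem integral_pressure_div {a γ T : ℝ} (hΩ : IsOpen Ω) (hb : Bornology.IsBounded Ω)
    {S : ℝ × Space d → Phase d} {S' : ℝ × Space d → (ℝ × Space d) →L[ℝ] Phase d}
    (hS : IsC1OnClosure T Ω S S') (hpos : ∀ p ∈ cylClosure T Ω, S p ∈ posStates d)
    (h0 : ∀ t ∈ Icc 0 T, ∀ x ∈ frontier Ω, (S (t, x)).2.2 = 0) {t : ℝ} (ht : t ∈ Ioo 0 T) :
    IntegrableOn (fun x => statePressure a γ (S (t, x)) * velDiv (S' (t, x))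
      + statePressureDeriv a γ (S (t, x)) (S' (t, x) (0, (S (t, x)).2.2))) Ω ∧
    ∫ x in Ω, (statePressure a γ (S (t, x)) * velDiv (S' (t, x))
      + statePressureDeriv a γ (S (t, x)) (S' (t, x) (0, (S (t, x)).2.2))) = 0 := by
  have ht' := Ioo_subset_Icc_self ht
  have hfin : IsFiniteMeasure ((volume : Measure (Space d)).restrict Ω) :=
    ⟨by rw [Measure.restrict_apply_univ]; exact hb.measure_lt_top⟩
  have hU := hS.velocity.memW12Zero_slice hΩ hb h0 ht
  have hπ := hS.comp hpos (fun y hy => hasFDerivAt_statePressure a γ hy)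
    (continuousOn_statePressureDeriv a γ)
  have cF := continuousOn_slice hπ.continuousOn ht'
  have cG := continuousOn_slice (ContinuousOn.spatial hπ.continuousOn_deriv) ht'
  have hw : HasWeakDeriv Ω (fun x => statePressure a γ (S (t, x))) _ :=
    hasWeakDeriv_of_hasFDerivAt hΩ (fun x hx => hπ.hasFDerivAt_slice ht hx)
      (cG.mono subset_closure)
  have ml : ∀ {F : Type _} [NormedAddCommGroup F] [NormedSpace ℝ F] {f : Space d → F},
      ContinuousOn f (closure Ω) → MemLp f 2 (volume.restrict Ω) := by
    intro F _ _ f hf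
    obtain ⟨K, hK⟩ := hb.isCompact_closure.exists_bound_of_continuousOn hf
    exact MemLp.of_bound ((hf.mono subset_closure).aestronglyMeasurable hΩ.measurableSet) K
      ((ae_restrict_mem hΩ.measurableSet).mono fun x hx => hK x (subset_closure hx))
  have hF2 := ml cF
  have hG2 := ml cG
  have hibp := fun j => hU.integral_mul_weakDeriv hw hF2 hG2 (EuclideanSpace.single j 1) j
  have hG3 : ∀ j, MemLp (fun x => spatial ((statePressureDeriv a γ (S (t, x))).comp (S' (t, x)))
      (EuclideanSpace.single j 1)) 2 (volume.restrict Ω) := fun j =>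
    (ContinuousLinearMap.apply ℝ ℝ (EuclideanSpace.single j 1 : Space d)).comp_memLp' hG2
  have I1 : ∀ j, IntegrableOn (fun x => spatial ((velCLM d).comp (S' (t, x)))
      (EuclideanSpace.single j 1) j * statePressure a γ (S (t, x))) Ω := fun j =>
    MemLp.integrable_mul (p := 2) (q := 2) ((gradEntry j j).comp_memLp' hU.2.1) hF2
  have I2 : ∀ j, IntegrableOn (fun x => (S (t, x)).2.2 j *
      spatial ((statePressureDeriv a γ (S (t, x))).comp (S' (t, x)))
      (EuclideanSpace.single j 1)) Ω := fun j =>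
    MemLp.integrable_mul (p := 2) (q := 2) ((EuclideanSpace.proj (𝕜 := ℝ) j).comp_memLp' hU.1)
      (hG3 j)
  have e : ∀ x, statePressure a γ (S (t, x)) * velDiv (S' (t, x))
      + statePressureDeriv a γ (S (t, x)) (S' (t, x) (0, (S (t, x)).2.2))
      = ∑ j, (spatial ((velCLM d).comp (S' (t, x))) (EuclideanSpace.single j 1) j
          * statePressure a γ (S (t, x)) + (S (t, x)).2.2 j *
            spatial ((statePressureDeriv a γ (S (t, x))).comp (S' (t, x)))
              (EuclideanSpace.single j 1)) := by
    intro x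
    rw [Finset.sum_add_distrib, ← Finset.sum_mul, mul_comm]
    congr 1
    have := map_eq_sum_single ((statePressureDeriv a γ (S (t, x))).comp (S' (t, x)))
      (S (t, x)).2.2
    simpa only [ContinuousLinearMap.comp_apply, smul_eq_mul, spatial,
      ContinuousLinearMap.inr_apply] using this
  simp only [e]
  have I3 : ∀ j, IntegrableOn (fun x => spatial ((velCLM d).comp (S' (t, x)))
      (EuclideanSpace.single j 1) j * statePressure a γ (S (t, x)) + (S (t, x)).2.2 j *
        spatial ((statePressureDeriv a γ (S (t, x))).comp (S' (t, x)))
          (EuclideanSpace.single j 1)) Ω := fun j => (I1 j).add (I2 j)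
  refine ⟨integrable_finsetSum _ fun j _ => I3 j, ?_⟩
  rw [integral_finsetSum _ fun j _ => I3 j]
  -- Each `∂ⱼ(p Uⱼ)` integrates to zero on its own, the velocity being in `W₀^{1,2}`.
  refine Finset.sum_eq_zero fun j _ => ?_
  rw [integral_add (I1 j) (I2 j), hibp j]
  simp

end Strong

end PotTempNS

namespace PotTempNS

/-! ### Estimates of the defects -/

section Defects

variable {d : ℕ}

/-- The quadratic form on `eᵢ + eⱼ` and on `eᵢ - eⱼ` gives `2|Aᵢⱼ| ≤ Aᵢᵢ + Aⱼⱼ`, and each diagonal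
entry is at most the trace. -/
theorem abs_entry_le_trace {n : Type*} [Fintype n] [DecidableEq n] {A : Matrix n n ℝ}
    (hA : A.PosSemidef) (i j : n) : |A i j| ≤ A.trace := by
  have hd : ∀ k, 0 ≤ A k k := fun k => hA.diag_nonneg
  have htr : ∀ k, A k k ≤ A.trace := fun k =>
    Finset.single_le_sum (f := fun k => A k k) (fun k _ => hd k) (Finset.mem_univ k)
  have hsym : A j i = A i j := by
    have := hA.isHermitian.apply i j
    simpa using this
  have hq : ∀ s : ℝ, 0 ≤ A i i + s * (2 * A i j) + s ^ 2 * A j j := by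
    intro s
    have := hA.dotProduct_mulVec_nonneg (Pi.single i 1 + s • Pi.single j 1)
    simp only [star_trivial, Matrix.mulVec_add, Matrix.mulVec_smul, add_dotProduct, smul_dotProduct,
      dotProduct_add, dotProduct_smul, smul_eq_mul, Matrix.mulVec_single_one,
      single_one_dotProduct, Matrix.col_apply, hsym] at this
    linarith
  have h1 := hq 1
  have h2 := hq (-1)
  have h3 := htr i
  have h4 := htr j
  rw [abs_le]
  constructor <;> linarith

/-- On every Borel set the entries of a positive semidefinite matrix measure are bounded by its
trace, hence by `c ν`. A bound on all sets passes to the variation measures, and with it to the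
integrals of bounded functions. -/
theorem abs_matrixPairing_le {Ω : Set (Space d)} {R : Fin d → Fin d → SignedMeasure (Space d)}
    {ν : Measure (Space d)} [IsFiniteMeasure ν] {c K : ℝ} (hc : 0 ≤ c) (hK : 0 ≤ K)
    (hpsd : ∀ A, MeasurableSet A → (Matrix.of fun i j => R i j A).PosSemidef)
    (htr : ∀ A, MeasurableSet A → ∑ i, R i i A ≤ c * ν.real A)
    (hconc : ∀ i j, (R i j).variation (closure Ω)ᶜ = 0) (hν : ν (closure Ω)ᶜ = 0)
    {M : Space d → Matrix (Fin d) (Fin d) ℝ} (hM : ∀ x ∈ closure Ω, ∀ i j, |M x i j| ≤ K) :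
    |matrixPairing M R| ≤ d * (d * (K * (c * ν.real (closure Ω)))) := by
  have hvar : ∀ i j, (R i j).variation ≤ ENNReal.ofReal c • ν := by
    intro i j
    refine VectorMeasure.variation_le_of_forall_enorm_le fun A hA => ?_
    have h1 := abs_entry_le_trace (hpsd A hA) i j
    have h2 : |R i j A| ≤ c * ν.real A := h1.trans (htr A hA)
    rw [Real.enorm_eq_ofReal_abs]
    refine (ENNReal.ofReal_le_ofReal h2).trans_eq ?_
    rw [ENNReal.ofReal_mul hc, ofReal_measureReal]
    rfl
  have huniv : ν univ = ν (closure Ω) := by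
    rw [← measure_add_measure_compl isClosed_closure.measurableSet (s := closure Ω) (μ := ν), hν,
      add_zero]
  have hent : ∀ i j, |(R i j).integral (fun x => M x i j) (ContinuousLinearMap.lsmul ℝ ℝ)|
      ≤ K * (c * ν.real (closure Ω)) := by
    intro i j
    have h1 := VectorMeasure.enorm_integral_le_lintegral_enorm (f := fun x => M x i j)
      (μ := R i j) (B := ContinuousLinearMap.lsmul ℝ ℝ)
    have hae : ∀ᵐ x ∂(R i j).variation, ‖M x i j‖ₑ ≤ ENNReal.ofReal K := by
      have : ∀ᵐ x ∂(R i j).variation, x ∈ closure Ω := hconc i j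
      filter_upwards [this] with x hx
      rw [Real.enorm_eq_ofReal_abs]
      exact ENNReal.ofReal_le_ofReal (hM x hx i j)
    have hB : ‖(ContinuousLinearMap.lsmul ℝ ℝ : ℝ →L[ℝ] ℝ →L[ℝ] ℝ)‖ₑ ≤ 1 := by
      rw [← ofReal_norm]
      refine (ENNReal.ofReal_le_ofReal ContinuousLinearMap.opNorm_lsmul_le).trans_eq (by simp)
    have h2 : ‖(R i j).integral (fun x => M x i j) (ContinuousLinearMap.lsmul ℝ ℝ)‖ₑ
        ≤ ENNReal.ofReal (K * (c * ν.real (closure Ω))) := by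
      refine h1.trans ?_
      calc _ ≤ 1 * ∫⁻ _, ENNReal.ofReal K ∂(R i j).variation := by
            gcongr ?_ * ?_
            exact lintegral_mono_ae hae
        _ = ENNReal.ofReal K * (R i j).variation univ := by rw [one_mul, lintegral_const]
        _ ≤ ENNReal.ofReal K * (ENNReal.ofReal c * ν (closure Ω)) := by
            gcongr
            rw [← huniv]
            exact hvar i j univ
        _ = _ := by
            rw [ENNReal.ofReal_mul hK, ENNReal.ofReal_mul hc, ofReal_measureReal]
    rw [Real.enorm_eq_ofReal_abs] at h2
    exact (ENNReal.ofReal_le_ofReal_iff (by positivity)).1 h2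
  refine (Finset.abs_sum_le_sum_abs _ _).trans ?_
  have h3 : ∀ i : Fin d, |∑ j, (R i j).integral (fun x => M x i j)
      (ContinuousLinearMap.lsmul ℝ ℝ)| ≤ d * (K * (c * ν.real (closure Ω))) := fun i =>
    (Finset.abs_sum_le_sum_abs _ _).trans
      ((Finset.sum_le_sum fun j _ => hent i j).trans_eq (by simp))
  exact (Finset.sum_le_sum fun i _ => h3 i).trans_eq (by simp)

theorem reynolds_eq_zero {R : Fin d → Fin d → SignedMeasure (Space d)}
    (hpsd : ∀ A, MeasurableSet A → (Matrix.of fun i j => R i j A).PosSemidef)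
    (htr : ∀ A, MeasurableSet A → ∑ i, R i i A ≤ 0) (i j : Fin d) : R i j = 0 := by
  refine VectorMeasure.ext fun A hA => ?_
  have h1 := abs_entry_le_trace (hpsd A hA) i j
  have h2 : |R i j A| ≤ 0 := h1.trans (htr A hA)
  simpa using abs_nonpos_iff.1 h2

variable {T : ℝ} {Ω : Set (Space d)} {V : Kernel (ℝ × Space d) (Phase d)}
  {Du : ℝ × Space d → Space d →L[ℝ] Space d} {𝔈 : Kernel ℝ (Space d)}
  {𝔇 : Measure (ℝ × Space d)}

/-- Poincaré's inequality with Bochner integrals. -/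
theorem PoincareInequality.integral_le [IsMarkovKernel V]
    (h : PoincareInequality T Ω V Du 𝔈 𝔇) : ∃ C : ℝ, 0 < C ∧ ∀ U DU, MemL2W12Zero T Ω U DU →
    ∀ᵐ τ ∂(volume.restrict (Ioo 0 T)),
      (∀ᵐ p ∂(volume.restrict (cyl τ Ω)), Integrable (fun z => ‖z.2.2 - U p‖ ^ 2) (V p)) ∧
      IntegrableOn (fun p => ∫ z, ‖z.2.2 - U p‖ ^ 2 ∂V p) (cyl τ Ω) ∧
      ∫ p in cyl τ Ω, ∫ z, ‖z.2.2 - U p‖ ^ 2 ∂V p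
        ≤ C * ((∫ p in cyl τ Ω, frob (gradMat (Du p - DU p)) (gradMat (Du p - DU p)))
            + (∫ t in Ioo 0 τ, (𝔈 t).real (closure Ω)) + 𝔇.real (cylClosure τ Ω)) := by
  obtain ⟨C, hC, hP⟩ := h
  refine ⟨C, hC, fun U DU hU => ?_⟩
  filter_upwards [hP U DU hU, ae_restrict_mem measurableSet_Ioo] with τ hτ hτT
  have hUm : AEStronglyMeasurable U (volume.restrict (cyl τ Ω)) :=
    hU.1.1.mono_measure (Measure.restrict_mono (cyl_mono hτT.2.le) le_rfl)
  set L : ℝ × Space d → ENNReal := fun p => ∫⁻ z, ENNReal.ofReal (‖z.2.2 - U p‖ ^ 2) ∂V p with hL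
  have hLm : AEMeasurable L (volume.restrict (cyl τ Ω)) := by
    refine ⟨fun p => ∫⁻ z, ENNReal.ofReal (‖z.2.2 - hUm.mk U p‖ ^ 2) ∂V p, ?_, ?_⟩
    · refine Measurable.lintegral_kernel_prod_right'
        (f := fun q : (ℝ × Space d) × Phase d => ENNReal.ofReal (‖q.2.2.2 - hUm.mk U q.1‖ ^ 2)) ?_
      have := hUm.stronglyMeasurable_mk.measurable
      fun_prop
    · filter_upwards [hUm.ae_eq_mk] with p hp
      simp only [hL, hp]
  -- The right-hand side of Poincaré's inequality is a real number, so the inequality itself gives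
  -- the finiteness that Bochner integrals require.
  have hfin : ∫⁻ p in cyl τ Ω, L p ≠ ⊤ := ne_top_of_le_ne_top ENNReal.ofReal_ne_top hτ
  have hLt : ∀ᵐ p ∂(volume.restrict (cyl τ Ω)), L p < ⊤ := ae_lt_top' hLm hfin
  have hms : ∀ p, AEStronglyMeasurable (fun z : Phase d => ‖z.2.2 - U p‖ ^ 2) (V p) := by
    intro p
    have : Measurable fun z : Phase d => ‖z.2.2 - U p‖ ^ 2 := by fun_prop
    exact this.aestronglyMeasurable
  have heq : ∀ p, ∫ z, ‖z.2.2 - U p‖ ^ 2 ∂V p = (L p).toReal := fun p =>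
    integral_eq_lintegral_of_nonneg_ae (Filter.Eventually.of_forall fun z => by positivity) (hms p)
  refine ⟨?_, ?_, ?_⟩
  · filter_upwards [hLt] with p hp
    refine ⟨hms p, ?_⟩
    rw [hasFiniteIntegral_iff_ofReal (Filter.Eventually.of_forall fun z => by positivity)]
    exact hp
  · simp only [heq]
    exact integrable_toReal_of_lintegral_ne_top hLm hfin
  · simp only [heq]
    rw [integral_toReal hLm hLt]
    refine ENNReal.toReal_le_of_le_ofReal ?_ hτ
    refine mul_nonneg hC.le (add_nonneg (add_nonneg ?_ ?_) measureReal_nonneg)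
    · exact integral_nonneg fun p => frob_nonneg _
    · exact integral_nonneg fun t => measureReal_nonneg

end Defects

end PotTempNS

namespace PotTempNS

/-! ### Test states which follow a strong solution up to a given time -/

section TestState

variable {d : ℕ} {a γ μ lam T : ℝ} {Ω : Set (Space d)}

/-- `S` is a state of class `C¹` on the closed cylinder, with values in a fixed compact set of
states and no-slip velocity, which up to the time `T₁` solves the Navier–Stokes system, `D2u` being
the second derivative of its velocity. -/
structure IsTestState (a γ μ lam m M K T T₁ : ℝ) (Ω : Set (Space d)) (S : ℝ × Space d → Phase d)
    (S' : ℝ × Space d → (ℝ × Space d) →L[ℝ] Phase d)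
    (D2u : ℝ × Space d → Space d →L[ℝ] Space d →L[ℝ] Space d) (h : ℝ → ℝ) : Prop where
  c1 : IsC1OnClosure T Ω S S'
  mem_box : ∀ p ∈ cylClosure T Ω, S p ∈ stateBox d m M
  norm_deriv_le : ∀ p ∈ cylClosure T Ω, ‖S' p‖ ≤ K
  no_slip : ∀ t ∈ Icc 0 T, ∀ x ∈ frontier Ω, (S (t, x)).2.2 = 0
  equations : ∀ p ∈ cyl T₁ Ω, (S' p (1, (S p).2.2)).1 = -((S p).1 * velDiv (S' p)) ∧
    (S' p (1, (S p).2.2)).2.1 = 0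
  momentum : ∀ᵐ p ∂(volume.restrict (cyl T₁ Ω)), ∀ v,
    (S p).1 * inner ℝ (S' p (1, (S p).2.2)).2.2 v
      + statePressureDeriv a γ (S p) (S' p (0, v)) = inner ℝ (divStressVec μ lam (D2u p)) v
  aestronglyMeasurable : AEStronglyMeasurable D2u (volume.restrict (cyl T₁ Ω))
  norm_le : ∀ᵐ p ∂(volume.restrict (cyl T₁ Ω)), ‖D2u p‖ ≤ h p.1
  hasWeakDeriv : ∀ᵐ t ∂(volume.restrict (Ioo 0 T₁)),
    HasWeakDeriv Ω (fun x => velGrad (S' (t, x))) (fun x => D2u (t, x))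

/-- A change of time with speed at most one does not increase the bound on space-time derivatives.
-/
theorem norm_timeScaling_le {s : ℝ} (hs : |s| ≤ 1) :
    ‖(s • ContinuousLinearMap.fst ℝ ℝ (Space d)).prod
      (ContinuousLinearMap.snd ℝ ℝ (Space d))‖ ≤ 1 := by
  refine ContinuousLinearMap.opNorm_le_bound _ zero_le_one fun v => ?_
  rw [one_mul]
  refine max_le ?_ (norm_snd_le v)
  have : ‖s • v.1‖ ≤ 1 * ‖v.1‖ := by
    rw [norm_smul]
    exact mul_le_mul_of_nonneg_right hs (norm_nonneg _)
  simpa using this.trans (by simpa using norm_fst_le v)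

/-- The strong solution lives on `(0, Tstar)` only, whereas test functions must be given on `(0,
T)`. Slowing down time after `T₁` prolongs it, at the cost of the equations beyond `T₁`. The
constants, `D2u` and `h` are fixed before `T₁` is; this uniformity is what the treatment of the
dissipation defect rests on. -/
theorem IsStrongSolution.exists_isTestState {Tstar : ℝ} {ρ θ : ℝ × Space d → ℝ}
    {u : ℝ × Space d → Space d} (hΩ : IsOpen Ω) (hb : Bornology.IsBounded Ω)
    (hs : IsStrongSolution a γ μ lam Tstar Ω ρ θ u) :
    ∃ (m M K : ℝ) (D2u : ℝ × Space d → Space d →L[ℝ] Space d →L[ℝ] Space d) (h : ℝ → ℝ),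
      0 < m ∧ 0 ≤ K ∧ (∀ t, 0 ≤ h t) ∧ MemLp h 2 (volume.restrict (Ioo 0 Tstar)) ∧
      ∀ T T₁, 0 < T₁ → T₁ < Tstar → ∃ S S',
        IsTestState a γ μ lam m M K T T₁ Ω S S' D2u h ∧
        ∀ p, p.1 ≤ T₁ → S p = (ρ p, θ p, u p) := by
  obtain ⟨ρ', hρ⟩ := hs.density_C1
  obtain ⟨θ', hθ⟩ := hs.temperature_C1
  obtain ⟨u', D2u, hu, ⟨-, -, hm, ⟨h, hh, hbd⟩, hw⟩, hmom⟩ := hs.velocity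
  have hσ := hρ.prodMk (hθ.prodMk hu)
  obtain ⟨m, M, hm0, hbox⟩ := exists_mem_stateBox hb hσ.continuousOn
    (fun p hp => hs.pos p hp)
  obtain ⟨K, hK, hK'⟩ := hσ.exists_bound hb
  -- The given bound is non-negative only almost everywhere; its absolute value is non-negative at
  -- every time.
  refine ⟨m, M, K, D2u, fun t => |h t|, hm0, hK, fun t => abs_nonneg _, hh.abs, ?_⟩
  intro T T₁ h0 h1
  obtain ⟨χ, χ', hχ, hχc, hχ1, hχt, hχ't, hχS, hχpos⟩ := exists_timeCutoff h0.le h1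
  have hmem : ∀ t, 0 ≤ t → χ t ∈ Icc 0 Tstar := fun t ht => by
    refine ⟨?_, (hχS t).le⟩
    rcases ht.eq_or_lt with rfl | ht
    · rw [hχt 0 h0.le]
    · exact (hχpos t ht).le
  have hcl : ∀ p ∈ cylClosure T Ω, (χ p.1, p.2) ∈ cylClosure Tstar Ω :=
    fun p hp => ⟨hmem _ hp.1.1, hp.2⟩
  have hid : ∀ p : ℝ × Space d, p.1 ≤ T₁ →
      ((ρ' (χ p.1, p.2)).prod ((θ' (χ p.1, p.2)).prod (u' (χ p.1, p.2)))).comp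
        ((χ' p.1 • ContinuousLinearMap.fst ℝ ℝ (Space d)).prod
          (ContinuousLinearMap.snd ℝ ℝ (Space d))) = (ρ' p).prod ((θ' p).prod (u' p)) := by
    intro p hp
    rw [hχt _ hp, hχ't _ hp]
    ext v <;> simp
  have hsub : cyl T₁ Ω ⊆ cyl Tstar Ω := cyl_mono h1.le
  have hle : (volume : Measure (ℝ × Space d)).restrict (cyl T₁ Ω)
      ≤ volume.restrict (cyl Tstar Ω) := Measure.restrict_mono hsub le_rfl
  have hle' : (volume : Measure ℝ).restrict (Ioo 0 T₁) ≤ volume.restrict (Ioo 0 Tstar) :=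
    Measure.restrict_mono (Ioo_subset_Ioo_right h1.le) le_rfl
  have hcyl : ∀ᵐ p ∂((volume : Measure (ℝ × Space d)).restrict (cyl T₁ Ω)), p.1 < T₁ ∧
      p ∈ cyl T₁ Ω := by
    filter_upwards [ae_restrict_mem (isOpen_cyl hΩ).measurableSet] with p hp using ⟨hp.1.2, hp⟩
  have heq : ∀ p : ℝ × Space d, p.1 ≤ T₁ → (ρ (χ p.1, p.2), θ (χ p.1, p.2), u (χ p.1, p.2))
      = (ρ p, θ p, u p) := fun p hp => by rw [hχt _ hp]
  refine ⟨_, _, ⟨hσ.comp_time (T := T) hχ hχc (fun t ht => hmem t ht.1)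
    (fun t ht => ⟨hχpos t ht.1, hχS t⟩), fun p hp => hbox _ (hcl p hp), fun p hp => ?_,
    fun t ht x hx => hs.no_slip _ (hmem t ht.1) x hx, fun p hp => ?_, ?_, hm.mono_measure hle,
    ?_, ?_⟩, heq⟩
  · refine (ContinuousLinearMap.opNorm_comp_le _ _).trans ?_
    have := mul_le_mul (hK' _ (hcl p hp)).2 (norm_timeScaling_le (d := d) (hχ1 p.1))
      (norm_nonneg _) hK
    rwa [mul_one] at this
  · have hpS := hsub hp
    have := strong_equations (a := a) (γ := γ) (hρ.hasFDerivAt p hpS) (hθ.hasFDerivAt p hpS)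
      (hu.hasFDerivAt p hpS) (hs.pos p (cyl_subset_cylClosure hpS)) (hs.continuity p hpS)
      (hs.temperature p hpS)
    simp only [hid p hp.1.2.le]
    simp only [hχt _ hp.1.2.le]
    exact ⟨this.1, this.2.1⟩
  · filter_upwards [hcyl, ae_mono hle hmom] with p hp hmp
    have hpS := hsub hp.2
    have := strong_equations (a := a) (γ := γ) (hρ.hasFDerivAt p hpS) (hθ.hasFDerivAt p hpS)
      (hu.hasFDerivAt p hpS) (hs.pos p (cyl_subset_cylClosure hpS)) (hs.continuity p hpS)
      (hs.temperature p hpS)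
    simp only [hid p hp.1.le]
    simp only [hχt _ hp.1.le]
    exact this.2.2 (divStressVec μ lam (D2u p)) hmp
  · filter_upwards [ae_mono hle hbd] with p hp
    exact hp.2.2.trans (le_abs_self _)
  · filter_upwards [ae_mono hle' hw, ae_restrict_mem measurableSet_Ioo] with t ht htm
    have e : (fun x => velGrad (((ρ' (χ t, x)).prod ((θ' (χ t, x)).prod (u' (χ t, x)))).comp
        ((χ' t • ContinuousLinearMap.fst ℝ ℝ (Space d)).prod
          (ContinuousLinearMap.snd ℝ ℝ (Space d))))) = fun x => spatial (u' (t, x)) := by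
      funext x
      rw [hid (t, x) htm.2.le]
      ext v
      simp [spatial]
    rw [e]
    exact ht.2

end TestState

end PotTempNS

namespace PotTempNS

/-! ### The gain of relative energy on a time slice -/

section Slice

variable {d : ℕ} {a γ μ lam T T₁ : ℝ} {Ω : Set (Space d)} {V : Kernel (ℝ × Space d) (Phase d)}
  {Du : ℝ × Space d → Space d →L[ℝ] Space d} {S : ℝ × Space d → Phase d}
  {S' : ℝ × Space d → (ℝ × Space d) →L[ℝ] Phase d}

/-- The right-hand side of the relative energy inequality without the Reynolds defect. -/
noncomputable def gain (a γ μ lam : ℝ) (V : Kernel (ℝ × Space d) (Phase d))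
    (Du : ℝ × Space d → Space d →L[ℝ] Space d) (S : ℝ × Space d → Phase d)
    (S' : ℝ × Space d → (ℝ × Space d) →L[ℝ] Phase d) (p : ℝ × Space d) : ℝ :=
  (∫ z, relIntegrand a γ (S p) (S' p) z ∂V p)
    - frob (stress μ lam (gradMat (Du p))) (gradMat (Du p - velGrad (S' p)))

/-- The mean velocity deviation from `w` on the states of low density. -/
noncomputable def lowDeviation (m : ℝ) (ν : Measure (Phase d)) (w : Space d) : ℝ :=
  ∫ z, (lowDensity d m).indicator (fun z => ‖z.2.2 - w‖) z ∂ν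

theorem measurableSet_lowDensity (m : ℝ) : MeasurableSet (lowDensity d m) :=
  measurableSet_lt measurable_fst measurable_const

theorem lowDeviation_nonneg (m : ℝ) (ν : Measure (Phase d)) (w : Space d) :
    0 ≤ lowDeviation m ν w :=
  integral_nonneg fun z => indicator_nonneg (fun _ _ => norm_nonneg _) z

theorem integrable_velocity_sub {ν : Measure (Phase d)} [IsProbabilityMeasure ν] {w : Space d}
    (h : Integrable (fun z : Phase d => ‖z.2.2 - w‖ ^ 2) ν) :
    Integrable (fun z : Phase d => ‖z.2.2 - w‖) ν := by
  refine Integrable.mono' ((integrable_const (1 : ℝ)).add h)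
    (by fun_prop) (Filter.Eventually.of_forall fun z => ?_)
  rw [norm_norm]
  simp only [Pi.add_apply]
  nlinarith [sq_nonneg (‖z.2.2 - w‖ - 1), norm_nonneg (z.2.2 - w)]

theorem lowDeviation_le {m : ℝ} {ν : Measure (Phase d)} [IsProbabilityMeasure ν] {w : Space d}
    (h : Integrable (fun z : Phase d => ‖z.2.2 - w‖ ^ 2) ν) :
    lowDeviation m ν w ≤ 1 + ∫ z, ‖z.2.2 - w‖ ^ 2 ∂ν := by
  have h1 := integrable_velocity_sub h
  have : lowDeviation m ν w ≤ ∫ z, (1 + ‖z.2.2 - w‖ ^ 2) ∂ν := by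
    refine integral_mono (h1.indicator (measurableSet_lowDensity m))
      ((integrable_const (1 : ℝ)).add h) fun z => ?_
    refine (indicator_le_self' (fun _ _ => norm_nonneg _) z).trans ?_
    simp only
    nlinarith [sq_nonneg (‖z.2.2 - w‖ - 1), norm_nonneg (z.2.2 - w)]
  rwa [integral_add (integrable_const _) h, integral_const, probReal_univ, one_smul] at this

theorem integrableOn_lowDeviation [IsMarkovKernel V] (hb : Bornology.IsBounded Ω) {m τ : ℝ}
    {U : ℝ × Space d → Space d} (hU : AEStronglyMeasurable U (volume.restrict (cyl τ Ω)))
    (h1 : ∀ᵐ p ∂(volume.restrict (cyl τ Ω)), Integrable (fun z => ‖z.2.2 - U p‖ ^ 2) (V p))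
    (h2 : IntegrableOn (fun p => ∫ z, ‖z.2.2 - U p‖ ^ 2 ∂V p) (cyl τ Ω)) :
    IntegrableOn (fun p => lowDeviation m (V p) (U p)) (cyl τ Ω) := by
  have hfin := isFiniteMeasure_restrict_cyl (T := τ) hb
  refine Integrable.mono' ((integrable_const (1 : ℝ)).add h2) ?_ ?_
  · have hmk : StronglyMeasurable fun p => lowDeviation m (V p) (hU.mk U p) := by
      refine StronglyMeasurable.integral_kernel_prod_right'
        (f := fun q : (ℝ × Space d) × Phase d => (lowDensity d m).indicator
          (fun z => ‖z.2.2 - hU.mk U q.1‖) q.2) ?_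
      have hm := hU.stronglyMeasurable_mk.measurable
      have e : (fun q : (ℝ × Space d) × Phase d => (lowDensity d m).indicator
          (fun z => ‖z.2.2 - hU.mk U q.1‖) q.2) =
          (Prod.snd ⁻¹' lowDensity d m).indicator
            (fun q : (ℝ × Space d) × Phase d => ‖q.2.2.2 - hU.mk U q.1‖) := by
        funext q
        rfl
      rw [e]
      refine (Measurable.indicator ?_
        (measurable_snd (measurableSet_lowDensity m))).stronglyMeasurable
      fun_prop
    refine ⟨_, hmk, ?_⟩
    filter_upwards [hU.ae_eq_mk] with p hp
    rw [hp]
  · filter_upwards [h1] with p hp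
    rw [Real.norm_of_nonneg (lowDeviation_nonneg _ _ _)]
    exact lowDeviation_le hp

/-- Poincaré's inequality is available for almost every `τ` only. A single good `τ` between `T₁` and
`T` is enough. -/
theorem exists_integrable_sq_deviation [IsMarkovKernel V] {𝔈 : Kernel ℝ (Space d)}
    {𝔇 : Measure (ℝ × Space d)} (hP : PoincareInequality T Ω V Du 𝔈 𝔇)
    {U : ℝ × Space d → Space d} {DU : ℝ × Space d → Space d →L[ℝ] Space d}
    (hU : MemL2W12Zero T Ω U DU) (h0 : 0 ≤ T₁) (hT : T₁ < T) :
    (∀ᵐ p ∂(volume.restrict (cyl T₁ Ω)), Integrable (fun z => ‖z.2.2 - U p‖ ^ 2) (V p)) ∧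
      IntegrableOn (fun p => ∫ z, ‖z.2.2 - U p‖ ^ 2 ∂V p) (cyl T₁ Ω) := by
  obtain ⟨C, -, h⟩ := hP.integral_le
  have h1 : ∀ᵐ τ ∂(volume.restrict (Ioo T₁ T)), τ ∈ Ioo T₁ T ∧ _ :=
    (ae_restrict_mem measurableSet_Ioo).and
      (ae_mono (Measure.restrict_mono (Ioo_subset_Ioo_left h0) le_rfl) (h U DU hU))
  have : (ae ((volume : Measure ℝ).restrict (Ioo T₁ T))).NeBot := by
    rw [ae_neBot, Ne, Measure.restrict_eq_zero, Real.volume_Ioo]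
    simpa using hT
  obtain ⟨τ, hτ, h2, h3, -⟩ := h1.exists
  exact ⟨ae_mono (Measure.restrict_mono (cyl_mono hτ.1.le) le_rfl) h2,
    h3.mono_set (cyl_mono hτ.1.le)⟩

/-- The work of `f` is linear in the velocity, so after averaging it sees only the mean velocity, to
which integration by parts applies. -/
theorem integral_relIntegrand_le {ν : Measure (Phase d)} [IsProbabilityMeasure ν]
    {y : Phase d} {L : (ℝ × Space d) →L[ℝ] Phase d} {f : Space d} {c m C D : ℝ}
    (hadm : ∀ᵐ z ∂ν, z ∈ admStates d c)
    (h : ∀ z ∈ admStates d c, relIntegrand a γ y L z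
        ≤ C * relEnergy a γ y z + ‖f‖ * (lowDensity d m).indicator (fun z => ‖z.2.2 - y.2.2‖) z
          - inner ℝ f (z.2.2 - y.2.2) - D)
    (h1 : Integrable (relIntegrand a γ y L) ν) (h2 : Integrable (relEnergy a γ y) ν)
    (h3 : Integrable (fun z : Phase d => z.2.2) ν) :
    ∫ z, relIntegrand a γ y L z ∂ν ≤ C * (∫ z, relEnergy a γ y z ∂ν)
      + ‖f‖ * lowDeviation m ν y.2.2 - inner ℝ f ((∫ z, z.2.2 ∂ν) - y.2.2) - D := by
  have i3 : Integrable (fun z : Phase d => z.2.2 - y.2.2) ν := h3.sub (integrable_const _)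
  have i2 : Integrable (fun z : Phase d => (lowDensity d m).indicator
      (fun z => ‖z.2.2 - y.2.2‖) z) ν := i3.norm.indicator (measurableSet_lowDensity m)
  have i4 : Integrable (fun z : Phase d => inner ℝ f (z.2.2 - y.2.2)) ν := i3.const_inner f
  have i5 : Integrable (fun z : Phase d => C * relEnergy a γ y z + ‖f‖ * (lowDensity d m).indicator
      (fun z => ‖z.2.2 - y.2.2‖) z) ν := (h2.const_mul C).add (i2.const_mul ‖f‖)
  have i6 : Integrable (fun z : Phase d => C * relEnergy a γ y z + ‖f‖ * (lowDensity d m).indicator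
      (fun z => ‖z.2.2 - y.2.2‖) z - inner ℝ f (z.2.2 - y.2.2)) ν := i5.sub i4
  refine (integral_mono_ae h1 (i6.sub (integrable_const D)) ?_).trans_eq ?_
  · filter_upwards [hadm] with z hz using h z hz
  · simp only [Pi.sub_apply]
    rw [integral_sub i6 (integrable_const D), integral_sub i5 i4,
      integral_add (h2.const_mul C) (i2.const_mul ‖f‖), integral_const_mul, integral_const_mul,
      integral_inner i3, integral_sub h3 (integrable_const _), integral_const, integral_const,
      probReal_univ, one_smul, one_smul, lowDeviation]

theorem continuous_divStressVec (μ lam : ℝ) : Continuous (divStressVec (d := d) μ lam) := by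
  refine (PiLp.continuous_toLp 2 _).comp (continuous_pi fun i => ?_)
  refine continuous_finsetSum _ fun j _ => ?_
  exact (stressEntry μ lam i j).continuous.comp
    (ContinuousLinearMap.apply ℝ _ (EuclideanSpace.single j 1 : Space d)).continuous

variable {m M K : ℝ} {D2u : ℝ × Space d → Space d →L[ℝ] Space d →L[ℝ] Space d} {h : ℝ → ℝ}

theorem IsTestState.mem_posStates (hS : IsTestState a γ μ lam m M K T T₁ Ω S S' D2u h)
    (hm : 0 < m) : ∀ p ∈ cylClosure T Ω, S p ∈ posStates d :=
  fun p hp => stateBox_subset_posStates hm (hS.mem_box p hp)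

theorem IsTestState.relIntegrand_moment [IsMarkovKernel V] {c : ℝ} (ha : 0 < a) (hγ : 1 < γ)
    (hc : 0 < c) (hm : 0 < m) (hK : 0 ≤ K) (hadm : ConcentratedOnAdm c T Ω V)
    (hen : MomentIntegrable T Ω V (energyDensity a γ)) (hΩ : IsOpen Ω)
    (hb : Bornology.IsBounded Ω) (hS : IsTestState a γ μ lam m M K T T₁ Ω S S' D2u h) :
    (∀ᵐ p ∂(volume.restrict (cyl T Ω)), Integrable (relIntegrand a γ (S p) (S' p)) (V p)) ∧
      IntegrableOn (fun p => ∫ z, relIntegrand a γ (S p) (S' p) z ∂V p) (cyl T Ω) := by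
  obtain ⟨C, -, hC⟩ := exists_relIntegrand_bound (d := d) ha hγ hm M hc hK
  have := PotTempNS.relIntegrand_moment hadm hen hΩ hb hS.c1 (C := C) fun p hp z hz =>
    hC _ (hS.mem_box p (cyl_subset_cylClosure hp)) _
      (hS.norm_deriv_le p (cyl_subset_cylClosure hp)) z hz
  exact ⟨this.1, this.2.1⟩

theorem IsTestState.memL2W12Zero (hΩ : IsOpen Ω) (hb : Bornology.IsBounded Ω)
    (hS : IsTestState a γ μ lam m M K T T₁ Ω S S' D2u h) :
    MemL2W12Zero T Ω (fun p => (S p).2.2) (fun p => velGrad (S' p)) :=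
  hS.c1.velocity.memL2W12Zero hΩ hb hS.no_slip

theorem IsTestState.integrableOn_gain [IsMarkovKernel V] {c : ℝ} (ha : 0 < a) (hγ : 1 < γ)
    (hc : 0 < c) (hm : 0 < m) (hK : 0 ≤ K) (hadm : ConcentratedOnAdm c T Ω V)
    (hen : MomentIntegrable T Ω V (energyDensity a γ)) (hΩ : IsOpen Ω)
    (hb : Bornology.IsBounded Ω) (hDu : MemL2W12Zero T Ω (meanVelocity V) Du)
    (hS : IsTestState a γ μ lam m M K T T₁ Ω S S' D2u h) :
    IntegrableOn (gain a γ μ lam V Du S S') (cyl T Ω) :=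
  (hS.relIntegrand_moment ha hγ hc hm hK hadm hen hΩ hb).2.sub
    (integrable_frob_stress μ lam hDu.2.1 (hDu.2.1.sub (hS.memL2W12Zero hΩ hb).2.1))

/-- On a time slice the work of the viscous force on `u_V - U` becomes, by parts, `𝕊(∇U) : ∇(u_V -
U)`. Together with `-𝕊(∇u_V) : ∇(u_V - U)` it forms minus the dissipation of `u_V - U`. The
divergence of pressure times velocity integrates to zero. -/
theorem IsTestState.exists_gain_slice_le [IsMarkovKernel V] {c : ℝ} (ha : 0 < a) (hγ : 1 < γ)
    (hc : 0 < c) (hm : 0 < m) (hK : 0 ≤ K) (hadm : ConcentratedOnAdm c T Ω V)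
    (hen : MomentIntegrable T Ω V (energyDensity a γ)) (hΩ : IsOpen Ω)
    (hb : Bornology.IsBounded Ω) (hDu : MemL2W12Zero T Ω (meanVelocity V) Du)
    {𝔈 : Kernel ℝ (Space d)} {𝔇 : Measure (ℝ × Space d)}
    (hP : PoincareInequality T Ω V Du 𝔈 𝔇)
    (hint : ∀ᵐ p ∂(volume.restrict (cyl T Ω)), Integrable (fun z : Phase d => z.2.2) (V p))
    (hh : ∀ t, 0 ≤ h t) (h0 : 0 < T₁) (hT : T₁ < T)
    (hS : IsTestState a γ μ lam m M K T T₁ Ω S S' D2u h) :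
    ∃ C : ℝ, 0 ≤ C ∧ ∀ᵐ t ∂(volume.restrict (Ioo 0 T₁)),
      ∫ x in Ω, gain a γ μ lam V Du S S' (t, x)
        ≤ C * (1 + h t) * (∫ x in Ω, ∫ z, relEnergy a γ (S (t, x)) z ∂V (t, x))
          + C * h t * (∫ x in Ω, lowDeviation m (V (t, x)) (S (t, x)).2.2)
          - ∫ x in Ω, frob (stress μ lam (gradMat (Du (t, x) - velGrad (S' (t, x)))))
              (gradMat (Du (t, x) - velGrad (S' (t, x)))) := by
  obtain ⟨C₀, hC₀, hrel⟩ := exists_relIntegrand_le (d := d) (M := M) ha hγ hm hc hK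
  obtain ⟨Cf, hCf, hf⟩ := exists_norm_divStressVec_le d μ lam
  have hpos := hS.mem_posStates hm
  have hfin : IsFiniteMeasure ((volume : Measure (Space d)).restrict Ω) :=
    ⟨by rw [Measure.restrict_apply_univ]; exact hb.measure_lt_top⟩
  have hle : (volume : Measure (ℝ × Space d)).restrict (cyl T₁ Ω)
      ≤ volume.restrict (cyl T Ω) := Measure.restrict_mono (cyl_mono hT.le) le_rfl
  have hle' : (volume : Measure ℝ).restrict (Ioo 0 T₁) ≤ volume.restrict (Ioo 0 T) :=
    Measure.restrict_mono (Ioo_subset_Ioo_right hT.le) le_rfl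
  have hUW := hS.memL2W12Zero hΩ hb
  have hrE := relEnergy_moment ha hγ hc hadm hen hΩ hb hS.c1 hpos
  have hrI := hS.relIntegrand_moment ha hγ hc hm hK hadm hen hΩ hb
  have hG := hS.integrableOn_gain ha hγ hc hm hK hadm hen hΩ hb hDu
  have hdev := exists_integrable_sq_deviation hP hUW h0.le hT
  have hJ := integrableOn_lowDeviation (m := m) hb (hUW.1.1.mono_measure hle) hdev.1 hdev.2
  have hlow : ∀ᵐ p ∂(volume.restrict (cyl T₁ Ω)), gain a γ μ lam V Du S S' p
      ≤ (C₀ * (1 + Cf)) * (1 + h p.1) * (∫ z, relEnergy a γ (S p) z ∂V p)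
        + (Cf * h p.1) * lowDeviation m (V p) (S p).2.2
        - inner ℝ (divStressVec μ lam (D2u p)) (meanVelocity V p - (S p).2.2)
        - (statePressure a γ (S p) * velDiv (S' p)
          + statePressureDeriv a γ (S p) (S' p (0, (S p).2.2)))
        - frob (stress μ lam (gradMat (Du p))) (gradMat (Du p - velGrad (S' p))) := by
    filter_upwards [ae_mono hle hadm, ae_mono hle hrE.1, ae_mono hle hrI.1, ae_mono hle hint,
      hS.momentum, hS.norm_le, ae_restrict_mem (isOpen_cyl hΩ).measurableSet]
      with p h1 h2 h3 h4 h5 h6 h7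
    have hcl : p ∈ cylClosure T Ω := cyl_subset_cylClosure (cyl_mono hT.le h7)
    have heq := hS.equations p h7
    have hb1 := hS.mem_box p hcl
    have hfb : ‖divStressVec μ lam (D2u p)‖ ≤ Cf * h p.1 :=
      (hf _).trans (mul_le_mul_of_nonneg_left h6 hCf)
    have h8 := integral_relIntegrand_le h1 (fun z hz => hrel (S p) hb1 (S' p)
      (divStressVec μ lam (D2u p)) (hS.norm_deriv_le p hcl) heq.1 heq.2 h5 z hz) h3 h2 h4
    have hE0 : 0 ≤ ∫ z, relEnergy a γ (S p) z ∂V p :=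
      integral_nonneg_of_ae (h1.mono fun z hz =>
        relEnergy_nonneg ha hγ (hpos p hcl) hz.1 (hc.trans_le hz.2))
    have hJ0 := lowDeviation_nonneg m (V p) (S p).2.2
    have e1 : C₀ * (1 + ‖divStressVec μ lam (D2u p)‖) ≤ C₀ * (1 + Cf) * (1 + h p.1) := by
      have : 1 + ‖divStressVec μ lam (D2u p)‖ ≤ (1 + Cf) * (1 + h p.1) := by
        nlinarith [hh p.1]
      rw [mul_assoc]
      exact mul_le_mul_of_nonneg_left this hC₀
    have e2 := mul_le_mul_of_nonneg_right e1 hE0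
    have e3 := mul_le_mul_of_nonneg_right hfb hJ0
    rw [gain]
    simp only [meanVelocity]
    linarith
  refine ⟨C₀ * (1 + Cf) + Cf, by positivity, ?_⟩
  filter_upwards [ae_ae_of_ae_cyl hlow, ae_mono hle' (integrable_slice hG),
    ae_mono hle' (integrable_slice hrE.2), integrable_slice hJ, ae_mono hle' hDu.2.2,
    hS.hasWeakDeriv, ae_ae_of_ae_cyl hS.norm_le, ae_restrict_mem measurableSet_Ioo,
    (restrict_cyl T₁ Ω ▸ hS.aestronglyMeasurable).prodMk_left,
    ae_mono hle' (ae_ae_of_ae_cyl hadm)]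
    with t t1 t2 t3 t4 t5 t6 t7 t8 t9 t10
  have t8' : t ∈ Ioo 0 T := ⟨t8.1, t8.2.trans hT⟩
  have hUs : MemW12Zero Ω (fun x => (S (t, x)).2.2) (fun x => velGrad (S' (t, x))) :=
    hS.c1.velocity.memW12Zero_slice hΩ hb hS.no_slip t8'
  have hq : MemW12Zero Ω (fun x => meanVelocity V (t, x) - (S (t, x)).2.2)
      (fun x => Du (t, x) - velGrad (S' (t, x))) := t5.sub hUs
  have hdivm := (continuous_divStressVec (d := d) μ lam).comp_aestronglyMeasurable t9
  have Iin : IntegrableOn (fun x => inner ℝ (divStressVec μ lam (D2u (t, x)))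
      (meanVelocity V (t, x) - (S (t, x)).2.2)) Ω := by
    refine Integrable.mono' (((hq.1.integrable (by norm_num)).norm).const_mul (Cf * h t))
      (hdivm.inner hq.1.1) ?_
    filter_upwards [t7] with x hx
    refine (norm_inner_le_norm _ _).trans ?_
    exact mul_le_mul_of_nonneg_right ((hf _).trans (mul_le_mul_of_nonneg_left hx hCf))
      (norm_nonneg _)
  have hpd := integral_pressure_div (a := a) (γ := γ) hΩ hb hS.c1 hpos hS.no_slip t8'
  have hst := MemW12Zero.integral_divStress (μ := μ) (lam := lam) hq t6 hUs.2.1 t9 t7 hfin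
  have hsf := integrable_frob_stress μ lam t5.2.1 hq.2.1
  have hsf2 := integrable_frob_stress μ lam hUs.2.1 hq.2.1
  have hE0 : 0 ≤ ∫ x in Ω, ∫ z, relEnergy a γ (S (t, x)) z ∂V (t, x) := by
    refine integral_nonneg_of_ae ?_
    filter_upwards [t10, ae_restrict_mem hΩ.measurableSet] with x hx hxΩ
    exact integral_nonneg_of_ae (hx.mono fun z hz =>
        relEnergy_nonneg ha hγ (hpos (t, x) (cyl_subset_cylClosure ⟨t8', hxΩ⟩)) hz.1
          (hc.trans_le hz.2))
  have hJ0 : 0 ≤ ∫ x in Ω, lowDeviation m (V (t, x)) (S (t, x)).2.2 :=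
    integral_nonneg fun x => lowDeviation_nonneg _ _ _
  have i1 := t3.const_mul (C₀ * (1 + Cf) * (1 + h t))
  have i2 := t4.const_mul (Cf * h t)
  have hmono := integral_mono_ae t2 ((((i1.add i2).sub Iin).sub hpd.1).sub hsf) t1
  rw [integral_sub' (((i1.add i2).sub Iin).sub hpd.1) hsf, integral_sub' ((i1.add i2).sub Iin) hpd.1,
    integral_sub' (i1.add i2) Iin, integral_add' i1 i2, integral_const_mul, integral_const_mul,
    hpd.2, hst] at hmono
  have e6 : ∫ x in Ω, frob (stress μ lam (gradMat (Du (t, x) - velGrad (S' (t, x)))))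
              (gradMat (Du (t, x) - velGrad (S' (t, x))))
      = (∫ x in Ω, frob (stress μ lam (gradMat (Du (t, x))))
            (gradMat (Du (t, x) - velGrad (S' (t, x)))))
        - ∫ x in Ω, frob (stress μ lam (gradMat (velGrad (S' (t, x)))))
            (gradMat (Du (t, x) - velGrad (S' (t, x)))) := by
    rw [← integral_sub hsf hsf2]
    exact integral_congr_ae (Filter.Eventually.of_forall fun x => frob_sub_stress _ _ _ _ _)
  have e7 : C₀ * (1 + Cf) * (1 + h t) * (∫ x in Ω, ∫ z, relEnergy a γ (S (t, x)) z ∂V (t, x))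
      ≤ (C₀ * (1 + Cf) + Cf) * (1 + h t)
        * (∫ x in Ω, ∫ z, relEnergy a γ (S (t, x)) z ∂V (t, x)) := by
    gcongr
    · linarith [hh t]
    · linarith
  have e8 : Cf * h t * (∫ x in Ω, lowDeviation m (V (t, x)) (S (t, x)).2.2)
      ≤ (C₀ * (1 + Cf) + Cf) * h t * (∫ x in Ω, lowDeviation m (V (t, x)) (S (t, x)).2.2) := by
    have := hh t
    gcongr
    have : 0 ≤ C₀ * (1 + Cf) := by positivity
    linarith
  rw [e6]
  linarith

end Slice

end PotTempNS

namespace PotTempNS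

/-! ### The integral inequality for the relative energy -/

section Gronwall

variable {d : ℕ} {a γ μ lam T T₁ : ℝ} {Ω : Set (Space d)} {ρ₀ θ₀ : Space d → ℝ}
  {u₀ : Space d → Space d} {V : Kernel (ℝ × Space d) (Phase d)}
  {Du : ℝ × Space d → Space d →L[ℝ] Space d} {𝔈 : Kernel ℝ (Space d)}
  {𝔇 : Measure (ℝ × Space d)} {ℜ : ℝ → Fin d → Fin d → SignedMeasure (Space d)}
  {S : ℝ × Space d → Phase d} {S' : ℝ × Space d → (ℝ × Space d) →L[ℝ] Phase d}
  {m M K : ℝ} {D2u : ℝ × Space d → Space d →L[ℝ] Space d →L[ℝ] Space d} {h : ℝ → ℝ}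

/-- The relative energy of the fluid at time `t`. -/
noncomputable def totalRelEnergy (a γ : ℝ) (Ω : Set (Space d))
    (V : Kernel (ℝ × Space d) (Phase d)) (S : ℝ × Space d → Phase d) (t : ℝ) : ℝ :=
  ∫ x in Ω, ∫ z, relEnergy a γ (S (t, x)) z ∂V (t, x)

theorem norm_velGrad_le (L : (ℝ × Space d) →L[ℝ] Phase d) : ‖velGrad L‖ ≤ ‖L‖ := by
  refine ContinuousLinearMap.opNorm_le_bound _ (norm_nonneg _) fun v => ?_
  rw [velGrad_apply]
  calc ‖(L (0, v)).2.2‖ ≤ ‖L (0, v)‖ := (norm_snd_le _).trans (norm_snd_le _)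
    _ ≤ ‖L‖ * ‖((0 : ℝ), v)‖ := L.le_opNorm _
    _ = ‖L‖ * ‖v‖ := by rw [Prod.norm_mk, norm_zero, max_eq_right (norm_nonneg v)]

theorem IsEnergyDefect.integrableOn (h𝔈 : IsEnergyDefect T Ω 𝔈) :
    IntegrableOn (fun t => (𝔈 t).real (closure Ω)) (Ioo 0 T) := by
  obtain ⟨C, hC⟩ := h𝔈.bounded
  refine Integrable.mono' (integrable_const (C : ℝ)) ?_ ?_
  · exact ((𝔈.measurable_coe isClosed_closure.measurableSet).ennreal_toReal).aestronglyMeasurable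
  · filter_upwards [hC] with t ht
    rw [Real.norm_of_nonneg measureReal_nonneg]
    exact ENNReal.toReal_le_coe_of_le_coe ((measure_mono (subset_univ _)).trans ht)

/-- The Reynolds defect is controlled by the energy defect. -/
theorem IsDMVSolution.exists_abs_matrixPairing_le
    (hV : IsDMVSolution a γ μ lam T Ω ρ₀ θ₀ u₀ V Du 𝔈 𝔇 ℜ) (hK : 0 ≤ K) :
    ∃ C : ℝ, 0 ≤ C ∧ ∀ᵐ t ∂(volume.restrict (Ioo 0 T)),
      ∀ M : Space d → Matrix (Fin d) (Fin d) ℝ, (∀ x ∈ closure Ω, ∀ i j, |M x i j| ≤ K) →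
        |matrixPairing M (ℜ t)| ≤ C * (𝔈 t).real (closure Ω) := by
  obtain ⟨c₁, c₂, h1, h2, hc⟩ := hV.compatible
  have h3 : 0 ≤ c₂ := h1.le.trans h2
  obtain ⟨B, hB⟩ := hV.energyDefect.bounded
  refine ⟨d * (d * (K * c₂)), by positivity, ?_⟩
  filter_upwards [hc, hB, hV.energyDefect.concentrated, hV.reynoldsDefect.concentrated,
    hV.reynoldsDefect.posSemidef] with t t1 t2 t3 t4 t5 M hM
  have : IsFiniteMeasure (𝔈 t) := ⟨t2.trans_lt ENNReal.coe_lt_top⟩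
  refine (abs_matrixPairing_le h3 hK t5 (fun A hA => (t1 A hA).2) t4 t3 hM).trans_eq ?_
  ring

/-- The relative energy inequality with a test state, uniformly with respect to the latter. -/
theorem IsDMVSolution.exists_totalRelEnergy_le (ha : 0 < a) (hγ : 1 < γ) (hm : 0 < m) (M : ℝ)
    (hK : 0 ≤ K) (hΩ : IsOpen Ω) (hb : Bornology.IsBounded Ω) (hT : 0 < T)
    (hV : IsDMVSolution a γ μ lam T Ω ρ₀ θ₀ u₀ V Du 𝔈 𝔇 ℜ) :
    ∃ C : ℝ, 0 ≤ C ∧ ∀ S S' T₁ D2u h, IsTestState a γ μ lam m M K T T₁ Ω S S' D2u h →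
      (∀ᵐ x ∂(volume.restrict Ω), S (0, x) = (ρ₀ x, θ₀ x, u₀ x)) →
      ∀ᵐ τ ∂(volume.restrict (Ioo 0 T)),
        totalRelEnergy a γ Ω V S τ + (𝔈 τ).real (closure Ω) + 𝔇.real (cylClosure τ Ω)
          ≤ (∫ p in cyl τ Ω, gain a γ μ lam V Du S S' p)
            + ∫ t in Ioo 0 τ, C * (𝔈 t).real (closure Ω) := by
  obtain ⟨C, hC, hp⟩ := hV.exists_abs_matrixPairing_le hK
  refine ⟨C, hC, fun S S' T₁ D2u h hS hinit => ?_⟩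
  filter_upwards [hV.relEnergy_inequality ha hγ hΩ hb hT hS.c1 (hS.mem_posStates hm) hS.no_slip
    hinit, ae_restrict_mem measurableSet_Ioo] with τ h1 h2
  have h3 : ‖∫ t in Ioo 0 τ, matrixPairing (fun x => gradMat (velGrad (S' (t, x)))) (ℜ t)‖
      ≤ ∫ t in Ioo 0 τ, C * (𝔈 t).real (closure Ω) := by
    have hsub : Ioo 0 τ ⊆ Ioo 0 T := Ioo_subset_Ioo_right h2.2.le
    refine norm_integral_le_of_norm_le
      ((hV.energyDefect.integrableOn.mono_set hsub).const_mul C) ?_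
    filter_upwards [ae_mono (Measure.restrict_mono hsub le_rfl) hp,
      ae_restrict_mem measurableSet_Ioo] with t ht htm
    refine ht _ fun x hx i j => (abs_gradMat_le _ i j).trans ((norm_velGrad_le _).trans ?_)
    exact hS.norm_deriv_le _ ⟨⟨htm.1.le, (htm.2.trans h2.2).le⟩, hx⟩
  have h4 := (abs_le.1 h3).1
  unfold totalRelEnergy gain
  linarith

theorem IsDMVSolution.totalRelEnergy_nonneg (ha : 0 < a) (hγ : 1 < γ) (hm : 0 < m)
    (hΩ : IsOpen Ω) (hV : IsDMVSolution a γ μ lam T Ω ρ₀ θ₀ u₀ V Du 𝔈 𝔇 ℜ)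
    (hS : IsTestState a γ μ lam m M K T T₁ Ω S S' D2u h) :
    ∀ᵐ t ∂(volume.restrict (Ioo 0 T)), 0 ≤ totalRelEnergy a γ Ω V S t := by
  have := hV.markov
  obtain ⟨c, hc, hsupp⟩ := hV.support
  filter_upwards [ae_ae_of_ae_cyl (concentratedOnAdm_of_support hsupp),
    ae_restrict_mem measurableSet_Ioo] with t t1 t2
  refine integral_nonneg_of_ae ?_
  filter_upwards [t1, ae_restrict_mem hΩ.measurableSet] with x hx hxΩ
  exact integral_nonneg_of_ae (hx.mono fun z hz =>
    relEnergy_nonneg ha hγ (hS.mem_posStates hm (t, x) (cyl_subset_cylClosure ⟨t2, hxΩ⟩)) hz.1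
      (hc.trans_le hz.2))

theorem IsDMVSolution.integrableOn_totalRelEnergy (ha : 0 < a) (hγ : 1 < γ) (hm : 0 < m)
    (hΩ : IsOpen Ω) (hb : Bornology.IsBounded Ω)
    (hV : IsDMVSolution a γ μ lam T Ω ρ₀ θ₀ u₀ V Du 𝔈 𝔇 ℜ)
    (hS : IsTestState a γ μ lam m M K T T₁ Ω S S' D2u h) :
    IntegrableOn (totalRelEnergy a γ Ω V S) (Ioo 0 T) := by
  have := hV.markov
  obtain ⟨c, hc, hsupp⟩ := hV.support
  exact integrableOn_integral_slice (relEnergy_moment ha hγ hc (concentratedOnAdm_of_support hsupp)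
    hV.energy.2.2.1 hΩ hb hS.c1 (hS.mem_posStates hm)).2

/-- A crude bound, with all integrals extended to the full cylinder. It supplies the boundedness
assumed in `ae_eq_zero_of_osgood`. -/
theorem IsDMVSolution.exists_totalRelEnergy_bound (ha : 0 < a) (hγ : 1 < γ) (hm : 0 < m)
    (hK : 0 ≤ K) (hΩ : IsOpen Ω) (hb : Bornology.IsBounded Ω) (hT : 0 < T)
    (hV : IsDMVSolution a γ μ lam T Ω ρ₀ θ₀ u₀ V Du 𝔈 𝔇 ℜ)
    (hS : IsTestState a γ μ lam m M K T T₁ Ω S S' D2u h)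
    (hinit : ∀ᵐ x ∂(volume.restrict Ω), S (0, x) = (ρ₀ x, θ₀ x, u₀ x)) :
    ∃ B : ℝ, ∀ᵐ t ∂(volume.restrict (Ioo 0 T)),
      totalRelEnergy a γ Ω V S t + (𝔈 t).real (closure Ω) ≤ B := by
  have := hV.markov
  obtain ⟨c, hc, hsupp⟩ := hV.support
  obtain ⟨C, hC, hE⟩ := hV.exists_totalRelEnergy_le ha hγ hm M hK hΩ hb hT
  have hG := hS.integrableOn_gain ha hγ hc hm hK (concentratedOnAdm_of_support hsupp)
    hV.energy.2.2.1 hΩ hb hV.energy.2.1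
  refine ⟨(∫ p in cyl T Ω, ‖gain a γ μ lam V Du S S' p‖)
    + ∫ t in Ioo 0 T, C * (𝔈 t).real (closure Ω), ?_⟩
  filter_upwards [hE S S' T₁ D2u h hS hinit, ae_restrict_mem measurableSet_Ioo] with τ h1 h2
  have h3 : ∫ p in cyl τ Ω, gain a γ μ lam V Du S S' p
      ≤ ∫ p in cyl T Ω, ‖gain a γ μ lam V Du S S' p‖ :=
    ((Real.le_norm_self _).trans (norm_integral_le_integral_norm _)).trans
      (setIntegral_mono_set hG.norm (Filter.Eventually.of_forall fun _ => norm_nonneg _)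
        (cyl_mono h2.2.le).eventuallyLE)
  have h4 : ∫ t in Ioo 0 τ, C * (𝔈 t).real (closure Ω)
      ≤ ∫ t in Ioo 0 T, C * (𝔈 t).real (closure Ω) :=
    setIntegral_mono_set (hV.energyDefect.integrableOn.const_mul C)
      (Filter.Eventually.of_forall fun _ => mul_nonneg hC measureReal_nonneg)
      (Ioo_subset_Ioo_right h2.2.le).eventuallyLE
  have h5 : 0 ≤ 𝔇.real (cylClosure τ Ω) := measureReal_nonneg
  linarith

/-- The velocity is compared with `y.2.2` through an arbitrary vector `U`. Young's inequality splits
`s ‖u - U‖`, the constant part being paid for by the relative energy, which is bounded below on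
states of low density. The remaining `‖U - y.2.2‖` does not depend on the state and meets only the
mass of the low densities. The freedom in `U` separates the cases of two and three dimensions. -/
theorem mul_lowDeviation_le {ν : Measure (Phase d)} [IsProbabilityMeasure ν] {y : Phase d}
    {U : Space d} {c s C δ : ℝ} (hδ : 0 < δ) (hs : 0 ≤ s) (hadm : ∀ᵐ z ∂ν, z ∈ admStates d c)
    (hC : ∀ z ∈ admStates d c, 0 ≤ C * relEnergy a γ y z ∧
      (z ∈ lowDensity d m → 1 ≤ C * relEnergy a γ y z))
    (h1 : Integrable (relEnergy a γ y) ν)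
    (h2 : Integrable (fun z : Phase d => ‖z.2.2 - U‖ ^ 2) ν)
    (h3 : Integrable (fun z : Phase d => z.2.2) ν) :
    s * lowDeviation m ν y.2.2 ≤ δ * (∫ z, ‖z.2.2 - U‖ ^ 2 ∂ν)
      + s ^ 2 / (4 * δ) * (C * ∫ z, relEnergy a γ y z ∂ν)
      + s * (ν.real (lowDensity d m) * ‖U - y.2.2‖) := by
  have hlm := measurableSet_lowDensity (d := d) m
  have i1 : Integrable (fun z : Phase d => (lowDensity d m).indicator
      (fun z => ‖z.2.2 - y.2.2‖) z) ν := (h3.sub (integrable_const _)).norm.indicator hlm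
  have i2 := h2.const_mul δ
  have i3 := (h1.const_mul C).const_mul (s ^ 2 / (4 * δ))
  have i4 : Integrable ((lowDensity d m).indicator fun _ : Phase d => s * ‖U - y.2.2‖) ν :=
    (integrable_const _).indicator hlm
  rw [lowDeviation, ← integral_const_mul]
  refine (integral_mono_ae (i1.const_mul s) ((i2.add i3).add i4) ?_).trans_eq ?_
  · filter_upwards [hadm] with z hz
    simp only [Pi.add_apply]
    obtain ⟨e1, e2⟩ := hC z hz
    by_cases hl : z ∈ lowDensity d m
    · rw [indicator_of_mem hl, indicator_of_mem hl]
      have e3 : ‖z.2.2 - y.2.2‖ ≤ ‖z.2.2 - U‖ + ‖U - y.2.2‖ := by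
        simpa using norm_add_le (z.2.2 - U) (U - y.2.2)
      have e4 : s * ‖z.2.2 - U‖ ≤ δ * ‖z.2.2 - U‖ ^ 2 + s ^ 2 / (4 * δ) * 1 := by
        have : 0 ≤ (2 * δ * ‖z.2.2 - U‖ - s) ^ 2 / (4 * δ) := by positivity
        have e : (2 * δ * ‖z.2.2 - U‖ - s) ^ 2 / (4 * δ)
          = δ * ‖z.2.2 - U‖ ^ 2 + s ^ 2 / (4 * δ) * 1 - s * ‖z.2.2 - U‖ := by
          field_simp
          ring
        linarith
      have e5 := mul_le_mul_of_nonneg_left (e2 hl) (by positivity : 0 ≤ s ^ 2 / (4 * δ))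
      have e6 := mul_le_mul_of_nonneg_left e3 hs
      linarith
    · rw [indicator_of_notMem hl, indicator_of_notMem hl, mul_zero]
      have : 0 ≤ δ * ‖z.2.2 - U‖ ^ 2 := by positivity
      have := mul_nonneg (by positivity : 0 ≤ s ^ 2 / (4 * δ)) e1
      linarith
  · rw [integral_add' (i2.add i3) i4, integral_add' i2 i3, integral_const_mul, integral_const_mul,
      integral_const_mul, integral_indicator hlm, setIntegral_const, smul_eq_mul]
    ring

end Gronwall

end PotTempNS

namespace PotTempNS

/-! ### The Grönwall inequality with a free reference velocity -/

section Uniqueness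

variable {d : ℕ} {a γ μ lam T T₁ : ℝ} {Ω : Set (Space d)} {ρ₀ θ₀ : Space d → ℝ}
  {u₀ : Space d → Space d} {V : Kernel (ℝ × Space d) (Phase d)}
  {Du : ℝ × Space d → Space d →L[ℝ] Space d} {𝔈 : Kernel ℝ (Space d)}
  {𝔇 : Measure (ℝ × Space d)} {ℜ : ℝ → Fin d → Fin d → SignedMeasure (Space d)}
  {S : ℝ × Space d → Phase d} {S' : ℝ × Space d → (ℝ × Space d) →L[ℝ] Phase d}
  {m M K : ℝ} {D2u : ℝ × Space d → Space d →L[ℝ] Space d →L[ℝ] Space d} {h : ℝ → ℝ}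

theorem integrable_frob_gradMat {α : Type*} [MeasurableSpace α] {ν : Measure α}
    {A : α → Space d →L[ℝ] Space d} (hA : MemLp A 2 ν) :
    Integrable (fun x => frob (gradMat (A x)) (gradMat (A x))) ν := by
  have m : ∀ i j, MemLp (fun x => gradMat (A x) i j) 2 ν := fun i j =>
    (gradEntry i j).comp_memLp' hA
  exact integrable_finsetSum _ fun i _ => integrable_finsetSum _ fun j _ =>
    (m i j).integrable_mul (m i j)

theorem measurable_lowDensity_mass [IsMarkovKernel V] :
    Measurable fun p => (V p).real (lowDensity d m) :=
  (V.measurable_coe (measurableSet_lowDensity m)).ennreal_toReal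

theorem integrableOn_mass_mul_norm [IsMarkovKernel V] (hb : Bornology.IsBounded Ω)
    (hh : MemLp h 2 (volume.restrict (Ioo 0 T))) {q : ℝ × Space d → Space d}
    (hq : MemLp q 2 (volume.restrict (cyl T Ω))) :
    IntegrableOn (fun p => h p.1 * ((V p).real (lowDensity d m) * ‖q p‖)) (cyl T Ω) := by
  have hfinΩ : IsFiniteMeasure ((volume : Measure (Space d)).restrict Ω) :=
    ⟨by rw [Measure.restrict_apply_univ]; exact hb.measure_lt_top⟩
  have h1 : MemLp (fun p : ℝ × Space d => h p.1) 2 (volume.restrict (cyl T Ω)) := by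
    rw [restrict_cyl]
    exact hh.comp_fst _
  have h3 := (h1.integrable_mul hq.norm).bdd_mul (c := 1)
    (measurable_lowDensity_mass (V := V) (m := m)).aestronglyMeasurable
    (Filter.Eventually.of_forall fun p => by
      rw [Real.norm_of_nonneg measureReal_nonneg]
      exact measureReal_le_one)
  refine h3.congr (Filter.Eventually.of_forall fun p => ?_)
  simp only [Pi.mul_apply]
  ring

theorem integrable_weight_mul {B T : ℝ} {h F : ℝ → ℝ} (hh : MemLp h 2 (volume.restrict (Ioo 0 T)))
    (hF : AEStronglyMeasurable F (volume.restrict (Ioo 0 T)))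
    (hB : ∀ᵐ t ∂(volume.restrict (Ioo 0 T)), 0 ≤ F t ∧ F t ≤ B) :
    IntegrableOn (fun t => (1 + h t + h t ^ 2) * F t) (Ioo 0 T) := by
  have hi : IntegrableOn (fun t => 1 + h t + h t ^ 2) (Ioo 0 T) :=
    ((integrable_const (1 : ℝ)).add (hh.integrable (by norm_num))).add hh.integrable_sq
  refine hi.mul_bdd hF (c := B) ?_
  filter_upwards [hB] with t ht
  rw [Real.norm_of_nonneg ht.1]
  exact ht.2

/-- The integral inequality for the relative energy, in which the velocity field `U` serves as
reference in Poincaré's inequality. -/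
theorem IsDMVSolution.exists_gronwall (ha : 0 < a) (hγ : 1 < γ) (hm : 0 < m) (hK : 0 ≤ K)
    (hΩ : IsOpen Ω) (hb : Bornology.IsBounded Ω) (h0 : 0 < T₁) (hT : T₁ < T)
    (hV : IsDMVSolution a γ μ lam T Ω ρ₀ θ₀ u₀ V Du 𝔈 𝔇 ℜ)
    (hS : IsTestState a γ μ lam m M K T T₁ Ω S S' D2u h)
    (hinit : ∀ᵐ x ∂(volume.restrict Ω), S (0, x) = (ρ₀ x, θ₀ x, u₀ x))
    (hh : ∀ t, 0 ≤ h t) (hh2 : MemLp h 2 (volume.restrict (Ioo 0 T₁)))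
    {U : ℝ × Space d → Space d} {DU : ℝ × Space d → Space d →L[ℝ] Space d} {k : ℝ} (hk : 0 < k)
    (hU : MemL2W12Zero T Ω U DU)
    (hdiss : ∀ᵐ t ∂(volume.restrict (Ioo 0 T₁)),
      k * (∫ x in Ω, frob (gradMat (Du (t, x) - DU (t, x))) (gradMat (Du (t, x) - DU (t, x))))
        ≤ ∫ x in Ω, frob (stress μ lam (gradMat (Du (t, x) - velGrad (S' (t, x)))))
            (gradMat (Du (t, x) - velGrad (S' (t, x))))) :
    ∃ A C : ℝ, 0 ≤ A ∧ 0 ≤ C ∧ ∀ᵐ τ ∂(volume.restrict (Ioo 0 T₁)),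
      totalRelEnergy a γ Ω V S τ + (𝔈 τ).real (closure Ω)
        ≤ ∫ t in Ioo 0 τ, (A * (1 + h t + h t ^ 2)
            * (totalRelEnergy a γ Ω V S t + (𝔈 t).real (closure Ω))
          + C * (h t * ∫ x in Ω,
              (V (t, x)).real (lowDensity d m) * ‖U (t, x) - (S (t, x)).2.2‖)) := by
  have := hV.markov
  have hT0 : 0 < T := h0.trans hT
  obtain ⟨c, hc, hsupp⟩ := hV.support
  have hadm := concentratedOnAdm_of_support hsupp
  obtain ⟨hint, hDu, hen, -⟩ := hV.energy
  have hpos := hS.mem_posStates hm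
  have hle : (volume : Measure (ℝ × Space d)).restrict (cyl T₁ Ω)
      ≤ volume.restrict (cyl T Ω) := Measure.restrict_mono (cyl_mono hT.le) le_rfl
  have hle' : (volume : Measure ℝ).restrict (Ioo 0 T₁) ≤ volume.restrict (Ioo 0 T) :=
    Measure.restrict_mono (Ioo_subset_Ioo_right hT.le) le_rfl
  obtain ⟨C, hC, hgain⟩ := hS.exists_gain_slice_le ha hγ hc hm hK hadm hen hΩ hb hDu hV.poincare
    hint hh h0 hT
  obtain ⟨C₁, hC₁, hlow⟩ := exists_one_le_relEnergy (d := d) (M := M) ha hγ hm hc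
  obtain ⟨CP, hCP, hP⟩ := hV.poincare.integral_le
  obtain ⟨Cp, hCp, hE⟩ := hV.exists_totalRelEnergy_le ha hγ hm M hK hΩ hb hT0
  obtain ⟨B, hB⟩ := hV.exists_totalRelEnergy_bound ha hγ hm hK hΩ hb hT0 hS hinit
  have hE0 := hV.totalRelEnergy_nonneg ha hγ hm hΩ hS
  have hEi := hV.integrableOn_totalRelEnergy ha hγ hm hΩ hb hS
  have hei := hV.energyDefect.integrableOn
  have hG := hS.integrableOn_gain ha hγ hc hm hK hadm hen hΩ hb hDu
  have hUW := hS.memL2W12Zero hΩ hb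
  have hrE := relEnergy_moment ha hγ hc hadm hen hΩ hb hS.c1 hpos
  have hdev := exists_integrable_sq_deviation hV.poincare hU h0.le hT
  have hdevS := exists_integrable_sq_deviation hV.poincare hUW h0.le hT
  have hJ := integrableOn_lowDeviation (m := m) hb (hUW.1.1.mono_measure hle) hdevS.1 hdevS.2
  -- the choice of the parameter
  obtain ⟨δ, hδ, hδ1, hδk⟩ : ∃ δ : ℝ, 0 < δ ∧ C * δ * CP ≤ 1 ∧ C * δ * CP ≤ k := by
    have hp : 0 < C * CP + 1 := by positivity
    have h1 : C * (min k 1 / (C * CP + 1)) * CP ≤ min k 1 := by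
      have : C * (min k 1 / (C * CP + 1)) * CP = min k 1 * (C * CP / (C * CP + 1)) := by
        field_simp
      rw [this]
      refine mul_le_of_le_one_right (by positivity) ?_
      rw [div_le_one hp]
      linarith
    exact ⟨min k 1 / (C * CP + 1), by positivity, h1.trans (min_le_right _ _),
      h1.trans (min_le_left _ _)⟩
  -- the functions on the cylinder
  set W : ℝ × Space d → ℝ := fun p => ∫ z, ‖z.2.2 - U p‖ ^ 2 ∂V p with hW
  set Y : ℝ × Space d → ℝ := fun p =>
    h p.1 * ((V p).real (lowDensity d m) * ‖U p - (S p).2.2‖) with hY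
  set D : ℝ × Space d → ℝ := fun p => frob (gradMat (Du p - DU p)) (gradMat (Du p - DU p)) with hD
  have hYi : IntegrableOn Y (cyl T₁ Ω) :=
    integrableOn_mass_mul_norm hb hh2 ((hU.1.sub hUW.1).mono_measure hle)
  have hDi : IntegrableOn D (cyl T Ω) := integrable_frob_gradMat (hDu.2.1.sub hU.2.1)
  have hpt : ∀ᵐ p ∂(volume.restrict (cyl T₁ Ω)), h p.1 * lowDeviation m (V p) (S p).2.2
      ≤ δ * W p + h p.1 ^ 2 / (4 * δ) * (C₁ * ∫ z, relEnergy a γ (S p) z ∂V p) + Y p := by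
    filter_upwards [ae_mono hle hadm, ae_mono hle hrE.1, hdev.1, ae_mono hle hint,
      ae_restrict_mem (isOpen_cyl hΩ).measurableSet] with p h1 h2 h3 h4 h5
    have hcl : p ∈ cylClosure T Ω := cyl_subset_cylClosure (cyl_mono hT.le h5)
    exact mul_lowDeviation_le hδ (hh _) h1 (fun z hz => ⟨mul_nonneg hC₁.le
      (relEnergy_nonneg ha hγ (hpos p hcl) hz.1 (hc.trans_le hz.2)),
      hlow _ (hS.mem_box p hcl) z hz⟩) h2 h3 h4
  set E := totalRelEnergy a γ Ω V S with hEdef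
  set e : ℝ → ℝ := fun t => (𝔈 t).real (closure Ω) with he
  have he0 : ∀ t, 0 ≤ e t := fun t => measureReal_nonneg
  have hF : ∀ᵐ t ∂(volume.restrict (Ioo 0 T₁)), 0 ≤ E t + e t ∧ E t + e t ≤ B := by
    filter_upwards [ae_mono hle' hE0, ae_mono hle' hB] with t t1 t2
    exact ⟨add_nonneg t1 (he0 t), t2⟩
  have hEB : ∀ᵐ t ∂(volume.restrict (Ioo 0 T₁)), 0 ≤ E t ∧ E t ≤ B := by
    filter_upwards [ae_mono hle' hE0, ae_mono hle' hB] with t t1 t2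
    exact ⟨t1, by linarith [he0 t]⟩
  have hFm : AEStronglyMeasurable (fun t => E t + e t) (volume.restrict (Ioo 0 T₁)) :=
    (hEi.add hei).1.mono_measure hle'
  have iwF := integrable_weight_mul hh2 hFm hF
  have iwE := integrable_weight_mul hh2 (hEi.1.mono_measure hle') hEB
  have iY := integrableOn_integral_slice hYi
  have iW := integrableOn_integral_slice hdev.2
  have iD := (integrableOn_integral_slice hDi).mono_set (Ioo_subset_Ioo_right hT.le)
  set A₀ := C + C * C₁ / (4 * δ) with hA₀
  have hA₀0 : 0 ≤ A₀ := by positivity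
  -- the estimate on time slices
  have hslice : ∀ᵐ t ∂(volume.restrict (Ioo 0 T₁)), ∫ x in Ω, gain a γ μ lam V Du S S' (t, x)
      ≤ A₀ * ((1 + h t + h t ^ 2) * E t) + C * (∫ x in Ω, Y (t, x))
        + C * δ * (∫ x in Ω, W (t, x)) - k * ∫ x in Ω, D (t, x) := by
    filter_upwards [hgain, hdiss, ae_ae_of_ae_cyl hpt, integrable_slice hJ, integrable_slice hdev.2,
      ae_mono hle' (integrable_slice hrE.2), integrable_slice hYi, hEB]
      with t t1 t2 t3 t4 t5 t6 t7 t8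
    have t9 := integral_mono_ae (t4.const_mul (h t)) (((t5.const_mul δ).add
      ((t6.const_mul C₁).const_mul (h t ^ 2 / (4 * δ)))).add t7) t3
    rw [integral_add' ((t5.const_mul δ).add
      ((t6.const_mul C₁).const_mul (h t ^ 2 / (4 * δ)))) t7, integral_add' (t5.const_mul δ)
      ((t6.const_mul C₁).const_mul (h t ^ 2 / (4 * δ))), integral_const_mul, integral_const_mul,
      integral_const_mul, integral_const_mul] at t9
    have t10 := mul_le_mul_of_nonneg_left t9 hC
    change _ ≤ C * (1 + h t) * E t + _ - _ at t1
    change _ ≤ C * (δ * _ + h t ^ 2 / (4 * δ) * (C₁ * E t) + _) at t10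
    have t11 : C * (1 + h t) * E t + C * (h t ^ 2 / (4 * δ) * (C₁ * E t))
        ≤ A₀ * ((1 + h t + h t ^ 2) * E t) := by
      have e1 : C * (h t ^ 2 / (4 * δ) * (C₁ * E t)) = C * C₁ / (4 * δ) * (h t ^ 2 * E t) := by
        field_simp
      have e2 : 0 ≤ C * C₁ / (4 * δ) * ((1 + h t) * E t) :=
        mul_nonneg (by positivity) (mul_nonneg (by linarith [hh t]) t8.1)
      have e3 : 0 ≤ C * (h t ^ 2 * E t) := mul_nonneg hC (mul_nonneg (sq_nonneg _) t8.1)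
      rw [e1, hA₀]
      linarith
    change k * (∫ x in Ω, D (t, x)) ≤ _ at t2
    linarith
  refine ⟨A₀ + (1 + Cp), C, by positivity, hC, ?_⟩
  filter_upwards [ae_mono hle' (hE S S' T₁ D2u h hS hinit), ae_mono hle' (hP U DU hU),
    ae_restrict_mem measurableSet_Ioo] with τ h1 h2 h3
  have hsub : Ioo 0 τ ⊆ Ioo 0 T₁ := Ioo_subset_Ioo_right h3.2.le
  have hsub' : Ioo 0 τ ⊆ Ioo 0 T := Ioo_subset_Ioo_right (h3.2.trans hT).le
  have hτ : (volume : Measure ℝ).restrict (Ioo 0 τ) ≤ volume.restrict (Ioo 0 T₁) :=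
    Measure.restrict_mono hsub le_rfl
  have jE := (iwE.mono_set hsub).const_mul A₀
  have jY := (iY.mono_set hsub).const_mul C
  have jW := (iW.mono_set hsub).const_mul (C * δ)
  have jD := (iD.mono_set hsub).const_mul k
  have je := hei.mono_set hsub'
  rw [integral_cyl (hG.mono_set (cyl_mono (h3.2.trans hT).le))] at h1
  have h4 := integral_mono_ae (integrableOn_integral_slice
    (hG.mono_set (cyl_mono (h3.2.trans hT).le))) (((jE.add jY).add jW).sub jD) (ae_mono hτ hslice)
  rw [integral_sub' ((jE.add jY).add jW) jD, integral_add' (jE.add jY) jW, integral_add' jE jY,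
    integral_const_mul (C * δ), integral_const_mul k] at h4
  obtain ⟨-, -, h5⟩ := h2
  rw [integral_cyl (hdev.2.mono_set (cyl_mono h3.2.le)),
    integral_cyl (hDi.mono_set (cyl_mono (h3.2.trans hT).le))] at h5
  have h6 := mul_le_mul_of_nonneg_left h5 (mul_nonneg hC hδ.le)
  have hD0 : 0 ≤ ∫ t in Ioo 0 τ, ∫ x in Ω, D (t, x) :=
    integral_nonneg fun t => integral_nonneg fun x => frob_nonneg _
  have hi0 : 0 ≤ ∫ t in Ioo 0 τ, e t := integral_nonneg he0
  have h𝔇0 : 0 ≤ 𝔇.real (cylClosure τ Ω) := measureReal_nonneg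
  -- By the choice of `δ`, the gradient term of Poincaré's inequality is absorbed by the dissipation
  -- and the term in `𝔇` by the one on the left-hand side of the relative energy inequality. The
  -- energy defect goes to the Grönwall term.
  have h7 : C * δ * (CP * ((∫ t in Ioo 0 τ, ∫ x in Ω, D (t, x)) + (∫ t in Ioo 0 τ, e t)
      + 𝔇.real (cylClosure τ Ω))) ≤ k * (∫ t in Ioo 0 τ, ∫ x in Ω, D (t, x))
      + (∫ t in Ioo 0 τ, e t) + 𝔇.real (cylClosure τ Ω) := by
    have e1 := mul_le_mul_of_nonneg_right hδk hD0
    have e2 := mul_le_mul_of_nonneg_right hδ1 hi0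
    have e3 := mul_le_mul_of_nonneg_right hδ1 h𝔇0
    linarith
  rw [integral_const_mul Cp] at h1
  have h8 : E τ + e τ ≤ (∫ t in Ioo 0 τ, A₀ * ((1 + h t + h t ^ 2) * E t))
      + (∫ t in Ioo 0 τ, C * ∫ x in Ω, Y (t, x)) + (1 + Cp) * ∫ t in Ioo 0 τ, e t := by
    linarith
  refine h8.trans ?_
  rw [← integral_const_mul (1 + Cp), ← integral_add' jE jY,
    ← integral_add' (jE.add jY) (je.const_mul (1 + Cp))]
  have hFi : IntegrableOn (fun t => (A₀ + (1 + Cp)) * (1 + h t + h t ^ 2) * (E t + e t)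
      + C * (h t * ∫ x in Ω,
        (V (t, x)).real (lowDensity d m) * ‖U (t, x) - (S (t, x)).2.2‖)) (Ioo 0 τ) := by
    refine (((iwF.mono_set hsub).const_mul (A₀ + (1 + Cp))).add jY).congr
      (Filter.Eventually.of_forall fun t => ?_)
    simp only [Pi.add_apply, hY, integral_const_mul]
    ring
  refine integral_mono_ae ((jE.add jY).add (je.const_mul (1 + Cp))) hFi ?_
  filter_upwards [ae_mono hτ hEB] with t ht
  simp only [Pi.add_apply, hY, integral_const_mul]
  have hw : 1 ≤ 1 + h t + h t ^ 2 := by nlinarith [hh t]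
  have e1 : 0 ≤ (1 + Cp) * ((1 + h t + h t ^ 2) * E t) :=
    mul_nonneg (by linarith) (mul_nonneg (by linarith) ht.1)
  have e2 : 0 ≤ A₀ * ((1 + h t + h t ^ 2) * e t) :=
    mul_nonneg hA₀0 (mul_nonneg (by linarith) (he0 t))
  have e3 : (1 + Cp) * e t ≤ (1 + Cp) * ((1 + h t + h t ^ 2) * e t) :=
    mul_le_mul_of_nonneg_left (le_mul_of_one_le_left (he0 t) hw) (by linarith)
  linarith

end Uniqueness

end PotTempNS

namespace PotTempNS

/-! ### Vanishing of the relative energy and of the energy defect before `T₁` -/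

section Vanishing

variable {d : ℕ} {a γ μ lam T T₁ : ℝ} {Ω : Set (Space d)} {ρ₀ θ₀ : Space d → ℝ}
  {u₀ : Space d → Space d} {V : Kernel (ℝ × Space d) (Phase d)}
  {Du : ℝ × Space d → Space d →L[ℝ] Space d} {𝔈 : Kernel ℝ (Space d)}
  {𝔇 : Measure (ℝ × Space d)} {ℜ : ℝ → Fin d → Fin d → SignedMeasure (Space d)}
  {S : ℝ × Space d → Phase d} {S' : ℝ × Space d → (ℝ × Space d) →L[ℝ] Phase d}
  {m M K : ℝ} {D2u : ℝ × Space d → Space d →L[ℝ] Space d →L[ℝ] Space d} {h : ℝ → ℝ}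

/-- The mass of the states of low density is controlled by the relative energy. -/
theorem IsDMVSolution.exists_integral_mass_le (ha : 0 < a) (hγ : 1 < γ) (hm : 0 < m)
    (hΩ : IsOpen Ω) (hb : Bornology.IsBounded Ω)
    (hV : IsDMVSolution a γ μ lam T Ω ρ₀ θ₀ u₀ V Du 𝔈 𝔇 ℜ)
    (hS : IsTestState a γ μ lam m M K T T₁ Ω S S' D2u h) :
    ∃ C : ℝ, 0 < C ∧ ∀ᵐ t ∂(volume.restrict (Ioo 0 T)),
      ∫ x in Ω, (V (t, x)).real (lowDensity d m) ≤ C * totalRelEnergy a γ Ω V S t := by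
  have := hV.markov
  obtain ⟨c, hc, hsupp⟩ := hV.support
  have hadm := concentratedOnAdm_of_support hsupp
  have hpos := hS.mem_posStates hm
  have hfinΩ : IsFiniteMeasure ((volume : Measure (Space d)).restrict Ω) :=
    ⟨by rw [Measure.restrict_apply_univ]; exact hb.measure_lt_top⟩
  obtain ⟨C, hC, hlow⟩ := exists_one_le_relEnergy (d := d) (M := M) ha hγ hm hc
  have hrE := relEnergy_moment ha hγ hc hadm hV.energy.2.2.1 hΩ hb hS.c1 hpos
  have hpt : ∀ᵐ p ∂(volume.restrict (cyl T Ω)), (V p).real (lowDensity d m)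
      ≤ C * ∫ z, relEnergy a γ (S p) z ∂V p := by
    filter_upwards [hadm, hrE.1, ae_restrict_mem (isOpen_cyl hΩ).measurableSet] with p h1 h2 h3
    have hcl : p ∈ cylClosure T Ω := cyl_subset_cylClosure h3
    rw [← integral_indicator_one (measurableSet_lowDensity m), ← integral_const_mul]
    refine integral_mono_ae ((integrable_const 1).indicator (measurableSet_lowDensity m))
      (h2.const_mul C) ?_
    filter_upwards [h1] with z hz
    by_cases hl : z ∈ lowDensity d m
    · rw [indicator_of_mem hl]
      exact hlow _ (hS.mem_box p hcl) z hz hl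
    · rw [indicator_of_notMem hl]
      exact mul_nonneg hC.le (relEnergy_nonneg ha hγ (hpos p hcl) hz.1 (hc.trans_le hz.2))
  refine ⟨C, hC, ?_⟩
  filter_upwards [ae_ae_of_ae_cyl hpt, integrable_slice hrE.2] with t t1 t2
  rw [totalRelEnergy, ← integral_const_mul]
  refine integral_mono_ae ?_ (t2.const_mul C) t1
  refine Integrable.mono' (integrable_const (1 : ℝ))
    ((measurable_lowDensity_mass (V := V) (m := m)).comp
      measurable_prodMk_left).aestronglyMeasurable (Filter.Eventually.of_forall fun x => ?_)
  rw [Real.norm_of_nonneg measureReal_nonneg]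
  exact measureReal_le_one

theorem IsDMVSolution.memW12Zero_velocity_sub (hΩ : IsOpen Ω) (hb : Bornology.IsBounded Ω)
    (hV : IsDMVSolution a γ μ lam T Ω ρ₀ θ₀ u₀ V Du 𝔈 𝔇 ℜ)
    (hS : IsTestState a γ μ lam m M K T T₁ Ω S S' D2u h) :
    ∀ᵐ t ∂(volume.restrict (Ioo 0 T)), MemW12Zero Ω
      (fun x => meanVelocity V (t, x) - (S (t, x)).2.2)
      (fun x => Du (t, x) - velGrad (S' (t, x))) := by
  filter_upwards [hV.energy.2.1.2.2, (hS.memL2W12Zero hΩ hb).2.2] with t t1 t2 using t1.sub t2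

/-- Up to the time `T₁`, the relative energy and the energy defect vanish. -/
theorem IsDMVSolution.ae_totalRelEnergy_add_eq_zero (hd : d = 2 ∨ d = 3) (ha : 0 < a) (hγ : 1 < γ)
    (hμ : 0 < μ) (hlam : -(2 / (d : ℝ)) * μ ≤ lam) (hm : 0 < m) (hK : 0 ≤ K)
    (hΩ : IsOpen Ω) (hb : Bornology.IsBounded Ω) (h0 : 0 < T₁) (hT : T₁ < T)
    (hV : IsDMVSolution a γ μ lam T Ω ρ₀ θ₀ u₀ V Du 𝔈 𝔇 ℜ)
    (hS : IsTestState a γ μ lam m M K T T₁ Ω S S' D2u h)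
    (hinit : ∀ᵐ x ∂(volume.restrict Ω), S (0, x) = (ρ₀ x, θ₀ x, u₀ x))
    (hh : ∀ t, 0 ≤ h t) (hh2 : MemLp h 2 (volume.restrict (Ioo 0 T₁))) :
    ∀ᵐ t ∂(volume.restrict (Ioo 0 T₁)),
      totalRelEnergy a γ Ω V S t + (𝔈 t).real (closure Ω) = 0 := by
  have := hV.markov
  have hT0 : 0 < T := h0.trans hT
  have hle' : (volume : Measure ℝ).restrict (Ioo 0 T₁) ≤ volume.restrict (Ioo 0 T) :=
    Measure.restrict_mono (Ioo_subset_Ioo_right hT.le) le_rfl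
  have hle : (volume : Measure (ℝ × Space d)).restrict (cyl T₁ Ω)
      ≤ volume.restrict (cyl T Ω) := Measure.restrict_mono (cyl_mono hT.le) le_rfl
  have hfinΩ : IsFiniteMeasure ((volume : Measure (Space d)).restrict Ω) :=
    ⟨by rw [Measure.restrict_apply_univ]; exact hb.measure_lt_top⟩
  obtain ⟨B, hB⟩ := hV.exists_totalRelEnergy_bound ha hγ hm hK hΩ hb hT0 hS hinit
  have hE0 := hV.totalRelEnergy_nonneg ha hγ hm hΩ hS
  have hFm : AEStronglyMeasurable (fun t => totalRelEnergy a γ Ω V S t + (𝔈 t).real (closure Ω))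
      (volume.restrict (Ioo 0 T₁)) :=
    ((hV.integrableOn_totalRelEnergy ha hγ hm hΩ hb hS).add
      hV.energyDefect.integrableOn).1.mono_measure hle'
  have hF : ∀ᵐ t ∂(volume.restrict (Ioo 0 T₁)),
      0 ≤ totalRelEnergy a γ Ω V S t + (𝔈 t).real (closure Ω) ∧
      totalRelEnergy a γ Ω V S t + (𝔈 t).real (closure Ω) ≤ B := by
    filter_upwards [ae_mono hle' hE0, ae_mono hle' hB] with t t1 t2
    exact ⟨add_nonneg t1 measureReal_nonneg, t2⟩
  have hw : IntegrableOn (fun t => 1 + h t + h t ^ 2) (Ioo 0 T₁) :=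
    ((integrable_const (1 : ℝ)).add (hh2.integrable (by norm_num))).add hh2.integrable_sq
  have hw0 : ∀ t, 0 ≤ 1 + h t + h t ^ 2 := fun t => by nlinarith [hh t]
  have hUW := hS.memL2W12Zero hΩ hb
  have hDu := hV.energy.2.1
  have hq := ae_mono hle' (hV.memW12Zero_velocity_sub hΩ hb hS)
  rcases hd with hd | hd
  -- In the plane `lam = -μ` is allowed, and the coercivity constant `μ - k` degenerates to zero.
  -- The mean velocity serves as reference in Poincaré's inequality: the gradient term then vanishes
  -- identically, any positive `k` is admissible, and the dissipation is only required to be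
  -- non-negative.
  · have hdr : (d : ℝ) = 2 := by rw [hd]; norm_num
    obtain ⟨A, C, hA, hC, hgr⟩ := hV.exists_gronwall ha hγ hm hK hΩ hb h0 hT hS hinit hh hh2
      zero_lt_one hDu (by
        filter_upwards [hq] with t ht
        have := ht.integral_stress_ge hΩ (μ := μ) (lam := lam) hμ.le (by
          rw [hdr] at hlam ⊢
          linarith)
        rw [sub_self, zero_mul] at this
        refine le_trans (le_of_eq ?_) this
        have e : frob (gradMat (0 : Space d →L[ℝ] Space d)) (gradMat 0) = 0 := by
          simp [frob, gradMat]
        simp only [sub_self, e, integral_zero, mul_zero])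
    obtain ⟨C₁, hC₁, hmass⟩ := hV.exists_integral_mass_le ha hγ hm hΩ hb hS
    obtain ⟨C₂, hC₂, hmos⟩ := exists_integral_weight_mul_norm_le (Ω := Ω) hd hb
    have hDq : MemLp (fun p => Du p - velGrad (S' p)) 2 (volume.restrict (cyl T₁ Ω)) :=
      (hDu.2.1.sub hUW.2.1).mono_measure hle
    have iDq : IntegrableOn (fun t => ∫ x in Ω, ‖Du (t, x) - velGrad (S' (t, x))‖ ^ 2)
      (Ioo 0 T₁) := integrableOn_integral_slice hDq.norm.integrable_sq
    have hsq : MemLp (fun t => Real.sqrt (∫ x in Ω, ‖Du (t, x) - velGrad (S' (t, x))‖ ^ 2)) 2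
        (volume.restrict (Ioo 0 T₁)) := by
      rw [memLp_two_iff_integrable_sq (Real.continuous_sqrt.comp_aestronglyMeasurable iDq.1)]
      refine iDq.congr (Filter.Eventually.of_forall fun t => ?_)
      exact (Real.sq_sqrt (integral_nonneg fun x => sq_nonneg _)).symm
    have hXi := integrableOn_integral_slice (integrableOn_mass_mul_norm (V := V) (m := m) hb hh2
      ((hDu.1.sub hUW.1).mono_measure hle))
    simp only [integral_const_mul, Pi.sub_apply] at hXi
    -- The weight `g` is integrable as a product of two `L²` functions of time: the bound `h` of the
    -- second derivatives and the norm of the gradient of `u_V - U`.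
    refine ae_eq_zero_of_osgood (g := fun t => C * C₂ * (max 1 C₁) *
      (h t * Real.sqrt (∫ x in Ω, ‖Du (t, x) - velGrad (S' (t, x))‖ ^ 2))) h0.le hFm
      (hXi.1.const_mul C) hF (Filter.Eventually.of_forall fun t => ?_) (hw.const_mul A)
      ((hh2.integrable_mul hsq).const_mul _) (fun t => mul_nonneg hA (hw0 t)) (fun t => ?_) ?_ hgr
    · exact mul_nonneg hC (mul_nonneg (hh t) (integral_nonneg fun x =>
        mul_nonneg measureReal_nonneg (norm_nonneg _)))
    · have := hh t
      positivity
    · filter_upwards [hq, ae_mono hle' hmass, hF, ae_mono hle' hE0] with t t1 t2 t3 t4 n hn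
      have h5 := hmos _ _ t1 (fun x => (V (t, x)).real (lowDensity d m))
        ((measurable_lowDensity_mass (V := V) (m := m)).comp
          measurable_prodMk_left).aestronglyMeasurable (fun x => measureReal_nonneg)
        (fun x => measureReal_le_one) n hn
      set F := totalRelEnergy a γ Ω V S t + (𝔈 t).real (closure Ω) with hFdef
      set κ := ∫ x in Ω, (V (t, x)).real (lowDensity d m) with hκ
      have hn' : (1 : ℝ) ≤ n := by exact_mod_cast hn
      have hs0 : 0 ≤ 1 - 1 / (4 * n : ℝ) := by
        rw [sub_nonneg, div_le_one (by positivity)]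
        linarith
      have hs1 : 1 - 1 / (4 * n : ℝ) ≤ 1 := by
        have : 0 ≤ 1 / (4 * n : ℝ) := by positivity
        linarith
      have hκF : κ ≤ max 1 C₁ * F := by
        refine t2.trans (mul_le_mul (le_max_right _ _) ?_ t4 (by positivity))
        exact le_add_of_nonneg_right measureReal_nonneg
      -- The constant is taken at least 1, so that its power with exponent between 0 and 1 is
      -- bounded by the constant itself, uniformly in `n`.
      have h6 : κ ^ (1 - 1 / (4 * n : ℝ)) ≤ max 1 C₁ * F ^ (1 - 1 / (4 * n : ℝ)) := by
        refine (Real.rpow_le_rpow (integral_nonneg fun x => measureReal_nonneg) hκF hs0).trans ?_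
        rw [Real.mul_rpow (by positivity) t3.1]
        refine mul_le_mul_of_nonneg_right ?_ (Real.rpow_nonneg t3.1 _)
        exact Real.rpow_le_self_of_one_le (le_max_left _ _) hs1
      have h7 : C₂ * n * κ ^ (1 - 1 / (4 * n : ℝ))
          * Real.sqrt (∫ x in Ω, ‖Du (t, x) - velGrad (S' (t, x))‖ ^ 2)
          ≤ C₂ * n * (max 1 C₁ * F ^ (1 - 1 / (4 * n : ℝ)))
          * Real.sqrt (∫ x in Ω, ‖Du (t, x) - velGrad (S' (t, x))‖ ^ 2) := by
        gcongr
      have h8 := mul_le_mul_of_nonneg_left (mul_le_mul_of_nonneg_left (h5.trans h7) (hh t)) hC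
      refine h8.trans_eq ?_
      ring
  -- Here `μ + lam - 2μ/3 ≥ -μ/3`, so the dissipation controls `2μ/3` times the squared gradient.
  -- The strong velocity itself is the reference, the additional term is zero, and the Osgood lemma
  -- reduces to Grönwall's.
  · have hdr : (d : ℝ) = 3 := by rw [hd]; norm_num
    obtain ⟨A, C, hA, hC, hgr⟩ := hV.exists_gronwall ha hγ hm hK hΩ hb h0 hT hS hinit hh hh2
      (k := μ - μ / 3) (by linarith) hUW (by
        filter_upwards [hq] with t ht
        exact ht.integral_stress_ge hΩ (by positivity) (by
          rw [hdr] at hlam ⊢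
          linarith))
    simp only [sub_self, norm_zero, mul_zero, integral_zero] at hgr
    refine ae_eq_zero_of_osgood (X := fun _ => 0) (g := fun _ => 0) h0.le hFm
      aestronglyMeasurable_const hF (Filter.Eventually.of_forall fun _ => le_rfl)
      (hw.const_mul A) (integrable_zero _ _ _) (fun t => mul_nonneg hA (hw0 t)) (fun _ => le_rfl)
      (Filter.Eventually.of_forall fun t n _ => by simp) hgr

end Vanishing

end PotTempNS

namespace PotTempNS

/-! ### Dirac masses, and an upper bound for the dissipation defect -/

section Conclusion

variable {d : ℕ} {a γ μ lam T T₁ : ℝ} {Ω : Set (Space d)} {ρ₀ θ₀ : Space d → ℝ}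
  {u₀ : Space d → Space d} {V : Kernel (ℝ × Space d) (Phase d)}
  {Du : ℝ × Space d → Space d →L[ℝ] Space d} {𝔈 : Kernel ℝ (Space d)}
  {𝔇 : Measure (ℝ × Space d)} {ℜ : ℝ → Fin d → Fin d → SignedMeasure (Space d)}
  {S : ℝ × Space d → Phase d} {S' : ℝ × Space d → (ℝ × Space d) →L[ℝ] Phase d}
  {m M K : ℝ} {D2u : ℝ × Space d → Space d →L[ℝ] Space d →L[ℝ] Space d} {h : ℝ → ℝ}

theorem eq_dirac_of_ae_eq {α : Type*} [MeasurableSpace α] {ν : Measure α} [IsProbabilityMeasure ν]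
    {y : α} (h : ∀ᵐ z ∂ν, z = y) : ν = Measure.dirac y := by
  have : ν.map id = ν.map (fun _ => y) := Measure.map_congr h
  simpa [Measure.map_const] using this

theorem lowDeviation_dirac (m : ℝ) (y : Phase d) :
    lowDeviation m (Measure.dirac y) y.2.2 = 0 := by
  rw [lowDeviation, integral_dirac]
  exact indicator_apply_eq_zero.2 fun _ => by simp

/-- If the relative energy vanishes then the measure-valued solution is a Dirac mass. -/
theorem IsDMVSolution.ae_eq_dirac (ha : 0 < a) (hγ : 1 < γ) (hm : 0 < m)
    (hΩ : IsOpen Ω) (hb : Bornology.IsBounded Ω) (hT : T₁ ≤ T)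
    (hV : IsDMVSolution a γ μ lam T Ω ρ₀ θ₀ u₀ V Du 𝔈 𝔇 ℜ)
    (hS : IsTestState a γ μ lam m M K T T₁ Ω S S' D2u h)
    (hE : ∀ᵐ t ∂(volume.restrict (Ioo 0 T₁)), totalRelEnergy a γ Ω V S t = 0) :
    ∀ᵐ p ∂(volume.restrict (cyl T₁ Ω)), V p = Measure.dirac (S p) := by
  have := hV.markov
  obtain ⟨c, hc, hsupp⟩ := hV.support
  have hadm := concentratedOnAdm_of_support hsupp
  have hpos := hS.mem_posStates hm
  have hle : (volume : Measure (ℝ × Space d)).restrict (cyl T₁ Ω)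
      ≤ volume.restrict (cyl T Ω) := Measure.restrict_mono (cyl_mono hT) le_rfl
  have hrE := relEnergy_moment ha hγ hc hadm hV.energy.2.2.1 hΩ hb hS.c1 hpos
  have hi := hrE.2.mono_set (cyl_mono (Ω := Ω) hT)
  have hnn : ∀ᵐ p ∂(volume.restrict (cyl T₁ Ω)), ∀ᵐ z ∂V p, 0 ≤ relEnergy a γ (S p) z ∧
      (relEnergy a γ (S p) z = 0 → z = S p) := by
    filter_upwards [ae_mono hle hadm, ae_restrict_mem (isOpen_cyl hΩ).measurableSet] with p h1 h2
    have hp := hpos p (cyl_subset_cylClosure (cyl_mono hT h2))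
    filter_upwards [h1] with z hz
    exact ⟨relEnergy_nonneg ha hγ hp hz.1 (hc.trans_le hz.2),
      eq_of_relEnergy_eq_zero ha hγ hp hz.1 (hc.trans_le hz.2)⟩
  have h0 : ∫ p in cyl T₁ Ω, ∫ z, relEnergy a γ (S p) z ∂V p = 0 := by
    rw [integral_cyl hi]
    exact integral_eq_zero_of_ae hE
  have h1 := (integral_eq_zero_iff_of_nonneg_ae
    (hnn.mono fun p hp => integral_nonneg_of_ae (hp.mono fun z hz => hz.1)) hi).1 h0
  filter_upwards [h1, hnn, ae_mono hle hrE.1] with p p1 p2 p3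
  refine eq_dirac_of_ae_eq ?_
  have h2 := (integral_eq_zero_iff_of_nonneg_ae (p2.mono fun z hz => hz.1) p3).1 p1
  filter_upwards [h2, p2] with z z1 z2 using z2.2 z1

/-- The gain of relative energy is dominated, uniformly with respect to the test state. -/
theorem IsDMVSolution.exists_gain_bound (ha : 0 < a) (hγ : 1 < γ) (hm : 0 < m) (M : ℝ)
    (hK : 0 ≤ K) (hΩ : IsOpen Ω) (hb : Bornology.IsBounded Ω)
    (hV : IsDMVSolution a γ μ lam T Ω ρ₀ θ₀ u₀ V Du 𝔈 𝔇 ℜ) :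
    ∃ N : ℝ × Space d → ℝ, IntegrableOn N (cyl T Ω) ∧ ∀ S S' T₁ D2u h,
      IsTestState a γ μ lam m M K T T₁ Ω S S' D2u h →
      ∀ᵐ p ∂(volume.restrict (cyl T Ω)), gain a γ μ lam V Du S S' p ≤ N p := by
  have := hV.markov
  have hfin := isFiniteMeasure_restrict_cyl (T := T) hb
  obtain ⟨c, hc, hsupp⟩ := hV.support
  have hadm := concentratedOnAdm_of_support hsupp
  obtain ⟨-, hDu, hen, -⟩ := hV.energy
  obtain ⟨C, -, hC⟩ := exists_relIntegrand_bound (d := d) ha hγ hm M hc hK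
  obtain ⟨Cs, hCs, hs⟩ := exists_frob_stress_le d μ lam
  have i1 : Integrable (fun p => C * (1 + ∫ z, energyDensity a γ z ∂V p))
      (volume.restrict (cyl T Ω)) := ((integrable_const (1 : ℝ)).add hen.2).const_mul C
  have i2 : Integrable (fun p => Cs * (‖Du p‖ ^ 2 + K * ‖Du p‖)) (volume.restrict (cyl T Ω)) :=
    (hDu.2.1.norm.integrable_sq.add
      ((hDu.2.1.integrable (by norm_num)).norm.const_mul K)).const_mul Cs
  refine ⟨_, i1.add i2, ?_⟩
  intro S S' T₁ D2u h hS
  have h1 := (PotTempNS.relIntegrand_moment hadm hen hΩ hb hS.c1 (C := C) fun p hp z hz =>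
    hC _ (hS.mem_box p (cyl_subset_cylClosure hp)) _
      (hS.norm_deriv_le p (cyl_subset_cylClosure hp)) z hz).2.2
  filter_upwards [h1, ae_restrict_mem (isOpen_cyl hΩ).measurableSet] with p p1 p2
  have h2 := (Real.le_norm_self _).trans p1
  have h3 := hs (Du p) (Du p - velGrad (S' p))
  have h4 : ‖Du p - velGrad (S' p)‖ ≤ ‖Du p‖ + K :=
    (norm_sub_le _ _).trans (by
      gcongr
      exact (norm_velGrad_le _).trans (hS.norm_deriv_le p (cyl_subset_cylClosure p2)))
  have h5 := (abs_le.1 h3).1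
  have h6 : Cs * (‖Du p‖ * ‖Du p - velGrad (S' p)‖) ≤ Cs * (‖Du p‖ * (‖Du p‖ + K)) := by gcongr
  rw [gain, Pi.add_apply]
  linarith

/-- The dissipation defect up to the time `τ > T₁` is controlled by an absolutely continuous
measure of the interval `(T₁, τ)`. -/
theorem IsDMVSolution.exists_dissipation_le (hd : d = 2 ∨ d = 3) (ha : 0 < a) (hγ : 1 < γ)
    (hμ : 0 < μ) (hlam : -(2 / (d : ℝ)) * μ ≤ lam) (hm : 0 < m) (M : ℝ) (hK : 0 ≤ K)
    (hΩ : IsOpen Ω) (hb : Bornology.IsBounded Ω) (hT : 0 < T)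
    (hV : IsDMVSolution a γ μ lam T Ω ρ₀ θ₀ u₀ V Du 𝔈 𝔇 ℜ) :
    ∃ N : ℝ → ℝ, IntegrableOn N (Ioo 0 T) ∧ ∀ S S' T₁ D2u h, 0 < T₁ → T₁ < T →
      IsTestState a γ μ lam m M K T T₁ Ω S S' D2u h →
      (∀ᵐ x ∂(volume.restrict Ω), S (0, x) = (ρ₀ x, θ₀ x, u₀ x)) → (∀ t, 0 ≤ h t) →
      MemLp h 2 (volume.restrict (Ioo 0 T₁)) →
      ∀ᵐ τ ∂(volume.restrict (Ioo T₁ T)), 𝔇.real (cylClosure τ Ω) ≤ ∫ t in Ioo T₁ τ, N t := by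
  have := hV.markov
  obtain ⟨c, hc, hsupp⟩ := hV.support
  have hadm := concentratedOnAdm_of_support hsupp
  obtain ⟨hint, hDu, hen, -⟩ := hV.energy
  obtain ⟨N, hN, hgN⟩ := hV.exists_gain_bound ha hγ hm M hK hΩ hb
  obtain ⟨Cp, hCp, hE⟩ := hV.exists_totalRelEnergy_le ha hγ hm M hK hΩ hb hT
  have hei := hV.energyDefect.integrableOn
  refine ⟨fun t => (∫ x in Ω, N (t, x)) + Cp * (𝔈 t).real (closure Ω),
    (integrableOn_integral_slice hN).add (hei.const_mul Cp), ?_⟩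
  intro S S' T₁ D2u h h0 h1 hS hinit hh hh2
  have hle : (volume : Measure (ℝ × Space d)).restrict (cyl T₁ Ω)
      ≤ volume.restrict (cyl T Ω) := Measure.restrict_mono (cyl_mono h1.le) le_rfl
  have hle' : (volume : Measure ℝ).restrict (Ioo 0 T₁) ≤ volume.restrict (Ioo 0 T) :=
    Measure.restrict_mono (Ioo_subset_Ioo_right h1.le) le_rfl
  have hG := hS.integrableOn_gain ha hγ hc hm hK hadm hen hΩ hb hDu
  have hE0 := hV.totalRelEnergy_nonneg ha hγ hm hΩ hS
  have hz := hV.ae_totalRelEnergy_add_eq_zero hd ha hγ hμ hlam hm hK hΩ hb h0 h1 hS hinit hh hh2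
  have hz' : ∀ᵐ t ∂(volume.restrict (Ioo 0 T₁)), totalRelEnergy a γ Ω V S t = 0 ∧
      (𝔈 t).real (closure Ω) = 0 := by
    filter_upwards [hz, ae_mono hle' hE0] with t t1 t2
    have : 0 ≤ (𝔈 t).real (closure Ω) := measureReal_nonneg
    constructor <;> linarith
  have hdir := hV.ae_eq_dirac ha hγ hm hΩ hb h1.le hS (hz'.mono fun t ht => ht.1)
  obtain ⟨C, hC, hgain⟩ := hS.exists_gain_slice_le ha hγ hc hm hK hadm hen hΩ hb hDu hV.poincare
    hint hh h0 h1
  -- Before `T₁` the relative energy, the energy defect and the low-density deviation all vanish,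
  -- the measures being Dirac masses. The gain is then at most minus the dissipation, which is
  -- non-negative.
  have hneg : ∀ᵐ t ∂(volume.restrict (Ioo 0 T₁)),
      (∫ x in Ω, gain a γ μ lam V Du S S' (t, x)) + Cp * (𝔈 t).real (closure Ω) ≤ 0 := by
    filter_upwards [hz', hgain, ae_ae_of_ae_cyl hdir,
      ae_mono hle' (hV.memW12Zero_velocity_sub hΩ hb hS)] with t t1 t2 t3 t4
    have hJ : ∫ x in Ω, lowDeviation m (V (t, x)) (S (t, x)).2.2 = 0 := by
      refine integral_eq_zero_of_ae ?_
      filter_upwards [t3] with x hx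
      rw [hx, lowDeviation_dirac, Pi.zero_apply]
    have hst := t4.integral_stress_ge hΩ (μ := μ) (lam := lam) hμ.le (by
      rcases hd with rfl | rfl <;> norm_num at hlam ⊢ <;> linarith)
    rw [sub_self, zero_mul] at hst
    have hE' : ∫ x in Ω, ∫ z, relEnergy a γ (S (t, x)) z ∂V (t, x) = 0 := t1.1
    rw [hJ, hE'] at t2
    rw [t1.2]
    linarith
  have hup : ∀ᵐ t ∂(volume.restrict (Ioo 0 T)),
      ∫ x in Ω, gain a γ μ lam V Du S S' (t, x) ≤ ∫ x in Ω, N (t, x) := by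
    filter_upwards [ae_ae_of_ae_cyl (hgN S S' T₁ D2u h hS), integrable_slice hG,
      integrable_slice hN] with t t1 t2 t3 using integral_mono_ae t2 t3 t1
  filter_upwards [ae_mono (Measure.restrict_mono (Ioo_subset_Ioo_left h0.le) le_rfl)
    (hE S S' T₁ D2u h hS hinit), ae_mono (Measure.restrict_mono (Ioo_subset_Ioo_left h0.le) le_rfl)
    hE0, ae_restrict_mem measurableSet_Ioo] with τ t1 t2 t3
  have hsub : Ioo 0 τ ⊆ Ioo 0 T := Ioo_subset_Ioo_right t3.2.le
  have hGτ := hG.mono_set (cyl_mono (Ω := Ω) t3.2.le)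
  rw [integral_cyl hGτ, ← integral_add (integrableOn_integral_slice hGτ)
    ((hei.mono_set hsub).const_mul Cp)] at t1
  have h5 : 0 ≤ (𝔈 τ).real (closure Ω) := measureReal_nonneg
  have hNi : IntegrableOn (fun t => (∫ x in Ω, N (t, x)) + Cp * (𝔈 t).real (closure Ω))
      (Ioo 0 T) := (integrableOn_integral_slice hN).add (hei.const_mul Cp)
  -- The integral is split at `T₁`: non-positive before, dominated afterwards by a function that
  -- does not depend on the test state.
  have h6 : ∫ t in Ioo 0 τ, ((∫ x in Ω, gain a γ μ lam V Du S S' (t, x))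
        + Cp * (𝔈 t).real (closure Ω))
      ≤ ∫ t in Ioo 0 τ, (Ioo T₁ τ).indicator
        (fun t => (∫ x in Ω, N (t, x)) + Cp * (𝔈 t).real (closure Ω)) t := by
    refine integral_mono_ae ((integrableOn_integral_slice hGτ).add
      ((hei.mono_set hsub).const_mul Cp)) ((hNi.mono_set hsub).indicator measurableSet_Ioo) ?_
    have h7 := (ae_restrict_iff' measurableSet_Ioo).1 hneg
    have h8 : ∀ᵐ t ∂(volume : Measure ℝ), t ≠ T₁ := by simp [ae_iff, measure_singleton]
    filter_upwards [ae_restrict_of_ae h7, ae_restrict_of_ae h8,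
      ae_mono (Measure.restrict_mono hsub le_rfl) hup, ae_restrict_mem measurableSet_Ioo]
      with t s1 s2 s3 s4
    rcases lt_or_gt_of_ne s2 with hlt | hgt
    · rw [indicator_of_notMem fun hm => hlt.not_gt hm.1]
      exact s1 ⟨s4.1, hlt⟩
    · rw [indicator_of_mem (show t ∈ Ioo T₁ τ from ⟨hgt, s4.2⟩)]
      linarith
  rw [setIntegral_indicator measurableSet_Ioo, inter_eq_right.2 (Ioo_subset_Ioo_left h0.le)] at h6
  linarith

theorem IsEnergyDefect.eq_zero (h𝔈 : IsEnergyDefect T Ω 𝔈) :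
    ∀ᵐ t ∂(volume.restrict (Ioo 0 T)), (𝔈 t).real (closure Ω) = 0 → 𝔈 t = 0 := by
  obtain ⟨C, hC⟩ := h𝔈.bounded
  filter_upwards [hC, h𝔈.concentrated] with t t1 t2 t3
  have : IsFiniteMeasure (𝔈 t) := ⟨t1.trans_lt ENNReal.coe_lt_top⟩
  rw [measureReal_eq_zero_iff] at t3
  rw [← Measure.measure_univ_eq_zero, ← union_compl_self (closure Ω)]
  exact measure_union_null t3 t2

end Conclusion

end PotTempNS

namespace PotTempNS

/-! ### Passage to the limit in `T₁` -/

section Limit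

variable {d : ℕ} {T : ℝ} {Ω : Set (Space d)}

theorem ae_Ioo_of_forall_lt {P : ℝ → Prop} (hT : 0 < T)
    (h : ∀ T₁, 0 < T₁ → T₁ < T → ∀ᵐ t ∂(volume.restrict (Ioo 0 T₁)), P t) :
    ∀ᵐ t ∂(volume.restrict (Ioo 0 T)), P t := by
  obtain ⟨u, -, hu, hlim⟩ := exists_seq_strictMono_tendsto' hT
  refine ae_restrict_of_ae_restrict_of_subset (t := ⋃ n, Ioo 0 (u n)) (fun t ht => ?_)
    ((ae_restrict_iUnion_iff _ _).2 fun n => h _ (hu n).1 (hu n).2)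
  obtain ⟨n, hn⟩ := (hlim.eventually (lt_mem_nhds ht.2)).exists
  exact mem_iUnion.2 ⟨n, ht.1, hn⟩

theorem ae_cyl_of_forall_lt {P : ℝ × Space d → Prop} (hT : 0 < T)
    (h : ∀ T₁, 0 < T₁ → T₁ < T → ∀ᵐ p ∂(volume.restrict (cyl T₁ Ω)), P p) :
    ∀ᵐ p ∂(volume.restrict (cyl T Ω)), P p := by
  obtain ⟨u, -, hu, hlim⟩ := exists_seq_strictMono_tendsto' hT
  refine ae_restrict_of_ae_restrict_of_subset (t := ⋃ n, cyl (u n) Ω) (fun p hp => ?_)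
    ((ae_restrict_iUnion_iff _ _).2 fun n => h _ (hu n).1 (hu n).2)
  obtain ⟨n, hn⟩ := (hlim.eventually (lt_mem_nhds hp.1.2)).exists
  exact mem_iUnion.2 ⟨n, ⟨hp.1.1, hn⟩, hp.2⟩

theorem cylClosure_mono {s t : ℝ} (h : s ≤ t) : cylClosure s Ω ⊆ cylClosure t Ω :=
  prod_mono (Icc_subset_Icc_right h) le_rfl

/-- A defect which is controlled by an absolutely continuous measure of arbitrarily short
intervals vanishes. -/
theorem IsDissipationDefect.cylClosure_eq_zero {𝔇 : Measure (ℝ × Space d)} {Tstar s : ℝ}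
    (h𝔇 : IsDissipationDefect T Ω 𝔇) {N : ℝ → ℝ} (hN : IntegrableOn N (Ioo 0 T))
    (h : ∀ T₁, 0 < T₁ → T₁ < Tstar →
      ∀ᵐ τ ∂(volume.restrict (Ioo T₁ T)), 𝔇.real (cylClosure τ Ω) ≤ ∫ t in Ioo T₁ τ, N t)
    (hs : 0 < s) (hsT : s ≤ Tstar) (hsT' : s < T) : 𝔇 (cylClosure s Ω) = 0 := by
  have := h𝔇.finite
  have hNi : IntervalIntegrable N volume 0 T := by
    rwa [intervalIntegrable_iff_integrableOn_Ioo_of_le (hs.trans hsT').le]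
  rw [← measureReal_eq_zero_iff]
  refine le_antisymm (le_of_forall_pos_le_add fun ε hε => ?_) measureReal_nonneg
  rw [zero_add]
  obtain ⟨δ, hδ, hint⟩ := exists_pos_integral_le hNi hε
  -- With `T₁ = s - η` and `τ` in `(s, s + η)`, the interval `(T₁, τ)` is shorter than `2η ≤ δ`,
  -- while the closed cylinder up to `τ` contains the one up to `s`. Here `s < T` is needed, but `s
  -- = Tstar` is allowed.
  obtain ⟨η, hη, hηs, hηT, hηδ⟩ : ∃ η : ℝ, 0 < η ∧ η < s ∧ s + η < T ∧ 2 * η ≤ δ := by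
    refine ⟨min (min (s / 2) ((T - s) / 2)) (δ / 2), ?_, ?_, ?_, ?_⟩
    · have : 0 < T - s := by linarith
      positivity
    · have := (min_le_left (min (s / 2) ((T - s) / 2)) (δ / 2)).trans (min_le_left _ _)
      linarith
    · have := (min_le_left (min (s / 2) ((T - s) / 2)) (δ / 2)).trans (min_le_right _ _)
      linarith
    · have := min_le_right (min (s / 2) ((T - s) / 2)) (δ / 2)
      linarith
  have h1 := ae_mono (Measure.restrict_mono (Ioo_subset_Ioo (a₁ := s) (b₁ := s + η) (by linarith)
    (by linarith)) le_rfl) (h (s - η) (by linarith) (by linarith))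
  have hne : (ae ((volume : Measure ℝ).restrict (Ioo s (s + η)))).NeBot := by
    rw [ae_neBot, Ne, Measure.restrict_eq_zero, Real.volume_Ioo]
    simpa using hη
  obtain ⟨τ, hτ, hτm⟩ := (Filter.Eventually.and h1 (ae_restrict_mem measurableSet_Ioo)).exists
  rw [← integral_Ioc_eq_integral_Ioo,
    ← intervalIntegral.integral_of_le (by linarith [hτm.1])] at hτ
  exact (measureReal_mono (cylClosure_mono hτm.1.le)).trans (hτ.trans (hint _ _ (by linarith)
    (by linarith [hτm.1]) (by linarith [hτm.2]) (by linarith [hτm.2])))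

/-- The set is exhausted by the closed cylinders up to the times `min Tstar (u n)`, where `u n`
increases to `T`. This treats `Tstar < T` and `Tstar = T` at once; points outside the full closed
cylinder carry no mass. -/
theorem IsDissipationDefect.eq_zero_of_cylClosure {𝔇 : Measure (ℝ × Space d)} {Tstar : ℝ}
    (h𝔇 : IsDissipationDefect T Ω 𝔇) (hTstar : 0 < Tstar) (hT : Tstar ≤ T)
    (h : ∀ s, 0 < s → s ≤ Tstar → s < T → 𝔇 (cylClosure s Ω) = 0) :
    𝔇 {p | p.1 ≤ Tstar ∧ p.1 < T} = 0 := by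
  obtain ⟨u, -, hu, hlim⟩ := exists_seq_strictMono_tendsto' (hTstar.trans_le hT)
  refine measure_mono_null (t := (cylClosure T Ω)ᶜ ∪ ⋃ n, cylClosure (min Tstar (u n)) Ω)
    (fun p hp => ?_) (measure_union_null h𝔇.concentrated (measure_iUnion_null fun n => h _
      (lt_min hTstar (hu n).1) (min_le_left _ _) ((min_le_right _ _).trans_lt (hu n).2)))
  by_cases hc : p ∈ cylClosure T Ω
  · obtain ⟨n, hn⟩ := (hlim.eventually (lt_mem_nhds hp.2)).exists
    exact Or.inr (mem_iUnion.2 ⟨n, ⟨hc.1.1, le_min hp.1 hn.le⟩, hc.2⟩)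
  · exact Or.inl hc

end Limit

end PotTempNS

/-! ### DMV-strong uniqueness -/

theorem theorem3p1 {d : ℕ} (hd : d = 2 ∨ d = 3) (a γ μ lam : ℝ) (ha : 0 < a) (hγ : 1 < γ)
    (hμ : 0 < μ) (hlam : -(2 / (d : ℝ)) * μ ≤ lam)
    (Ω : Set (Space d)) (hΩ : IsBoundedLipschitzDomain Ω)
    (T Tstar : ℝ) (hTstar : 0 < Tstar) (hT : Tstar ≤ T)
    (ρ θ : ℝ × Space d → ℝ) (u : ℝ × Space d → Space d)
    (hstrong : IsStrongSolution a γ μ lam Tstar Ω ρ θ u)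
    (ρ₀ θ₀ : Space d → ℝ) (u₀ : Space d → Space d)
    (hinit : ∀ᵐ x ∂(volume.restrict Ω), ρ (0, x) = ρ₀ x ∧ θ (0, x) = θ₀ x ∧ u (0, x) = u₀ x)
    (V : Kernel (ℝ × Space d) (Phase d)) (Du : ℝ × Space d → Space d →L[ℝ] Space d)
    (𝔈 : Kernel ℝ (Space d)) (𝔇 : Measure (ℝ × Space d))
    (ℜ : ℝ → Fin d → Fin d → SignedMeasure (Space d))
    (hV : IsDMVSolution a γ μ lam T Ω ρ₀ θ₀ u₀ V Du 𝔈 𝔇 ℜ) :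
    (∀ᵐ t ∂(volume.restrict (Ioo 0 Tstar)), 𝔈 t = 0) ∧
    𝔇 {p | p.1 ≤ Tstar ∧ p.1 < T} = 0 ∧
    (∀ᵐ t ∂(volume.restrict (Ioo 0 Tstar)), ∀ i j, ℜ t i j = 0) ∧
    ∀ᵐ p ∂(volume.restrict (cyl Tstar Ω)), V p = Measure.dirac (ρ p, θ p, u p) := by
  have hΩo := hΩ.isOpen
  have hb := hΩ.isBounded
  have hT0 : 0 < T := hTstar.trans_le hT
  obtain ⟨m, M, K, D2u, h, hm, hK, hh, hh2, htest⟩ :=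
    hstrong.exists_isTestState hΩo hb
  have hh2' : ∀ T₁, T₁ < Tstar → MemLp h 2 (volume.restrict (Ioo 0 T₁)) := fun T₁ h1 =>
    hh2.mono_measure (Measure.restrict_mono (Ioo_subset_Ioo_right h1.le) le_rfl)
  have hinit' : ∀ {S : ℝ × Space d → Phase d} {T₁ : ℝ}, 0 < T₁ →
      (∀ p : ℝ × Space d, p.1 ≤ T₁ → S p = (ρ p, θ p, u p)) →
      ∀ᵐ x ∂(volume.restrict Ω), S (0, x) = (ρ₀ x, θ₀ x, u₀ x) := by
    intro S T₁ h0 hS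
    filter_upwards [hinit] with x hx
    rw [hS (0, x) h0.le, hx.1, hx.2.1, hx.2.2]
  -- The gap between `T₁` and `Tstar` is where the change of time takes place; exhaustion then
  -- reaches `Tstar`.
  have hkey : ∀ T₁, 0 < T₁ → T₁ < Tstar →
      (∀ᵐ t ∂(volume.restrict (Ioo 0 T₁)), 𝔈 t = 0) ∧
      ∀ᵐ p ∂(volume.restrict (cyl T₁ Ω)), V p = Measure.dirac (ρ p, θ p, u p) := by
    intro T₁ h0 h1
    obtain ⟨S, S', hS, hSσ⟩ := htest T T₁ h0 h1
    have h1T := h1.trans_le hT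
    have hle' : (volume : Measure ℝ).restrict (Ioo 0 T₁) ≤ volume.restrict (Ioo 0 T) :=
      Measure.restrict_mono (Ioo_subset_Ioo_right h1T.le) le_rfl
    have hz := hV.ae_totalRelEnergy_add_eq_zero hd ha hγ hμ hlam hm hK hΩo hb h0 h1T hS
      (hinit' h0 hSσ) hh (hh2' T₁ h1)
    have hz' : ∀ᵐ t ∂(volume.restrict (Ioo 0 T₁)), totalRelEnergy a γ Ω V S t = 0 ∧
        (𝔈 t).real (closure Ω) = 0 := by
      filter_upwards [hz, ae_mono hle' (hV.totalRelEnergy_nonneg ha hγ hm hΩo hS)] with t t1 t2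
      have : 0 ≤ (𝔈 t).real (closure Ω) := measureReal_nonneg
      constructor <;> linarith
    refine ⟨?_, ?_⟩
    · filter_upwards [hz', ae_mono hle' hV.energyDefect.eq_zero] with t t1 t2 using t2 t1.2
    · filter_upwards [hV.ae_eq_dirac ha hγ hm hΩo hb h1T.le hS (hz'.mono fun t ht => ht.1),
        ae_restrict_mem (isOpen_cyl hΩo).measurableSet] with p hp hpm
      rw [hp, hSσ p hpm.1.2.le]
  have h𝔈 : ∀ᵐ t ∂(volume.restrict (Ioo 0 Tstar)), 𝔈 t = 0 :=
    ae_Ioo_of_forall_lt hTstar fun T₁ h0 h1 => (hkey T₁ h0 h1).1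
  refine ⟨h𝔈, ?_, ?_, ae_cyl_of_forall_lt hTstar fun T₁ h0 h1 => (hkey T₁ h0 h1).2⟩
  -- The majorant `N` is chosen once, before `T₁`, so that its integrals over short intervals can be
  -- made small.
  · obtain ⟨N, hN, hdis⟩ := hV.exists_dissipation_le hd ha hγ hμ hlam hm M hK hΩo hb hT0
    refine hV.dissipationDefect.eq_zero_of_cylClosure hTstar hT fun s hs hsT hsT' =>
      hV.dissipationDefect.cylClosure_eq_zero hN (fun T₁ h0 h1 => ?_) hs hsT hsT'
    obtain ⟨S, S', hS, hSσ⟩ := htest T T₁ h0 h1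
    exact hdis S S' T₁ D2u h h0 (h1.trans_le hT) hS (hinit' h0 hSσ) hh (hh2' T₁ h1)
  -- With `𝔈 t = 0`, compatibility makes the trace of `ℜ t` non-positive on every Borel set, and a
  -- positive semidefinite matrix with non-positive trace is zero.
  · obtain ⟨c₁, c₂, -, -, hc⟩ := hV.compatible
    have hle' : (volume : Measure ℝ).restrict (Ioo 0 Tstar) ≤ volume.restrict (Ioo 0 T) :=
      Measure.restrict_mono (Ioo_subset_Ioo_right hT) le_rfl
    filter_upwards [h𝔈, ae_mono hle' hc, ae_mono hle' hV.reynoldsDefect.posSemidef]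
      with t t1 t2 t3 i j
    refine reynolds_eq_zero t3 (fun A hA => ?_) i j
    have := (t2 A hA).2
    simpa [t1] using this
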